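/- **Setting.** Let $\Omega\subset\mathbb R^d$ ($d\ge1$) be a bounded Lipschitz domain and let $B=(b_{ij})\in\mathbb R^{n\times n}$ be symmetric positive semidefinite with $b_{ij}\ge0$ and $b_{ii}>0$ for all $i,j$. Put $L=\ker B$, let $P_L,P_{L^\perp}$ be the orthogonal projections onto $L$ and $L^\perp$, write $\widehat s=P_{L^\perp}s$ for $s\in\mathbb R^n$, and let $W=[0,\infty)^n\times(L^\perp)^d$. For a measure $\nu$ on $W$ write $\langle\nu,f(s,p)\rangle=\int_W f\,\mathrm d\nu$. Let $h_S(s)=\sum_i(s_i(\log s_i-1)+1)$ and $h_R(s)=\frac12 s^{T}Bs$. Let $u^{\rm in}\in L^2(\Omega;[0,\infty)^n)$. **Dissipative measure-valued solutions.** A weakly$^*$ measurable family $\mu=(\mu_{x,t})$ of probability measures on $W$, $(x,t)\in\Omega\times[0,\infty)$, with barycenters $u=\langle\mu,s\rangle$, $y=\langle\mu,p\rangle$, is a dissipative measure-valued solution to $\partial_tu_i=\operatorname{div}(u_i\nabla(Bu)_i)$ in $\Omega$, $u_i\nabla(Bu)_i\cdot\nu_{\partial\Omega}=0$ on $\partial\Omega$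 (with $\nu_{\partial\Omega}$ the outer unit normal), $u(0)=u^{\rm in}$, if for all $T>0$: 1. $u_i\in L^\infty(0,\infty;L^2(\Omega))$, $\partial_tu_i\in L^2(0,\infty;W^{1,4}(\Omega)^*)$, $y\in L^2(\Omega\times(0,T);(L^\perp)^d)$, $y=\nabla\widehat u$, and for a.e. $(x,t)$, $\langle\mu_{x,t},f(s,p)\rangle=\langle\mu_{x,t},f(\widehat u(x,t)+P_Ls,p)\rangle$ for all $f\in C_0(\mathbb R^n\times(\mathbb R^{n})^d)$; 2. for a.e. $t>0$, $$\int_\Omega\langle\mu_{x,t},h_S(s)\rangle\,\mathrm dx+\int_0^t\!\int_\Omega\langle\mu_{x,\tau},|B^{1/2}p|^2\rangle\,\mathrm dx\,\mathrm d\tau\le\int_\Omega h_S(u^{\rm in})\,\mathrm dx,$$ $$\int_\Omega h_R(u(x,t))\,\mathrm dx+\sum_{i=1}^n\int_0^t\!\int_\Omega\langle\mu_{x,\tau},s_i|(Bp)_i|^2\rangle\,\mathrm dx\,\mathrm d\tau\le\int_\Omega h_R(u^{\rm in})\,\mathrm dx;$$ 3. for all $i$ and all $\phi\in C^1_c(\overline\Omega\times[0,T))$,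 $$\int_0^T\!\int_\Omega u_i\partial_t\phi\,\mathrm dx\,\mathrm dt+\int_\Omega u_i^{\rm in}\phi(0)\,\mathrm dx=\int_0^T\!\int_\Omega\langle\mu_{x,t},s_i(Bp)_i\rangle\cdot\nabla\phi\,\mathrm dx\,\mathrm dt.$$ **Theorem (long-time behavior).** Let $\mu$ be a dissipative measure-valued solution with initial datum $u^{\rm in}$, let $u=\langle\mu,s\rangle$ and $\mathsf m=\int_\Omega u^{\rm in}\,\mathrm dx$, and let $$\mathfrak S_{\mathsf m}=\Big\{v\in L^2(\Omega;[0,\infty)^n):\ \int_\Omega v\,\mathrm dx=\mathsf m,\ \nabla(Bv)=0\text{ in }\Omega\Big\}.$$ Then $\mathfrak S_{\mathsf m}\subset L^\infty(\Omega;[0,\infty)^n)$, and there is $u^*\in\mathfrak S_{\mathsf m}$ such that, with $\widehat u^*=P_{L^\perp}u^*$, $$\widehat u(t)\to\widehat u^*\quad\text{strongly in }L^2(\Omega;\mathbb R^n)\text{ as }t\to\infty,$$ where, as $u$ is defined only for almost every $t$, the limit is understood up to a null set of times: for each $\varepsilon>0$ there is $T_\varepsilon$ with $\|\widehat u(t)-\widehat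 u^*\|_{L^2(\Omega)}\le\varepsilon$ for a.e. $t>T_\varepsilon$. -/

import Mathlib

open MeasureTheory Set Filter Topology ProbabilityTheory
open scoped ContDiff ENNReal ZeroAtInfty

noncomputable section

/-- `ℝ^d` with the Euclidean norm and Lebesgue measure. -/
abbrev Euc (d : ℕ) : Type := EuclideanSpace ℝ (Fin d)

/-- Bounded Lipschitz domain: a nonempty bounded connected open set which, near each of its boundary
points, is the strict epigraph of a Lipschitz function over the hyperplane orthogonal to some unit
vector `ν`. -/
structure IsBoundedLipschitzDomain {d : ℕ} (Ω : Set (Euc d)) : Prop where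
  isOpen : IsOpen Ω
  isConnected : IsConnected Ω
  isBounded : Bornology.IsBounded Ω
  lipschitz_boundary : ∀ x₀ ∈ frontier Ω, ∃ (ν : Euc d) (γ : (ℝ ∙ ν)ᗮ → ℝ) (K : NNReal)
    (U : Set (Euc d)), ‖ν‖ = 1 ∧ LipschitzWith K γ ∧ IsOpen U ∧ x₀ ∈ U ∧
      ∀ x ∈ U, (x ∈ Ω ↔ γ ((ℝ ∙ ν)ᗮ.orthogonalProjectionOnto x) < inner ℝ ν x)

/-- `g = ∇ f` in the sense of distributions in the open set `Ω` (used for functions `f`, `g k` that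
are integrable on `Ω`). -/
def HasWeakGrad {d : ℕ} (Ω : Set (Euc d)) (f : Euc d → ℝ) (g : Fin d → Euc d → ℝ) : Prop :=
  ∀ φ : Euc d → ℝ, ContDiff ℝ ∞ φ → HasCompactSupport φ → tsupport φ ⊆ Ω →
    ∀ k : Fin d, ∫ x in Ω, f x * fderiv ℝ φ x (EuclideanSpace.single k 1)
      = - ∫ x in Ω, g k x * φ x

/-- The norm of `W^{1,4}(Ω)` of a function `φ` with weak gradient `g`. -/
def normW14 {d : ℕ} (Ω : Set (Euc d)) (φ : Euc d → ℝ) (g : Fin d → Euc d → ℝ) : ℝ :=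
  (eLpNorm φ 4 (volume.restrict Ω)).toReal + ∑ k, (eLpNorm (g k) 4 (volume.restrict Ω)).toReal

/-- `∂ₜ v ∈ L²(0,∞; W^{1,4}(Ω)*)`: the pairing of `v(t)` with any `φ ∈ W^{1,4}(Ω)` has a weak time
derivative `G` with `|G(t)| ≤ N(t) ‖φ‖` for a.e. `t`, where `N ∈ L²(0,∞)` does not depend on `φ`.
(As `W^{1,4}(Ω)` is separable and reflexive, this is membership in the Bochner space.) -/
def TimeDerivMemL2DualW14 {d : ℕ} (Ω : Set (Euc d)) (v : Euc d → ℝ → ℝ) : Prop :=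
  ∃ N : ℝ → ℝ, MemLp N 2 (volume.restrict (Ioi 0)) ∧
    ∀ (φ : Euc d → ℝ) (g : Fin d → Euc d → ℝ),
      MemLp φ 4 (volume.restrict Ω) → (∀ k, MemLp (g k) 4 (volume.restrict Ω)) →
      HasWeakGrad Ω φ g →
      ∃ G : ℝ → ℝ, AEStronglyMeasurable G (volume.restrict (Ioi 0)) ∧
        (∀ᵐ t ∂(volume.restrict (Ioi (0 : ℝ))), |G t| ≤ N t * normW14 Ω φ g) ∧
        ∀ θ : ℝ → ℝ, ContDiff ℝ ∞ θ → HasCompactSupport θ → tsupport θ ⊆ Ioi 0 →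
          ∫ t in Ioi (0 : ℝ), (∫ x in Ω, v x t * φ x) * deriv θ t
            = - ∫ t in Ioi (0 : ℝ), G t * θ t

variable {n d : ℕ}

/-- The linear map `s ↦ B s`. -/
def mulB (B : Matrix (Fin n) (Fin n) ℝ) (s : Euc n) : Euc n := WithLp.toLp 2 (B.mulVec s.ofLp)

/-- `L = ker B`. -/
def kerB (B : Matrix (Fin n) (Fin n) ℝ) : Submodule ℝ (Euc n) where
  carrier := {s | mulB B s = 0}
  add_mem' {a b} ha hb := by
    simp only [mulB, mem_ofPred_eq, WithLp.toLp_eq_zero] at ha hb ⊢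
    simp [Matrix.mulVec_add, ha, hb]
  zero_mem' := by simp [mulB]
  smul_mem' c a ha := by
    simp only [mulB, mem_ofPred_eq, WithLp.toLp_eq_zero] at ha ⊢
    simp [Matrix.mulVec_smul, ha]

/-- `ŝ`, the orthogonal projection of `s` onto the orthogonal complement of `L = ker B`. -/
def hatB (B : Matrix (Fin n) (Fin n) ℝ) (s : Euc n) : Euc n := (kerB B)ᗮ.starProjection s

/-- The orthogonal projection of `s` onto `L = ker B`. -/
def projKerB (B : Matrix (Fin n) (Fin n) ℝ) (s : Euc n) : Euc n := (kerB B).starProjection s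

/-- The quadratic form `zᵀ B z`, which is `|B^{1/2} z|²` for positive semidefinite `B`. -/
def quadB (B : Matrix (Fin n) (Fin n) ℝ) (z : Euc n) : ℝ := ∑ i, ∑ j, B i j * z i * z j

/-- Phase space of the Young measures: `(s, p)` with `s ∈ ℝⁿ` and `p = (p_k)_{k < d}`,
`p_k ∈ ℝⁿ` standing for the `k`-th partial derivative. -/
abbrev Phase (n d : ℕ) : Type := Euc n × (Fin d → Euc n)

/-- The closed subset `W = [0,∞)ⁿ × (Lᗮ)^d` of the phase space. -/
def phaseW (B : Matrix (Fin n) (Fin n) ℝ) (d : ℕ) : Set (Phase n d) :=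
  {w | (∀ i, 0 ≤ w.1 i) ∧ ∀ k, w.2 k ∈ (kerB B)ᗮ}

/-- Shannon entropy density. -/
def hS (s : Euc n) : ℝ := ∑ i, (s i * (Real.log (s i) - 1) + 1)

/-- Rao entropy density. -/
def hR (B : Matrix (Fin n) (Fin n) ℝ) (s : Euc n) : ℝ := (1 / 2) * quadB B s

/-- The barycenter `u = ⟨μ, s⟩`. -/
def baryS (μ : Kernel (Euc d × ℝ) (Phase n d)) (x : Euc d) (t : ℝ) : Euc n :=
  ∫ w, w.1 ∂(μ (x, t))

/-- The barycenter `y = ⟨μ, p⟩`. -/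
def baryP (μ : Kernel (Euc d × ℝ) (Phase n d)) (x : Euc d) (t : ℝ) (k : Fin d) : Euc n :=
  ∫ w, w.2 k ∂(μ (x, t))

/-- The measure `dx dt` on `Ω × (0,∞)`. -/
def spaceTime (Ω : Set (Euc d)) : Measure (Euc d × ℝ) :=
  (volume.restrict Ω).prod (volume.restrict (Ioi 0))

/-- Dissipative measure-valued solution of `∂ₜ uᵢ = div (uᵢ ∇(B u)ᵢ)` in `Ω` with no-flux boundary
conditions and initial datum `uin`. A weakly* measurable family of probability measures on `W`
(defined up to a null set of `(x,t)`) is represented by a Markov kernel that is concentrated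
on `W` at almost every point of `Ω × (0,∞)`. The integrals of nonnegative functions in the entropy
inequalities are `[0,∞]`-valued, so that their finiteness is part of the inequalities. -/
structure IsDissipativeMVSolution (Ω : Set (Euc d)) (B : Matrix (Fin n) (Fin n) ℝ)
    (uin : Euc d → Euc n) (μ : Kernel (Euc d × ℝ) (Phase n d)) : Prop where
  uin_memLp : MemLp uin 2 (volume.restrict Ω)
  uin_nonneg : ∀ᵐ x ∂(volume.restrict Ω), ∀ i, 0 ≤ uin x i
  prob : IsMarkovKernel μ
  concentrated : ∀ᵐ z ∂(spaceTime Ω), μ z (phaseW B d)ᶜ = 0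
  /-- the barycenters are well defined -/
  integrable_s : ∀ᵐ z ∂(spaceTime Ω), Integrable (fun w : Phase n d => w.1) (μ z)
  integrable_p : ∀ᵐ z ∂(spaceTime Ω), ∀ k, Integrable (fun w : Phase n d => w.2 k) (μ z)
  /-- `u ∈ L^∞(0,∞; L²(Ω))` -/
  regularity_u : ∃ C : ENNReal, C < ⊤ ∧ ∀ᵐ t ∂(volume.restrict (Ioi (0 : ℝ))),
    AEStronglyMeasurable (fun x => baryS μ x t) (volume.restrict Ω) ∧
      eLpNorm (fun x => baryS μ x t) 2 (volume.restrict Ω) ≤ C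
  regularity_dt : ∀ i, TimeDerivMemL2DualW14 Ω (fun x t => baryS μ x t i)
  /-- `y ∈ L²(Ω × (0,T))` for all `T` -/
  regularity_y : ∀ T : ℝ, 0 < T → ∀ k, MemLp (fun z : Euc d × ℝ => baryP μ z.1 z.2 k) 2
    ((volume.restrict Ω).prod (volume.restrict (Ioo 0 T)))
  /-- `y = ∇ û` -/
  grad_eq : ∀ᵐ t ∂(volume.restrict (Ioi (0 : ℝ))), ∀ i,
    HasWeakGrad Ω (fun x => hatB B (baryS μ x t) i) (fun k x => baryP μ x t k i)
  /-- `μ` acts trivially on the `ŝ`-component. The functions of `C₀(W)` are the restrictions to the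
  closed set `W` of those of `C₀` of the whole phase space, on which the shifted argument makes
  sense a priori. -/
  separation : ∀ f : C₀(Phase n d, ℝ), ∀ᵐ z ∂(spaceTime Ω),
    ∫ w, f w ∂(μ z) = ∫ w, f (hatB B (baryS μ z.1 z.2) + projKerB B w.1, w.2) ∂(μ z)
  shannon : ∀ᵐ t ∂(volume.restrict (Ioi (0 : ℝ))),
    (∫⁻ x in Ω, ∫⁻ w, ENNReal.ofReal (hS w.1) ∂(μ (x, t)))
      + (∫⁻ τ in Ioo 0 t, ∫⁻ x in Ω, ∫⁻ w, ENNReal.ofReal (∑ k, quadB B (w.2 k)) ∂(μ (x, τ)))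
      ≤ ∫⁻ x in Ω, ENNReal.ofReal (hS (uin x))
  rao : ∀ᵐ t ∂(volume.restrict (Ioi (0 : ℝ))),
    (∫⁻ x in Ω, ENNReal.ofReal (hR B (baryS μ x t)))
      + (∑ i, ∫⁻ τ in Ioo 0 t, ∫⁻ x in Ω, ∫⁻ w,
          ENNReal.ofReal (w.1 i * ∑ k, (mulB B (w.2 k) i) ^ 2) ∂(μ (x, τ)))
      ≤ ∫⁻ x in Ω, ENNReal.ofReal (hR B (uin x))
  /-- The weak formulation. Test functions in `C¹_c(closure Ω × [0,T))` are the restrictions of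
  `C¹` functions on the whole space with compact support in `ℝ^d × (-∞,T)`. -/
  evolution : ∀ (i : Fin n) (T : ℝ), 0 < T → ∀ φ : Euc d × ℝ → ℝ, ContDiff ℝ 1 φ →
    HasCompactSupport φ → tsupport φ ⊆ univ ×ˢ Iio T →
    (∫ t in Ioo 0 T, ∫ x in Ω, baryS μ x t i * fderiv ℝ φ (x, t) (0, 1))
      + (∫ x in Ω, uin x i * φ (x, 0))
      = ∫ t in Ioo 0 T, ∫ x in Ω, ∑ k,
          (∫ w, w.1 i * mulB B (w.2 k) i ∂(μ (x, t)))
            * fderiv ℝ φ (x, t) (EuclideanSpace.single k 1, 0)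

/-- The set of steady states with mass vector `m`. -/
def steadyStates (Ω : Set (Euc d)) (B : Matrix (Fin n) (Fin n) ℝ) (m : Euc n) :
    Set (Euc d → Euc n) :=
  {v | MemLp v 2 (volume.restrict Ω) ∧ (∀ᵐ x ∂(volume.restrict Ω), ∀ i, 0 ≤ v x i) ∧
    (∫ x in Ω, v x) = m ∧ ∀ i, HasWeakGrad Ω (fun x => mulB B (v x) i) (fun _ _ => 0)}

end

/-! Choose `T` with `Tᵀ T = B` and put `vᵢ = T eᵢ`, `ζ = T u = ∑ uᵢ vᵢ`. Then `⟨vᵢ, vⱼ⟩ = bᵢⱼ ≥ 0`,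
and `T` is injective on `Lᗮ`, so it suffices that `ζ(t)` tends in `L²` to its conserved mean `z`.
The limit `u*` is the constant with the mass of the initial datum. The equation becomes `∂ₜ ζ = div
J`. With `D` the sum of the Shannon and Rao dissipation densities, the entropy inequalities make `D`
integrable on `Ω × (0,∞)`, and `|J|² ≤ K D |ζ|` pointwise (`exists_norm_rootFlux_le`).

Integrability gives arbitrarily late times `t₀` with small dissipation, and Poincaré's inequality
makes `ζ(t₀)` close to `z`. The difficulty is to reach all later times, because the entropy
inequalities compare only with time `0`. What is needed is the stability estimate `‖ζ(t) - z‖² ≤ C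
(‖ζ(t₀) - z‖² + ∫_{t₀}^∞ ∫ D)` of `exists_stability`, and it has to come from the evolution equation
alone. Testing with `ζ - z` fails: `ζ - z` is not an admissible test function, and `|J| |∇ζ|` is
only bounded by `D |ζ|^{1/2}`.

Two devices repair this. The first replaces `|· - z|²` by a comparable potential `Ψ`. The Rao
dissipation controls `∇ζ` with weight `|ζ|` only in the directions in which the mobility `∑ sᵢ vᵢ ⊗
vᵢ` is of order `|ζ|`. These contain the core flat at `ζ`, the intersection of all flats generated
by the `vᵢ` that pass close to `ζ` (`exists_lower_bound_coreFlat`). A homogeneous map `ρ` close to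
the identity is built which near each point depends only on the projection to its core flat
(`exists_retraction`); `Ψ` is `|ρ|²` far out and `|· - z|²` near the origin, so for large arguments
the increments of its gradient are controlled by core directions.

The second device replaces the integral of `Ψ(ζ)` by `∑ₐ mₐ Ψ(ζₐ)`, where `ζₐ` is the mean of `ζ`
for a partition of unity at scale `ε` and `mₐ` its mass. Since the gradients of the partition sum to
zero, the time derivative is a sum over neighbouring pairs of `(∇Ψ(ζₐ) - ∇Ψ(ζ_b)) J ∇φₐ`. It is
bounded by the dissipation, uniformly in `ε`, once `|∇Ψ(ζₐ) - ∇Ψ(ζ_b)|² ∫ |ζ| ≤ C ε² ∫ D` on a ball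
of radius comparable to `ε` (`exists_pair_bound`). This follows from Poincaré's inequality applied
to suitable functions `f(ζ)` with `|∇f(ζ)|² ≤ c D` (`exists_cluster_bound`): the cone condition
prevents cancellation in averages, a cutoff of `ρ` shows that `ζ` concentrates near its mean when
the mean is large compared with the dissipation, and a localized projection then measures the core
directions. Letting `ε → 0` gives the stability estimate.

The measure-valued nature enters only pointwise: almost every `s` charged by `μ_{x,t}` satisfies `T
s = ζ(x,t)`, so bounds valid for all nonnegative representations of `ζ` survive averaging (`isAdm`).
The boundedness of steady states is independent of this: `B v` is constant, and nonnegativity gives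
`bᵢᵢ vᵢ ≤ (B v)ᵢ`. -/

/-! ### The finite lattice of flats generated by the vectors -/

section SpanFlat

variable {E ι : Type*} [NormedAddCommGroup E] [InnerProductSpace ℝ E]

/-- The intersections of the subspaces spanned by members of a family of vectors. -/
def spanFlat (v : ι → E) (S : Finset (Finset ι)) : Submodule ℝ E :=
  S.inf fun I => Submodule.span ℝ (v '' I)

/-- Indexing by sets of index sets makes the family closed under intersection, and still finite when
`ι` is. The construction of the retraction needs both. -/
theorem spanFlat_inf (v : ι → E) (S S' : Finset (Finset ι)) :
    ∃ S'', spanFlat v S'' = spanFlat v S ⊓ spanFlat v S' := by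
  classical
  exact ⟨S ∪ S', Finset.inf_union⟩

theorem exists_spanFlat_eq_top (v : ι → E) : ∃ S, spanFlat v S = ⊤ := ⟨∅, rfl⟩

end SpanFlat

/-! ### Core flats, the retraction onto flats, and coercivity of the mobility -/

section Flats

variable {E J : Type*} [NormedAddCommGroup E] [InnerProductSpace ℝ E] [FiniteDimensional ℝ E]

theorem norm_sub_starProjection_le (F : Submodule ℝ E) (z : E) {w : E} (hw : w ∈ F) :
    ‖z - F.starProjection z‖ ≤ ‖z - w‖ := by
  rw [Submodule.starProjection_minimal]
  exact ciInf_le ⟨0, by rintro _ ⟨x, rfl⟩; exact norm_nonneg _⟩ (⟨w, hw⟩ : F)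

theorem norm_sub_starProjection_sq (F : Submodule ℝ E) (z : E) :
    ‖z - F.starProjection z‖ ^ 2 = ‖z‖ ^ 2 - ‖F.starProjection z‖ ^ 2 := by
  have h := F.norm_sq_eq_add_norm_sq_starProjection z
  rw [Submodule.starProjection_orthogonal_val] at h
  linarith

/-- The squared distance to an intersection of two subspaces is controlled by the squared
distances to the two subspaces. -/
theorem exists_dist_inf_le (F G : Submodule ℝ E) :
    ∃ C : ℝ, 0 ≤ C ∧ ∀ (z : E) (H : Submodule ℝ E), H = F ⊓ G →
      ‖z - H.starProjection z‖ ^ 2 ≤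
        C * (‖z - F.starProjection z‖ ^ 2 + ‖z - G.starProjection z‖ ^ 2) := by
  let L : E →ₗ[ℝ] E × E :=
    (LinearMap.id - F.starProjection.toLinearMap).prod
      (LinearMap.id - G.starProjection.toLinearMap)
  have hL : ∀ z, L z = (z - F.starProjection z, z - G.starProjection z) := fun z => rfl
  -- On the complement of `F ⊓ G` the pair of deviations from `F` and `G` vanishes only at `0`; an
  -- injective linear map in finite dimension is bounded below, and this bound gives the constant.
  let M := L.comp ((F ⊓ G)ᗮ).subtype
  have hker : LinearMap.ker M = ⊥ := by
    rw [LinearMap.ker_eq_bot']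
    rintro ⟨x, hx⟩ h
    have h' : L x = 0 := h
    rw [hL, Prod.mk_eq_zero, sub_eq_zero, sub_eq_zero] at h'
    have hF : x ∈ F := F.starProjection_eq_self_iff.1 h'.1.symm
    have hG : x ∈ G := G.starProjection_eq_self_iff.1 h'.2.symm
    have := Submodule.inner_right_of_mem_orthogonal (Submodule.mem_inf.2 ⟨hF, hG⟩) hx
    simpa using this
  obtain ⟨K, _, hK⟩ := M.exists_antilipschitzWith hker
  refine ⟨(K : ℝ) ^ 2, by positivity, ?_⟩
  rintro z H rfl
  have hmem : z - (F ⊓ G).starProjection z ∈ (F ⊓ G)ᗮ :=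
    Submodule.sub_starProjection_mem_orthogonal z
  have hP := (F ⊓ G).starProjection_apply_mem z
  have h1 := hK.le_mul_dist ⟨_, hmem⟩ 0
  have h2 : M ⟨_, hmem⟩ = L z := by
    change L (z - (F ⊓ G).starProjection z) = L z
    rw [map_sub, sub_eq_self, hL, F.starProjection_eq_self_iff.2 hP.1,
      G.starProjection_eq_self_iff.2 hP.2]
    simp
  rw [dist_zero_right, map_zero, dist_zero_right, h2, hL, Submodule.coe_norm, Prod.norm_def] at h1
  have h3 : (max ‖z - F.starProjection z‖ ‖z - G.starProjection z‖) ^ 2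
      ≤ ‖z - F.starProjection z‖ ^ 2 + ‖z - G.starProjection z‖ ^ 2 := by
    rcases max_cases ‖z - F.starProjection z‖ ‖z - G.starProjection z‖ with h | h <;>
      rw [h.1] <;> simp
  calc ‖z - (F ⊓ G).starProjection z‖ ^ 2
      ≤ (K * max ‖z - F.starProjection z‖ ‖z - G.starProjection z‖) ^ 2 := by
        gcongr
    _ ≤ _ := by rw [mul_pow]; gcongr

/-- The intersection of the members of the family `F` that are within relative distance `δ`
of `z`. -/
def coreFlat (F : J → Submodule ℝ E) (δ : ℝ) (z : E) : Submodule ℝ E :=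
  ⨅ (j : J) (_ : ‖z - (F j).starProjection z‖ ≤ δ * ‖z‖), F j

theorem coreFlat_le {F : J → Submodule ℝ E} {δ : ℝ} {z : E} {j : J}
    (h : ‖z - (F j).starProjection z‖ ≤ δ * ‖z‖) : coreFlat F δ z ≤ F j :=
  iInf₂_le j h

/-- Weight comparing two nonnegative numbers: it is `1` if `b ≤ a` and `0` if `a ≤ (1 - e) b`. -/
noncomputable def compareWeight (e a b : ℝ) : ℝ :=
  Real.smoothTransition ((a - (1 - e) * b) / (e / 2 * (a + b)))

theorem compareWeight_eq_one {e a b : ℝ} (he : 0 < e) (he1 : e ≤ 1) (ha : 0 < a) (hb : 0 ≤ b)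
    (hab : b ≤ a) : compareWeight e a b = 1 := by
  refine Real.smoothTransition.one_of_one_le ?_
  rw [le_div_iff₀ (by positivity)]
  nlinarith

theorem lt_of_compareWeight_ne_zero {e a b : ℝ} (he : 0 < e) (ha : 0 ≤ a) (hb : 0 ≤ b)
    (h : compareWeight e a b ≠ 0) : (1 - e) * b < a := by
  by_contra! hle
  exact h (Real.smoothTransition.zero_of_nonpos
    (div_nonpos_of_nonpos_of_nonneg (by linarith) (by positivity)))

theorem compareWeight_smul {e a b t : ℝ} (ht : t ≠ 0) :
    compareWeight e (t * a) (t * b) = compareWeight e a b := by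
  unfold compareWeight
  rw [show t * a - (1 - e) * (t * b) = t * (a - (1 - e) * b) by ring,
    show e / 2 * (t * a + t * b) = t * (e / 2 * (a + b)) by ring, mul_div_mul_left _ _ ht]

variable [Fintype J]

/-- A positively homogeneous map `ρ`, smooth away from `0` and close to the identity, which near
`z₀` only depends on the projection onto the intersection of the members of the family `F` that are
close to `z₀`. -/
structure IsFlatRetraction (F : J → Submodule ℝ E) (κ α : ℝ) (ρ : E → E) : Prop where
  pos : 0 < α
  le_half : α ≤ 1 / 2
  contDiffAt : ∀ z, z ≠ 0 → ContDiffAt ℝ ∞ ρ z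
  map_smul : ∀ (t : ℝ) (z : E), 0 < t → ρ (t • z) = t • ρ z
  norm_sub_le : ∀ z, ‖ρ z - z‖ ≤ κ * ‖z‖
  invariant : ∀ z₀ z d : E, z₀ ≠ 0 → ‖z - z₀‖ ≤ α * ‖z₀‖ → ‖z + d - z₀‖ ≤ α * ‖z₀‖ →
    d ∈ (coreFlat F (2 * α) z₀)ᗮ → ρ (z + d) = ρ z

/-- Smooth approximate retraction onto the members of a finite family of subspaces. -/
theorem exists_retraction (F : J → Submodule ℝ E) (hinf : ∀ j k, ∃ l, F l = F j ⊓ F k)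
    (htop : ∃ j, F j = ⊤) {κ : ℝ} (hκ : 0 < κ) :
    ∃ (α : ℝ) (ρ : E → E), IsFlatRetraction F κ α ρ := by
  classical
  obtain ⟨j₀, hj₀⟩ := htop
  choose C hC0 hC using fun j k => exists_dist_inf_le (F j) (F k)
  obtain ⟨C0, hC0pos, hC0⟩ : ∃ C0 : ℝ, 0 ≤ C0 ∧ ∀ j k, C j k ≤ C0 :=
    ⟨∑ j, ∑ k, C j k, Finset.sum_nonneg fun j _ => Finset.sum_nonneg fun k _ => hC0 j k,
      fun j k => (Finset.single_le_sum (fun k _ => hC0 j k) (Finset.mem_univ k)).trans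
        (Finset.single_le_sum (f := fun j => ∑ k, C j k)
          (fun j _ => Finset.sum_nonneg fun k _ => hC0 j k) (Finset.mem_univ j))⟩
  set N := Module.finrank ℝ E
  -- The third condition lets a flat of lower dimension win the comparison in `hact`; the last one
  -- turns the squared distance `2 η ‖z‖²` into `κ ‖z‖`.
  obtain ⟨η, hη, hη1, hη2, hηκ⟩ : ∃ η : ℝ, 0 < η ∧ η ≤ 1 / 2 ∧ η * (4 + 6 * C0) ≤ 1 ∧
      2 * η ≤ κ ^ 2 := by
    refine ⟨min (1 / (4 + 6 * C0)) (κ ^ 2 / 2), by positivity, ?_, ?_, ?_⟩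
    · refine (min_le_left _ _).trans ?_
      exact one_div_le_one_div_of_le (by norm_num) (by linarith)
    · have := min_le_left (1 / (4 + 6 * C0)) (κ ^ 2 / 2)
      rwa [le_div_iff₀ (by positivity)] at this
    · have := min_le_right (1 / (4 + 6 * C0)) (κ ^ 2 / 2)
      linarith
  -- A bonus that grows by a factor of at least `1 / η` with each drop in dimension: among flats
  -- passing almost equally close to `z`, the smallest has the highest score `a`.
  let w : J → ℝ := fun j => η ^ (Module.finrank ℝ (F j) + 1)
  have hw : ∀ j, 0 < w j := fun j => by positivity
  have hwη : ∀ j, w j ≤ η := fun j => by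
    simpa using pow_le_pow_of_le_one hη.le (by linarith)
      (show 1 ≤ Module.finrank ℝ (F j) + 1 by omega)
  -- The tolerance for being almost maximal, at most every bonus `w j`.
  set e : ℝ := η ^ (N + 2)
  have he : 0 < e := by positivity
  have he1 : e ≤ 1 := pow_le_one₀ hη.le (by linarith)
  have hew : ∀ j, e ≤ w j := fun j => by
    refine pow_le_pow_of_le_one hη.le (by linarith) ?_
    have := (F j).finrank_le
    omega
  have hwlt : ∀ j k, F k < F j → w j ≤ η * w k := by
    intro j k h
    have := Submodule.finrank_lt_finrank_of_lt h
    change η ^ (_ + 1) ≤ η * η ^ (_ + 1)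
    rw [← pow_succ']
    exact pow_le_pow_of_le_one hη.le (by linarith) (by omega)
  let a : J → E → ℝ := fun j z => (1 + w j) * ‖(F j).starProjection z‖ ^ 2
  have ha0 : ∀ j z, 0 ≤ a j z := fun j z => by have := hw j; positivity
  have hatop : ∀ z, ‖z‖ ^ 2 ≤ a j₀ z := by
    intro z
    have : (F j₀).starProjection z = z := by
      rw [Submodule.starProjection_eq_self_iff, hj₀]; trivial
    simp only [a, this]
    nlinarith [hw j₀, sq_nonneg ‖z‖]
  have hale : ∀ j z, a j z ≤ (1 + w j) * ‖z‖ ^ 2 := fun j z => by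
    have := hw j
    have := (F j).norm_starProjection_apply_le z
    simp only [a]; gcongr
  -- almost maximal members
  have hdist : ∀ j z, (∀ k, (1 - e) * a k z < a j z) →
      ‖z - (F j).starProjection z‖ ^ 2 ≤ 2 * w j * ‖z‖ ^ 2 := by
    intro j z h
    have h1 := h j₀
    have h2 := hatop z
    have h3 := hw j
    have h4 := hew j
    rw [norm_sub_starProjection_sq]
    have h5 : (1 - e) * ‖z‖ ^ 2 ≤ (1 + w j) * ‖(F j).starProjection z‖ ^ 2 :=
      (mul_le_mul_of_nonneg_left h2 (by linarith)).trans h1.le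
    have h6 : ‖(F j).starProjection z‖ ^ 2 ≤ ‖z‖ ^ 2 := by
      have := (F j).norm_starProjection_apply_le z
      gcongr
    nlinarith [sq_nonneg ‖z‖, mul_le_mul_of_nonneg_left h6 h3.le,
      mul_le_mul_of_nonneg_right h4 (sq_nonneg ‖z‖)]
  -- An almost maximal flat is contained in every flat that passes very close to `z`. Otherwise the
  -- intersection of the two would be strictly smaller and, by the comparison of distances, still so
  -- close that its larger bonus beats the score of `F j`.
  have hact : ∀ j k z, z ≠ 0 → (∀ k, (1 - e) * a k z < a j z) →
      ‖z - (F k).starProjection z‖ ^ 2 ≤ e * ‖z‖ ^ 2 → F j ≤ F k := by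
    intro j k z hz h hk
    by_contra hle
    obtain ⟨l, hl⟩ := hinf j k
    have hlt : F l < F j := by
      rw [hl]; exact inf_lt_left.2 hle
    have h1 := hC j k z _ hl
    have h2 := hdist j z h
    have h3 : ‖z - (F l).starProjection z‖ ^ 2 ≤ 3 * C0 * w j * ‖z‖ ^ 2 := by
      refine h1.trans ?_
      calc _ ≤ C0 * (2 * w j * ‖z‖ ^ 2 + w j * ‖z‖ ^ 2) := by
            gcongr
            · exact hC0 j k
            · exact hk.trans (mul_le_mul_of_nonneg_right (hew j) (sq_nonneg _))
        _ = _ := by ring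
    rw [norm_sub_starProjection_sq] at h3
    have h4 := h l
    have h5 := hale j z
    have h6 := hwlt j l hlt
    have h7 := hwη l
    have hl0 := hw l
    have hj0 := hw j
    have hz2 : 0 < ‖z‖ ^ 2 := by have := norm_pos_iff.2 hz; positivity
    have h8 : (1 - e) * ((1 + w l) * ((1 - 3 * C0 * w j) * ‖z‖ ^ 2)) < (1 + w j) * ‖z‖ ^ 2 := by
      refine lt_of_le_of_lt ?_ (h4.trans_le h5)
      simp only [a]
      have : 0 ≤ 1 - e := by linarith
      gcongr
      linarith
    have h9 : (1 - e) * ((1 + w l) * (1 - 3 * C0 * w j)) < 1 + w j := by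
      by_contra! hcon
      have := mul_le_mul_of_nonneg_right hcon hz2.le
      nlinarith
    have h10 := hew j
    have h11 : (1 + w l) - 2 * (e + 3 * C0 * w j)
        ≤ (1 - e) * ((1 + w l) * (1 - 3 * C0 * w j)) := by
      have hx : 0 ≤ C0 * w j := by positivity
      have : 0 ≤ (1 + w l) * (e * (3 * C0 * w j)) := by positivity
      have h12 : (1 + w l) * (e + 3 * C0 * w j) ≤ 2 * (e + 3 * C0 * w j) := by
        gcongr; linarith
      nlinarith
    have h13 : w l < w j * (3 + 6 * C0) := by nlinarith
    have h14 : w j * (3 + 6 * C0) ≤ w l * (η * (4 + 6 * C0)) := by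
      calc w j * (3 + 6 * C0) ≤ η * w l * (4 + 6 * C0) := by gcongr; norm_num
        _ = _ := by ring
    nlinarith
  -- The weight is `1` at a maximizer and `0` as soon as `j` fails to be almost maximal; `ρ` is the
  -- resulting weighted average of the projections.
  let W : J → E → ℝ := fun j z => ∏ k, compareWeight e (a j z) (a k z)
  have hW0 : ∀ j z, 0 ≤ W j z := fun j z =>
    Finset.prod_nonneg fun k _ => Real.smoothTransition.nonneg _
  have hWact : ∀ j z, W j z ≠ 0 → ∀ k, (1 - e) * a k z < a j z := fun j z h k =>
    lt_of_compareWeight_ne_zero he (ha0 j z) (ha0 k z) (Finset.prod_ne_zero_iff.1 h k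
      (Finset.mem_univ k))
  have hmax : ∀ z, z ≠ 0 → ∃ j, (∀ k, a k z ≤ a j z) ∧ 0 < a j z ∧ W j z = 1 := by
    intro z hz
    obtain ⟨j, _, hj⟩ := Finset.exists_max_image Finset.univ (fun j => a j z)
      ⟨j₀, Finset.mem_univ _⟩
    have hpos : 0 < a j z := by
      have := hj j₀ (Finset.mem_univ _)
      have := hatop z
      have := norm_pos_iff.2 hz
      have : 0 < ‖z‖ ^ 2 := by positivity
      linarith
    exact ⟨j, fun k => hj k (Finset.mem_univ k), hpos, Finset.prod_eq_one fun k _ =>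
      compareWeight_eq_one he he1 hpos (ha0 k z) (hj k (Finset.mem_univ k))⟩
  have hWsum : ∀ z, z ≠ 0 → 0 < ∑ j, W j z := by
    intro z hz
    obtain ⟨j, _, _, hj⟩ := hmax z hz
    have := Finset.single_le_sum (fun k _ => hW0 k z) (Finset.mem_univ j)
    linarith
  have hasm : ∀ j, ContDiff ℝ ∞ (a j) := fun j =>
    contDiff_const.mul ((F j).starProjection.contDiff.norm_sq ℝ)
  -- Where `a j z = 0` the factor `k = j` is a quotient `0 / 0`, but there the score of `⊤`
  -- dominates and the weight vanishes in a neighbourhood.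
  have hWsm : ∀ j z, z ≠ 0 → ContDiffAt ℝ ∞ (W j) z := by
    intro j z hz
    rcases (ha0 j z).eq_or_lt with h | h
    · have hev : W j =ᶠ[𝓝 z] fun _ => 0 := by
        have hpos : a j z < (1 - e) * a j₀ z := by
          rw [← h]
          have := hatop z
          have := norm_pos_iff.2 hz
          have h3 : 0 < ‖z‖ ^ 2 := by positivity
          have : e < 1 := pow_lt_one₀ hη.le (by linarith) (by omega)
          have : 0 < 1 - e := by linarith
          have : 0 < a j₀ z := by linarith
          positivity
        filter_upwards [(hasm j).continuous.continuousAt.eventually_lt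
          ((hasm j₀).continuous.const_mul _ |>.continuousAt) hpos] with y hy
        by_contra hne
        exact absurd (hWact j y hne j₀) (not_lt.2 hy.le)
      exact contDiffAt_const.congr_of_eventuallyEq hev
    · refine contDiffAt_prod fun k _ => ?_
      refine Real.smoothTransition.contDiffAt.comp z ?_
      refine ContDiffAt.div ?_ ?_ ?_
      · exact (hasm j).contDiffAt.sub (contDiffAt_const.mul (hasm k).contDiffAt)
      · exact contDiffAt_const.mul ((hasm j).contDiffAt.add (hasm k).contDiffAt)
      · have := ha0 k z; positivity
  -- With this choice a flat within `2 α ‖z₀‖` of `z₀` is within `3 α ‖z₀‖ = e / 2 * ‖z₀‖ ≤ e ‖y‖`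
  -- of any `y` with `‖y - z₀‖ ≤ α ‖z₀‖`, so `hact` applies at `y`.
  let α := e / 6
  refine ⟨α, fun z => (∑ j, W j z)⁻¹ • ∑ j, W j z • (F j).starProjection z, by positivity,
    by simp only [α]; linarith, ?_, ?_, ?_, ?_⟩
  · intro z hz
    refine ContDiffAt.smul (ContDiffAt.inv (ContDiffAt.sum fun j _ => hWsm j z hz)
      (hWsum z hz).ne') (ContDiffAt.sum fun j _ => (hWsm j z hz).smul
      (F j).starProjection.contDiff.contDiffAt)
  · intro t z ht
    have hat : ∀ j, a j (t • z) = t ^ 2 * a j z := fun j => by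
      simp only [a, map_smul, norm_smul, mul_pow, Real.norm_eq_abs, sq_abs]; ring
    have hWt : ∀ j, W j (t • z) = W j z := fun j => by
      simp only [W, hat]
      exact Finset.prod_congr rfl fun k _ => compareWeight_smul (by positivity)
    simp only [hWt, map_smul, smul_comm _ t, ← Finset.smul_sum]
  · intro z
    rcases eq_or_ne z 0 with rfl | hz
    · simp
    have hs := hWsum z hz
    have : (∑ j, W j z)⁻¹ • ∑ j, W j z • (F j).starProjection z - z
        = (∑ j, W j z)⁻¹ • ∑ j, W j z • ((F j).starProjection z - z) := by
      simp only [smul_sub, Finset.sum_sub_distrib, ← Finset.sum_smul]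
      rw [smul_smul, inv_mul_cancel₀ hs.ne', one_smul]
    rw [this, norm_smul, norm_inv, Real.norm_of_nonneg hs.le, inv_mul_le_iff₀ hs, Finset.sum_mul]
    refine (norm_sum_le _ _).trans (Finset.sum_le_sum fun j _ => ?_)
    rw [norm_smul, Real.norm_of_nonneg (hW0 j z)]
    rcases eq_or_ne (W j z) 0 with h | h
    · simp [h]
    refine mul_le_mul_of_nonneg_left ?_ (hW0 j z)
    rw [norm_sub_rev]
    refine le_of_sq_le_sq ?_ (by positivity)
    refine (hdist j z (hWact j z h)).trans ?_
    rw [mul_pow]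
    gcongr
    linarith [hwη j]
  · intro z₀ z d hz₀ hz hzd hd
    have hz₀' := norm_pos_iff.2 hz₀
    have hα : α ≤ 1 / 6 := by simp only [α]; linarith
    have key : ∀ y, ‖y - z₀‖ ≤ α * ‖z₀‖ → y ≠ 0 ∧
        ∀ j, (∀ k, (1 - e) * a k y < a j y) → F j ≤ coreFlat F (2 * α) z₀ := by
      intro y hy
      have hyn : ‖z₀‖ / 2 ≤ ‖y‖ := by
        have := norm_sub_norm_le z₀ y
        rw [norm_sub_rev] at this
        nlinarith
      have hy0 : y ≠ 0 := norm_pos_iff.1 (by linarith)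
      refine ⟨hy0, fun j hj => le_iInf₂ fun k hk => hact j k y hy0 hj ?_⟩
      have h1 : ‖y - (F k).starProjection y‖ ≤ e * ‖y‖ := by
        refine (norm_sub_starProjection_le (F k) y ((F k).starProjection_apply_mem z₀)).trans ?_
        have := norm_sub_le_norm_sub_add_norm_sub y z₀ ((F k).starProjection z₀)
        have : α = e / 6 := rfl
        nlinarith
      calc ‖y - (F k).starProjection y‖ ^ 2 ≤ (e * ‖y‖) ^ 2 := by gcongr
        _ = e * (e * ‖y‖ ^ 2) := by ring
        _ ≤ 1 * (e * ‖y‖ ^ 2) := by gcongr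
        _ = _ := one_mul _
    set K := coreFlat F (2 * α) z₀
    -- Flats not inside `K` drop out of the product: a maximizer lies in `K`, and a flat outside `K`
    -- is not almost maximal, so its score is below that of `j` whenever `j` survives the comparison
    -- with the maximizer. What remains depends only on projections onto flats inside `K`, which do
    -- not see `d`.
    have hWeq : ∀ y, ‖y - z₀‖ ≤ α * ‖z₀‖ → ∀ j, F j ≤ K →
        W j y = ∏ k with F k ≤ K, compareWeight e (a j y) (a k y) := by
      intro y hy j hj
      obtain ⟨hy0, hy1⟩ := key y hy
      simp only [W]
      rw [← Finset.prod_filter_mul_prod_filter_not Finset.univ (fun k => F k ≤ K)]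
      by_cases h : ∏ k with F k ≤ K, compareWeight e (a j y) (a k y) = 0
      · rw [h, zero_mul]
      rw [Finset.prod_eq_one (s := Finset.univ.filter fun k => ¬ F k ≤ K), mul_one]
      intro k hk
      obtain ⟨m, hm1, hm2, hm3⟩ := hmax y hy0
      have hmK : F m ≤ K := hy1 m (hWact m y (by simp [hm3]))
      have h1 := lt_of_compareWeight_ne_zero he (ha0 j y) (ha0 m y)
        (Finset.prod_ne_zero_iff.1 h m (by simpa using hmK))
      have h2 : ¬ ∀ l, (1 - e) * a l y < a k y := fun hcon =>
        (Finset.mem_filter.1 hk).2 (hy1 k hcon)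
      push Not at h2
      obtain ⟨l, hl⟩ := h2
      have h3 : a k y ≤ a j y := hl.trans
        ((mul_le_mul_of_nonneg_left (hm1 l) (by linarith)).trans h1.le)
      have h4 : 0 < a j y := lt_of_le_of_lt (mul_nonneg (by linarith) (ha0 m y)) h1
      exact compareWeight_eq_one he he1 h4 (ha0 k y) h3
    have hPd : ∀ j, F j ≤ K → (F j).starProjection (z + d) = (F j).starProjection z := by
      intro j hj
      have : d ∈ (F j)ᗮ := Submodule.orthogonal_le hj hd
      rw [map_add, (Submodule.starProjection_apply_eq_zero_iff _).2 this, add_zero]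
    have had : ∀ j, F j ≤ K → a j (z + d) = a j z := fun j hj => by simp only [a, hPd j hj]
    have hWd : ∀ j, W j (z + d) = W j z := by
      intro j
      by_cases hj : F j ≤ K
      · rw [hWeq _ hzd j hj, hWeq _ hz j hj]
        refine Finset.prod_congr rfl fun k hk => ?_
        rw [had j hj, had k (Finset.mem_filter.1 hk).2]
      · rw [not_not.1 fun h => hj ((key _ hzd).2 j (hWact j _ h)),
          not_not.1 fun h => hj ((key _ hz).2 j (hWact j _ h))]
    simp only [hWd]
    congr 1
    refine Finset.sum_congr rfl fun j _ => ?_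
    by_cases hj : F j ≤ K
    · rw [hPd j hj]
    · rw [not_not.1 fun h => hj ((key _ hz).2 j (hWact j _ h)), zero_smul, zero_smul]

variable {ι : Type*}

/-- A vector of the span that is orthogonal to all its generators is zero, so the map to the inner
products with the generators is injective on the span and hence bounded below. -/
theorem exists_lower_bound_span [Fintype ι] (v : ι → E) (I : Finset ι) :
    ∃ c : ℝ, 0 < c ∧ ∀ y : E, c * ‖(spanFlat v {I}).starProjection y‖ ^ 2
      ≤ ∑ i ∈ I, inner ℝ (v i) y ^ 2 := by
  classical
  set F := spanFlat v {I} with hF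
  have hFI : F = Submodule.span ℝ (v '' I) := by simp [hF, spanFlat]
  have hvF : ∀ i ∈ I, v i ∈ F := fun i hi => by
    rw [hFI]; exact Submodule.subset_span ⟨i, hi, rfl⟩
  let M : F →ₗ[ℝ] (I → ℝ) := LinearMap.pi fun i => (innerₛₗ ℝ (v i)).comp F.subtype
  have hM : ∀ (x : F) (i : I), M x i = inner ℝ (v i) (x : E) := fun x i => rfl
  have hker : LinearMap.ker M = ⊥ := by
    rw [LinearMap.ker_eq_bot']
    intro x hx
    have h1 : (x : E) ∈ Fᗮ := by
      refine (Submodule.mem_orthogonal _ _).2 fun u hu => ?_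
      rw [hFI] at hu
      induction hu using Submodule.span_induction with
      | mem u hu =>
        obtain ⟨i, hi, rfl⟩ := hu
        exact congrFun hx ⟨i, hi⟩
      | zero => simp
      | add a b _ _ ha hb => rw [inner_add_left, ha, hb, add_zero]
      | smul t a _ ha => rw [inner_smul_left, ha, mul_zero]
    have := Submodule.inner_right_of_mem_orthogonal x.2 h1
    simpa using this
  obtain ⟨K, hK0, hK⟩ := M.exists_antilipschitzWith hker
  refine ⟨((K : ℝ) ^ 2)⁻¹, by positivity, fun y => ?_⟩
  have h1 := hK.le_mul_dist ⟨_, F.starProjection_apply_mem y⟩ 0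
  rw [dist_zero_right, map_zero, dist_zero_right, Submodule.coe_norm] at h1
  rw [inv_mul_le_iff₀ (by positivity)]
  refine (pow_le_pow_left₀ (norm_nonneg _) h1 2).trans ?_
  rw [mul_pow]
  refine mul_le_mul_of_nonneg_left ?_ (by positivity)
  have hnn : 0 ≤ ∑ i ∈ I, inner ℝ (v i) y ^ 2 := Finset.sum_nonneg fun i _ => sq_nonneg _
  rw [← Real.le_sqrt (norm_nonneg _) hnn, pi_norm_le_iff_of_nonneg (Real.sqrt_nonneg _)]
  rintro ⟨i, hi⟩
  have h2 : M ⟨F.starProjection y, F.starProjection_apply_mem y⟩ ⟨i, hi⟩ = inner ℝ (v i) y := by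
    rw [hM]
    change inner ℝ (v i) (F.starProjection y) = _
    rw [← Submodule.inner_starProjection_left_eq_right, F.starProjection_eq_self_iff.2 (hvF i hi)]
  rw [h2]
  refine Real.le_sqrt_of_sq_le ?_
  rw [Real.norm_eq_abs, sq_abs]
  exact Finset.single_le_sum (f := fun i => inner ℝ (v i) y ^ 2) (fun i _ => sq_nonneg _) hi

/-- The mobility `∑ sᵢ vᵢ ⊗ vᵢ` of a nonnegative representation of a vector near `z₀` is uniformly
positive on the core flat at `z₀`. -/
theorem exists_lower_bound_coreFlat [Fintype ι] (v : ι → E) {α : ℝ} (hα : 0 < α) :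
    ∃ c : ℝ, 0 < c ∧ ∀ (z₀ : E) (s : ι → ℝ), z₀ ≠ 0 → (∀ i, 0 ≤ s i) →
      ‖∑ i, s i • v i - z₀‖ ≤ α * ‖z₀‖ → ∀ y : E,
        c * ‖z₀‖ * ‖(coreFlat (spanFlat v) (2 * α) z₀).starProjection y‖ ^ 2
          ≤ ∑ i, s i * inner ℝ (v i) y ^ 2 := by
  classical
  choose c hc0 hc using exists_lower_bound_span v
  obtain ⟨c₁, hc₁, hc₁'⟩ : ∃ c₁ : ℝ, 0 < c₁ ∧ ∀ I, c₁ ≤ c I := by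
    obtain ⟨I, _, hI⟩ := Finset.exists_min_image Finset.univ c ⟨∅, Finset.mem_univ _⟩
    exact ⟨c I, hc0 I, fun I' => hI I' (Finset.mem_univ _)⟩
  -- Chosen so that all terms with coefficient below `β ‖z₀‖` together have norm at most `α ‖z₀‖`.
  set β := α / (1 + ∑ i, ‖v i‖)
  have hS : 0 ≤ ∑ i, ‖v i‖ := Finset.sum_nonneg fun i _ => norm_nonneg _
  have hβ : 0 < β := by positivity
  have hβ' : β * ∑ i, ‖v i‖ ≤ α := by
    rw [div_mul_eq_mul_div, div_le_iff₀ (by positivity)]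
    nlinarith
  refine ⟨β * c₁, by positivity, fun z₀ s hz₀ hs hz y => ?_⟩
  -- The indices with large coefficients span a flat within `2 α ‖z₀‖` of `z₀`. The core flat is
  -- contained in it, and on it the mobility is at least of order `‖z₀‖`.
  let I : Finset ι := Finset.univ.filter fun i => β * ‖z₀‖ ≤ s i
  have hw : ∑ i ∈ I, s i • v i ∈ spanFlat v {I} := by
    simp only [spanFlat, Finset.inf_singleton]
    exact Submodule.sum_mem _ fun i hi => Submodule.smul_mem _ _
      (Submodule.subset_span ⟨i, hi, rfl⟩)
  have hnear : ‖z₀ - (spanFlat v {I}).starProjection z₀‖ ≤ 2 * α * ‖z₀‖ := by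
    refine (norm_sub_starProjection_le _ _ hw).trans ?_
    have h1 : z₀ - ∑ i ∈ I, s i • v i = (z₀ - ∑ i, s i • v i)
        + ∑ i with ¬ β * ‖z₀‖ ≤ s i, s i • v i := by
      rw [← Finset.sum_filter_add_sum_filter_not Finset.univ (fun i => β * ‖z₀‖ ≤ s i)]
      abel
    have h2 : ‖∑ i with ¬ β * ‖z₀‖ ≤ s i, s i • v i‖ ≤ α * ‖z₀‖ := by
      calc _ ≤ ∑ i with ¬ β * ‖z₀‖ ≤ s i, β * ‖z₀‖ * ‖v i‖ := by
            refine norm_sum_le_of_le _ fun i hi => ?_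
            rw [norm_smul, Real.norm_of_nonneg (hs i)]
            exact mul_le_mul_of_nonneg_right (not_le.1 (Finset.mem_filter.1 hi).2).le
              (norm_nonneg _)
        _ ≤ ∑ i, β * ‖z₀‖ * ‖v i‖ := Finset.sum_le_sum_of_subset_of_nonneg
            (Finset.filter_subset _ _) fun i _ _ => by positivity
        _ = (β * ∑ i, ‖v i‖) * ‖z₀‖ := by rw [← Finset.mul_sum]; ring
        _ ≤ _ := by gcongr
    rw [h1]
    refine (norm_add_le _ _).trans ?_
    rw [norm_sub_rev]
    linarith
  have hle := coreFlat_le hnear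
  have hP : ‖(coreFlat (spanFlat v) (2 * α) z₀).starProjection y‖
      ≤ ‖(spanFlat v {I}).starProjection y‖ := by
    have h := congrArg (fun L => L y) (Submodule.starProjection_comp_starProjection_of_le hle)
    simp only [ContinuousLinearMap.comp_apply] at h
    rw [← h]
    exact Submodule.norm_starProjection_apply_le _ _
  calc _ ≤ β * c₁ * ‖z₀‖ * ‖(spanFlat v {I}).starProjection y‖ ^ 2 := by gcongr
    _ = β * ‖z₀‖ * (c₁ * ‖(spanFlat v {I}).starProjection y‖ ^ 2) := by ring
    _ ≤ β * ‖z₀‖ * ∑ i ∈ I, inner ℝ (v i) y ^ 2 := by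
        have := (mul_le_mul_of_nonneg_right (hc₁' I) (sq_nonneg _)).trans (hc I y)
        gcongr
    _ = ∑ i ∈ I, β * ‖z₀‖ * inner ℝ (v i) y ^ 2 := by rw [Finset.mul_sum]
    _ ≤ ∑ i ∈ I, s i * inner ℝ (v i) y ^ 2 := Finset.sum_le_sum fun i hi =>
        mul_le_mul_of_nonneg_right (Finset.mem_filter.1 hi).2 (sq_nonneg _)
    _ ≤ _ := Finset.sum_le_sum_of_subset_of_nonneg (Finset.subset_univ _) fun i _ _ =>
        mul_nonneg (hs i) (sq_nonneg _)

end Flats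


/-! ### Derivatives of positively homogeneous maps -/

section Homogeneous

theorem one_add_one_le_infty : (1 : WithTop ℕ∞) + 1 ≤ ((⊤ : ℕ∞) : WithTop ℕ∞) := by
  rw [one_add_one_eq_two]
  exact WithTop.coe_le_coe.2 (le_top : (2 : ℕ∞) ≤ ⊤)

variable {E E' : Type*} [NormedAddCommGroup E] [NormedSpace ℝ E] [NormedAddCommGroup E']

theorem fderiv_smul_of_homogeneous [NormedSpace ℝ E'] {f : E → E'} {k : ℕ}
    (h : ∀ (t : ℝ) (z : E), 0 < t → f (t • z) = t ^ (k + 1) • f z) {t : ℝ} (ht : 0 < t) {z : E}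
    (hf : DifferentiableAt ℝ f z) : fderiv ℝ f (t • z) = t ^ k • fderiv ℝ f z := by
  have h1 : fderiv ℝ (fun y => f (t • y)) z = t • fderiv ℝ f (t • z) := fderiv_comp_smul t
  have h2 : (fun y => f (t • y)) = fun y => t ^ (k + 1) • f y := funext fun y => h t y ht
  rw [h2, fderiv_fun_const_smul hf, pow_succ', mul_smul] at h1
  exact (smul_right_injective _ ht.ne' h1).symm

/-- All values are attained on the unit sphere, which is compact. -/
theorem exists_norm_le_of_homogeneous_zero [FiniteDimensional ℝ E] {f : E → E'}
    (h : ∀ (t : ℝ) (z : E), 0 < t → z ≠ 0 → f (t • z) = f z) (hf : ContinuousOn f {0}ᶜ) :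
    ∃ C : ℝ, 0 ≤ C ∧ ∀ z, z ≠ 0 → ‖f z‖ ≤ C := by
  have := FiniteDimensional.proper_real E
  obtain ⟨C, hC⟩ := (isCompact_sphere (0 : E) 1).exists_bound_of_continuousOn
    (hf.mono fun z hz => by rintro rfl; simp at hz)
  refine ⟨max C 0, le_max_right _ _, fun z hz => ?_⟩
  have hz' := norm_pos_iff.2 hz
  rw [← h ‖z‖⁻¹ z (by positivity) hz]
  refine (hC _ ?_).trans (le_max_left _ _)
  simp [norm_smul, hz'.ne']

end Homogeneous

/-! ### The cut-off retraction and the potential -/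

section Retraction

variable {E J : Type*} [NormedAddCommGroup E] [InnerProductSpace ℝ E] [FiniteDimensional ℝ E]
  {F : J → Submodule ℝ E} {κ α : ℝ} {ρ : E → E}

/-- Invariance with base point `z` itself makes `ρ` constant along short segments from `z`
orthogonal to the core flat, so the derivative vanishes in these directions. -/
theorem IsFlatRetraction.fderiv_apply (hρ : IsFlatRetraction F κ α ρ) {z : E} (hz : z ≠ 0)
    (y : E) : fderiv ℝ ρ z y = fderiv ℝ ρ z ((coreFlat F (2 * α) z).starProjection y) := by
  have hz' := norm_pos_iff.2 hz
  have hd : y - (coreFlat F (2 * α) z).starProjection y ∈ (coreFlat F (2 * α) z)ᗮ :=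
    Submodule.sub_starProjection_mem_orthogonal y
  set d := y - (coreFlat F (2 * α) z).starProjection y
  have h0 : fderiv ℝ ρ z d = 0 := by
    have hdiff : DifferentiableAt ℝ ρ z := (hρ.contDiffAt z hz).differentiableAt (by simp)
    have h1 : HasDerivAt (fun t : ℝ => ρ (z + t • d)) (fderiv ℝ ρ z d) 0 := by
      have h2 : HasDerivAt (fun t : ℝ => z + t • d) d 0 := by
        simpa using ((hasDerivAt_id (0 : ℝ)).smul_const d).const_add z
      have h3 : HasFDerivAt ρ (fderiv ℝ ρ z) (z + (0 : ℝ) • d) := by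
        simpa using hdiff.hasFDerivAt
      exact h3.comp_hasDerivAt 0 h2
    have h4 : (fun t : ℝ => ρ (z + t • d)) =ᶠ[𝓝 0] fun _ => ρ z := by
      have h5 : ∀ᶠ t : ℝ in 𝓝 0, ‖t • d‖ < α * ‖z‖ := by
        have : Continuous fun t : ℝ => ‖t • d‖ := by fun_prop
        refine this.continuousAt.eventually_lt continuousAt_const ?_
        simpa using mul_pos hρ.pos hz'
      filter_upwards [h5] with t ht
      refine hρ.invariant z z (t • d) hz ?_ ?_ (Submodule.smul_mem _ _ hd)
      · simpa using mul_nonneg hρ.pos.le hz'.le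
      · simpa using ht.le
    exact h1.unique ((hasDerivAt_const (0 : ℝ) (ρ z)).congr_of_eventuallyEq h4)
  rw [map_sub, sub_eq_zero] at h0
  exact h0

theorem IsFlatRetraction.norm_le (hρ : IsFlatRetraction F κ α ρ) (hκ : κ ≤ 1 / 2) (z : E) :
    ‖ρ z‖ ≤ 3 / 2 * ‖z‖ := by
  have h1 := hρ.norm_sub_le z
  have h2 := norm_le_norm_add_norm_sub' (ρ z) z
  nlinarith [norm_nonneg z]

theorem IsFlatRetraction.le_norm (hρ : IsFlatRetraction F κ α ρ) (hκ : κ ≤ 1 / 2) (z : E) :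
    1 / 2 * ‖z‖ ≤ ‖ρ z‖ := by
  have h1 := hρ.norm_sub_le z
  have h2 := norm_le_norm_add_norm_sub (ρ z) z
  nlinarith [norm_nonneg z]

theorem IsFlatRetraction.exists_norm_fderiv_le (hρ : IsFlatRetraction F κ α ρ) :
    ∃ C : ℝ, 0 ≤ C ∧ ∀ z, z ≠ 0 → ‖fderiv ℝ ρ z‖ ≤ C := by
  refine exists_norm_le_of_homogeneous_zero (fun t z ht hz => ?_) fun z hz => ?_
  · have := fderiv_smul_of_homogeneous (k := 0) (by simpa using hρ.map_smul) ht
      ((hρ.contDiffAt z hz).differentiableAt (by simp))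
    simpa using this
  · exact ((hρ.contDiffAt z hz).fderiv_right (m := 0) (by simp)).continuousAt.continuousWithinAt

/-- The retraction, cut off at the level `lam`. -/
theorem IsFlatRetraction.exists_cutoff (hρ : IsFlatRetraction F κ α ρ) (hκ : κ ≤ 1 / 2) :
    ∃ C : ℝ, 0 ≤ C ∧ ∀ lam : ℝ, 0 < lam → ∃ H : E → E, ContDiff ℝ ∞ H ∧
      (∀ z, ‖H z - z‖ ≤ κ * ‖z‖ + 2 * lam) ∧
      (∀ z y, ‖fderiv ℝ H z y‖ ≤ C * ‖(coreFlat F (2 * α) z).starProjection y‖) ∧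
      ∀ z, ‖z‖ < lam / 2 → fderiv ℝ H z = 0 := by
  obtain ⟨C₁, hC₁, hC₁'⟩ := hρ.exists_norm_fderiv_le
  -- A fixed profile that vanishes on the unit ball and is the identity far out. The cutoff at level
  -- `lam` is its rescaling, which has the same derivative bound; this is why the constant does not
  -- depend on `lam`.
  let h : E → E := fun ξ => Real.smoothTransition (‖ξ‖ ^ 2 - 1) • ξ
  have hh : ContDiff ℝ ∞ h :=
    (Real.smoothTransition.contDiff.comp ((contDiff_norm_sq ℝ).sub contDiff_const)).smul contDiff_id
  obtain ⟨C₂, hC₂⟩ := (isCompact_closedBall (0 : E) 2).exists_bound_of_continuousOn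
    (hh.continuous_fderiv (by simp)).continuousOn
  have hC₂' : ∀ ξ, ‖fderiv ℝ h ξ‖ ≤ max C₂ 1 := by
    intro ξ
    rcases le_or_gt ‖ξ‖ 2 with hξ | hξ
    · exact (hC₂ ξ (by simpa using hξ)).trans (le_max_left _ _)
    · have : h =ᶠ[𝓝 ξ] id := by
        filter_upwards [continuous_norm.continuousAt.eventually_const_lt hξ] with x hx
        simp only [h]
        rw [Real.smoothTransition.one_of_one_le (by nlinarith), one_smul]; rfl
      rw [this.fderiv_eq, fderiv_id]
      exact ContinuousLinearMap.norm_id_le.trans (le_max_right _ _)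
  refine ⟨max C₂ 1 * C₁, by positivity, fun lam hlam => ?_⟩
  let hl : E → E := fun ξ => Real.smoothTransition (‖ξ‖ ^ 2 / lam ^ 2 - 1) • ξ
  have hlh : hl = fun ξ => lam • h (lam⁻¹ • ξ) := by
    funext ξ
    simp only [hl, h, norm_smul, norm_inv, Real.norm_of_nonneg hlam.le, mul_pow, smul_smul]
    congr 1
    rw [show (lam⁻¹) ^ 2 * ‖ξ‖ ^ 2 = ‖ξ‖ ^ 2 / lam ^ 2 by field_simp]
    field_simp
  have hlsm : ContDiff ℝ ∞ hl := by
    rw [hlh]; exact contDiff_const.smul (hh.comp (contDiff_const.smul contDiff_id))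
  have hl' : ∀ ξ, ‖fderiv ℝ hl ξ‖ ≤ max C₂ 1 := by
    intro ξ
    have : fderiv ℝ hl ξ = fderiv ℝ h (lam⁻¹ • ξ) := by
      have hd : DifferentiableAt ℝ (fun ξ => h (lam⁻¹ • ξ)) ξ :=
        ((hh.differentiable (by simp)).differentiableAt).comp ξ
          (differentiableAt_id.const_smul lam⁻¹)
      rw [hlh, fderiv_fun_const_smul hd, fderiv_comp_smul, smul_smul, mul_inv_cancel₀ hlam.ne',
        one_smul]
    rw [this]; exact hC₂' _
  have hzero : ∀ z, ‖z‖ < lam / 2 → hl ∘ ρ =ᶠ[𝓝 z] fun _ => 0 := by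
    intro z hz
    filter_upwards [continuous_norm.continuousAt.eventually_lt_const hz] with x hx
    have h1 := hρ.norm_le hκ x
    have h2 : ‖ρ x‖ ≤ lam := by linarith
    simp only [Function.comp, hl]
    rw [Real.smoothTransition.zero_of_nonpos, zero_smul]
    rw [sub_nonpos, div_le_one (by positivity)]
    gcongr
  have hfd0 : ∀ z, ‖z‖ < lam / 2 → fderiv ℝ (hl ∘ ρ) z = 0 := fun z hz => by
    rw [(hzero z hz).fderiv_eq]; simp
  refine ⟨hl ∘ ρ, ?_, ?_, ?_, hfd0⟩
  · rw [contDiff_iff_contDiffAt]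
    intro z
    rcases eq_or_ne z 0 with rfl | hz
    · exact contDiffAt_const.congr_of_eventuallyEq (hzero 0 (by simpa using hlam))
    · exact hlsm.contDiffAt.comp z (hρ.contDiffAt z hz)
  · intro z
    have h1 := hρ.norm_sub_le z
    have h2 : ‖hl (ρ z) - ρ z‖ ≤ 2 * lam := by
      simp only [hl]
      rcases le_or_gt (2 * lam) ‖ρ z‖ with h3 | h3
      · rw [Real.smoothTransition.one_of_one_le, one_smul, sub_self, norm_zero]
        · positivity
        · rw [le_sub_iff_add_le, le_div_iff₀ (by positivity)]
          nlinarith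
      · rw [show ∀ (r : ℝ) (v : E), r • v - v = (r - 1) • v by intro r v; rw [sub_smul, one_smul],
          norm_smul]
        have h4 := Real.smoothTransition.nonneg (‖ρ z‖ ^ 2 / lam ^ 2 - 1)
        have h5 := Real.smoothTransition.le_one (‖ρ z‖ ^ 2 / lam ^ 2 - 1)
        have h6 : ‖Real.smoothTransition (‖ρ z‖ ^ 2 / lam ^ 2 - 1) - 1‖ ≤ 1 := by
          rw [Real.norm_eq_abs, abs_le]; constructor <;> linarith
        nlinarith [norm_nonneg (ρ z)]
    have h3 := norm_sub_le_norm_sub_add_norm_sub (hl (ρ z)) (ρ z) z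
    simp only [Function.comp]
    linarith
  · intro z y
    rcases eq_or_ne z 0 with rfl | hz
    · rw [hfd0 0 (by simpa using hlam)]
      rw [zero_apply, norm_zero]
      positivity
    rw [fderiv_comp z (hlsm.differentiable (by simp)).differentiableAt
      ((hρ.contDiffAt z hz).differentiableAt (by simp)), ContinuousLinearMap.comp_apply,
      hρ.fderiv_apply hz, mul_assoc]
    refine ((fderiv ℝ hl (ρ z)).le_of_opNorm_le (hl' _) _).trans ?_
    refine mul_le_mul_of_nonneg_left ?_ (by positivity)
    exact (fderiv ℝ ρ z).le_of_opNorm_le (hC₁' z hz) _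

/-- A potential that is comparable to the squared distance to a given point and which, far away
from the origin, only depends on the retraction. -/
structure IsFlatPotential (F : J → Submodule ℝ E) (α : ℝ) (zb : E) (L K : ℝ) (Ψ : E → ℝ) :
    Prop where
  lip_pos : 0 < L
  level_pos : 0 < K
  contDiff : ContDiff ℝ ∞ Ψ
  le : ∀ z, Ψ z ≤ 9 * ‖z - zb‖ ^ 2
  ge : ∀ z, ‖z - zb‖ ^ 2 ≤ 9 * Ψ z
  lipschitz : ∀ z z', ‖fderiv ℝ Ψ z - fderiv ℝ Ψ z'‖ ≤ L * ‖z - z'‖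
  lipschitz_core : ∀ z₀ z z', K ≤ ‖z₀‖ → ‖z - z₀‖ < α / 3 * ‖z₀‖ → ‖z' - z₀‖ < α / 3 * ‖z₀‖ →
    ‖fderiv ℝ Ψ z - fderiv ℝ Ψ z'‖ ≤ L * ‖(coreFlat F (2 * α) z₀).starProjection (z - z')‖

theorem IsFlatRetraction.exists_potential (hρ : IsFlatRetraction F (1 / 2) α ρ) (zb : E) :
    ∃ L K Ψ, IsFlatPotential F α zb L K Ψ := by
  -- Beyond this radius `‖z‖ ≥ 2 ‖zb‖`, so `‖ρ z‖` and `‖z - zb‖` are comparable with factor `3` in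
  -- both directions.
  let K₀ : ℝ := 2 * ‖zb‖ + 1
  have hK₀ : 0 < K₀ := by positivity
  let χ : E → ℝ := fun z => Real.smoothTransition (‖z‖ ^ 2 / K₀ ^ 2 - 1)
  have hχ : ContDiff ℝ ∞ χ :=
    Real.smoothTransition.contDiff.comp (((contDiff_norm_sq ℝ).div_const _).sub contDiff_const)
  let q : E → ℝ := fun z => ‖ρ z‖ ^ 2
  have hq : ∀ z, z ≠ 0 → ContDiffAt ℝ ∞ q z := fun z hz => (hρ.contDiffAt z hz).norm_sq ℝ
  -- Near the origin `ρ` need not be smooth and no core structure is required, so the plain squared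
  -- distance is used there.
  let Ψ : E → ℝ := fun z => χ z * q z + (1 - χ z) * ‖z - zb‖ ^ 2
  have hΨlow : ∀ z, ‖z‖ ≤ K₀ → Ψ z = ‖z - zb‖ ^ 2 := by
    intro z hz
    have : χ z = 0 := Real.smoothTransition.zero_of_nonpos (by
      rw [sub_nonpos, div_le_one (by positivity)]; gcongr)
    simp [Ψ, this]
  have hΨhigh : ∀ z, 2 * K₀ ≤ ‖z‖ → Ψ z = q z := by
    intro z hz
    have : χ z = 1 := Real.smoothTransition.one_of_one_le (by
      rw [le_sub_iff_add_le, le_div_iff₀ (by positivity)]; nlinarith)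
    simp [Ψ, this]
  have hΨsm : ContDiff ℝ ∞ Ψ := by
    rw [contDiff_iff_contDiffAt]
    intro z
    have hn : ContDiff ℝ ∞ fun z : E => ‖z - zb‖ ^ 2 := (contDiff_id.sub contDiff_const).norm_sq ℝ
    rcases eq_or_ne z 0 with rfl | hz
    · refine hn.contDiffAt.congr_of_eventuallyEq ?_
      filter_upwards [continuous_norm.continuousAt.eventually_lt_const
        (show ‖(0 : E)‖ < K₀ by simpa using hK₀)] with x hx
      exact hΨlow x hx.le
    · exact (hχ.contDiffAt.mul (hq z hz)).add
        ((contDiffAt_const.sub hχ.contDiffAt).mul hn.contDiffAt)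
  -- second derivative
  have hq1 : ∀ (t : ℝ) (z : E), 0 < t → q (t • z) = t ^ (1 + 1) • q z := by
    intro t z ht
    simp only [q, hρ.map_smul t z ht, norm_smul, Real.norm_of_nonneg ht.le, mul_pow, smul_eq_mul]
  -- The second derivative of a function homogeneous of degree two has degree zero, hence is
  -- bounded; this makes `fderiv ℝ Ψ` globally Lipschitz.
  have hq2 : ∀ (t : ℝ) (z : E), 0 < t → z ≠ 0 →
      fderiv ℝ (fderiv ℝ q) (t • z) = fderiv ℝ (fderiv ℝ q) z := by
    intro t z ht hz
    have h1 : (fun y => fderiv ℝ q (t • y)) =ᶠ[𝓝 z] fun y => t • fderiv ℝ q y := by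
      filter_upwards [isOpen_ne.mem_nhds hz] with y hy
      simpa using fderiv_smul_of_homogeneous hq1 ht ((hq y hy).differentiableAt (by simp))
    have h2 := h1.fderiv_eq (𝕜 := ℝ)
    have h3 : DifferentiableAt ℝ (fderiv ℝ q) z :=
      ((hq z hz).fderiv_right (m := 1) one_add_one_le_infty).differentiableAt (by simp)
    rw [fderiv_fun_const_smul h3, fderiv_comp_smul] at h2
    exact smul_right_injective _ ht.ne' h2
  obtain ⟨C₁, hC₁0, hC₁⟩ := exists_norm_le_of_homogeneous_zero hq2 fun z hz =>
    (((hq z hz).fderiv_right (m := 1) one_add_one_le_infty).fderiv_right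
      (m := 0) (by simp)).continuousAt.continuousWithinAt
  have hΨ1 : ContDiff ℝ 1 (fderiv ℝ Ψ) := hΨsm.fderiv_right one_add_one_le_infty
  obtain ⟨C₂, hC₂⟩ := (isCompact_closedBall (0 : E) (2 * K₀)).exists_bound_of_continuousOn
    (hΨ1.continuous_fderiv (by simp)).continuousOn
  let L := max C₂ C₁ + 1
  have hL : 0 < L := by have := le_max_right C₂ C₁; simp only [L]; linarith
  have hΨ2 : ∀ z, ‖fderiv ℝ (fderiv ℝ Ψ) z‖ ≤ L := by
    intro z
    rcases le_or_gt ‖z‖ (2 * K₀) with hz | hz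
    · have := hC₂ z (by simpa using hz)
      have := le_max_left C₂ C₁
      simp only [L]; linarith
    · have hev : Ψ =ᶠ[𝓝 z] q := by
        filter_upwards [continuous_norm.continuousAt.eventually_const_lt hz] with x hx
        exact hΨhigh x hx.le
      rw [hev.fderiv.fderiv_eq]
      have := hC₁ z (norm_pos_iff.1 (by linarith))
      have := le_max_right C₂ C₁
      simp only [L]; linarith
  have hlip : ∀ z z', ‖fderiv ℝ Ψ z - fderiv ℝ Ψ z'‖ ≤ L * ‖z - z'‖ := fun z z' =>
    convex_univ.norm_image_sub_le_of_norm_fderiv_le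
      (fun x _ => (hΨ1.differentiable (by simp)).differentiableAt) (fun x _ => hΨ2 x)
      (mem_univ z') (mem_univ z)
  have hcmp : ∀ z, ‖z - zb‖ ^ 2 ≤ 9 * q z ∧ q z ≤ 9 * ‖z - zb‖ ^ 2 ∨ ‖z‖ < K₀ := by
    intro z
    rcases lt_or_ge ‖z‖ K₀ with h | h
    · exact Or.inr h
    left
    have h1 := hρ.norm_le le_rfl z
    have h2 := hρ.le_norm le_rfl z
    have h3 := _root_.norm_sub_le z zb
    have h4 := norm_sub_norm_le z zb
    have h5 : 2 * ‖zb‖ ≤ ‖z‖ := by simp only [K₀] at h; linarith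
    constructor
    · calc ‖z - zb‖ ^ 2 ≤ (3 * ‖ρ z‖) ^ 2 := by gcongr; linarith
        _ = _ := by ring
    · calc q z ≤ (3 * ‖z - zb‖) ^ 2 := by simp only [q]; gcongr; linarith
        _ = _ := by ring
  have hχ01 : ∀ z, 0 ≤ χ z ∧ χ z ≤ 1 := fun z =>
    ⟨Real.smoothTransition.nonneg _, Real.smoothTransition.le_one _⟩
  -- Since `α ≤ 1 / 2`, a ball of radius `α ‖z₀‖` around a point with `‖z₀‖ ≥ 4 K₀` stays in the
  -- region `‖z‖ ≥ 2 K₀` where `Ψ` is `‖ρ ·‖²`.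
  refine ⟨L, 4 * K₀, Ψ, hL, by positivity, hΨsm, fun z => ?_, fun z => ?_, hlip, ?_⟩
  · rcases hcmp z with h | h
    · obtain ⟨h0, h1⟩ := hχ01 z
      simp only [Ψ]
      nlinarith [mul_le_mul_of_nonneg_left h.2 h0, sq_nonneg ‖z - zb‖,
        mul_nonneg (sub_nonneg.2 h1) (sq_nonneg ‖z - zb‖)]
    · rw [hΨlow z h.le]; nlinarith [sq_nonneg ‖z - zb‖]
  · rcases hcmp z with h | h
    · obtain ⟨h0, h1⟩ := hχ01 z
      simp only [Ψ]
      nlinarith [mul_le_mul_of_nonneg_left h.1 h0, sq_nonneg ‖z - zb‖,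
        mul_nonneg (sub_nonneg.2 h1) (sq_nonneg ‖z - zb‖)]
    · rw [hΨlow z h.le]; nlinarith [sq_nonneg ‖z - zb‖]
  · intro z₀ z z' hz₀ hz hz'
    have hz₀n : 0 < ‖z₀‖ := by linarith
    have hα := hρ.le_half
    have hα0 := hρ.pos
    set P := (coreFlat F (2 * α) z₀).starProjection
    -- The step from `z` to `z'` is split into its core part followed by `d`. The intermediate point
    -- is still within `α ‖z₀‖` of `z₀`, and the move by `d` leaves the gradient of `Ψ` unchanged.
    set d := z' - z - P (z' - z)
    have hd : d ∈ (coreFlat F (2 * α) z₀)ᗮ := Submodule.sub_starProjection_mem_orthogonal (z' - z)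
    have hinv : ∀ y, ‖y - z₀‖ < α * ‖z₀‖ → ‖y + d - z₀‖ < α * ‖z₀‖ →
        fderiv ℝ Ψ (y + d) = fderiv ℝ Ψ y := by
      intro y hy hyd
      have hev : (fun x => Ψ (x + d)) =ᶠ[𝓝 y] Ψ := by
        have c1 : Continuous fun x : E => ‖x - z₀‖ := by fun_prop
        have c2 : Continuous fun x : E => ‖x + d - z₀‖ := by fun_prop
        filter_upwards [c1.continuousAt.eventually_lt_const hy,
          c2.continuousAt.eventually_lt_const hyd] with x hx hxd
        have big : ∀ x, ‖x - z₀‖ < α * ‖z₀‖ → 2 * K₀ ≤ ‖x‖ := by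
          intro x hx
          have := norm_sub_norm_le z₀ x
          rw [norm_sub_rev] at this
          nlinarith
        rw [hΨhigh _ (big x hx), hΨhigh _ (big _ hxd)]
        simp only [q]
        rw [hρ.invariant z₀ x d (norm_pos_iff.1 hz₀n) hx.le hxd.le hd]
      rw [← hev.fderiv_eq, fderiv_comp_add_right]
    have hdn : ‖P (z' - z)‖ ≤ ‖z' - z‖ := Submodule.norm_starProjection_apply_le _ _
    have hzz : ‖z' - z‖ < 2 * (α / 3 * ‖z₀‖) := by
      have := norm_sub_le_norm_sub_add_norm_sub z' z₀ z
      rw [norm_sub_rev z₀ z] at this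
      linarith
    have h1 : z + P (z' - z) + d = z' := by simp only [d]; abel
    have h2 : fderiv ℝ Ψ z' = fderiv ℝ Ψ (z + P (z' - z)) := by
      rw [← hinv (z + P (z' - z)), h1]
      · have : z + P (z' - z) - z₀ = (z - z₀) + P (z' - z) := by abel
        rw [this]
        refine (norm_add_le _ _).trans_lt ?_
        linarith
      · rw [h1]; nlinarith
    rw [h2]
    refine (hlip _ _).trans (le_of_eq ?_)
    congr 1
    rw [sub_add_cancel_left, norm_neg, ← norm_neg, ← map_neg, neg_sub]

end Retraction


/-! ### Chain rule along absolutely continuous curves -/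

section ChainRule

theorem AbsolutelyContinuousOnInterval.of_dist_le {X : Type*} [PseudoMetricSpace X] {N : ℝ → ℝ}
    {g : ℝ → X} {a b C : ℝ} (hN : AbsolutelyContinuousOnInterval N a b) (hC : 0 ≤ C)
    (h : ∀ x ∈ uIcc a b, ∀ y ∈ uIcc a b, dist (g x) (g y) ≤ C * dist (N x) (N y)) :
    AbsolutelyContinuousOnInterval g a b := by
  rw [absolutelyContinuousOnInterval_iff] at hN ⊢
  intro ε hε
  obtain ⟨δ, hδ, H⟩ := hN (ε / (C + 1)) (by positivity)
  refine ⟨δ, hδ, fun I hI hIδ => ?_⟩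
  calc ∑ i ∈ Finset.range I.1, dist (g (I.2 i).1) (g (I.2 i).2)
      ≤ ∑ i ∈ Finset.range I.1, C * dist (N (I.2 i).1) (N (I.2 i).2) :=
        Finset.sum_le_sum fun i hi => h _ (hI.1 i hi).1 _ (hI.1 i hi).2
    _ = C * ∑ i ∈ Finset.range I.1, dist (N (I.2 i).1) (N (I.2 i).2) := by rw [Finset.mul_sum]
    _ ≤ C * (ε / (C + 1)) := by gcongr; exact (H I hI hIδ).le
    _ < ε := by rw [mul_div, div_lt_iff₀ (by positivity)]; nlinarith

variable {E E' : Type*} [NormedAddCommGroup E] [InnerProductSpace ℝ E] [FiniteDimensional ℝ E]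
  [NormedAddCommGroup E'] [InnerProductSpace ℝ E'] [FiniteDimensional ℝ E']

/-- The chain rule along absolutely continuous curves. -/
theorem integral_fderiv_primitive {f : E → E'} (hf : ContDiff ℝ 1 f) {a : E} {η : ℝ → E} {p q : ℝ}
    (hη : IntervalIntegrable η volume p q) :
    ∫ s in p..q, fderiv ℝ f (a + ∫ τ in p..s, η τ) (η s)
      = f (a + ∫ τ in p..q, η τ) - f a := by
  have := FiniteDimensional.proper_real E
  set w : ℝ → E := fun s => a + ∫ τ in p..s, η τ with hw
  have hsub : ∀ x ∈ uIcc p q, ∀ y ∈ uIcc p q, IntervalIntegrable η volume x y := fun x hx y hy =>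
    hη.mono_set (uIcc_subset_uIcc hx hy)
  have hwc : ContinuousOn w (uIcc p q) :=
    continuousOn_const.add (intervalIntegral.continuousOn_primitive_interval' hη left_mem_uIcc)
  have hcpt : IsCompact (w '' uIcc p q) := isCompact_uIcc.image_of_continuousOn hwc
  obtain ⟨R, hR⟩ := hcpt.isBounded.subset_closedBall 0
  obtain ⟨K, hK⟩ := hf.contDiffOn.exists_lipschitzOnWith (by simp) (convex_closedBall (0 : E) R)
    (isCompact_closedBall (0 : E) R)
  have hwd : ∀ x ∈ uIcc p q, ∀ y ∈ uIcc p q, dist (w x) (w y) ≤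
      dist (∫ τ in p..x, ‖η τ‖) (∫ τ in p..y, ‖η τ‖) := by
    intro x hx y hy
    rw [dist_eq_norm, Real.dist_eq, intervalIntegral.integral_interval_sub_left
      (hsub _ left_mem_uIcc _ hx).norm (hsub _ left_mem_uIcc _ hy).norm]
    simp only [hw, add_sub_add_left_eq_sub]
    rw [intervalIntegral.integral_interval_sub_left (hsub _ left_mem_uIcc _ hx)
      (hsub _ left_mem_uIcc _ hy)]
    exact intervalIntegral.norm_integral_le_abs_integral_norm
  have hderiv : ∀ᵐ x, x ∈ uIcc p q →
      HasDerivAt (fun s => f (w s)) (fderiv ℝ f (w x) (η x)) x := by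
    filter_upwards [hη.ae_hasDerivAt_integral] with x hx hxm
    have h1 : HasDerivAt w (η x) x := (hx hxm p left_mem_uIcc).const_add a
    exact ((hf.differentiable (by simp)) _).hasFDerivAt.comp_hasDerivAt x h1
  have hint : IntervalIntegrable (fun s => fderiv ℝ f (w s) (η s)) volume p q := by
    have h1 : ContinuousOn (fun s => fderiv ℝ f (w s)) (uIcc p q) :=
      (hf.continuous_fderiv (by simp)).comp_continuousOn hwc
    obtain ⟨C, hC⟩ := isCompact_uIcc.exists_bound_of_continuousOn h1
    refine (hη.norm.const_mul C).mono_fun ?_ ?_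
    · have h2 : AEStronglyMeasurable (fun s => fderiv ℝ f (w s)) (volume.restrict (uIoc p q)) :=
        (h1.mono uIoc_subset_uIcc).aestronglyMeasurable measurableSet_uIoc
      exact (ContinuousLinearMap.apply ℝ E' :
        E →L[ℝ] (E →L[ℝ] E') →L[ℝ] E').aestronglyMeasurable_comp₂
        (hη.def'.aestronglyMeasurable) h2
    · refine (ae_restrict_iff' measurableSet_uIoc).2 (Eventually.of_forall fun s hs => ?_)
      refine (ContinuousLinearMap.le_of_opNorm_le _ (hC s (uIoc_subset_uIcc hs)) _).trans ?_
      exact le_abs_self _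
  -- The fundamental theorem for absolutely continuous functions is applied to the scalar functions
  -- `⟨e, f ∘ w⟩`; a `C¹` map is Lipschitz on a ball containing the compact curve.
  refine ext_inner_left ℝ fun e => ?_
  have hAC : AbsolutelyContinuousOnInterval (fun s => inner ℝ e (f (w s))) p q := by
    refine (hη.norm.absolutelyContinuousOnInterval_intervalIntegral left_mem_uIcc).of_dist_le
      (C := ‖e‖ * K) (by positivity) fun x hx y hy => ?_
    rw [Real.dist_eq, ← inner_sub_right]
    refine (abs_real_inner_le_norm _ _).trans ?_
    rw [mul_assoc]
    gcongr
    rw [← dist_eq_norm]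
    refine (hK.dist_le_mul _ (hR (mem_image_of_mem _ hx)) _ (hR (mem_image_of_mem _ hy))).trans ?_
    gcongr
    exact hwd x hx y hy
  have h1 := hAC.integral_deriv_eq_sub
  have h2 : ∫ x in p..q, deriv (fun s => inner ℝ e (f (w s))) x
      = ∫ x in p..q, inner ℝ e (fderiv ℝ f (w x) (η x)) := by
    refine intervalIntegral.integral_congr_ae ?_
    filter_upwards [hderiv] with x hx hxm
    have := (hasDerivAt_const x e).inner ℝ (hx (uIoc_subset_uIcc hxm))
    simpa using this.deriv
  have h3 : ∫ x in p..q, inner ℝ e (fderiv ℝ f (w x) (η x))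
      = inner ℝ e (∫ x in p..q, fderiv ℝ f (w x) (η x)) :=
    (innerSL ℝ e).intervalIntegral_comp_comm hint
  rw [← h3, ← h2, h1, ← inner_sub_right]
  simp [hw]

end ChainRule


/-! ### Weak derivatives along almost every line -/

section Lines

variable {d : ℕ}

theorem measurePreserving_add_smul (h : Euc d) (ν : Measure ℝ) [SFinite ν] :
    MeasurePreserving (fun p : ℝ × Euc d => (p.1, p.2 + p.1 • h)) (ν.prod volume)
      (ν.prod volume) := by
  refine (MeasurePreserving.id ν).skew_product (g := fun (τ : ℝ) (x : Euc d) => x + τ • h)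
    (by fun_prop) (Eventually.of_forall fun τ => ?_)
  exact map_add_right_eq_self volume (τ • h)

theorem MeasureTheory.Integrable.comp_add_smul {E : Type*} [NormedAddCommGroup E] {y : Euc d → E}
    (hy : Integrable y) (h : Euc d) (ν : Measure ℝ) [IsFiniteMeasure ν] :
    Integrable (fun p : Euc d × ℝ => y (p.1 + p.2 • h)) (volume.prod ν) := by
  have h1 : Integrable (fun p : ℝ × Euc d => y p.2) (ν.prod volume) := hy.comp_snd ν
  exact ((measurePreserving_add_smul h ν).integrable_comp_of_integrable h1).swap

/-- Functions with a weak directional derivative are absolutely continuous on almost all lines. -/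
theorem ae_sub_eq_integral_of_weak_deriv {Ω : Set (Euc d)} {w y : Euc d → ℝ} (hw : Integrable w)
    (hy : Integrable y) {h : Euc d}
    (hwy : ∀ φ : Euc d → ℝ, ContDiff ℝ ∞ φ → HasCompactSupport φ → tsupport φ ⊆ Ω →
      ∫ x, w x * fderiv ℝ φ x h = - ∫ x, y x * φ x)
    {A : Set (Euc d)} (hA : IsOpen A) {s : ℝ} (hs : 0 ≤ s)
    (hAs : ∀ x ∈ A, ∀ τ ∈ Icc 0 s, x + τ • h ∈ Ω) :
    ∀ᵐ x, x ∈ A → w (x + s • h) - w x = ∫ τ in 0..s, y (x + τ • h) := by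
  set ν : Measure ℝ := volume.restrict (Ioc 0 s) with hν
  have hyp := hy.comp_add_smul h ν
  have hwsh : Integrable fun x => w (x + s • h) := hw.comp_add_right (s • h)
  have hyi : Integrable fun x => ∫ τ in 0..s, y (x + τ • h) := by
    simp_rw [intervalIntegral.integral_of_le hs]
    exact hyp.integral_prod_left
  -- The identity is tested against smooth `g` supported in `A`. Moving the translation onto `g`
  -- turns the increment of `w` into an integral over `τ` of derivatives of the translates `g (· - τ
  -- h)`, which still have support in `Ω`, so the weak derivative may be inserted for each `τ`.
  have key := hA.ae_eq_zero_of_integral_contDiff_smul_eq_zero (μ := volume)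
    (f := fun x => w (x + s • h) - w x - ∫ τ in 0..s, y (x + τ • h))
    (((hwsh.sub hw).sub hyi).locallyIntegrable.locallyIntegrableOn A) ?_
  · filter_upwards [key] with x hx hxA
    exact sub_eq_zero.1 (hx hxA)
  intro g hg hgc hgA
  have hgcont := hg.continuous
  obtain ⟨M, hM⟩ := hgc.exists_bound_of_continuous hgcont
  have hdg : Continuous fun x => fderiv ℝ g x h :=
    (hg.continuous_fderiv (by simp)).clm_apply continuous_const
  obtain ⟨M', hM'⟩ := ((hgc.fderiv (𝕜 := ℝ)).comp_left (g := fun L : Euc d →L[ℝ] ℝ => L h)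
    (by simp)).exists_bound_of_continuous hdg
  have i1 : Integrable fun x => g x * w (x + s • h) :=
    hwsh.bdd_mul hgcont.aestronglyMeasurable (Eventually.of_forall hM)
  have i2 : Integrable fun x => g x * w x :=
    hw.bdd_mul hgcont.aestronglyMeasurable (Eventually.of_forall hM)
  have i3 : Integrable fun x => g x * ∫ τ in 0..s, y (x + τ • h) :=
    hyi.bdd_mul hgcont.aestronglyMeasurable (Eventually.of_forall hM)
  have i4 : Integrable fun x => g (x - s • h) * w x :=
    hw.bdd_mul (by fun_prop) (Eventually.of_forall fun x => hM _)
  have e1 : ∫ x, g x * w (x + s • h) = ∫ x, g (x - s • h) * w x := by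
    rw [← integral_add_right_eq_self (fun x => g (x - s • h) * w x) (s • h)]
    simp
  have e2 : ∀ x, g (x - s • h) - g x = - ∫ τ in 0..s, fderiv ℝ g (x - τ • h) h := by
    intro x
    have := intervalIntegral.integral_eq_sub_of_hasDerivAt (a := 0) (b := s)
      (f := fun τ : ℝ => g (x - τ • h)) (f' := fun τ => - fderiv ℝ g (x - τ • h) h)
      (fun τ _ => by
        have h1 : HasDerivAt (fun τ : ℝ => x - τ • h) (-h) τ := by
          simpa using ((hasDerivAt_id τ).smul_const h).const_sub x
        have := ((hg.differentiable (by simp)) (x - τ • h)).hasFDerivAt.comp_hasDerivAt τ h1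
        simpa [Function.comp_def] using this)
      (Continuous.intervalIntegrable (by
        have : Continuous fun τ : ℝ => x - τ • h := by fun_prop
        exact (hdg.comp this).neg) _ _)
    rw [intervalIntegral.integral_neg] at this
    simpa using this.symm
  have i5 : Integrable (fun p : Euc d × ℝ => w p.1 * fderiv ℝ g (p.1 - p.2 • h) h)
      (volume.prod ν) := by
    have : Continuous fun p : Euc d × ℝ => p.1 - p.2 • h := by fun_prop
    exact (hw.comp_fst ν).mul_bdd (hdg.comp this).aestronglyMeasurable
      (Eventually.of_forall fun p => hM' _)
  have i6 : Integrable (fun p : Euc d × ℝ => g p.1 * y (p.1 + p.2 • h)) (volume.prod ν) := by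
    refine hyp.bdd_mul (c := M) ?_ (Eventually.of_forall fun p => hM _)
    exact (hgcont.comp continuous_fst).aestronglyMeasurable
  have e3 : ∀ τ ∈ Ioc 0 s, ∫ x, w x * fderiv ℝ g (x - τ • h) h
      = - ∫ x, g x * y (x + τ • h) := by
    intro τ hτ
    have h1 := hwy (fun x => g (x - τ • h)) (hg.comp (contDiff_id.sub contDiff_const))
      (hgc.comp_homeomorph (Homeomorph.subRight (τ • h))) (by
        intro x hx
        have h2 : x - τ • h ∈ tsupport g := by
          have := tsupport_comp_subset_preimage g (f := fun x => x - τ • h) (by fun_prop)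
          exact this hx
        have := hAs _ (hgA h2) τ ⟨hτ.1.le, hτ.2⟩
        simpa using this)
    simp only [fderiv_comp_sub] at h1
    rw [h1, ← integral_add_right_eq_self (fun x => y x * g (x - τ • h)) (τ • h)]
    simp [mul_comm]
  have e4 : ∫ x, w x * ∫ τ in 0..s, fderiv ℝ g (x - τ • h) h
      = - ∫ x, g x * ∫ τ in 0..s, y (x + τ • h) := by
    simp_rw [intervalIntegral.integral_of_le hs, ← integral_const_mul]
    rw [integral_integral_swap (f := fun x τ => w x * fderiv ℝ g (x - τ • h) h) i5,
      integral_integral_swap (f := fun x τ => g x * y (x + τ • h)) i6, ← integral_neg]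
    exact setIntegral_congr_fun measurableSet_Ioc e3
  have e5 : ∀ x, g (x - s • h) * w x - g x * w x
      = - (w x * ∫ τ in 0..s, fderiv ℝ g (x - τ • h) h) := by
    intro x; rw [← sub_mul, e2]; ring
  simp only [smul_eq_mul, mul_sub]
  rw [integral_sub (f := fun x => g x * w (x + s • h) - g x * w x) (i1.sub i2) i3,
    integral_sub i1 i2, e1, ← integral_sub i4 i2]
  simp_rw [e5]
  rw [integral_neg, e4]
  ring

end Lines


/-! ### Translation estimates for functions of a Sobolev map -/

section TransEst

variable {n d : ℕ} {E' : Type*} [NormedAddCommGroup E'] [InnerProductSpace ℝ E']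

/-- The squared `L²` norms of the increments of `F` are controlled by the density `g`. -/
def TransEst {E' : Type*} [NormedAddCommGroup E'] (Ω : Set (Euc d)) (F : Euc d → E')
    (g : Euc d → ℝ≥0∞) : Prop :=
  ∀ (A A' : Set (Euc d)) (h : Euc d), IsOpen A → MeasurableSet A' → A' ⊆ Ω →
    (∀ x ∈ A, ∀ s ∈ Icc (0 : ℝ) 1, x + s • h ∈ A') →
    ∫⁻ x in A, ‖F (x + h) - F x‖ₑ ^ 2 ≤ ‖h‖ₑ ^ 2 * ∫⁻ x in A', g x

theorem sum_smul_single (h : Euc d) : ∑ k, h k • EuclideanSpace.single k (1 : ℝ) = h := by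
  ext j
  simp [Pi.single_apply]

theorem HasWeakGrad.integral_dir {Ω : Set (Euc d)} {w : Euc d → ℝ} {Y : Fin d → Euc d → ℝ}
    (hw : Integrable w) (hY : ∀ k, Integrable (Y k)) (hwY : HasWeakGrad Ω w Y) (h : Euc d)
    (φ : Euc d → ℝ) (hφ : ContDiff ℝ ∞ φ) (hc : HasCompactSupport φ) (hs : tsupport φ ⊆ Ω) :
    ∫ x, w x * fderiv ℝ φ x h = - ∫ x, (∑ k, h k * Y k x) * φ x := by
  have hdg : ∀ v, Continuous fun x => fderiv ℝ φ x v := fun v =>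
    (hφ.continuous_fderiv (by simp)).clm_apply continuous_const
  have h0 : ∀ k, ∫ x, w x * fderiv ℝ φ x (EuclideanSpace.single k 1) = - ∫ x, Y k x * φ x := by
    intro k
    rw [← setIntegral_eq_integral_of_forall_compl_eq_zero (s := Ω),
      ← setIntegral_eq_integral_of_forall_compl_eq_zero (s := Ω) (f := fun x => Y k x * φ x)]
    · exact hwY φ hφ hc hs k
    · intro x hx
      rw [image_eq_zero_of_notMem_tsupport fun h => hx (hs h), mul_zero]
    · intro x hx
      have : fderiv ℝ φ x = 0 := image_eq_zero_of_notMem_tsupport fun h =>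
        hx (hs (tsupport_fderiv_subset ℝ h))
      simp [this]
  obtain ⟨M, hM⟩ := hc.exists_bound_of_continuous hφ.continuous
  have i1 : ∀ k, Integrable fun x => w x * fderiv ℝ φ x (EuclideanSpace.single k 1) := fun k => by
    obtain ⟨M', hM'⟩ := ((hc.fderiv (𝕜 := ℝ)).comp_left
      (g := fun L : Euc d →L[ℝ] ℝ => L (EuclideanSpace.single k 1))
      (by simp)).exists_bound_of_continuous (hdg _)
    exact hw.mul_bdd (hdg _).aestronglyMeasurable (Eventually.of_forall hM')
  have i2 : ∀ k, Integrable fun x => Y k x * φ x := fun k =>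
    (hY k).mul_bdd hφ.continuous.aestronglyMeasurable (Eventually.of_forall hM)
  have e1 : ∀ x, w x * fderiv ℝ φ x h
      = ∑ k, h k * (w x * fderiv ℝ φ x (EuclideanSpace.single k 1)) := by
    intro x
    conv_lhs => rw [← sum_smul_single h]
    simp only [map_sum, map_smul, smul_eq_mul, Finset.mul_sum]
    exact Finset.sum_congr rfl fun k _ => by ring
  simp_rw [e1, Finset.sum_mul]
  rw [integral_finsetSum _ fun k _ => (i1 k).const_mul _,
    integral_finsetSum _ fun k _ => by simpa [mul_assoc] using (i2 k).const_mul (h k),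
    ← Finset.sum_neg_distrib]
  refine Finset.sum_congr rfl fun k _ => ?_
  simp_rw [mul_assoc]
  rw [integral_const_mul, integral_const_mul, h0]
  ring

/-- Cauchy–Schwarz on an interval of length one. If `v` is not integrable, the integral on the left
is `0` by convention. -/
theorem enorm_sq_integral_Ioc_le (v : ℝ → E') :
    ‖∫ s in (0 : ℝ)..1, v s‖ₑ ^ 2 ≤ ∫⁻ s in Ioc (0 : ℝ) 1, ‖v s‖ₑ ^ 2 := by
  by_cases hv : IntervalIntegrable v volume 0 1
  swap
  · rw [intervalIntegral.integral_undef hv]; simp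
  rw [intervalIntegral.integral_of_le zero_le_one]
  have hm : AEMeasurable (fun s => ‖v s‖ₑ) (volume.restrict (Ioc (0 : ℝ) 1)) :=
    hv.1.aestronglyMeasurable.enorm
  have h1 := ENNReal.lintegral_mul_le_Lp_mul_Lq (volume.restrict (Ioc (0 : ℝ) 1))
    Real.HolderConjugate.two_two hm (aemeasurable_const (b := (1 : ℝ≥0∞)))
  simp only [Pi.mul_apply, mul_one, ENNReal.one_rpow, lintegral_const, Measure.restrict_apply_univ,
    Real.volume_Ioc, sub_zero, ENNReal.ofReal_one] at h1
  have h2 := (enorm_integral_le_lintegral_enorm (μ := volume.restrict (Ioc (0 : ℝ) 1)) v).trans h1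
  calc _ ≤ ((∫⁻ s in Ioc (0 : ℝ) 1, ‖v s‖ₑ ^ (2 : ℝ)) ^ (1 / 2 : ℝ)) ^ 2 := by gcongr
    _ = _ := by
      rw [← ENNReal.rpow_natCast, ← ENNReal.rpow_mul]
      norm_num

theorem norm_sq_sum_smul_le (h : Euc d) (v : Fin d → E') :
    ‖∑ k, h k • v k‖ ^ 2 ≤ ‖h‖ ^ 2 * ∑ k, ‖v k‖ ^ 2 := by
  have h1 : ‖∑ k, h k • v k‖ ≤ ∑ k, |h k| * ‖v k‖ :=
    (norm_sum_le _ _).trans (le_of_eq (by simp [norm_smul]))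
  have h2 := Finset.sum_mul_sq_le_sq_mul_sq Finset.univ (fun k => |h k|) (fun k => ‖v k‖)
  calc _ ≤ (∑ k, |h k| * ‖v k‖) ^ 2 := by gcongr
    _ ≤ _ := h2
    _ = _ := by rw [EuclideanSpace.norm_sq_eq]; simp

/-- No growth of `f` is assumed, so `f ∘ w` need not be integrable and a weak chain rule is not at
hand. On almost every line, however, `w` is a primitive, and there the one-dimensional chain rule
applies. -/
theorem ae_comp_sub_eq_integral [FiniteDimensional ℝ E'] {Ω : Set (Euc d)}
    {f : Euc n → E'} (hf : ContDiff ℝ 1 f)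
    {w : Euc d → Euc n} {Y : Fin d → Euc d → Euc n} (hwm : StronglyMeasurable w)
    (hYm : ∀ k, StronglyMeasurable (Y k)) (hw : Integrable w) (hY : ∀ k, Integrable (Y k))
    (hwY : ∀ i, HasWeakGrad Ω (fun x => w x i) (fun k x => Y k x i)) {A : Set (Euc d)}
    (hA : IsOpen A) {h : Euc d} (hAΩ : ∀ x ∈ A, ∀ s ∈ Icc (0 : ℝ) 1, x + s • h ∈ Ω) :
    ∀ᵐ x, x ∈ A → f (w (x + h)) - f (w x)
      = ∫ s in (0 : ℝ)..1, fderiv ℝ f (w (x + s • h)) (∑ k, h k • Y k (x + s • h)) := by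
  set y : Euc d → Euc n := fun x => ∑ k, h k • Y k x with hy
  have hym : StronglyMeasurable y :=
    Finset.stronglyMeasurable_fun_sum _ fun k _ => (hYm k).const_smul (h k)
  have hyi : Integrable y := integrable_finsetSum _ fun k _ => (hY k).smul (h k)
  have hline : ∀ᵐ x, IntegrableOn (fun τ : ℝ => y (x + τ • h)) (Ioc 0 1) :=
    (hyi.comp_add_smul h (volume.restrict (Ioc (0 : ℝ) 1))).prod_right_ae
  have hpt : ∀ s ∈ Icc (0 : ℝ) 1, ∀ᵐ x, x ∈ A →
      w (x + s • h) = w x + ∫ τ in (0 : ℝ)..s, y (x + τ • h) := by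
    intro s hs
    have h1 : ∀ i : Fin n, ∀ᵐ x, x ∈ A → w (x + s • h) i - w x i
        = ∫ τ in (0 : ℝ)..s, y (x + τ • h) i := by
      intro i
      have hci : ∀ {g : Euc d → Euc n}, Integrable g → Integrable fun x => g x i := fun hg =>
        (EuclideanSpace.proj (𝕜 := ℝ) i : Euc n →L[ℝ] ℝ).integrable_comp hg
      refine ae_sub_eq_integral_of_weak_deriv (Ω := Ω) (w := fun x => w x i)
        (y := fun x => y x i) (hci hw) (hci hyi) (fun φ h1 h2 h3 => ?_) hA hs.1
        fun x hx τ hτ => hAΩ x hx τ ⟨hτ.1, hτ.2.trans hs.2⟩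
      rw [(hwY i).integral_dir (hci hw) (fun k => hci (hY k)) h φ h1 h2 h3]
      simp [hy]
    rw [← ae_all_iff] at h1
    filter_upwards [h1, hline] with x hx hxl hxA
    ext i
    have hint : IntervalIntegrable (fun τ : ℝ => y (x + τ • h)) volume 0 s := by
      rw [intervalIntegrable_iff_integrableOn_Ioc_of_le hs.1]
      exact hxl.mono_set (Ioc_subset_Ioc_right hs.2)
    have h2 : ∫ τ in (0 : ℝ)..s, y (x + τ • h) i = (∫ τ in (0 : ℝ)..s, y (x + τ • h)) i :=
      (EuclideanSpace.proj (𝕜 := ℝ) i : Euc n →L[ℝ] ℝ).intervalIntegral_comp_comm hint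
    rw [PiLp.add_apply, ← h2, ← hx i hxA]
    ring
  -- For each `s` the formula holds for almost every `x`; exchanging the quantifiers, which needs
  -- joint measurability, identifies the whole path `s ↦ w (x + s h)` up to null sets.
  have hswap : ∀ᵐ x, ∀ᵐ s ∂(volume.restrict (Ioc (0 : ℝ) 1)), x ∈ A →
      w (x + s • h) = w x + ∫ τ in (0 : ℝ)..s, y (x + τ • h) := by
    rw [Measure.ae_ae_comm]
    · refine (ae_restrict_iff' measurableSet_Ioc).2 (Eventually.of_forall fun s hs => ?_)
      exact hpt s (Ioc_subset_Icc_self hs)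
    have hsh : Measurable fun p : Euc d × ℝ => p.1 + p.2 • h := by fun_prop
    have m1 : StronglyMeasurable fun p : Euc d × ℝ => w (p.1 + p.2 • h) :=
      hwm.comp_measurable hsh
    have m2 : StronglyMeasurable fun p : Euc d × ℝ => w p.1 := hwm.comp_measurable measurable_fst
    have m3 : StronglyMeasurable fun p : Euc d × ℝ => ∫ τ in Ioc 0 p.2, y (p.1 + τ • h) := by
      have : ∀ p : Euc d × ℝ, ∫ τ in Ioc 0 p.2, y (p.1 + τ • h)
          = ∫ τ, {q : (Euc d × ℝ) × ℝ | q.2 ∈ Ioc 0 q.1.2}.indicator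
              (fun q => y (q.1.1 + q.2 • h)) (p, τ) := by
        intro p
        rw [← integral_indicator measurableSet_Ioc]
        rfl
      simp_rw [this]
      refine StronglyMeasurable.integral_prod_right' ?_
      refine StronglyMeasurable.indicator ?_ ?_
      · exact hym.comp_measurable (by fun_prop)
      · exact (measurableSet_lt measurable_const measurable_snd).inter
          (measurableSet_le measurable_snd (measurable_snd.comp measurable_fst))
    have m4 : StronglyMeasurable fun p : Euc d × ℝ => ∫ τ in Ioc p.2 0, y (p.1 + τ • h) := by
      have : ∀ p : Euc d × ℝ, ∫ τ in Ioc p.2 0, y (p.1 + τ • h)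
          = ∫ τ, {q : (Euc d × ℝ) × ℝ | q.2 ∈ Ioc q.1.2 0}.indicator
              (fun q => y (q.1.1 + q.2 • h)) (p, τ) := by
        intro p
        rw [← integral_indicator measurableSet_Ioc]
        rfl
      simp_rw [this]
      refine StronglyMeasurable.integral_prod_right' ?_
      refine StronglyMeasurable.indicator ?_ ?_
      · exact hym.comp_measurable (by fun_prop)
      · exact (measurableSet_lt (measurable_snd.comp measurable_fst) measurable_snd).inter
          (measurableSet_le measurable_snd measurable_const)
    have : MeasurableSet {p : Euc d × ℝ | w (p.1 + p.2 • h)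
        = w p.1 + ∫ τ in (0 : ℝ)..p.2, y (p.1 + τ • h)} :=
      m1.measurableSet_eq_fun (m2.add (m3.sub m4))
    have hc : MeasurableSet {p : Euc d × ℝ | p.1 ∈ A} := measurable_fst hA.measurableSet
    exact hc.imp this
  filter_upwards [hswap, hpt 1 (by simp), hline] with x hx h1 hxl hxA
  have hint : IntervalIntegrable (fun τ : ℝ => y (x + τ • h)) volume 0 1 := by
    rwa [intervalIntegrable_iff_integrableOn_Ioc_of_le zero_le_one]
  have h2 := integral_fderiv_primitive hf (a := w x) hint
  rw [← h1 hxA, one_smul] at h2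
  rw [← h2]
  refine intervalIntegral.integral_congr_ae ?_
  rw [uIoc_of_le zero_le_one]
  have h3 := (ae_restrict_iff' measurableSet_Ioc).1 hx
  filter_upwards [h3] with s hs hsm
  rw [hs hsm hxA]

/-- Cauchy–Schwarz in the line formula, then integration over `A`: for each `s` the translate of `A`
by `s h` lies in `A'`, so the integral over `s` costs nothing. The estimate is `[0,∞]`-valued and
needs no integrability of `f ∘ w`. -/
theorem transEst_comp [FiniteDimensional ℝ E'] {Ω : Set (Euc d)} (hΩ : MeasurableSet Ω)
    {f : Euc n → E'}
    (hf : ContDiff ℝ 1 f)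
    {w : Euc d → Euc n} {Y : Fin d → Euc d → Euc n} (hw : IntegrableOn w Ω)
    (hY : ∀ k, IntegrableOn (Y k) Ω)
    (hwY : ∀ i, HasWeakGrad Ω (fun x => w x i) (fun k x => Y k x i)) :
    TransEst Ω (fun x => f (w x)) fun x => ∑ k, ‖fderiv ℝ f (w x) (Y k x)‖ₑ ^ 2 := by
  intro A A' h hA hA' hA'Ω hAA'
  -- Strongly measurable representatives of the extensions by zero; inside `Ω` neither the weak
  -- gradient nor the integrals notice the change.
  set w₀ : Euc d → Euc n := (hw.integrable_indicator hΩ).aestronglyMeasurable.mk _ with hw₀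
  set Y₀ : Fin d → Euc d → Euc n := fun k =>
    ((hY k).integrable_indicator hΩ).aestronglyMeasurable.mk _ with hY₀
  have hwm : StronglyMeasurable w₀ := AEStronglyMeasurable.stronglyMeasurable_mk _
  have hYm : ∀ k, StronglyMeasurable (Y₀ k) := fun k => AEStronglyMeasurable.stronglyMeasurable_mk _
  have ew : ∀ᵐ x, x ∈ Ω → w x = w₀ x := by
    filter_upwards [(hw.integrable_indicator hΩ).aestronglyMeasurable.ae_eq_mk] with x hx hxΩ
    rw [hw₀, ← hx, indicator_of_mem hxΩ]
  have eY : ∀ k, ∀ᵐ x, x ∈ Ω → Y k x = Y₀ k x := fun k => by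
    filter_upwards [((hY k).integrable_indicator hΩ).aestronglyMeasurable.ae_eq_mk] with x hx hxΩ
    rw [hY₀]
    simp only
    rw [← hx, indicator_of_mem hxΩ]
  have hwi : Integrable w₀ := (hw.integrable_indicator hΩ).congr (AEStronglyMeasurable.ae_eq_mk _)
  have hYi : ∀ k, Integrable (Y₀ k) := fun k =>
    ((hY k).integrable_indicator hΩ).congr (AEStronglyMeasurable.ae_eq_mk _)
  have hwY₀ : ∀ i, HasWeakGrad Ω (fun x => w₀ x i) (fun k x => Y₀ k x i) := by
    intro i φ h1 h2 h3 k
    rw [setIntegral_congr_ae (g := fun x => w x i * fderiv ℝ φ x (EuclideanSpace.single k 1)) hΩ,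
      setIntegral_congr_ae (f := fun x => Y₀ k x i * φ x) (g := fun x => Y k x i * φ x) hΩ]
    · exact hwY i φ h1 h2 h3 k
    · filter_upwards [eY k] with x hx hxΩ
      rw [hx hxΩ]
    · filter_upwards [ew] with x hx hxΩ
      rw [hx hxΩ]
  have hAΩ : ∀ x ∈ A, ∀ s ∈ Icc (0 : ℝ) 1, x + s • h ∈ Ω := fun x hx s hs =>
    hA'Ω (hAA' x hx s hs)
  have key := ae_comp_sub_eq_integral hf hwm hYm hwi hYi hwY₀ hA hAΩ
  set g₀ : Euc d → ℝ≥0∞ := fun x => ∑ k, ‖fderiv ℝ f (w₀ x) (Y₀ k x)‖ₑ ^ 2 with hg₀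
  have hg₀m : Measurable g₀ := by
    refine Finset.measurable_fun_sum _ fun k _ => ?_
    refine (StronglyMeasurable.enorm ?_).pow_const 2
    have h1 : StronglyMeasurable fun x => fderiv ℝ f (w₀ x) :=
      (hf.continuous_fderiv (by simp)).comp_stronglyMeasurable hwm
    exact isBoundedBilinearMap_apply.continuous.comp_stronglyMeasurable (h1.prodMk (hYm k))
  have hshift : ∀ᵐ x, x ∈ A → w (x + h) = w₀ (x + h) := by
    have := (measurePreserving_add_right (volume : Measure (Euc d)) h).quasiMeasurePreserving.ae ew
    filter_upwards [this] with x hx hxA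
    exact hx (by simpa using hAΩ x hxA 1 (by simp))
  have hpt : ∀ᵐ x, x ∈ A → ‖f (w (x + h)) - f (w x)‖ₑ ^ 2
      ≤ ∫⁻ s in Ioc (0 : ℝ) 1, ‖h‖ₑ ^ 2 * g₀ (x + s • h) := by
    filter_upwards [key, hshift, ew] with x hx h1 h2 hxA
    rw [h1 hxA, h2 (by simpa using hAΩ x hxA 0 (by simp)), hx hxA]
    refine (enorm_sq_integral_Ioc_le _).trans (lintegral_mono fun s => ?_)
    simp only [hg₀, map_sum, map_smul]
    have := norm_sq_sum_smul_le h
      (fun k => fderiv ℝ f (w₀ (x + s • h)) (Y₀ k (x + s • h)))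
    have h4 := ENNReal.ofReal_le_ofReal this
    rw [ENNReal.ofReal_mul (by positivity), ENNReal.ofReal_sum_of_nonneg fun k _ => by positivity]
      at h4
    simpa only [ENNReal.ofReal_pow (norm_nonneg _), ofReal_norm] using h4
  calc ∫⁻ x in A, ‖f (w (x + h)) - f (w x)‖ₑ ^ 2
      ≤ ∫⁻ x in A, ∫⁻ s in Ioc (0 : ℝ) 1, ‖h‖ₑ ^ 2 * g₀ (x + s • h) :=
        setLIntegral_mono_ae' hA.measurableSet hpt
    _ = ∫⁻ s in Ioc (0 : ℝ) 1, ∫⁻ x in A, ‖h‖ₑ ^ 2 * g₀ (x + s • h) := by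
        refine lintegral_lintegral_swap (Measurable.aemeasurable ?_)
        exact (hg₀m.comp (by fun_prop : Measurable fun p : Euc d × ℝ => p.1 + p.2 • h)).const_mul _
    _ ≤ ∫⁻ s in Ioc (0 : ℝ) 1, ‖h‖ₑ ^ 2 * ∫⁻ x in A', ∑ k, ‖fderiv ℝ f (w x) (Y k x)‖ₑ ^ 2 := by
        refine setLIntegral_mono' measurableSet_Ioc fun s hs => ?_
        rw [lintegral_const_mul _ (show Measurable fun x => g₀ (x + s • h) from
          hg₀m.comp (measurable_add_const _))]
        refine mul_le_mul_right ?_ _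
        calc ∫⁻ x in A, g₀ (x + s • h) ≤ ∫⁻ x, A'.indicator g₀ (x + s • h) := by
              rw [← lintegral_indicator hA.measurableSet]
              refine lintegral_mono fun x => ?_
              by_cases hx : x ∈ A
              · rw [indicator_of_mem hx, indicator_of_mem (hAA' x hx s (Ioc_subset_Icc_self hs))]
              · rw [indicator_of_notMem hx]; exact zero_le
          _ = ∫⁻ x in A', g₀ x := by
              rw [lintegral_add_right_eq_self (A'.indicator g₀), lintegral_indicator hA']
          _ = ∫⁻ x in A', ∑ k, ‖fderiv ℝ f (w x) (Y k x)‖ₑ ^ 2 := by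
              refine setLIntegral_congr_fun_ae hA' ?_
              filter_upwards [ew, ae_all_iff.2 eY] with x h1 h2 hx
              simp only [hg₀]
              rw [h1 (hA'Ω hx)]
              simp_rw [h2 _ (hA'Ω hx)]
    _ = _ := by simp

end TransEst


/-! ### Interior cones and separated nets -/

section Geometry

variable {d : ℕ}

/-- A uniform interior cone condition for the part of `Ω` near a subset `S`. -/
def UniformCone (Ω S : Set (Euc d)) (r c : ℝ) : Prop :=
  ∀ x₀ ∈ S, ∃ ν : Euc d, ‖ν‖ = 1 ∧ ∀ x ∈ Ω, dist x x₀ < r → ∀ s ∈ Icc 0 r, ∀ w : Euc d,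
    ‖w‖ ≤ c * s → x + s • ν + w ∈ Ω

theorem UniformCone.mono {Ω S S' : Set (Euc d)} {r r' c c' : ℝ} (h : UniformCone Ω S r c)
    (hS : S' ⊆ S) (hr : r' ≤ r) (hc : c' ≤ c) : UniformCone Ω S' r' c' := by
  intro x₀ hx₀
  obtain ⟨ν, hν, H⟩ := h x₀ (hS hx₀)
  refine ⟨ν, hν, fun x hx hd s hs w hw => H x hx (hd.trans_le hr) s ⟨hs.1, hs.2.trans hr⟩ w ?_⟩
  exact hw.trans (mul_le_mul_of_nonneg_right hc hs.1)

/-- At an interior point a small ball suffices. At a boundary point, moving by `s` along `ν` raises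
the height over the graph by `s`, while a displacement `w` loses at most `(1 + K) ‖w‖`. -/
theorem IsBoundedLipschitzDomain.exists_cone (hd : 1 ≤ d) {Ω : Set (Euc d)}
    (hΩ : IsBoundedLipschitzDomain Ω) {x₀ : Euc d} (hx₀ : x₀ ∈ closure Ω) :
    ∃ (ν : Euc d) (r c : ℝ), 0 < r ∧ 0 < c ∧ c ≤ 1 ∧ ‖ν‖ = 1 ∧ ∀ x ∈ Ω, dist x x₀ < r →
      ∀ s ∈ Icc 0 r, ∀ w : Euc d, ‖w‖ ≤ c * s → x + s • ν + w ∈ Ω := by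
  by_cases hxΩ : x₀ ∈ Ω
  · obtain ⟨r, hr, hball⟩ := Metric.isOpen_iff.1 hΩ.isOpen x₀ hxΩ
    have hν : ‖EuclideanSpace.single (⟨0, hd⟩ : Fin d) (1 : ℝ)‖ = 1 := by simp
    refine ⟨EuclideanSpace.single ⟨0, hd⟩ 1, r / 3, 1, by positivity, one_pos, le_rfl, hν,
      fun x hx hdx s hs w hw => hball ?_⟩
    rw [Metric.mem_ball, dist_eq_norm]
    rw [dist_eq_norm] at hdx
    have h1 : ‖s • EuclideanSpace.single (⟨0, hd⟩ : Fin d) (1 : ℝ)‖ = s := by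
      rw [norm_smul, hν, mul_one, Real.norm_of_nonneg hs.1]
    calc _ = ‖(x - x₀) + s • EuclideanSpace.single (⟨0, hd⟩ : Fin d) (1 : ℝ) + w‖ := by
          congr 1; abel
      _ ≤ ‖x - x₀‖ + s + ‖w‖ := by
          refine (norm_add₃_le).trans ?_
          rw [h1]
      _ < r := by linarith [hs.2]
  · have hfr : x₀ ∈ frontier Ω := by
      rw [frontier, hΩ.isOpen.interior_eq]; exact ⟨hx₀, hxΩ⟩
    obtain ⟨ν, γ, K, U, hν, hγ, hU, hx₀U, hgraph⟩ := hΩ.lipschitz_boundary x₀ hfr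
    obtain ⟨r, hr, hball⟩ := Metric.isOpen_iff.1 hU x₀ hx₀U
    have hc : (0 : ℝ) < 1 / (1 + K) := by positivity
    have hc1 : (1 : ℝ) / (1 + K) ≤ 1 := by
      rw [div_le_one (by positivity)]; linarith [K.coe_nonneg]
    refine ⟨ν, r / 3, 1 / (1 + K), by positivity, hc, hc1, hν, fun x hx hdx s hs w hw => ?_⟩
    have hw' : ‖w‖ ≤ s := hw.trans (by nlinarith [hs.1])
    rw [dist_eq_norm] at hdx
    have hyU : x + s • ν + w ∈ U := by
      refine hball ?_
      rw [Metric.mem_ball, dist_eq_norm]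
      calc _ = ‖(x - x₀) + s • ν + w‖ := by congr 1; abel
        _ ≤ ‖x - x₀‖ + s + ‖w‖ := by
            refine (norm_add₃_le).trans ?_
            rw [norm_smul, hν, mul_one, Real.norm_of_nonneg hs.1]
        _ < r := by linarith [hs.2]
    have hxU : x ∈ U := hball (by rw [Metric.mem_ball, dist_eq_norm]; linarith)
    rw [hgraph _ hyU]
    have h1 := (hgraph _ hxU).1 hx
    set P := (ℝ ∙ ν)ᗮ.orthogonalProjectionOnto
    have hPν : P ν = 0 := Submodule.orthogonalProjectionOnto_orthogonal_apply_eq_zero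
      (Submodule.mem_span_singleton_self ν)
    have h2 : P (x + s • ν + w) = P x + P w := by simp [hPν]
    have h3 : γ (P x + P w) ≤ γ (P x) + K * ‖w‖ := by
      have := hγ.dist_le_mul (P x + P w) (P x)
      rw [dist_eq_norm, dist_eq_norm, add_sub_cancel_left] at this
      have h4 : ‖P w‖ ≤ ‖w‖ := Submodule.norm_orthogonalProjectionOnto_apply_le _ w
      have h5 := (Real.le_norm_self _).trans this
      nlinarith [K.coe_nonneg]
    have h6 : inner ℝ ν (x + s • ν + w) = inner ℝ ν x + s + inner ℝ ν w := by
      rw [inner_add_right, inner_add_right, inner_smul_right, real_inner_self_eq_norm_sq, hν]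
      ring
    have h7 : -‖w‖ ≤ inner ℝ ν w := by
      have := abs_real_inner_le_norm ν w
      rw [hν, one_mul] at this
      exact (abs_le.1 this).1
    rw [h2, h6]
    have h8 : (1 + K) * ‖w‖ ≤ s := by
      rw [one_div, inv_mul_eq_div, le_div_iff₀ (by positivity)] at hw
      linarith
    linarith

/-- Compactness of the closure: the property holds near each point and passes to unions of two sets
with the smaller constants. -/
theorem IsBoundedLipschitzDomain.exists_uniformCone (hd : 1 ≤ d) {Ω : Set (Euc d)}
    (hΩ : IsBoundedLipschitzDomain Ω) : ∃ r c : ℝ, 0 < r ∧ 0 < c ∧ c ≤ 1 ∧ UniformCone Ω Ω r c := by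
  suffices h : ∃ r c : ℝ, 0 < r ∧ 0 < c ∧ c ≤ 1 ∧ UniformCone Ω (closure Ω) r c by
    obtain ⟨r, c, hr, hc, hc1, h⟩ := h
    exact ⟨r, c, hr, hc, hc1, h.mono subset_closure le_rfl le_rfl⟩
  have hcpt : IsCompact (closure Ω) := hΩ.isBounded.isCompact_closure
  refine hcpt.induction_on (p := fun S => ∃ r c : ℝ, 0 < r ∧ 0 < c ∧ c ≤ 1 ∧ UniformCone Ω S r c)
    ⟨1, 1, one_pos, one_pos, le_rfl, fun x hx => absurd hx (notMem_empty x)⟩ ?_ ?_ ?_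
  · rintro S S' hS ⟨r, c, hr, hc, hc1, h⟩
    exact ⟨r, c, hr, hc, hc1, h.mono hS le_rfl le_rfl⟩
  · rintro S S' ⟨r, c, hr, hc, hc1, h⟩ ⟨r', c', hr', hc', hc1', h'⟩
    refine ⟨min r r', min c c', lt_min hr hr', lt_min hc hc', (min_le_left _ _).trans hc1, ?_⟩
    rintro x (hx | hx)
    · exact h.mono Subset.rfl (min_le_left _ _) (min_le_left _ _) x hx
    · exact h'.mono Subset.rfl (min_le_right _ _) (min_le_right _ _) x hx
  · intro x₀ hx₀
    obtain ⟨ν, r, c, hr, hc, hc1, hν, H⟩ := hΩ.exists_cone hd hx₀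
    refine ⟨Metric.ball x₀ (r / 2),
      mem_nhdsWithin_of_mem_nhds (Metric.ball_mem_nhds _ (by positivity)),
      r / 2, c, by positivity, hc, hc1, fun x₁ hx₁ => ⟨ν, hν, fun x hx hdx s hs => ?_⟩⟩
    refine H x hx ?_ s ⟨hs.1, by linarith [hs.2]⟩
    have := dist_triangle x x₁ x₀
    rw [Metric.mem_ball] at hx₁
    linarith

theorem volume_ball_eq (x : Euc d) {r : ℝ} (hr : 0 < r) :
    volume (Metric.ball x r) = ENNReal.ofReal (r ^ d) * volume (Metric.ball (0 : Euc d) 1) := by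
  have := Measure.addHaar_ball_of_pos (volume : Measure (Euc d)) x hr
  simpa using this

/-- The balls of radius `ε / 2` around the points are disjoint and fit into a ball of radius `r + ε
/ 2`; compare volumes. -/
theorem card_mul_pow_le {Z : Finset (Euc d)} {ε r : ℝ} (hε : 0 < ε) (hr : 0 ≤ r) {x : Euc d}
    (hZ : ∀ z ∈ Z, dist z x < r)
    (hsep : ∀ z ∈ Z, ∀ z' ∈ Z, z ≠ z' → ε ≤ dist z z') :
    (Z.card : ℝ) * (ε / 2) ^ d ≤ (r + ε / 2) ^ d := by
  have hdisj : (Z : Set (Euc d)).PairwiseDisjoint fun z => Metric.ball z (ε / 2) := by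
    intro z hz z' hz' hne
    refine Metric.ball_disjoint_ball ?_
    have := hsep z hz z' hz' hne
    linarith
  have h1 := measure_biUnion_finset (μ := (volume : Measure (Euc d))) hdisj
    fun z _ => Metric.isOpen_ball.measurableSet
  have h2 : (⋃ z ∈ Z, Metric.ball z (ε / 2)) ⊆ Metric.ball x (r + ε / 2) := by
    refine iUnion₂_subset fun z hz => Metric.ball_subset_ball' ?_
    linarith [hZ z hz]
  have h3 := measure_mono (μ := volume) h2
  rw [h1, Finset.sum_congr rfl fun z _ => volume_ball_eq z (half_pos hε), Finset.sum_const,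
    volume_ball_eq x (by positivity), nsmul_eq_mul, ← mul_assoc] at h3
  have h4 : volume (Metric.ball (0 : Euc d) 1) ≠ 0 := (Metric.measure_ball_pos _ _ one_pos).ne'
  have h5 : volume (Metric.ball (0 : Euc d) 1) ≠ ⊤ := measure_ball_lt_top.ne
  rw [ENNReal.mul_le_mul_iff_left h4 h5, ← ENNReal.ofReal_natCast,
    ← ENNReal.ofReal_mul (by positivity), ENNReal.ofReal_le_ofReal_iff (by positivity)] at h3
  exact h3

/-- A separated set of maximal cardinality covers; the packing bound guarantees that the maximum
exists. -/
theorem exists_separated_net {Ω : Set (Euc d)} (hΩ : Bornology.IsBounded Ω) {ε : ℝ} (hε : 0 < ε) :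
    ∃ Z : Finset (Euc d), (∀ z ∈ Z, z ∈ Ω) ∧ (∀ z ∈ Z, ∀ z' ∈ Z, z ≠ z' → ε ≤ dist z z') ∧
      ∀ x ∈ Ω, ∃ z ∈ Z, dist x z < ε := by
  classical
  obtain ⟨r, hr⟩ := hΩ.subset_ball (0 : Euc d)
  let P : Finset (Euc d) → Prop := fun Z => (∀ z ∈ Z, z ∈ Ω) ∧
    (∀ z ∈ Z, ∀ z' ∈ Z, z ≠ z' → ε ≤ dist z z')
  let M : Set ℕ := {m | ∃ Z, P Z ∧ Z.card = m}
  have hne : M.Nonempty := ⟨0, ∅, by simp [P]⟩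
  have hbdd : BddAbove M := by
    refine ⟨⌈(max r 0 + ε / 2) ^ d / (ε / 2) ^ d⌉₊, ?_⟩
    rintro m ⟨Z, hZ, rfl⟩
    have h1 := card_mul_pow_le hε (le_max_right r 0)
      (fun z hz => (Metric.mem_ball.1 (hr (hZ.1 z hz))).trans_le (le_max_left _ _)) hZ.2
    rw [← le_div_iff₀ (by positivity)] at h1
    exact_mod_cast h1.trans (Nat.le_ceil _)
  obtain ⟨Z, hZ, hcard⟩ := Nat.sSup_mem hne hbdd
  refine ⟨Z, hZ.1, hZ.2, fun x hx => ?_⟩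
  by_contra! h
  have hxZ : x ∉ Z := fun hxZ => by
    have := h x hxZ
    rw [dist_self] at this
    linarith
  have h2 : (insert x Z).card ∈ M := by
    refine ⟨insert x Z, ⟨fun z hz => ?_, fun z hz z' hz' hne => ?_⟩, rfl⟩
    · rcases Finset.mem_insert.1 hz with rfl | hz
      · exact hx
      · exact hZ.1 z hz
    · rcases Finset.mem_insert.1 hz with h1 | h1 <;> rcases Finset.mem_insert.1 hz' with h2 | h2
      · exact absurd (h1.trans h2.symm) hne
      · rw [h1]; exact h z' h2
      · rw [h2, dist_comm]; exact h z h1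
      · exact hZ.2 z h1 z' h2 hne
  have h3 := le_csSup hbdd h2
  rw [← hcard, Finset.card_insert_of_notMem hxZ] at h3
  omega

end Geometry


/-! ### Poincaré inequalities in double-integral form -/

section Poincare

variable {d : ℕ} {E' : Type*} [NormedAddCommGroup E']

theorem enorm_sub_sq_le (a b c e : E') :
    ‖a - e‖ₑ ^ 2 ≤ 3 * (‖b - a‖ₑ ^ 2 + ‖c - e‖ₑ ^ 2 + ‖b - c‖ₑ ^ 2) := by
  have h : ‖a - e‖₊ ^ 2 ≤ 3 * (‖b - a‖₊ ^ 2 + ‖c - e‖₊ ^ 2 + ‖b - c‖₊ ^ 2) := by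
    rw [← NNReal.coe_le_coe]
    push_cast
    have h1 : ‖a - e‖ ≤ ‖b - a‖ + ‖c - e‖ + ‖b - c‖ := by
      calc ‖a - e‖ = ‖-(b - a) + (c - e) + (b - c)‖ := by congr 1; abel
        _ ≤ ‖-(b - a)‖ + ‖c - e‖ + ‖b - c‖ := norm_add₃_le
        _ = _ := by rw [norm_neg]
    calc ‖a - e‖ ^ 2 ≤ (‖b - a‖ + ‖c - e‖ + ‖b - c‖) ^ 2 := by gcongr
      _ ≤ _ := by nlinarith [sq_nonneg (‖b - a‖ - ‖c - e‖), sq_nonneg (‖b - a‖ - ‖b - c‖),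
          sq_nonneg (‖c - e‖ - ‖b - c‖)]
  simp only [enorm_eq_nnnorm]
  exact_mod_cast h

theorem enorm_sub_sq_le_two (a b c : E') :
    ‖a - c‖ₑ ^ 2 ≤ 2 * (‖a - b‖ₑ ^ 2 + ‖b - c‖ₑ ^ 2) := by
  have h : ‖a - c‖₊ ^ 2 ≤ 2 * (‖a - b‖₊ ^ 2 + ‖b - c‖₊ ^ 2) := by
    rw [← NNReal.coe_le_coe]
    push_cast
    have h1 := norm_sub_le_norm_sub_add_norm_sub a b c
    nlinarith [norm_nonneg (a - c), sq_nonneg (‖a - b‖ - ‖b - c‖)]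
  simp only [enorm_eq_nnnorm]
  exact_mod_cast h

theorem setLIntegral_comp_add_le {A B : Set (Euc d)} (hA : MeasurableSet A) (hB : MeasurableSet B)
    {h : Euc d} (hAB : ∀ x ∈ A, x + h ∈ B) (G : Euc d → ℝ≥0∞) :
    ∫⁻ x in A, G (x + h) ≤ ∫⁻ x in B, G x := by
  calc ∫⁻ x in A, G (x + h) ≤ ∫⁻ x, B.indicator G (x + h) := by
        rw [← lintegral_indicator hA]
        refine lintegral_mono fun x => ?_
        by_cases hx : x ∈ A
        · rw [indicator_of_mem hx, indicator_of_mem (hAB x hx)]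
        · rw [indicator_of_notMem hx]; exact zero_le
    _ = ∫⁻ x in B, G x := by
        rw [lintegral_add_right_eq_self (B.indicator G), lintegral_indicator hB]

theorem StronglyMeasurable.measurable_enorm_sub_sq {F : Euc d → E'} (hF : StronglyMeasurable F) :
    Measurable fun p : Euc d × Euc d => ‖F p.1 - F p.2‖ₑ ^ 2 :=
  ((hF.comp_measurable measurable_fst).sub (hF.comp_measurable measurable_snd)).enorm.pow_const 2

/-- Poincaré's inequality on balls. -/
theorem TransEst.lintegral_ball_le {Ω : Set (Euc d)} {F : Euc d → E'} {g : Euc d → ℝ≥0∞}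
    (hF : StronglyMeasurable F) (hFg : TransEst Ω F g) {z : Euc d} {r : ℝ}
    (hball : Metric.ball z r ⊆ Ω) :
    ∫⁻ x in Metric.ball z r, ∫⁻ y in Metric.ball z r, ‖F x - F y‖ₑ ^ 2
      ≤ ENNReal.ofReal (2 * r) ^ 2 * volume (Metric.ball (0 : Euc d) (2 * r))
        * ∫⁻ x in Metric.ball z r, g x := by
  set B := Metric.ball z r with hB
  have hBm : MeasurableSet B := Metric.isOpen_ball.measurableSet
  have hm := StronglyMeasurable.measurable_enorm_sub_sq hF
  have hadd : Measurable fun p : Euc d × Euc d => (p.1, p.1 + p.2) := by fun_prop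
  -- Substituting `y = x + k` turns the double integral into increments by a fixed `k` with `‖k‖ < 2
  -- r`; the segments stay in the ball by convexity.
  have e1 : ∀ x, ∫⁻ y in B, ‖F x - F y‖ₑ ^ 2
      = ∫⁻ k, B.indicator (fun y => ‖F x - F y‖ₑ ^ 2) (x + k) := by
    intro x
    rw [lintegral_add_left_eq_self, lintegral_indicator hBm]
  simp_rw [e1]
  rw [lintegral_lintegral_swap]
  swap
  · have h1 : Measurable fun p : Euc d × Euc d =>
        ({p : Euc d × Euc d | p.2 ∈ B}.indicator (fun p => ‖F p.1 - F p.2‖ₑ ^ 2)) p :=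
      hm.indicator (measurable_snd hBm)
    exact (h1.comp hadd).aemeasurable
  calc _ ≤ ∫⁻ k, (Metric.ball (0 : Euc d) (2 * r)).indicator
        (fun _ => ENNReal.ofReal (2 * r) ^ 2 * ∫⁻ x in B, g x) k := by
        refine lintegral_mono fun k => ?_
        by_cases hk : k ∈ Metric.ball (0 : Euc d) (2 * r)
        · rw [indicator_of_mem hk]
          rw [mem_ball_zero_iff] at hk
          set A := B ∩ (fun x => x + k) ⁻¹' B with hAdef
          have hA : IsOpen A := Metric.isOpen_ball.inter
            (Metric.isOpen_ball.preimage (by fun_prop))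
          calc ∫⁻ x in B, B.indicator (fun y => ‖F x - F y‖ₑ ^ 2) (x + k)
              = ∫⁻ x in A, ‖F (x + k) - F x‖ₑ ^ 2 := by
                rw [← lintegral_indicator hBm, ← lintegral_indicator hA.measurableSet]
                congr 1
                funext x
                by_cases h1 : x ∈ B <;> by_cases h2 : x + k ∈ B
                · rw [indicator_of_mem h1, indicator_of_mem h2,
                  indicator_of_mem (show x ∈ A from ⟨h1, h2⟩),
                    enorm_sub_rev]
                · rw [indicator_of_mem h1, indicator_of_notMem h2,
                    indicator_of_notMem fun h => h2 h.2]
                · rw [indicator_of_notMem h1, indicator_of_notMem fun h => h1 h.1]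
                · rw [indicator_of_notMem h1, indicator_of_notMem fun h => h1 h.1]
            _ ≤ ‖k‖ₑ ^ 2 * ∫⁻ x in B, g x := by
                refine hFg A B k hA hBm hball fun x hx s hs => ?_
                have h1 := (convex_ball z r).add_smul_sub_mem hx.1 hx.2 hs
                rwa [add_sub_cancel_left] at h1
            _ ≤ _ := by
                gcongr
                rw [← ofReal_norm]
                exact ENNReal.ofReal_le_ofReal hk.le
        · rw [indicator_of_notMem hk, nonpos_iff_eq_zero, lintegral_eq_zero_of_ae_eq_zero]
          refine (ae_restrict_iff' hBm).2 (Eventually.of_forall fun x hx => ?_)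
          refine indicator_of_notMem (fun hxk => hk ?_) _
          rw [hB, Metric.mem_ball] at hx hxk
          rw [mem_ball_zero_iff]
          have := dist_triangle_right (x + k) x z
          rw [dist_eq_norm, add_sub_cancel_left] at this
          linarith
    _ = _ := by
        rw [lintegral_indicator Metric.isOpen_ball.measurableSet, setLIntegral_const]
        ring

theorem lintegral_pair_shift_le {F : Euc d → E'} (hF : StronglyMeasurable F) (A : Set (Euc d))
    (h : Euc d) : ∫⁻ x in A, ∫⁻ y in A, ‖F x - F y‖ₑ ^ 2
      ≤ 3 * (2 * (volume A * ∫⁻ x in A, ‖F (x + h) - F x‖ₑ ^ 2)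
        + ∫⁻ x in A, ∫⁻ y in A, ‖F (x + h) - F (y + h)‖ₑ ^ 2) := by
  have hm := StronglyMeasurable.measurable_enorm_sub_sq hF
  have hshm : Measurable fun x => ‖F (x + h) - F x‖ₑ ^ 2 :=
    ((hF.comp_measurable (measurable_add_const h)).sub hF).enorm.pow_const 2
  have hpair : Measurable fun p : Euc d × Euc d => ‖F (p.1 + h) - F (p.2 + h)‖ₑ ^ 2 :=
    hm.comp (f := fun p : Euc d × Euc d => (p.1 + h, p.2 + h)) (by fun_prop)
  have hx : ∀ x, Measurable fun y => ‖F (x + h) - F (y + h)‖ₑ ^ 2 := fun x =>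
    (stronglyMeasurable_const.sub (hF.comp_measurable (measurable_add_const h))).enorm.pow_const 2
  have hx2 : Measurable fun x => ∫⁻ y in A, ‖F (x + h) - F (y + h)‖ₑ ^ 2 :=
    Measurable.lintegral_prod_right'
      (f := fun p : Euc d × Euc d => ‖F (p.1 + h) - F (p.2 + h)‖ₑ ^ 2) hpair
  set I := ∫⁻ y in A, ‖F (y + h) - F y‖ₑ ^ 2 with hI
  calc ∫⁻ x in A, ∫⁻ y in A, ‖F x - F y‖ₑ ^ 2
      ≤ ∫⁻ x in A, ∫⁻ y in A, 3 * (‖F (x + h) - F x‖ₑ ^ 2 + ‖F (y + h) - F y‖ₑ ^ 2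
        + ‖F (x + h) - F (y + h)‖ₑ ^ 2) :=
        lintegral_mono fun x => lintegral_mono fun y => enorm_sub_sq_le _ _ _ _
    _ = ∫⁻ x in A, 3 * (‖F (x + h) - F x‖ₑ ^ 2 * volume A + I
          + ∫⁻ y in A, ‖F (x + h) - F (y + h)‖ₑ ^ 2) := by
        refine lintegral_congr fun x => ?_
        rw [lintegral_const_mul _ (by exact (measurable_const.add hshm).add (hx x)),
          lintegral_add_right _ (hx x), lintegral_add_right _ hshm, setLIntegral_const]
    _ = _ := by
        rw [lintegral_const_mul _ (by exact ((hshm.mul_const _).add measurable_const).add hx2),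
          lintegral_add_right _ hx2, lintegral_add_right _ measurable_const,
          lintegral_mul_const _ hshm, setLIntegral_const]
        ring

/-- The set `Ω ∩ ball x₀ ε` may be irregular or disconnected, but a shift by a multiple of `ε` along
the cone direction moves it, through `Ω`, into a ball contained in `Ω`. Poincaré's inequality on
that ball and the translation estimate for the shift combine. -/
theorem TransEst.lintegral_local_le {Ω : Set (Euc d)} (hΩ : IsOpen Ω) {F : Euc d → E'}
    {g : Euc d → ℝ≥0∞} (hF : StronglyMeasurable F) (hFg : TransEst Ω F g) {r c : ℝ}
    (hc : 0 < c) (hcone : UniformCone Ω Ω r c) {x₀ : Euc d} (hx₀ : x₀ ∈ Ω) {ε : ℝ}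
    (hε : 0 < ε) (hεr : 4 / c * ε ≤ r) (hεr' : ε ≤ r) :
    ∫⁻ x in Ω ∩ Metric.ball x₀ ε, ∫⁻ y in Ω ∩ Metric.ball x₀ ε, ‖F x - F y‖ₑ ^ 2
      ≤ (6 * ENNReal.ofReal ((4 / c) ^ 2) + 3 * 16 * ENNReal.ofReal (4 ^ d))
          * volume (Metric.ball (0 : Euc d) 1) * ENNReal.ofReal (ε ^ (d + 2))
        * ∫⁻ x in Ω ∩ Metric.ball x₀ ((4 / c + 2) * ε), g x := by
  obtain ⟨ν, hν, H⟩ := hcone x₀ hx₀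
  -- At height `δ` the cone has radius `4 ε`, enough to contain the ball of radius `2 ε` around `x₀
  -- + h`.
  set δ := 4 / c * ε with hδ
  have hδ0 : 0 < δ := by positivity
  have hcδ : c * δ = 4 * ε := by rw [hδ]; field_simp
  set h : Euc d := δ • ν with hh
  have hhn : ‖h‖ = δ := by rw [hh, norm_smul, hν, mul_one, Real.norm_of_nonneg hδ0.le]
  set A := Ω ∩ Metric.ball x₀ ε with hA
  set A' := Ω ∩ Metric.ball x₀ ((4 / c + 2) * ε) with hA'
  set B := Metric.ball (x₀ + h) (2 * ε) with hB
  have hAo : IsOpen A := hΩ.inter Metric.isOpen_ball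
  have hA'o : IsOpen A' := hΩ.inter Metric.isOpen_ball
  have hBm : MeasurableSet B := Metric.isOpen_ball.measurableSet
  have hR : (4 / c + 2) * ε = δ + 2 * ε := by rw [hδ]; ring
  have hBΩ : B ⊆ Ω := by
    intro y hy
    have h1 := H x₀ hx₀ (by rw [dist_self]; linarith) δ ⟨hδ0.le, hεr⟩ (y - (x₀ + h)) (by
      rw [hB, Metric.mem_ball, dist_eq_norm] at hy
      linarith)
    rwa [← hh, add_sub_cancel] at h1
  have hBA' : B ⊆ A' := fun y hy => ⟨hBΩ hy, by
    rw [hB, Metric.mem_ball] at hy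
    rw [Metric.mem_ball, hR]
    have h1 := dist_triangle y (x₀ + h) x₀
    rw [dist_eq_norm (x₀ + h), add_sub_cancel_left, hhn] at h1
    linarith⟩
  have hAB : ∀ x ∈ A, x + h ∈ B := by
    intro x hx
    have := hx.2
    rw [Metric.mem_ball] at this
    rw [hB, Metric.mem_ball, dist_add_right]
    linarith
  have hAA' : ∀ x ∈ A, ∀ s ∈ Icc (0 : ℝ) 1, x + s • h ∈ A' := by
    intro x hx s hs
    have hxb := hx.2
    rw [Metric.mem_ball] at hxb
    refine ⟨?_, ?_⟩
    · have h1 := H x hx.1 (by linarith) (s * δ) ⟨by nlinarith [hs.1], by nlinarith [hs.2]⟩ 0 (by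
        rw [norm_zero]; have := hs.1; positivity)
      rwa [add_zero, mul_smul, ← hh] at h1
    · rw [Metric.mem_ball, hR]
      have h1 := dist_triangle (x + s • h) x x₀
      rw [dist_eq_norm (x + s • h) x, add_sub_cancel_left, norm_smul, hhn,
        Real.norm_of_nonneg hs.1] at h1
      nlinarith [hs.2]
  have hm := StronglyMeasurable.measurable_enorm_sub_sq hF
  have t1 : ∫⁻ x in A, ‖F (x + h) - F x‖ₑ ^ 2 ≤ ENNReal.ofReal δ ^ 2 * ∫⁻ x in A', g x := by
    have := hFg A A' h hAo hA'o.measurableSet inter_subset_left hAA'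
    rwa [← ofReal_norm, hhn] at this
  have t3 : ∫⁻ x in A, ∫⁻ y in A, ‖F (x + h) - F (y + h)‖ₑ ^ 2
      ≤ ENNReal.ofReal (4 * ε) ^ 2 * volume (Metric.ball (0 : Euc d) (4 * ε))
        * ∫⁻ x in A', g x := by
    calc _ ≤ ∫⁻ x in A, ∫⁻ y in B, ‖F (x + h) - F y‖ₑ ^ 2 := by
          refine lintegral_mono fun x => ?_
          exact setLIntegral_comp_add_le hAo.measurableSet hBm hAB fun y => ‖F (x + h) - F y‖ₑ ^ 2
      _ ≤ ∫⁻ x in B, ∫⁻ y in B, ‖F x - F y‖ₑ ^ 2 :=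
          setLIntegral_comp_add_le hAo.measurableSet hBm hAB
            fun x => ∫⁻ y in B, ‖F x - F y‖ₑ ^ 2
      _ ≤ _ := hFg.lintegral_ball_le hF hBΩ
      _ ≤ _ := by
          rw [show 2 * (2 * ε) = 4 * ε by ring]
          gcongr
  have hvA : volume A ≤ ENNReal.ofReal (ε ^ d) * volume (Metric.ball (0 : Euc d) 1) :=
    (measure_mono inter_subset_right).trans (volume_ball_eq x₀ hε).le
  calc ∫⁻ x in A, ∫⁻ y in A, ‖F x - F y‖ₑ ^ 2
      ≤ 3 * (2 * (volume A * ∫⁻ x in A, ‖F (x + h) - F x‖ₑ ^ 2)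
        + ∫⁻ x in A, ∫⁻ y in A, ‖F (x + h) - F (y + h)‖ₑ ^ 2) := lintegral_pair_shift_le hF A h
    _ ≤ 3 * (2 * (ENNReal.ofReal (ε ^ d) * volume (Metric.ball (0 : Euc d) 1)
          * (ENNReal.ofReal δ ^ 2 * ∫⁻ x in A', g x))
        + ENNReal.ofReal (4 * ε) ^ 2 * volume (Metric.ball (0 : Euc d) (4 * ε))
          * ∫⁻ x in A', g x) := by gcongr
    _ = _ := by
        rw [volume_ball_eq 0 (show 0 < 4 * ε by positivity), hδ,
          ENNReal.ofReal_mul (by positivity : 0 ≤ 4 / c), mul_pow,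
          ENNReal.ofReal_pow (by positivity) 2, mul_pow 4 ε d,
          ENNReal.ofReal_mul (by positivity : (0 : ℝ) ≤ 4 ^ d),
          pow_add, ENNReal.ofReal_mul (by positivity : 0 ≤ ε ^ d),
          ENNReal.ofReal_mul (by positivity : (0 : ℝ) ≤ 4),
          ENNReal.ofReal_pow hε.le 2]
        have : ENNReal.ofReal 4 = 4 := by norm_num
        rw [this]
        ring

variable (E') in
/-- Poincaré's inequality at small scales. -/
theorem IsBoundedLipschitzDomain.exists_local_poincare (hd : 1 ≤ d) {Ω : Set (Euc d)}
    (hΩ : IsBoundedLipschitzDomain Ω) : ∃ (ε₀ R : ℝ) (C : ℝ≥0∞), 0 < ε₀ ∧ 1 ≤ R ∧ C ≠ ⊤ ∧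
      ∀ x₀ ∈ Ω, ∀ ε, 0 < ε → ε ≤ ε₀ → ∀ (F : Euc d → E') (g : Euc d → ℝ≥0∞),
        StronglyMeasurable F → TransEst Ω F g →
        ∫⁻ x in Ω ∩ Metric.ball x₀ ε, ∫⁻ y in Ω ∩ Metric.ball x₀ ε, ‖F x - F y‖ₑ ^ 2
          ≤ C * ENNReal.ofReal (ε ^ (d + 2)) * ∫⁻ x in Ω ∩ Metric.ball x₀ (R * ε), g x := by
  obtain ⟨r, c, hr, hc, hc1, hcone⟩ := hΩ.exists_uniformCone hd
  have h4 : 0 < 4 / c := by positivity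
  refine ⟨min r (r / (4 / c)), 4 / c + 2, _, by positivity, by linarith, ?_,
    fun x₀ hx₀ ε hε hεr F g hF hFg => hFg.lintegral_local_le hΩ.isOpen hF hc hcone hx₀ hε ?_ ?_⟩
  · exact ENNReal.mul_ne_top (by finiteness) measure_ball_lt_top.ne
  · have := hεr.trans (min_le_right _ _)
    rw [le_div_iff₀ h4] at this
    linarith
  · exact hεr.trans (min_le_left _ _)

theorem lintegral_pair_symm {F : Euc d → E'} (hF : StronglyMeasurable F) (A B : Set (Euc d)) :
    ∫⁻ x in A, ∫⁻ y in B, ‖F x - F y‖ₑ ^ 2 = ∫⁻ x in B, ∫⁻ y in A, ‖F x - F y‖ₑ ^ 2 := by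
  rw [lintegral_lintegral_swap (StronglyMeasurable.measurable_enorm_sub_sq hF).aemeasurable]
  simp_rw [enorm_sub_rev]

/-- The triangle inequality through an intermediate point, averaged over `D`; it chains local
estimates. -/
theorem lintegral_pair_trans {F : Euc d → E'} (hF : StronglyMeasurable F) (A B D : Set (Euc d)) :
    volume D * ∫⁻ x in A, ∫⁻ y in B, ‖F x - F y‖ₑ ^ 2
      ≤ 2 * (volume B * (∫⁻ x in A, ∫⁻ y in D, ‖F x - F y‖ₑ ^ 2)
        + volume A * ∫⁻ x in D, ∫⁻ y in B, ‖F x - F y‖ₑ ^ 2) := by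
  have hm := StronglyMeasurable.measurable_enorm_sub_sq hF
  have hmx : ∀ x, Measurable fun y => ‖F x - F y‖ₑ ^ 2 := fun x =>
    hm.comp (measurable_prodMk_left (x := x))
  have hi : ∀ S : Set (Euc d), Measurable fun x => ∫⁻ y in S, ‖F x - F y‖ₑ ^ 2 := fun S =>
    hm.lintegral_prod_right'
  calc volume D * ∫⁻ x in A, ∫⁻ y in B, ‖F x - F y‖ₑ ^ 2
      = ∫⁻ x in A, ∫⁻ y in B, ∫⁻ _ in D, ‖F x - F y‖ₑ ^ 2 := by
        simp_rw [setLIntegral_const]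
        rw [← lintegral_const_mul _ (hi B)]
        refine lintegral_congr fun x => ?_
        rw [lintegral_mul_const _ (hmx x), mul_comm]
    _ ≤ ∫⁻ x in A, ∫⁻ y in B, ∫⁻ z in D, 2 * (‖F x - F z‖ₑ ^ 2 + ‖F y - F z‖ₑ ^ 2) := by
        refine lintegral_mono fun x => lintegral_mono fun y => lintegral_mono fun z => ?_
        rw [enorm_sub_rev (F y)]
        exact enorm_sub_sq_le_two _ _ _
    _ = ∫⁻ x in A, ∫⁻ y in B, 2 * ((∫⁻ z in D, ‖F x - F z‖ₑ ^ 2)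
          + ∫⁻ z in D, ‖F y - F z‖ₑ ^ 2) := by
        refine lintegral_congr fun x => lintegral_congr fun y => ?_
        rw [lintegral_const_mul _ (by exact (hmx x).add (hmx y)), lintegral_add_right _ (hmx y)]
    _ = ∫⁻ x in A, 2 * ((∫⁻ z in D, ‖F x - F z‖ₑ ^ 2) * volume B
          + ∫⁻ y in B, ∫⁻ z in D, ‖F y - F z‖ₑ ^ 2) := by
        refine lintegral_congr fun x => ?_
        rw [lintegral_const_mul _ (by exact measurable_const.add (hi D)),
          lintegral_add_right _ (hi D), setLIntegral_const]
    _ = 2 * (volume B * (∫⁻ x in A, ∫⁻ y in D, ‖F x - F y‖ₑ ^ 2)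
        + volume A * ∫⁻ x in B, ∫⁻ y in D, ‖F x - F y‖ₑ ^ 2) := by
        rw [lintegral_const_mul _ (by exact ((hi D).mul_const _).add measurable_const),
          lintegral_add_right _ measurable_const, lintegral_mul_const _ (hi D), setLIntegral_const,
          mul_comm (volume A), mul_comm (volume B)]
    _ = _ := by rw [lintegral_pair_symm hF B D]

variable (E') in
/-- Poincaré's inequality on the whole domain. -/
theorem IsBoundedLipschitzDomain.exists_poincare (hd : 1 ≤ d) {Ω : Set (Euc d)}
    (hΩ : IsBoundedLipschitzDomain Ω) : ∃ C : ℝ≥0∞, C ≠ ⊤ ∧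
      ∀ (F : Euc d → E') (g : Euc d → ℝ≥0∞), StronglyMeasurable F → TransEst Ω F g →
        ∫⁻ x in Ω, ∫⁻ y in Ω, ‖F x - F y‖ₑ ^ 2 ≤ C * ∫⁻ x in Ω, g x := by
  obtain ⟨ε₀, R, C₀, hε₀, hR, hC₀, hloc⟩ := hΩ.exists_local_poincare E' hd
  -- Half the admissible scale, so that for `y` within `ε` of `x` both small balls lie in `ball x
  -- ε₀`.
  set ε := ε₀ / 2 with hε
  have hε0 : 0 < ε := by positivity
  let b : Euc d → Set (Euc d) := fun x => Ω ∩ Metric.ball x ε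
  have hbpos : ∀ x ∈ Ω, volume (b x) ≠ 0 := fun x hx =>
    ((hΩ.isOpen.inter Metric.isOpen_ball).measure_pos _ ⟨x, hx, Metric.mem_ball_self hε0⟩).ne'
  have hbfin : ∀ x, volume (b x) ≠ ⊤ := fun x =>
    ((measure_mono inter_subset_right).trans_lt measure_ball_lt_top).ne
  -- This relation holds for nearby points and is symmetric and transitive, so it holds for all
  -- pairs in the connected set `Ω`. A finite net then covers `Ω × Ω` by products of small balls.
  let P : Euc d → Euc d → Prop := fun x y => ∃ C : ℝ≥0∞, C ≠ ⊤ ∧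
    ∀ (F : Euc d → E') (g : Euc d → ℝ≥0∞), StronglyMeasurable F → TransEst Ω F g →
      ∫⁻ x in b x, ∫⁻ y in b y, ‖F x - F y‖ₑ ^ 2 ≤ C * ∫⁻ x in Ω, g x
  have hP : ∀ x ∈ Ω, ∀ y ∈ Ω, P x y := by
    intro x hx y hy
    refine hΩ.isConnected.isPreconnected.induction₂ P ?_ ?_ ?_ hx hy
    · intro x hx
      filter_upwards [mem_nhdsWithin_of_mem_nhds (Metric.ball_mem_nhds x hε0)] with y hy
      refine ⟨C₀ * ENNReal.ofReal (ε₀ ^ (d + 2)), by finiteness, fun F g hF hFg => ?_⟩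
      have hbx : b x ⊆ Ω ∩ Metric.ball x ε₀ :=
        inter_subset_inter_right _ (Metric.ball_subset_ball (by linarith))
      have hby : b y ⊆ Ω ∩ Metric.ball x ε₀ :=
        inter_subset_inter_right _ (Metric.ball_subset_ball' (by
          rw [Metric.mem_ball] at hy; linarith))
      calc _ ≤ ∫⁻ x in Ω ∩ Metric.ball x ε₀, ∫⁻ y in b y, ‖F x - F y‖ₑ ^ 2 :=
            lintegral_mono_set hbx
        _ ≤ ∫⁻ x' in Ω ∩ Metric.ball x ε₀, ∫⁻ y' in Ω ∩ Metric.ball x ε₀, ‖F x' - F y'‖ₑ ^ 2 :=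
            lintegral_mono fun _ => lintegral_mono_set hby
        _ ≤ _ := hloc x hx ε₀ hε₀ le_rfl F g hF hFg
        _ ≤ _ := by gcongr; exact inter_subset_left
    · rintro x y z hx hy hz ⟨C₁, hC₁, h₁⟩ ⟨C₂, hC₂, h₂⟩
      refine ⟨(volume (b y))⁻¹ * (2 * (volume (b z) * C₁ + volume (b x) * C₂)), ?_,
        fun F g hF hFg => ?_⟩
      · have := hbfin x
        have := hbfin z
        have := hbpos y hy
        finiteness
      · have h3 := lintegral_pair_trans hF (b x) (b z) (b y)
        have h4 := h₁ F g hF hFg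
        have h5 := h₂ F g hF hFg
        rw [mul_comm, ← ENNReal.le_div_iff_mul_le (Or.inl (hbpos y hy)) (Or.inl (hbfin y))] at h3
        refine h3.trans ?_
        rw [ENNReal.div_eq_inv_mul, mul_assoc (volume (b y))⁻¹]
        refine mul_le_mul_right ?_ _
        rw [mul_assoc, add_mul, mul_assoc, mul_assoc]
        gcongr
    · rintro x y hx hy ⟨C, hC, h⟩
      exact ⟨C, hC, fun F g hF hFg => by rw [lintegral_pair_symm hF]; exact h F g hF hFg⟩
  obtain ⟨Z, hZΩ, -, hZ⟩ := exists_separated_net hΩ.isBounded hε0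
  choose! C hC hP' using hP
  refine ⟨∑ z ∈ Z, ∑ z' ∈ Z, C z z', ?_, fun F g hF hFg => ?_⟩
  · exact ENNReal.sum_ne_top.2 fun z hz => ENNReal.sum_ne_top.2 fun z' hz' =>
      hC z (hZΩ z hz) z' (hZΩ z' hz')
  have hcover : Ω ⊆ ⋃ z : Z, b z := fun x hx => by
    obtain ⟨z, hz, hxz⟩ := hZ x hx
    exact mem_iUnion.2 ⟨⟨z, hz⟩, hx, hxz⟩
  have hle : ∀ G : Euc d → ℝ≥0∞, ∫⁻ x in Ω, G x ≤ ∑ z ∈ Z, ∫⁻ x in b z, G x := by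
    intro G
    calc ∫⁻ x in Ω, G x ≤ ∫⁻ x in ⋃ z : Z, b z, G x := lintegral_mono_set hcover
      _ ≤ ∑' z : Z, ∫⁻ x in b z, G x := lintegral_iUnion_le _ _
      _ = _ := by rw [tsum_fintype, ← Finset.sum_coe_sort Z]
  calc ∫⁻ x in Ω, ∫⁻ y in Ω, ‖F x - F y‖ₑ ^ 2
      ≤ ∑ z ∈ Z, ∫⁻ x in b z, ∑ z' ∈ Z, ∫⁻ y in b z', ‖F x - F y‖ₑ ^ 2 :=
        (hle _).trans (Finset.sum_le_sum fun z _ => lintegral_mono fun x => hle _)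
    _ = ∑ z ∈ Z, ∑ z' ∈ Z, ∫⁻ x in b z, ∫⁻ y in b z', ‖F x - F y‖ₑ ^ 2 := by
        refine Finset.sum_congr rfl fun z _ => lintegral_finsetSum _ fun z' _ => ?_
        exact (StronglyMeasurable.measurable_enorm_sub_sq hF).lintegral_prod_right'
    _ ≤ ∑ z ∈ Z, ∑ z' ∈ Z, C z z' * ∫⁻ x in Ω, g x :=
        Finset.sum_le_sum fun z hz => Finset.sum_le_sum fun z' hz' =>
          hP' z (hZΩ z hz) z' (hZΩ z' hz') F g hF hFg
    _ = _ := by simp_rw [Finset.sum_mul]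

end Poincare


/-! ### Partitions of unity at scale `ε` with uniform constants -/

section Partition

variable {d : ℕ}

/-- A partition of unity of `Ω` at the scale `ε`. -/
structure IsPartition (Ω : Set (Euc d)) (ε C : ℝ) (Z : Finset (Euc d)) (φ : Euc d → Euc d → ℝ) :
    Prop where
  mem : ∀ z ∈ Z, z ∈ Ω
  separated : ∀ z ∈ Z, ∀ z' ∈ Z, z ≠ z' → ε ≤ dist z z'
  contDiff : ∀ z, ContDiff ℝ ∞ (φ z)
  nonneg : ∀ z x, 0 ≤ φ z x
  sum_eq_one : ∀ x ∈ Ω, ∑ z ∈ Z, φ z x = 1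
  support : ∀ z x, 2 * ε ≤ dist x z → φ z x = 0
  norm_fderiv_le : ∀ z x, ‖fderiv ℝ (φ z) x‖ ≤ C / ε
  mass : ∀ z ∈ Z, ε ^ d ≤ C * ∫ x in Ω, φ z x

theorem card_filter_dist_le {Z : Finset (Euc d)} {ε R : ℝ} (hε : 0 < ε) (hR : 0 ≤ R)
    (hsep : ∀ z ∈ Z, ∀ z' ∈ Z, z ≠ z' → ε ≤ dist z z') (x : Euc d) :
    ((Z.filter fun z => dist z x < R * ε).card : ℝ) ≤ (2 * R + 1) ^ d := by
  have h := card_mul_pow_le (Z := Z.filter fun z => dist z x < R * ε) hε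
    (by positivity : 0 ≤ R * ε) (x := x) (fun z hz => (Finset.mem_filter.1 hz).2)
    fun z hz z' hz' => hsep z (Finset.mem_filter.1 hz).1 z' (Finset.mem_filter.1 hz').1
  rw [show R * ε + ε / 2 = (2 * R + 1) * (ε / 2) by ring, mul_pow] at h
  exact le_of_mul_le_mul_right h (by positivity)

theorem exists_smoothTransition_deriv_le (M : ℝ) :
    ∃ C, 0 ≤ C ∧ ∀ s ∈ Icc (-M) M, ‖fderiv ℝ Real.smoothTransition s‖ ≤ C := by
  obtain ⟨C, hC⟩ := (isCompact_Icc (a := -M) (b := M)).exists_bound_of_continuousOn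
    (ContDiff.continuous_fderiv (n := 1) Real.smoothTransition.contDiff (by simp)).continuousOn
  exact ⟨max C 0, le_max_right _ _, fun s hs => (hC s hs).trans (le_max_left _ _)⟩

variable (d) in
theorem exists_bump : ∃ (e : Euc d → ℝ) (C : ℝ), 0 ≤ C ∧ ContDiff ℝ ∞ e ∧ (∀ y, 0 ≤ e y) ∧
    (∀ y, e y ≤ 1) ∧ (∀ y, ‖y‖ ≤ 1 → e y = 1) ∧ (∀ y, 2 ≤ ‖y‖ → e y = 0) ∧
    (∀ y, ‖fderiv ℝ e y‖ ≤ C) ∧ ∀ y, 2 ≤ ‖y‖ → fderiv ℝ e y = 0 := by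
  let e : Euc d → ℝ := fun y => Real.smoothTransition (2 - ‖y‖ ^ 2)
  have he : ContDiff ℝ ∞ e :=
    Real.smoothTransition.contDiff.comp (contDiff_const.sub (contDiff_norm_sq ℝ))
  have h0 : ∀ y, 2 ≤ ‖y‖ → e =ᶠ[𝓝 y] fun _ => 0 := by
    intro y hy
    filter_upwards [continuous_norm.continuousAt.eventually_const_lt
      (show (3 / 2 : ℝ) < ‖y‖ by linarith)] with x hx
    exact Real.smoothTransition.zero_of_nonpos (by nlinarith)
  have h1 : ∀ y, 2 ≤ ‖y‖ → fderiv ℝ e y = 0 := fun y hy => by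
    rw [(h0 y hy).fderiv_eq]; simp
  obtain ⟨C, hC⟩ := (isCompact_closedBall (0 : Euc d) 2).exists_bound_of_continuousOn
    (he.continuous_fderiv (by simp)).continuousOn
  refine ⟨e, max C 0, le_max_right _ _, he, fun y => Real.smoothTransition.nonneg _,
    fun y => Real.smoothTransition.le_one _, fun y hy => ?_, fun y hy => (h0 y hy).self_of_nhds,
    fun y => ?_, h1⟩
  · exact Real.smoothTransition.one_of_one_le (by nlinarith [norm_nonneg y])
  · rcases le_or_gt ‖y‖ 2 with hy | hy
    · exact (hC y (by simpa using hy)).trans (le_max_left _ _)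
    · rw [h1 y hy.le, norm_zero]; exact le_max_right _ _

/-- Rescaled bumps around a separated net are divided by their sum. Bounded overlap controls the
derivatives, and the interior cone puts a ball of radius comparable to `ε` into `Ω` near each
centre, which bounds the masses from below. The constant does not depend on `ε`. -/
theorem IsBoundedLipschitzDomain.exists_partition (hd : 1 ≤ d) {Ω : Set (Euc d)}
    (hΩ : IsBoundedLipschitzDomain Ω) : ∃ ε₀ C : ℝ, 0 < ε₀ ∧ 0 < C ∧ ∀ ε, 0 < ε → ε ≤ ε₀ →
      ∃ Z φ, IsPartition Ω ε C Z φ := by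
  obtain ⟨r, c, hr, hc, hc1, hcone⟩ := hΩ.exists_uniformCone hd
  obtain ⟨e, Ce, hCe, he, he0, he1, heone, hezero, hefd, hefd0⟩ := exists_bump d
  let N : ℝ := (2 * 2 + 1) ^ d
  have hN : 0 < N := by positivity
  obtain ⟨CS, hCS, hS⟩ := exists_smoothTransition_deriv_le (2 * N + 1)
  let w : ℝ := (volume (Metric.ball (0 : Euc d) 1)).toReal
  have hw : 0 < w := ENNReal.toReal_pos (Metric.measure_ball_pos _ _ one_pos).ne'
    measure_ball_lt_top.ne
  let C₁ : ℝ := 2 * Ce + 4 * (N * Ce * (1 + 2 * CS))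
  let C₂ : ℝ := (N + 1) / (c / 2) ^ d / w
  have hC₁ : 0 ≤ C₁ := by positivity
  have hC₂ : 0 < C₂ := by positivity
  refine ⟨r, max C₁ C₂, hr, lt_max_of_lt_right hC₂, fun ε hε hεr => ?_⟩
  obtain ⟨Z, hZΩ, hsep, hcov⟩ := exists_separated_net hΩ.isBounded hε
  let η : Euc d → Euc d → ℝ := fun z x => e (ε⁻¹ • (x - z))
  have hscale : ∀ z x : Euc d, ‖ε⁻¹ • (x - z)‖ = dist x z / ε := fun z x => by
    rw [norm_smul, norm_inv, Real.norm_of_nonneg hε.le, dist_eq_norm]; ring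
  have hη : ∀ z, ContDiff ℝ ∞ (η z) := fun z =>
    he.comp ((contDiff_id.sub contDiff_const).const_smul ε⁻¹)
  have hη0 : ∀ z x, 0 ≤ η z x := fun z x => he0 _
  have hη1 : ∀ z x, η z x ≤ 1 := fun z x => he1 _
  have hηone : ∀ z x, dist x z ≤ ε → η z x = 1 := fun z x h => heone _ (by
    rw [hscale, div_le_one hε]; exact h)
  have hηzero : ∀ z x, 2 * ε ≤ dist x z → η z x = 0 := fun z x h => hezero _ (by
    rw [hscale, le_div_iff₀ hε]; exact h)
  have hηfd : ∀ z x, fderiv ℝ (η z) x = ε⁻¹ • fderiv ℝ e (ε⁻¹ • (x - z)) := by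
    intro z x
    have h1 : fderiv ℝ (η z) x = fderiv ℝ (fun y => e (ε⁻¹ • y)) (x - z) :=
      fderiv_comp_sub (f := fun y => e (ε⁻¹ • y)) z
    rw [h1]
    exact fderiv_comp_smul ε⁻¹
  have hηfdle : ∀ z x, ‖fderiv ℝ (η z) x‖ ≤ Ce / ε := by
    intro z x
    rw [hηfd, norm_smul, norm_inv, Real.norm_of_nonneg hε.le, div_eq_inv_mul]
    gcongr
    exact hefd _
  have hηfd0 : ∀ z x, 2 * ε ≤ dist x z → fderiv ℝ (η z) x = 0 := by
    intro z x h
    rw [hηfd, hefd0 _ (by rw [hscale, le_div_iff₀ hε]; exact h), smul_zero]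
  have hcount : ∀ x (f : Euc d → ℝ) (M : ℝ), 0 ≤ M → (∀ z, 2 * ε ≤ dist x z → f z = 0) →
      (∀ z, f z ≤ M) → ∑ z ∈ Z, f z ≤ N * M := by
    intro x f M hM hf0 hfM
    calc ∑ z ∈ Z, f z = ∑ z ∈ Z.filter fun z => dist z x < 2 * ε, f z := by
          rw [Finset.sum_filter_of_ne]
          intro z _ hz
          by_contra h
          rw [dist_comm] at h
          exact hz (hf0 z (not_lt.1 h))
      _ ≤ (Z.filter fun z => dist z x < 2 * ε).card • M := Finset.sum_le_card_nsmul _ _ _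
          fun z _ => hfM z
      _ ≤ N * M := by
          rw [nsmul_eq_mul]
          exact mul_le_mul_of_nonneg_right (card_filter_dist_le hε (by norm_num) hsep x) hM
  let Sg : Euc d → ℝ := fun x => ∑ z ∈ Z, η z x
  have hSg : ContDiff ℝ ∞ Sg := ContDiff.sum fun z _ => hη z
  have hSg0 : ∀ x, 0 ≤ Sg x := fun x => Finset.sum_nonneg fun z _ => hη0 z x
  have hSgN : ∀ x, Sg x ≤ N := fun x => by
    simpa using hcount x (fun z => η z x) 1 zero_le_one (fun z h => hηzero z x h) fun z => hη1 z x
  have hSg1 : ∀ x ∈ Ω, 1 ≤ Sg x := by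
    intro x hx
    obtain ⟨z, hz, hxz⟩ := hcov x hx
    rw [← hηone z x hxz.le]
    exact Finset.single_le_sum (f := fun z => η z x) (fun z _ => hη0 z x) hz
  have hSgfd : ∀ x, ‖fderiv ℝ Sg x‖ ≤ N * (Ce / ε) := by
    intro x
    have h1 : fderiv ℝ Sg x = ∑ z ∈ Z, fderiv ℝ (η z) x :=
      fderiv_fun_sum fun z _ => ((hη z).differentiable (by simp)).differentiableAt
    rw [h1]
    refine (norm_sum_le _ _).trans (hcount x (fun z => ‖fderiv ℝ (η z) x‖) _ (by positivity)
      (fun z h => by rw [hηfd0 z x h, norm_zero]) fun z => hηfdle z x)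
  -- The sum `Sg` may vanish outside `Ω`. This smooth substitute equals `Sg` where `Sg ≥ 1`, in
  -- particular on `Ω`, and is at least `1 / 2` everywhere.
  let q : Euc d → ℝ := fun x => Sg x + 1 - Real.smoothTransition (2 * Sg x - 1)
  have hq : ContDiff ℝ ∞ q := (hSg.add contDiff_const).sub
    (Real.smoothTransition.contDiff.comp ((contDiff_const.mul hSg).sub contDiff_const))
  have hqhalf : ∀ x, 1 / 2 ≤ q x := by
    intro x
    simp only [q]
    rcases le_or_gt (Sg x) (1 / 2) with h | h
    · rw [Real.smoothTransition.zero_of_nonpos (by linarith)]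
      linarith [hSg0 x]
    · linarith [Real.smoothTransition.le_one (2 * Sg x - 1)]
  have hqle : ∀ x, q x ≤ N + 1 := fun x => by
    simp only [q]; linarith [Real.smoothTransition.nonneg (2 * Sg x - 1), hSgN x]
  have hqeq : ∀ x ∈ Ω, q x = Sg x := fun x hx => by
    simp only [q]
    rw [Real.smoothTransition.one_of_one_le (by linarith [hSg1 x hx])]; ring
  have hqne : ∀ x, q x ≠ 0 := fun x => (lt_of_lt_of_le (by norm_num) (hqhalf x)).ne'
  have hqfd : ∀ x, ‖fderiv ℝ q x‖ ≤ N * (Ce / ε) * (1 + 2 * CS) := by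
    intro x
    have h1 : HasFDerivAt Sg (fderiv ℝ Sg x) x :=
      ((hSg.differentiable (by simp)) x).hasFDerivAt
    have h2 : HasFDerivAt (fun x => 2 * Sg x - 1) ((2 : ℝ) • fderiv ℝ Sg x) x :=
      (h1.const_mul 2).sub_const 1
    have h3 : HasFDerivAt Real.smoothTransition (fderiv ℝ Real.smoothTransition (2 * Sg x - 1))
        (2 * Sg x - 1) :=
      (ContDiff.differentiable (n := 1) Real.smoothTransition.contDiff (by simp) _).hasFDerivAt
    have h4 := ((h1.add_const 1).sub (h3.comp x h2)).fderiv
    have h5 : fderiv ℝ q x = fderiv ℝ Sg x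
        - (fderiv ℝ Real.smoothTransition (2 * Sg x - 1)).comp ((2 : ℝ) • fderiv ℝ Sg x) := h4
    rw [h5]
    calc _ ≤ ‖fderiv ℝ Sg x‖ + ‖fderiv ℝ Real.smoothTransition (2 * Sg x - 1)‖
          * ‖(2 : ℝ) • fderiv ℝ Sg x‖ :=
          (norm_sub_le _ _).trans (by gcongr; exact ContinuousLinearMap.opNorm_comp_le _ _)
      _ ≤ ‖fderiv ℝ Sg x‖ + CS * (2 * ‖fderiv ℝ Sg x‖) := by
          rw [norm_smul, Real.norm_ofNat]
          gcongr
          exact hS _ ⟨by linarith [hSg0 x], by linarith [hSgN x]⟩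
      _ = ‖fderiv ℝ Sg x‖ * (1 + 2 * CS) := by ring
      _ ≤ _ := by gcongr; exact hSgfd x
  refine ⟨Z, fun z x => η z x / q x, hZΩ, hsep, fun z => (hη z).div hq hqne,
    fun z x => div_nonneg (hη0 z x) (by linarith [hqhalf x]), fun x hx => ?_,
    fun z x h => by rw [hηzero z x h, zero_div], fun z x => ?_, fun z hz => ?_⟩
  · rw [← Finset.sum_div, hqeq x hx, div_self]
    linarith [hSg1 x hx]
  · have hη' : HasFDerivAt (η z) (fderiv ℝ (η z) x) x :=
      (((hη z).differentiable (by simp)) x).hasFDerivAt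
    have hq' : HasFDerivAt q (fderiv ℝ q x) x := ((hq.differentiable (by simp)) x).hasFDerivAt
    have hqinv : HasFDerivAt (fun x => (q x)⁻¹) (-(q x ^ 2)⁻¹ • fderiv ℝ q x) x :=
      (hasDerivAt_inv (hqne x)).comp_hasFDerivAt x hq'
    have h1 : fderiv ℝ (fun x => η z x / q x) x
        = η z x • (-(q x ^ 2)⁻¹ • fderiv ℝ q x) + (q x)⁻¹ • fderiv ℝ (η z) x := by
      simp_rw [div_eq_mul_inv]
      exact (hη'.mul hqinv).fderiv
    have hq2 : (q x)⁻¹ ≤ 2 := by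
      rw [inv_le_comm₀ (by linarith [hqhalf x]) two_pos]; linarith [hqhalf x]
    have hq0 : 0 ≤ (q x)⁻¹ := inv_nonneg.2 (by linarith [hqhalf x])
    have hq4 : (q x ^ 2)⁻¹ ≤ 4 := by
      rw [← inv_pow]; nlinarith
    rw [h1]
    calc _ ≤ 1 * (4 * (N * (Ce / ε) * (1 + 2 * CS))) + 2 * (Ce / ε) := by
          refine (norm_add_le _ _).trans ?_
          rw [norm_smul, norm_smul, norm_smul, norm_neg, Real.norm_of_nonneg (hη0 z x),
            Real.norm_of_nonneg hq0, Real.norm_of_nonneg (by positivity : 0 ≤ (q x ^ 2)⁻¹)]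
          gcongr
          · exact hη1 z x
          · exact hqfd x
          · exact hηfdle z x
      _ = C₁ / ε := by simp only [C₁]; field_simp; ring
      _ ≤ _ := by gcongr; exact le_max_left _ _
  · obtain ⟨ν, hν, H⟩ := hcone z (hZΩ z hz)
    set B := Metric.ball (z + (ε / 2) • ν) (c * (ε / 2)) with hB
    have hBsub : B ⊆ Ω ∩ Metric.ball z ε := by
      intro x hx
      rw [hB, Metric.mem_ball, dist_eq_norm] at hx
      refine ⟨?_, ?_⟩
      · have := H z (hZΩ z hz) (by rw [dist_self]; exact hr) (ε / 2)
          ⟨by positivity, by linarith⟩ (x - (z + (ε / 2) • ν)) hx.le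
        rwa [add_sub_cancel] at this
      · rw [Metric.mem_ball, dist_eq_norm]
        have h1 : x - z = (x - (z + (ε / 2) • ν)) + (ε / 2) • ν := by abel
        have h2 : ‖(ε / 2) • ν‖ = ε / 2 := by
          rw [norm_smul, hν, mul_one, Real.norm_of_nonneg (by positivity)]
        rw [h1]
        refine (norm_add_le _ _).trans_lt ?_
        rw [h2]
        nlinarith
    have hcont : Continuous fun x => η z x / q x := (hη z).continuous.div hq.continuous hqne
    have hcs : HasCompactSupport fun x => η z x / q x := by
      refine HasCompactSupport.of_support_subset_isCompact (isCompact_closedBall z (2 * ε)) ?_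
      intro x hx
      by_contra h
      rw [Metric.mem_closedBall, not_le] at h
      exact hx (by simp only; rw [hηzero z x h.le, zero_div])
    have hint : Integrable fun x => η z x / q x := hcont.integrable_of_hasCompactSupport hcs
    have hBm : MeasurableSet B := Metric.isOpen_ball.measurableSet
    have h1 : (volume B).toReal * (1 / (N + 1)) ≤ ∫ x in Ω, η z x / q x := by
      calc (volume B).toReal * (1 / (N + 1)) = ∫ _ in B, 1 / (N + 1) := by
            rw [setIntegral_const, smul_eq_mul]; rfl
        _ ≤ ∫ x in B, η z x / q x := by
            refine setIntegral_mono_on ?_ hint.integrableOn hBm fun x hx => ?_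
            · exact integrableOn_const measure_ball_lt_top.ne
            · rw [hηone z x (Metric.mem_ball.1 (hBsub hx).2).le]
              exact one_div_le_one_div_of_le (by linarith [hqhalf x]) (hqle x)
        _ ≤ ∫ x in Ω, η z x / q x := by
            refine setIntegral_mono_set hint.integrableOn (Eventually.of_forall fun x => ?_)
              (Eventually.of_forall fun x hx => (hBsub hx).1)
            exact div_nonneg (hη0 z x) (by linarith [hqhalf x])
    have h2 : (volume B).toReal = (c * (ε / 2)) ^ d * w := by
      rw [hB, volume_ball_eq _ (by positivity), ENNReal.toReal_mul,
        ENNReal.toReal_ofReal (by positivity)]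
    rw [h2] at h1
    have h3 : 0 ≤ ∫ x in Ω, η z x / q x := le_trans (by positivity) h1
    calc ε ^ d = C₂ * ((c * (ε / 2)) ^ d * w * (1 / (N + 1))) := by
          simp only [C₂]
          rw [show c * (ε / 2) = c / 2 * ε by ring, mul_pow]
          field_simp
      _ ≤ C₂ * ∫ x in Ω, η z x / q x := by gcongr
      _ ≤ _ := by gcongr; exact le_max_right _ _

end Partition


/-! ### Weighted means on probability spaces -/

section Weighted

variable {S X : Type*} [MeasurableSpace S] [NormedAddCommGroup X] {P : Measure S}

theorem integrable_and_integral_le_sqrt [IsProbabilityMeasure P] {G : S → X}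
    (hG : AEStronglyMeasurable G P) {M : ℝ} (hM : 0 ≤ M)
    (h : ∫⁻ x, ‖G x‖ₑ ^ 2 ∂P ≤ ENNReal.ofReal M) :
    Integrable (fun x => ‖G x‖) P ∧ ∫ x, ‖G x‖ ∂P ≤ √M := by
  have h2 : eLpNorm G 2 P ≤ ENNReal.ofReal (√M) := by
    rw [eLpNorm_eq_lintegral_rpow_enorm_toReal (by simp) (by simp)]
    simp only [ENNReal.toReal_ofNat, ENNReal.rpow_ofNat]
    rw [Real.sqrt_eq_rpow, ← ENNReal.ofReal_rpow_of_nonneg hM (by positivity)]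
    gcongr
  have h1 : ∫⁻ x, ‖G x‖ₑ ∂P ≤ ENNReal.ofReal (√M) := by
    rw [← eLpNorm_one_eq_lintegral_enorm]
    exact (eLpNorm_le_eLpNorm_of_exponent_le (by norm_num) hG).trans h2
  refine ⟨Integrable.norm ⟨hG, h1.trans_lt ENNReal.ofReal_lt_top⟩, ?_⟩
  rw [integral_norm_eq_lintegral_enorm hG]
  exact ENNReal.toReal_le_of_le_ofReal (Real.sqrt_nonneg _) h1

/-- Some `y` has a mean square deviation not above the average over `y`; the `L¹` bound is then
Jensen's inequality. The centre is a value of `G`, so no mean of `G` has to exist beforehand. -/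
theorem exists_center [IsProbabilityMeasure P] {G : S → X} (hG : StronglyMeasurable G) {M : ℝ}
    (hM : 0 ≤ M) (h : ∫⁻ x, ∫⁻ y, ‖G x - G y‖ₑ ^ 2 ∂P ∂P ≤ ENNReal.ofReal M) :
    ∃ y, Integrable (fun x => ‖G x - G y‖) P ∧ ∫ x, ‖G x - G y‖ ∂P ≤ √M := by
  have hm : Measurable fun p : S × S => ‖G p.1 - G p.2‖ₑ ^ 2 :=
    ((hG.comp_measurable measurable_fst).sub (hG.comp_measurable measurable_snd)).enorm.pow_const 2
  obtain ⟨y, hy⟩ := exists_le_lintegral (μ := P) (f := fun x => ∫⁻ y, ‖G x - G y‖ₑ ^ 2 ∂P)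
    hm.lintegral_prod_right'.aemeasurable
  refine ⟨y, integrable_and_integral_le_sqrt (hG.sub stronglyMeasurable_const).aestronglyMeasurable
    hM ?_⟩
  exact (lintegral_congr fun x => by rw [enorm_sub_rev]; rfl).trans_le (hy.trans h)

variable [NormedSpace ℝ X]

/-- Weights of mean one that are bounded by `Θ`. -/
structure IsWeight (P : Measure S) (Θ : ℝ) (p : S → ℝ) : Prop where
  measurable : Measurable p
  nonneg : ∀ x, 0 ≤ p x
  le : ∀ x, p x ≤ Θ
  integral : ∫ x, p x ∂P = 1

variable {Θ : ℝ} {p q : S → ℝ}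

theorem IsWeight.integrable_smul (hp : IsWeight P Θ p) {G : S → X} (hG : Integrable G P) :
    Integrable (fun x => p x • G x) P :=
  hG.bdd_smul Θ hp.measurable.aestronglyMeasurable (Eventually.of_forall fun x => by
    rw [Real.norm_of_nonneg (hp.nonneg x)]; exact hp.le x)

theorem IsWeight.integrable [IsProbabilityMeasure P] (hp : IsWeight P Θ p) : Integrable p P := by
  simpa using hp.integrable_smul (integrable_const (1 : ℝ))

theorem IsWeight.norm_sub_le [CompleteSpace X] [IsProbabilityMeasure P] (hp : IsWeight P Θ p)
    {G : S → X} (hG : Integrable G P) {c : X} {h : S → ℝ} (hh : Integrable h P)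
    (hGh : ∀ᵐ x ∂P, ‖G x - c‖ ≤ h x) :
    ‖(∫ x, p x • G x ∂P) - c‖ ≤ ∫ x, p x * h x ∂P := by
  have h1 : (∫ x, p x • G x ∂P) - c = ∫ x, p x • (G x - c) ∂P := by
    simp_rw [smul_sub]
    rw [integral_sub (hp.integrable_smul hG) (hp.integrable_smul (integrable_const c)),
      integral_smul_const, hp.integral, one_smul]
  rw [h1]
  refine norm_integral_le_of_norm_le (hp.integrable_smul hh) ?_
  filter_upwards [hGh] with x hx
  rw [norm_smul, Real.norm_of_nonneg (hp.nonneg x)]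
  exact mul_le_mul_of_nonneg_left hx (hp.nonneg x)

theorem IsWeight.integral_mul_le (hp : IsWeight P Θ p) {h : S → ℝ} (hh : Integrable h P)
    (hh0 : ∀ᵐ x ∂P, 0 ≤ h x) : ∫ x, p x * h x ∂P ≤ Θ * ∫ x, h x ∂P := by
  rw [← integral_const_mul]
  refine integral_mono_ae (hp.integrable_smul hh) (hh.const_mul Θ) ?_
  filter_upwards [hh0] with x hx
  exact mul_le_mul_of_nonneg_right (hp.le x) hx

theorem IsWeight.norm_integral_sub_le [CompleteSpace X] [IsProbabilityMeasure P]
    (hp : IsWeight P Θ p) (hq : IsWeight P Θ q) {G : S → X} (hG : Integrable G P) {c : X}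
    {h : S → ℝ} (hh : Integrable h P) (hGh : ∀ᵐ x ∂P, ‖G x - c‖ ≤ h x) :
    ‖(∫ x, p x • G x ∂P) - ∫ x, q x • G x ∂P‖ ≤ 2 * Θ * ∫ x, h x ∂P := by
  have h0 : ∀ᵐ x ∂P, 0 ≤ h x := by filter_upwards [hGh] with x hx using (norm_nonneg _).trans hx
  have h1 := (hp.norm_sub_le hG hh hGh).trans (hp.integral_mul_le hh h0)
  have h2 := (hq.norm_sub_le hG hh hGh).trans (hq.integral_mul_le hh h0)
  have h3 := norm_sub_le_norm_sub_add_norm_sub (∫ x, p x • G x ∂P) c (∫ x, q x • G x ∂P)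
  rw [norm_sub_rev c] at h3
  linarith

end Weighted

/-! ### Functions of the state controlled by the dissipation -/

section Admissible

variable {X ι : Type*} [NormedAddCommGroup X] [InnerProductSpace ℝ X] [FiniteDimensional ℝ X]
  [Fintype ι] {d : ℕ}

/-- The conditions satisfied by the value `ζ` and the gradient `Y` of `T u` at a point where the
dissipation is `D`. -/
structure IsAdm (v : ι → X) (ζ : X) (Y : Fin d → X) (D : ℝ) : Prop where
  cone : ∃ s : ι → ℝ, (∀ i, 0 ≤ s i) ∧ ∑ i, s i • v i = ζ
  sum_le : ∑ k, ‖Y k‖ ^ 2 ≤ D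
  proj_le : ∀ (F : Submodule ℝ X) (c : ℝ), 0 ≤ c →
    (∀ s : ι → ℝ, (∀ i, 0 ≤ s i) → ∑ i, s i • v i = ζ →
      ∀ y, c * ‖F.starProjection y‖ ^ 2 ≤ ∑ i, s i * inner ℝ (v i) y ^ 2) →
    c * ∑ k, ‖F.starProjection (Y k)‖ ^ 2 ≤ D

theorem IsAdm.nonneg {v : ι → X} {ζ : X} {Y : Fin d → X} {D : ℝ} (h : IsAdm v ζ Y D) : 0 ≤ D :=
  le_trans (by positivity) h.sum_le

/-- The derivative of `f` along admissible gradients is controlled by the dissipation. -/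
def DissipationBound (d : ℕ) (v : ι → X) (f : X → X) (c : ℝ) : Prop :=
  ∀ (ζ : X) (Y : Fin d → X) (D : ℝ), IsAdm v ζ Y D → ∑ k, ‖fderiv ℝ f ζ (Y k)‖ ^ 2 ≤ c * D

/-- The mobility bound on the core flat holds for every nonnegative representation of `ζ`, which is
what `proj_le` asks of its constant. -/
theorem IsAdm.core_le {v : ι → X} {α c : ℝ} (hc : 0 < c)
    (H : ∀ (z₀ : X) (s : ι → ℝ), z₀ ≠ 0 → (∀ i, 0 ≤ s i) →
      ‖∑ i, s i • v i - z₀‖ ≤ α * ‖z₀‖ → ∀ y : X,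
        c * ‖z₀‖ * ‖(coreFlat (spanFlat v) (2 * α) z₀).starProjection y‖ ^ 2
          ≤ ∑ i, s i * inner ℝ (v i) y ^ 2) {ζ z₀ : X} {Y : Fin d → X} {D : ℝ}
    (h : IsAdm v ζ Y D) (hz₀ : z₀ ≠ 0) (hζ : ‖ζ - z₀‖ ≤ α * ‖z₀‖) :
    ∑ k, ‖(coreFlat (spanFlat v) (2 * α) z₀).starProjection (Y k)‖ ^ 2 ≤ D / (c * ‖z₀‖) := by
  rw [le_div_iff₀' (mul_pos hc (norm_pos_iff.2 hz₀))]
  refine h.proj_le _ _ (by positivity) fun s hs hsζ y => ?_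
  refine H z₀ s hz₀ hs ?_ y
  rw [hsζ]
  exact hζ

/-- The derivative of the cut-off retraction sees only the core part of the gradient and vanishes
for `‖ζ‖ < lam / 2`; elsewhere the squared core part is at most a multiple of `D / ‖ζ‖`. Hence the
gain `1 / lam`. -/
theorem exists_cutoff_dissipationBound (v : ι → X) {κ : ℝ} (hκ : 0 < κ) (hκ2 : κ ≤ 1 / 2) :
    ∃ C : ℝ, 0 ≤ C ∧ ∀ lam : ℝ, 0 < lam → ∃ H : X → X, ContDiff ℝ ∞ H ∧
      (∀ z, ‖H z - z‖ ≤ κ * ‖z‖ + 2 * lam) ∧ DissipationBound d v H (C / lam) := by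
  classical
  obtain ⟨α, ρ, hρ⟩ := exists_retraction (spanFlat v)
    (fun S S' => spanFlat_inf v S S') (exists_spanFlat_eq_top v) hκ
  obtain ⟨c, hc, hcore⟩ := exists_lower_bound_coreFlat v hρ.pos
  obtain ⟨C, hC, hcut⟩ := hρ.exists_cutoff hκ2
  refine ⟨C ^ 2 * (2 / c), by positivity, fun lam hlam => ?_⟩
  obtain ⟨H, hH, hHz, hHd, hH0⟩ := hcut lam hlam
  refine ⟨H, hH, hHz, fun ζ Y D hA => ?_⟩
  rcases lt_or_ge ‖ζ‖ (lam / 2) with h | h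
  · rw [hH0 ζ h]
    simp only [zero_apply, norm_zero]
    have := hA.nonneg
    simp only [ne_eq, OfNat.ofNat_ne_zero, not_false_eq_true, zero_pow, Finset.sum_const_zero]
    positivity
  · have hζ : 0 < ‖ζ‖ := by linarith
    have h1 := hA.core_le hc hcore (norm_pos_iff.1 hζ) (by
      rw [sub_self, norm_zero]; have := hρ.pos; positivity)
    calc ∑ k, ‖fderiv ℝ H ζ (Y k)‖ ^ 2
        ≤ ∑ k, C ^ 2 * ‖(coreFlat (spanFlat v) (2 * α) ζ).starProjection (Y k)‖ ^ 2 :=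
          Finset.sum_le_sum fun k _ => by
            rw [← mul_pow]
            gcongr
            exact hHd ζ (Y k)
      _ ≤ C ^ 2 * (D / (c * ‖ζ‖)) := by rw [← Finset.mul_sum]; gcongr
      _ ≤ C ^ 2 * (D / (c * (lam / 2))) := by
          have := hA.nonneg
          gcongr
      _ = _ := by field_simp

theorem dissipationBound_id (v : ι → X) : DissipationBound d v (fun z => z) 1 := by
  intro ζ Y D h
  simpa using h.sum_le

/-- Localization of the projection onto `F` to the region where `H` is close to `c`. -/
theorem exists_localized_projection : ∃ C : ℝ, 0 ≤ C ∧ ∀ (H : X → X) (c z₀ : X) (q : ℝ)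
    (F : Submodule ℝ X), ContDiff ℝ ∞ H → 0 < q →
    (∀ z, ‖z - z₀‖ ≤ 2 * ‖H z - c‖ + q) →
    ∃ f : X → X, ContDiff ℝ ∞ f ∧
      (∀ z, ‖F.starProjection (z - z₀) - f z‖ ≤ 3 * ‖H z - c‖) ∧
      ∀ z, (fderiv ℝ f z = 0 ∨ ‖z - z₀‖ ≤ 4 * q) ∧
        ∀ y, ‖fderiv ℝ f z y‖ ≤ ‖F.starProjection y‖ + C * ‖fderiv ℝ H z y‖ := by
  obtain ⟨CS, hCS, hS⟩ := exists_smoothTransition_deriv_le 2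
  refine ⟨12 * CS, by positivity, fun H c z₀ q F hH hq hclose => ?_⟩
  -- The cutoff is a function of `H z` and not of `z`, so that differentiating it produces only
  -- `fderiv ℝ H`, which the dissipation controls. It is `1` for `‖H z - c‖ ≤ q` and `0` beyond `3 /
  -- 2 * q`.
  let u : X → ℝ := fun z => 2 - (q ^ 2)⁻¹ * ‖H z - c‖ ^ 2
  let f : X → X := fun z => Real.smoothTransition (u z) • F.starProjection (z - z₀)
  have hu : ContDiff ℝ ∞ u :=
    contDiff_const.sub (contDiff_const.mul ((hH.sub contDiff_const).norm_sq ℝ))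
  have hf : ContDiff ℝ ∞ f := (Real.smoothTransition.contDiff.comp hu).smul
    (F.starProjection.contDiff.comp (contDiff_id.sub contDiff_const))
  have hproj : ∀ y, ‖F.starProjection y‖ ≤ ‖y‖ := Submodule.norm_starProjection_apply_le F
  have hfar : ∀ z, (3 / 2 * q) < ‖H z - c‖ → fderiv ℝ f z = 0 := by
    intro z hz
    have h1 : f =ᶠ[𝓝 z] fun _ => 0 := by
      have hc : Continuous fun z => ‖H z - c‖ := (hH.continuous.sub continuous_const).norm
      filter_upwards [hc.continuousAt.eventually_const_lt hz] with x hx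
      simp only [f, u]
      rw [Real.smoothTransition.zero_of_nonpos, zero_smul]
      rw [sub_nonpos, inv_mul_eq_div, le_div_iff₀ (by positivity)]
      nlinarith
    rw [h1.fderiv_eq]; simp
  refine ⟨f, hf, fun z => ?_, fun z => ?_⟩
  · have h1 : F.starProjection (z - z₀) - f z
        = (1 - Real.smoothTransition (u z)) • F.starProjection (z - z₀) := by
      rw [sub_smul, one_smul]
    rcases le_or_gt ‖H z - c‖ q with h | h
    · rw [h1, Real.smoothTransition.one_of_one_le, sub_self, zero_smul, norm_zero]
      · positivity
      · simp only [u]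
        rw [le_sub_comm, inv_mul_eq_div, div_le_iff₀ (by positivity)]
        nlinarith [norm_nonneg (H z - c)]
    · have h2 := Real.smoothTransition.nonneg (u z)
      have h3 := Real.smoothTransition.le_one (u z)
      rw [h1, norm_smul, Real.norm_of_nonneg (by linarith)]
      have h4 := (hproj (z - z₀)).trans (hclose z)
      nlinarith [norm_nonneg (F.starProjection (z - z₀))]
  rcases lt_or_ge (3 / 2 * q) ‖H z - c‖ with h | h
  · rw [hfar z h]
    refine ⟨Or.inl rfl, fun y => ?_⟩
    rw [zero_apply, norm_zero]
    positivity
  have hz4 : ‖z - z₀‖ ≤ 4 * q := by linarith [hclose z]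
  refine ⟨Or.inr hz4, fun y => ?_⟩
  have hHd : HasFDerivAt H (fderiv ℝ H z) z := ((hH.differentiable (by simp)) z).hasFDerivAt
  have hud := ((hHd.sub_const c).norm_sq.const_mul (q ^ 2)⁻¹).const_sub 2
  by_cases hneg : u z < -2
  · exfalso
    simp only [u, inv_mul_eq_div] at hneg
    have : ‖H z - c‖ ^ 2 / q ^ 2 ≤ 4 := by
      rw [div_le_iff₀ (by positivity)]; nlinarith [norm_nonneg (H z - c)]
    linarith
  have hu2 : u z ≤ 2 := by
    simp only [u]
    have : 0 ≤ (q ^ 2)⁻¹ * ‖H z - c‖ ^ 2 := by positivity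
    linarith
  have hSd : HasFDerivAt Real.smoothTransition (fderiv ℝ Real.smoothTransition (u z)) (u z) :=
    (ContDiff.differentiable (n := 1) Real.smoothTransition.contDiff (by simp) _).hasFDerivAt
  have hP : HasFDerivAt (fun z => F.starProjection (z - z₀)) F.starProjection z :=
    F.starProjection.hasFDerivAt.comp z ((hasFDerivAt_id z).sub_const z₀)
  have hfd := ((hSd.comp z hud).smul hP).fderiv
  have e1 : fderiv ℝ f z y = Real.smoothTransition (u z) • F.starProjection y
      + (fderiv ℝ Real.smoothTransition (u z)
          (-((q ^ 2)⁻¹ * (2 * inner ℝ (H z - c) (fderiv ℝ H z y)))))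
            • F.starProjection (z - z₀) := by
    have h2 : fderiv ℝ f z y = _ := DFunLike.congr_fun hfd y
    rw [h2]
    simp [u, inner_sub_left, mul_sub, sub_mul]
    ring_nf
  rw [e1]
  refine (norm_add_le _ _).trans ?_
  rw [norm_smul, norm_smul]
  have h2 := Real.smoothTransition.nonneg (u z)
  have h3 := Real.smoothTransition.le_one (u z)
  rw [Real.norm_of_nonneg h2]
  have h4 : ‖fderiv ℝ Real.smoothTransition (u z)
      (-((q ^ 2)⁻¹ * (2 * inner ℝ (H z - c) (fderiv ℝ H z y))))‖
      ≤ CS * ((q ^ 2)⁻¹ * (2 * (3 / 2 * q * ‖fderiv ℝ H z y‖))) := by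
    refine (ContinuousLinearMap.le_of_opNorm_le _ (hS _ ⟨not_lt.1 hneg, hu2⟩) _).trans ?_
    rw [norm_neg, norm_mul, norm_mul, Real.norm_of_nonneg (by positivity : 0 ≤ (q ^ 2)⁻¹),
      Real.norm_ofNat]
    have := norm_inner_le_norm (𝕜 := ℝ) (H z - c) (fderiv ℝ H z y)
    gcongr
    exact this.trans (by gcongr)
  calc _ ≤ 1 * ‖F.starProjection y‖
        + CS * ((q ^ 2)⁻¹ * (2 * (3 / 2 * q * ‖fderiv ℝ H z y‖))) * (4 * q) := by
        gcongr
        exact (hproj _).trans hz4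
    _ = _ := by field_simp; ring

end Admissible


/-! ### Oscillation of the gradient of the potential on a cluster -/

section Cluster

variable {X ι : Type*} [NormedAddCommGroup X] [InnerProductSpace ℝ X] [FiniteDimensional ℝ X]
  [Fintype ι] {d : ℕ}

/-- Averages of vectors of the cone do not cancel: as the `vⱼ` have nonnegative inner products, the
functional `⟨∑ vⱼ, ·⟩` is bounded below by a multiple of the norm on the whole cone. -/
theorem exists_norm_integral_ge {v : ι → X} (hv : ∀ i j, 0 ≤ inner ℝ (v i) (v j))
    (hv0 : ∀ i, v i ≠ 0) : ∃ c : ℝ, 0 < c ∧ ∀ {S : Type} [MeasurableSpace S] (P : Measure S)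
      (ζ : S → X), Integrable ζ P → (∀ᵐ x ∂P, ∃ s : ι → ℝ, (∀ i, 0 ≤ s i) ∧ ∑ i, s i • v i = ζ x) →
      c * ∫ x, ‖ζ x‖ ∂P ≤ ‖∫ x, ζ x ∂P‖ := by
  let m : ℝ := (1 + ∑ i, ‖v i‖⁻¹)⁻¹
  have hm : 0 < m := by positivity
  have hmv : ∀ i, m ≤ ‖v i‖ := by
    intro i
    have hi : 0 < ‖v i‖ := norm_pos_iff.2 (hv0 i)
    rw [inv_le_comm₀ (by positivity) hi]
    have := Finset.single_le_sum (f := fun i => ‖v i‖⁻¹) (fun i _ => by positivity)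
      (Finset.mem_univ i)
    linarith
  let e : X := ∑ j, v j
  refine ⟨m / (‖e‖ + 1), by positivity, fun P ζ hζ hcone => ?_⟩
  have hpt : ∀ᵐ x ∂P, m * ‖ζ x‖ ≤ inner ℝ e (ζ x) := by
    filter_upwards [hcone] with x hx
    obtain ⟨s, hs, hsζ⟩ := hx
    rw [← hsζ, inner_sum]
    calc m * ‖∑ i, s i • v i‖ ≤ m * ∑ i, s i * ‖v i‖ := by
          gcongr
          refine (norm_sum_le _ _).trans (le_of_eq (Finset.sum_congr rfl fun i _ => ?_))
          rw [norm_smul, Real.norm_of_nonneg (hs i)]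
      _ ≤ ∑ i, inner ℝ e (s i • v i) := by
          rw [Finset.mul_sum]
          refine Finset.sum_le_sum fun i _ => ?_
          rw [inner_smul_right, sum_inner]
          have h1 := Finset.single_le_sum (f := fun j => inner ℝ (v j) (v i))
            (fun j _ => hv j i) (Finset.mem_univ i)
          rw [real_inner_self_eq_norm_sq] at h1
          have h2 : m * ‖v i‖ ≤ ∑ j, inner ℝ (v j) (v i) := by
            nlinarith [hmv i, norm_nonneg (v i)]
          nlinarith [hs i]
  rw [div_mul_eq_mul_div, div_le_iff₀ (by positivity)]
  calc m * ∫ x, ‖ζ x‖ ∂P = ∫ x, m * ‖ζ x‖ ∂P := (integral_const_mul _ _).symm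
    _ ≤ ∫ x, inner ℝ e (ζ x) ∂P := integral_mono_ae (hζ.norm.const_mul m) (hζ.const_inner e) hpt
    _ = inner ℝ e (∫ x, ζ x ∂P) := integral_inner hζ e
    _ ≤ ‖e‖ * ‖∫ x, ζ x ∂P‖ := real_inner_le_norm _ _
    _ ≤ _ := by nlinarith [norm_nonneg (∫ x, ζ x ∂P)]

set_option maxHeartbeats 2000000 in
/-- On a cluster, the gradient of the potential oscillates little where the average is large. -/
theorem IsFlatPotential.exists_cluster_bound {v : ι → X} (hv : ∀ i j, 0 ≤ inner ℝ (v i) (v j))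
    (hv0 : ∀ i, v i ≠ 0) {α L K : ℝ} {zb : X} {Ψ : X → ℝ} (hα : 0 < α)
    (hΨ : IsFlatPotential (spanFlat v) α zb L K Ψ) {Θ : ℝ} (hΘ : 0 ≤ Θ) (d : ℕ) :
    ∃ C : ℝ, 0 ≤ C ∧ ∀ {S : Type} [MeasurableSpace S] (P : Measure S) [IsProbabilityMeasure P]
      (ζ : S → X) (W : ℝ), StronglyMeasurable ζ → Integrable ζ P → 0 ≤ W →
      (∀ᵐ x ∂P, ∃ s : ι → ℝ, (∀ i, 0 ≤ s i) ∧ ∑ i, s i • v i = ζ x) →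
      (∀ (f : X → X) (c : ℝ), ContDiff ℝ 1 f → 0 ≤ c → DissipationBound d v f c →
        ∫⁻ x, ∫⁻ y, ‖f (ζ x) - f (ζ y)‖ₑ ^ 2 ∂P ∂P ≤ ENNReal.ofReal (c * W)) →
      ∀ p q : S → ℝ, IsWeight P Θ p → IsWeight P Θ q →
        ‖fderiv ℝ Ψ (∫ x, p x • ζ x ∂P) - fderiv ℝ Ψ (∫ x, q x • ζ x ∂P)‖ ^ 2 * ∫ x, ‖ζ x‖ ∂P
          ≤ C * W := by
  obtain ⟨c₁, hc₁, hcone₁⟩ := exists_norm_integral_ge hv hv0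
  -- The relative accuracy of the cutoff. The factor `128` leaves room for the radius `64 t r` of
  -- the localized projection and for the deviation `18 t r` of the means, measured against `α ‖ζ₀‖`
  -- and `α / 3 * ‖ζ₀‖`.
  set t : ℝ := min (α * c₁) 1 / 128 with ht
  have ht0 : 0 < t := by positivity
  have ht1 : t ≤ 1 / 128 := by rw [ht]; gcongr; exact min_le_right _ _
  have htα : 128 * t ≤ α * c₁ := by
    have := min_le_left (α * c₁) 1
    rw [ht]; linarith
  obtain ⟨CH, hCH, hcut⟩ := exists_cutoff_dissipationBound (d := d) v ht0 (by linarith)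
  obtain ⟨Cp, hCp, hlocal⟩ := exists_localized_projection (X := X)
  obtain ⟨c₀, hc₀, hcore⟩ := exists_lower_bound_coreFlat v hα
  have hL := hΨ.lip_pos
  have hK := hΨ.level_pos
  -- Ensures `Θ δ ≤ t`, so that an oscillation of size `δ r` stays below `t r` after multiplication
  -- by weights bounded by `Θ`.
  set δ : ℝ := t / (1 + Θ) with hδ
  have hδ0 : 0 < δ := by positivity
  have hδt : δ ≤ t := div_le_self ht0.le (by linarith)
  have hΘδ : Θ * δ ≤ t := by
    rw [hδ, mul_div_assoc', div_le_iff₀ (by positivity), mul_add, mul_comm t Θ]; linarith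
  set Cf : ℝ := 2 / (c₀ * c₁) + 2 * Cp ^ 2 * (CH / t) with hCf
  have hCf0 : 0 ≤ Cf := by positivity
  set A₁ : ℝ := L ^ 2 * (2 * Θ) ^ 2 * (K / c₁) with hA₁
  set A₂ : ℝ := L ^ 2 * (2 * Θ) ^ 2 * (CH / (δ ^ 2 * t)) with hA₂
  set A₃ : ℝ := L ^ 2 * (2 * Θ) ^ 2 * (3 * √(CH / t) + √Cf) ^ 2 with hA₃
  have hA₁0 : 0 ≤ A₁ := by positivity
  have hA₂0 : 0 ≤ A₂ := by positivity
  have hA₃0 : 0 ≤ A₃ := by positivity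
  refine ⟨A₁ + A₂ + A₃, by positivity, ?_⟩
  intro S _ P _ ζ W hζm hζ hW hcone hP p q hp hq
  generalize hr : ∫ x, ‖ζ x‖ ∂P = r
  have hr0 : 0 ≤ r := hr ▸ integral_nonneg fun x => norm_nonneg _
  generalize hza : ∫ x, p x • ζ x ∂P = za
  generalize hzb : ∫ x, q x • ζ x ∂P = zb'
  have hlip := hΨ.lipschitz za zb'
  have hΔ0 : 0 ≤ ‖fderiv ℝ Ψ za - fderiv ℝ Ψ zb'‖ := norm_nonneg _
  generalize hΔ : ‖fderiv ℝ Ψ za - fderiv ℝ Ψ zb'‖ = Δ at hΔ0 hlip ⊢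
  -- For bounded `r` the global Lipschitz bound and `f = id` suffice. If `W` is at least of order
  -- `r³`, the trivial bound `Δ ≤ C r` suffices. Only large `r` with small `W` needs the core
  -- structure.
  rcases le_or_gt r (K / c₁) with hcase | hcase
  · -- small averages
    obtain ⟨y, hy1, hy2⟩ := exists_center hζm (M := 1 * W) (by linarith)
      (hP (fun z => z) 1 contDiff_id zero_le_one (dissipationBound_id v))
    have h1 := hp.norm_integral_sub_le hq hζ hy1 (Eventually.of_forall fun x => le_rfl)
    rw [one_mul] at hy2
    rw [hza, hzb] at h1
    have h2 : Δ ≤ L * (2 * Θ * √W) := hlip.trans (by gcongr; exact h1.trans (by gcongr))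
    calc Δ ^ 2 * r ≤ (L * (2 * Θ * √W)) ^ 2 * (K / c₁) := by gcongr
      _ = A₁ * W := by rw [hA₁, mul_pow, mul_pow, Real.sq_sqrt hW]; ring
      _ ≤ _ := mul_le_mul_of_nonneg_right (by linarith) hW
  have hrpos : 0 < r := lt_of_le_of_lt (by positivity) hcase
  rcases lt_or_ge (δ ^ 2 * t * r ^ 3) (CH * W) with hcase2 | hcase2
  · -- large dissipation
    have h1 := hp.norm_integral_sub_le hq hζ (c := 0) hζ.norm
      (Eventually.of_forall fun x => by rw [sub_zero])
    rw [hza, hzb, hr] at h1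
    have h2 : Δ ≤ L * (2 * Θ * r) := hlip.trans (by gcongr)
    have h3 : r ^ 3 ≤ CH / (δ ^ 2 * t) * W := by
      rw [div_mul_eq_mul_div, le_div_iff₀ (by positivity)]; linarith
    calc Δ ^ 2 * r ≤ (L * (2 * Θ * r)) ^ 2 * r := by gcongr
      _ = L ^ 2 * (2 * Θ) ^ 2 * r ^ 3 := by ring
      _ ≤ L ^ 2 * (2 * Θ) ^ 2 * (CH / (δ ^ 2 * t) * W) := by gcongr
      _ = A₂ * W := by rw [hA₂]; ring
      _ ≤ _ := mul_le_mul_of_nonneg_right (by linarith) hW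
  -- the main case
  set ζ₀ := ∫ x, ζ x ∂P with hζ₀
  have hζ₀le : ‖ζ₀‖ ≤ r := hr ▸ norm_integral_le_integral_norm _
  have hζ₀ge : c₁ * r ≤ ‖ζ₀‖ := hr ▸ hcone₁ P ζ hζ hcone
  have hζ₀K : K ≤ ‖ζ₀‖ := by
    rw [div_lt_iff₀ hc₁] at hcase; linarith
  have hζ₀pos : 0 < ‖ζ₀‖ := by linarith
  have hαζ₀ : 128 * t * r ≤ α * ‖ζ₀‖ := by
    calc 128 * t * r ≤ α * c₁ * r := by gcongr
      _ = α * (c₁ * r) := by ring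
      _ ≤ _ := by gcongr
  -- Cutting at a level proportional to `r` gives `H ∘ ζ` mean oscillation `√(CH W / (t r)) ≤ δ r`,
  -- so `ζ` concentrates, relative to `r`, near the centre `c` and hence near its mean `ζ₀`.
  obtain ⟨H, hH, hHz, hHd⟩ := hcut (t * r) (by positivity)
  have hHm : StronglyMeasurable fun x => H (ζ x) := hH.continuous.comp_stronglyMeasurable hζm
  have hone : (1 : WithTop ℕ∞) ≤ ((⊤ : ℕ∞) : WithTop ℕ∞) := by
    exact WithTop.coe_le_coe.2 (le_top : (1 : ℕ∞) ≤ ⊤)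
  obtain ⟨y₁, hy1, hy2⟩ := exists_center hHm (M := CH / (t * r) * W) (by positivity)
    (hP H _ (hH.of_le hone) (by positivity) hHd)
  set c := H (ζ y₁) with hc
  have hsqrt : √(CH / (t * r) * W) ≤ δ * r := by
    rw [Real.sqrt_le_left (by positivity), div_mul_eq_mul_div, div_le_iff₀ (by positivity)]
    calc CH * W ≤ δ ^ 2 * t * r ^ 3 := hcase2
      _ = _ := by ring
  have hh1 : ∫ x, ‖H (ζ x) - c‖ ∂P ≤ δ * r := hy2.trans hsqrt
  have hw1 : IsWeight P 1 fun _ => (1 : ℝ) := ⟨measurable_const, fun _ => zero_le_one,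
    fun _ => le_rfl, by simp⟩
  have hcζ₀ : ‖ζ₀ - c‖ ≤ 4 * t * r := by
    have hbi₁ : Integrable (fun x => t * ‖ζ x‖ + 2 * (t * r)) P :=
      (hζ.norm.const_mul t).add (integrable_const _)
    have hbi : Integrable (fun x => t * ‖ζ x‖ + 2 * (t * r) + ‖H (ζ x) - c‖) P := hbi₁.add hy1
    have h1 := hw1.norm_sub_le hζ (c := c) hbi (Eventually.of_forall fun x => by
      have := norm_sub_le_norm_sub_add_norm_sub (ζ x) (H (ζ x)) c
      rw [norm_sub_rev (ζ x) (H (ζ x))] at this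
      linarith [hHz (ζ x)])
    simp only [one_smul, one_mul] at h1
    rw [integral_add hbi₁ hy1,
      integral_add (hζ.norm.const_mul t) (integrable_const _), integral_const_mul,
      integral_const] at h1
    simp only [probReal_univ, one_smul] at h1
    have h2 : δ * r ≤ t * r := by gcongr
    rw [hr] at h1
    linarith
  -- The error `t ‖z‖` of the retraction is not bounded a priori; as `t` is small, it is absorbed
  -- into `‖H z - c‖` and a multiple of `t r`.
  have hclose : ∀ z, ‖z - ζ₀‖ ≤ 2 * ‖H z - c‖ + 16 * t * r := by
    intro z
    have h1 := hHz z
    have h2 : ‖z‖ ≤ ‖H z - z‖ + ‖H z - c‖ + ‖ζ₀ - c‖ + ‖ζ₀‖ := by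
      calc ‖z‖ = ‖-(H z - z) + (H z - c) + (-(ζ₀ - c) + ζ₀)‖ := by congr 1; abel
        _ ≤ ‖-(H z - z)‖ + ‖H z - c‖ + ‖-(ζ₀ - c) + ζ₀‖ := norm_add₃_le
        _ ≤ ‖-(H z - z)‖ + ‖H z - c‖ + (‖-(ζ₀ - c)‖ + ‖ζ₀‖) := by gcongr; exact norm_add_le _ _
        _ = _ := by rw [norm_neg, norm_neg]; ring
    have h3 : ‖z - ζ₀‖ ≤ ‖H z - z‖ + ‖H z - c‖ + ‖ζ₀ - c‖ := by
      calc ‖z - ζ₀‖ = ‖-(H z - z) + (H z - c) + -(ζ₀ - c)‖ := by congr 1; abel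
        _ ≤ ‖-(H z - z)‖ + ‖H z - c‖ + ‖-(ζ₀ - c)‖ := norm_add₃_le
        _ = _ := by rw [norm_neg, norm_neg]
    have h4 : ‖z‖ ≤ 2 * ‖H z - c‖ + 3 * r := by
      have : t * ‖z‖ ≤ 1 / 128 * ‖z‖ := by gcongr
      have : t * r ≤ 1 / 128 * r := by gcongr
      have := norm_nonneg (H z - c)
      linarith
    have h5 : t * ‖z‖ ≤ 1 / 128 * (2 * ‖H z - c‖) + 3 * (t * r) := by
      calc t * ‖z‖ ≤ t * (2 * ‖H z - c‖ + 3 * r) := by gcongr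
        _ = t * (2 * ‖H z - c‖) + 3 * (t * r) := by ring
        _ ≤ _ := by gcongr
    have h6 : 0 ≤ t * r := by positivity
    have h7 := norm_nonneg (H z - c)
    linarith
  set F := coreFlat (spanFlat v) (2 * α) ζ₀ with hF
  obtain ⟨f, hf, hfrem, hfd⟩ := hlocal H c ζ₀ (16 * t * r) F hH (by positivity) hclose
  -- Where the derivative of `f` is not zero, `z` is within `64 t r ≤ α ‖ζ₀‖` of `ζ₀`, so the core
  -- part of the gradient is controlled with weight `‖ζ₀‖`, which is comparable to `r`.
  have hfD : DissipationBound d v f (Cf / r) := by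
    intro z Y D hA
    have hD := hA.nonneg
    obtain ⟨h0 | h0, hb⟩ := hfd z
    · rw [h0]
      simp only [zero_apply, norm_zero, ne_eq, OfNat.ofNat_ne_zero, not_false_eq_true, zero_pow,
        Finset.sum_const_zero]
      positivity
    · have h1 := hA.core_le hc₀ hcore (norm_pos_iff.1 hζ₀pos) (by
        have : 0 ≤ t * r := by positivity
        linarith)
      have h2 := hHd z Y D hA
      calc ∑ k, ‖fderiv ℝ f z (Y k)‖ ^ 2
          ≤ ∑ k, (2 * ‖F.starProjection (Y k)‖ ^ 2 + 2 * Cp ^ 2 * ‖fderiv ℝ H z (Y k)‖ ^ 2) := by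
            refine Finset.sum_le_sum fun k _ => ?_
            calc _ ≤ (‖F.starProjection (Y k)‖ + Cp * ‖fderiv ℝ H z (Y k)‖) ^ 2 := by
                  gcongr; exact hb _
              _ ≤ _ := by
                  exact add_sq_le.trans_eq (by ring)
        _ = 2 * ∑ k, ‖F.starProjection (Y k)‖ ^ 2
            + 2 * Cp ^ 2 * ∑ k, ‖fderiv ℝ H z (Y k)‖ ^ 2 := by
            rw [Finset.sum_add_distrib, Finset.mul_sum, Finset.mul_sum]
        _ ≤ 2 * (D / (c₀ * (c₁ * r))) + 2 * Cp ^ 2 * (CH / (t * r) * D) := by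
            gcongr
            exact h1.trans (by gcongr)
        _ = Cf / r * D := by rw [hCf]; field_simp
  have hfm : StronglyMeasurable fun x => f (ζ x) := hf.continuous.comp_stronglyMeasurable hζm
  obtain ⟨y₂, hy3, hy4⟩ := exists_center hfm (M := Cf / r * W) (by positivity)
    (hP f _ (hf.of_le hone) (by positivity) hfD)
  have hzclose : ∀ p : S → ℝ, IsWeight P Θ p → ‖(∫ x, p x • ζ x ∂P) - ζ₀‖ < α / 3 * ‖ζ₀‖ := by
    intro p hp
    have hbi : Integrable (fun x => 2 * ‖H (ζ x) - c‖ + 16 * t * r) P :=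
      (hy1.const_mul 2).add (integrable_const _)
    have h1 := hp.norm_sub_le hζ (c := ζ₀) hbi (Eventually.of_forall fun x => hclose _)
    have h2 : ∫ x, p x * (2 * ‖H (ζ x) - c‖ + 16 * t * r) ∂P
        = 2 * (∫ x, p x * ‖H (ζ x) - c‖ ∂P) + 16 * t * r := by
      rw [← integral_const_mul]
      have h3 : (fun x => p x * (2 * ‖H (ζ x) - c‖ + 16 * t * r))
          = fun x => 2 * (p x * ‖H (ζ x) - c‖) + p x * (16 * t * r) := by funext x; ring
      have hi : Integrable (fun x => p x * ‖H (ζ x) - c‖) P := hp.integrable_smul hy1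
      rw [h3, integral_add (hi.const_mul 2) (hp.integrable.mul_const _),
        integral_mul_const, hp.integral, one_mul]
    have h3 := hp.integral_mul_le hy1 (Eventually.of_forall fun x => norm_nonneg _)
    have h4 : Θ * ∫ x, ‖H (ζ x) - c‖ ∂P ≤ t * r := by
      calc _ ≤ Θ * (δ * r) := by gcongr
        _ = Θ * δ * r := by ring
        _ ≤ t * r := by gcongr
    rw [h2] at h1
    have h5 : 0 < t * r := by positivity
    calc _ ≤ 18 * (t * r) := by linarith
      _ < 128 * t * r / 3 := by linarith
      _ ≤ α * ‖ζ₀‖ / 3 := by gcongr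
      _ = _ := by ring
  -- The core component is `f ∘ ζ` up to an error `3 ‖H ζ - c‖`; both oscillate by a multiple of
  -- `√(W / r)`. This factor `1 / r` compensates the weight `r` of the claim.
  have hPdiff : ‖F.starProjection (za - zb')‖ ≤ 2 * Θ * ((3 * √(CH / t) + √Cf) * √(W / r)) := by
    have hsub : Integrable (fun x => ζ x - ζ₀) P := hζ.sub (integrable_const ζ₀)
    have hGi : Integrable (fun x => F.starProjection (ζ x - ζ₀)) P :=
      F.starProjection.integrable_comp hsub
    have e1 : ∀ p : S → ℝ, IsWeight P Θ p → ∫ x, p x • F.starProjection (ζ x - ζ₀) ∂P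
        = F.starProjection (∫ x, p x • ζ x ∂P) - F.starProjection ζ₀ := by
      intro p hp
      simp_rw [← map_smul]
      rw [F.starProjection.integral_comp_comm (hp.integrable_smul hsub),
        ← map_sub]
      congr 1
      simp_rw [smul_sub]
      rw [integral_sub (hp.integrable_smul hζ) (hp.integrable_smul (integrable_const _)),
        integral_smul_const, hp.integral, one_smul]
    have hbi : Integrable (fun x => 3 * ‖H (ζ x) - c‖ + ‖f (ζ x) - f (ζ y₂)‖) P :=
      (hy1.const_mul 3).add hy3
    have h1 := hp.norm_integral_sub_le hq hGi (c := f (ζ y₂)) hbi (Eventually.of_forall fun x => by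
      have := norm_sub_le_norm_sub_add_norm_sub (F.starProjection (ζ x - ζ₀)) (f (ζ x)) (f (ζ y₂))
      linarith [hfrem (ζ x)])
    rw [e1 p hp, e1 q hq, sub_sub_sub_cancel_right, ← map_sub, integral_add (hy1.const_mul 3) hy3,
      integral_const_mul] at h1
    rw [hza, hzb] at h1
    refine h1.trans ?_
    gcongr
    have s1 : √(CH / (t * r) * W) = √(CH / t) * √(W / r) := by
      rw [← Real.sqrt_mul (by positivity)]; congr 1; field_simp
    have s2 : √(Cf / r * W) = √Cf * √(W / r) := by
      rw [← Real.sqrt_mul (by positivity)]; congr 1; field_simp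
    rw [s1] at hy2
    rw [s2] at hy4
    linarith
  have hcoreΨ := hΨ.lipschitz_core ζ₀ za zb' hζ₀K (hza ▸ hzclose p hp) (hzb ▸ hzclose q hq)
  rw [hΔ] at hcoreΨ
  have h2 : Δ ≤ L * (2 * Θ * ((3 * √(CH / t) + √Cf) * √(W / r))) :=
    hcoreΨ.trans (by gcongr)
  calc Δ ^ 2 * r ≤ (L * (2 * Θ * ((3 * √(CH / t) + √Cf) * √(W / r)))) ^ 2 * r := by gcongr
    _ = L ^ 2 * (2 * Θ) ^ 2 * (3 * √(CH / t) + √Cf) ^ 2 * (√(W / r) ^ 2 * r) := by ring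
    _ = A₃ * W := by
        rw [Real.sq_sqrt (by positivity), hA₃, div_mul_cancel₀ _ hrpos.ne']
    _ ≤ _ := mul_le_mul_of_nonneg_right (by linarith) hW

end Cluster


/-! ### Fixed-time estimates: neighbouring means and the flux term -/

section FluxState

variable {X ι : Type*} [NormedAddCommGroup X] [InnerProductSpace ℝ X] [FiniteDimensional ℝ X]
  [Fintype ι] {d : ℕ}

/-- The state `ζ = T u` at one time, with gradient `Y`, dissipation `D` and flux `J`. -/
structure IsFluxState (Ω : Set (Euc d)) (v : ι → X) (K : ℝ) (ζ : Euc d → X)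
    (Y : Fin d → Euc d → X) (D : Euc d → ℝ) (J : Fin d → Euc d → X) : Prop where
  stronglyMeasurable : StronglyMeasurable ζ
  integrable : IntegrableOn ζ Ω
  integrable_dissipation : IntegrableOn D Ω
  adm : ∀ᵐ x ∂(volume.restrict Ω), IsAdm v (ζ x) (fun k => Y k x) (D x)
  transEst : ∀ f : X → X, ContDiff ℝ 1 f → TransEst Ω (fun x => f (ζ x))
    fun x => ∑ k, ‖fderiv ℝ f (ζ x) (Y k x)‖ₑ ^ 2
  flux_aestronglyMeasurable : ∀ k, AEStronglyMeasurable (J k) (volume.restrict Ω)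
  flux_le : ∀ᵐ x ∂(volume.restrict Ω), ∀ k, ‖J k x‖ ^ 2 ≤ K * D x * ‖ζ x‖

/-- The mean of `ζ` over `Ω` with weight `φ`. -/
noncomputable def weightedMean {X : Type*} [NormedAddCommGroup X] [NormedSpace ℝ X]
    (Ω : Set (Euc d)) (φ : Euc d → ℝ) (ζ : Euc d → X) : X :=
  (∫ x in Ω, φ x)⁻¹ • ∫ x in Ω, φ x • ζ x

theorem integral_cond_eq {S E : Type*} [MeasurableSpace S] [NormedAddCommGroup E] [NormedSpace ℝ E]
    (m : Measure S) (A : Set S) (f : S → E) :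
    ∫ x, f x ∂(ProbabilityTheory.cond m A) = (m A).toReal⁻¹ • ∫ x in A, f x ∂m := by
  rw [ProbabilityTheory.cond, integral_smul_measure, ENNReal.toReal_inv]

theorem lintegral_cond_eq {S : Type*} [MeasurableSpace S] (m : Measure S) (A : Set S)
    (f : S → ℝ≥0∞) :
    ∫⁻ x, f x ∂(ProbabilityTheory.cond m A) = (m A)⁻¹ * ∫⁻ x in A, f x ∂m := by
  rw [ProbabilityTheory.cond, lintegral_smul_measure, smul_eq_mul]

theorem IsPartition.mass_pos {Ω : Set (Euc d)} {ε C : ℝ} {Z : Finset (Euc d)}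
    {φ : Euc d → Euc d → ℝ} (hφ : IsPartition Ω ε C Z φ) (hε : 0 < ε) (hC : 0 ≤ C) {z : Euc d}
    (hz : z ∈ Z) : 0 < ∫ x in Ω, φ z x := by
  by_contra! h
  have h1 := hφ.mass z hz
  have h2 : 0 < ε ^ d := by positivity
  nlinarith

theorem IsPartition.le_one {Ω : Set (Euc d)} {ε C : ℝ} {Z : Finset (Euc d)}
    {φ : Euc d → Euc d → ℝ} (hφ : IsPartition Ω ε C Z φ) {z x : Euc d} (hz : z ∈ Z) (hx : x ∈ Ω) :
    φ z x ≤ 1 := by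
  rw [← hφ.sum_eq_one x hx]
  exact Finset.single_le_sum (f := fun z => φ z x) (fun z _ => hφ.nonneg z x) hz

theorem integral_cond_indicator_smul {S E : Type*} [MeasurableSpace S] [NormedAddCommGroup E]
    [NormedSpace ℝ E] {ν : Measure S} {A Ω : Set S} (hA : MeasurableSet A) (hΩ : MeasurableSet Ω)
    (hAΩ : A ⊆ Ω) (hA0 : (ν A).toReal ≠ 0) (φ : S → ℝ) (hφ : ∀ x ∈ Ω \ A, φ x = 0) (m : ℝ)
    (ζ : S → E) :
    ∫ x, A.indicator (fun x => (ν A).toReal / m * φ x) x • ζ x ∂(ProbabilityTheory.cond ν A)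
      = m⁻¹ • ∫ x in Ω, φ x • ζ x ∂ν := by
  rw [integral_cond_eq]
  have h1 : ∫ x in A, A.indicator (fun x => (ν A).toReal / m * φ x) x • ζ x ∂ν
      = ((ν A).toReal / m) • ∫ x in A, φ x • ζ x ∂ν := by
    rw [← integral_smul]
    refine setIntegral_congr_fun hA fun x hx => ?_
    simp only [indicator_of_mem hx, mul_smul]
  have h2 : ∫ x in Ω, φ x • ζ x ∂ν = ∫ x in A, φ x • ζ x ∂ν := by
    refine setIntegral_eq_of_subset_of_forall_sdiff_eq_zero hΩ hAΩ fun x hx => ?_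
    rw [hφ x hx, zero_smul]
  rw [h1, h2, smul_smul]
  congr 1
  field_simp

/-- The weight given by a partition function on a set of positive measure carrying it. -/
theorem IsPartition.isWeight_cond {X : Type*} [NormedAddCommGroup X] [NormedSpace ℝ X]
    {Ω A : Set (Euc d)} {ε C M : ℝ} {Z : Finset (Euc d)}
    {φ : Euc d → Euc d → ℝ} (hφ : IsPartition Ω ε C Z φ) (hε : 0 < ε) (hC : 0 ≤ C)
    (hA : MeasurableSet A) (hAΩ : A ⊆ Ω) (hA0 : volume A ≠ 0) (hA1 : volume A ≠ ⊤)
    (hM : (volume A).toReal * C ≤ M * ε ^ d)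
    {z : Euc d} (hz : z ∈ Z) (hzA : ∀ x ∈ Ω \ A, φ z x = 0) (hΩ : MeasurableSet Ω) :
    ∃ p : Euc d → ℝ, IsWeight (ProbabilityTheory.cond volume A) M p ∧
      ∀ ζ : Euc d → X, ∫ x, p x • ζ x ∂(ProbabilityTheory.cond volume A)
        = weightedMean Ω (φ z) ζ := by
  have hm := hφ.mass_pos hε hC hz
  have hv : 0 < (volume A).toReal := ENNReal.toReal_pos hA0 hA1
  set m := ∫ x in Ω, φ z x
  refine ⟨A.indicator fun x => (volume A).toReal / m * φ z x, ⟨?_, ?_, ?_, ?_⟩, fun ζ =>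
    integral_cond_indicator_smul hA hΩ hAΩ hv.ne' _ hzA _ ζ⟩
  · exact ((hφ.contDiff z).continuous.measurable.const_mul _).indicator hA
  · exact fun x => indicator_nonneg (fun x _ => mul_nonneg (by positivity) (hφ.nonneg z x)) x
  · have hmass := hφ.mass z hz
    have hM0 : 0 ≤ M := by
      by_contra! h
      have h3 : 0 < ε ^ d := by positivity
      have h4 : 0 ≤ (volume A).toReal * C := by positivity
      nlinarith
    have h5 : (volume A).toReal ≤ M * m := by
      have h3 : 0 < ε ^ d := by positivity
      by_contra! h6
      have h7 : (volume A).toReal * ε ^ d ≤ (volume A).toReal * (C * m) := by gcongr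
      have h8 : (volume A).toReal * C * m ≤ M * ε ^ d * m := by gcongr
      have h9 : M * m * ε ^ d < (volume A).toReal * ε ^ d := by gcongr
      linarith
    intro x
    by_cases hx : x ∈ A
    · rw [indicator_of_mem hx]
      calc (volume A).toReal / m * φ z x ≤ (volume A).toReal / m * 1 := by
            gcongr; exact hφ.le_one hz (hAΩ hx)
        _ ≤ M := by rw [mul_one, div_le_iff₀ hm]; exact h5
    · rw [indicator_of_notMem hx]; exact hM0
  · have h := integral_cond_indicator_smul hA hΩ hAΩ hv.ne' _ hzA m fun _ => (1 : ℝ)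
    simp only [smul_eq_mul, mul_one] at h
    rw [h, inv_mul_cancel₀ hm.ne']

/-- The pair estimate: gradients of the potential at neighbouring means. -/
theorem IsFlatPotential.exists_pair_bound (hd : 1 ≤ d) {Ω : Set (Euc d)}
    (hΩ : IsBoundedLipschitzDomain Ω) {v : ι → X} (hv : ∀ i j, 0 ≤ inner ℝ (v i) (v j))
    (hv0 : ∀ i, v i ≠ 0) {α L K : ℝ} {zb : X} {Ψ : X → ℝ} (hα : 0 < α)
    (hΨ : IsFlatPotential (spanFlat v) α zb L K Ψ) {Cφ : ℝ} (hCφ : 0 ≤ Cφ) (K' : ℝ) :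
    ∃ ε₀ R C : ℝ, 0 < ε₀ ∧ 1 ≤ R ∧ 0 ≤ C ∧ ∀ (ε : ℝ) (Z : Finset (Euc d)) (φ : Euc d → Euc d → ℝ),
      0 < ε → ε ≤ ε₀ → IsPartition Ω ε Cφ Z φ →
      ∀ ζ Y D J, IsFluxState Ω v K' ζ Y D J → ∀ a ∈ Z, ∀ b ∈ Z, dist a b < 4 * ε →
        ‖fderiv ℝ Ψ (weightedMean Ω (φ a) ζ) - fderiv ℝ Ψ (weightedMean Ω (φ b) ζ)‖ ^ 2
            * ∫ x in Ω ∩ Metric.ball b (6 * ε), ‖ζ x‖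
          ≤ ε ^ 2 * (C * ∫ x in Ω ∩ Metric.ball b (R * ε), D x) := by
  obtain ⟨ε₀, R, Cp, hε₀, hR, hCp, hloc⟩ := hΩ.exists_local_poincare X hd
  let ω₀ : ℝ := (volume (Metric.ball (0 : Euc d) 1)).toReal
  -- This bounds the volume of the cluster divided by the mass of a partition function, so the
  -- normalized partition functions are weights bounded by it, independently of `ε`.
  obtain ⟨C, hC, hclus⟩ := hΨ.exists_cluster_bound hv hv0 hα (Θ := 6 ^ d * ω₀ * Cφ)
    (by positivity) d
  refine ⟨ε₀ / 6, R * 6, C * (Cφ * (Cp.toReal * 6 ^ (d + 2))), by positivity, by linarith,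
    by positivity, ?_⟩
  intro ε Z φ hε hεε hφ ζ Y D J hst a ha b hb hab
  -- Contains the parts in `Ω` of the supports of both `φ a` and `φ b`: the centres are less than `4
  -- ε` apart and the supports have radius `2 ε`.
  set A := Ω ∩ Metric.ball b (6 * ε) with hA
  set A' := Ω ∩ Metric.ball b (R * 6 * ε) with hA'
  have hAo : IsOpen A := hΩ.isOpen.inter Metric.isOpen_ball
  have hbA : b ∈ A := ⟨hφ.mem b hb, Metric.mem_ball_self (by positivity)⟩
  have hA0 : volume A ≠ 0 := (hAo.measure_pos _ ⟨b, hbA⟩).ne'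
  have hAle : volume A ≤ volume (Metric.ball b (6 * ε)) := measure_mono inter_subset_right
  have hA1 : volume A ≠ ⊤ := (hAle.trans_lt measure_ball_lt_top).ne
  have : IsProbabilityMeasure (ProbabilityTheory.cond volume A) :=
    cond_isProbabilityMeasure_of_finite hA0 hA1
  have hvA : 0 < (volume A).toReal := ENNReal.toReal_pos hA0 hA1
  have hvA2 : (volume A).toReal ≤ 6 ^ d * ω₀ * ε ^ d := by
    rw [volume_ball_eq b (by positivity)] at hAle
    have := ENNReal.toReal_mono (by finiteness) hAle
    rw [ENNReal.toReal_mul, ENNReal.toReal_ofReal (by positivity), mul_pow] at this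
    linarith
  have hdnn : ∀ᵐ x ∂(volume.restrict Ω), 0 ≤ D x := by
    filter_upwards [hst.adm] with x hx using hx.nonneg
  have hdA' : 0 ≤ ∫ x in A', D x :=
    integral_nonneg_of_ae (ae_restrict_of_ae_restrict_of_subset inter_subset_left hdnn)
  have hsupp : ∀ z ∈ Z, dist z b < 4 * ε → ∀ x ∈ Ω \ A, φ z x = 0 := by
    intro z _ hzb x hx
    refine hφ.support z x ?_
    by_contra! h
    refine hx.2 ⟨hx.1, ?_⟩
    rw [Metric.mem_ball]
    linarith [dist_triangle x z b]
  have hMle : (volume A).toReal * Cφ ≤ 6 ^ d * ω₀ * Cφ * ε ^ d := by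
    calc _ ≤ 6 ^ d * ω₀ * ε ^ d * Cφ := by gcongr
      _ = _ := by ring
  have hmA : ε ^ d ≤ Cφ * (volume A).toReal := by
    refine (hφ.mass b hb).trans ?_
    gcongr
    have hbb := hsupp b hb (by rw [dist_self]; positivity)
    rw [setIntegral_eq_of_subset_of_forall_sdiff_eq_zero hΩ.isOpen.measurableSet
      (inter_subset_left : A ⊆ Ω) hbb]
    have h1 : ∫ x in A, φ b x ≤ ∫ x in A, (1 : ℝ) := by
      refine integral_mono_of_nonneg (Eventually.of_forall fun x => hφ.nonneg b x)
        (integrable_const_iff.2 (Or.inr ⟨by simpa using hA1.lt_top⟩)) ?_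
      filter_upwards [ae_restrict_mem hAo.measurableSet] with x hx using hφ.le_one hb hx.1
    simpa [Measure.real] using h1
  obtain ⟨p, hp, hpe⟩ := hφ.isWeight_cond (X := X) hε hCφ hAo.measurableSet
    inter_subset_left hA0 hA1
    hMle ha (hsupp a ha hab) hΩ.isOpen.measurableSet
  obtain ⟨q, hq, hqe⟩ := hφ.isWeight_cond (X := X) hε hCφ hAo.measurableSet
    inter_subset_left hA0 hA1
    hMle hb (hsupp b hb (by rw [dist_self]; positivity)) hΩ.isOpen.measurableSet
  have hcond : ∀ {Q : Euc d → Prop}, (∀ᵐ x ∂(volume.restrict Ω), Q x) →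
      ∀ᵐ x ∂(ProbabilityTheory.cond volume A), Q x := fun h =>
    Measure.ae_smul_measure (ae_restrict_of_ae_restrict_of_subset inter_subset_left h) _
  have hζi : Integrable ζ (ProbabilityTheory.cond volume A) :=
    (hst.integrable.mono_set inter_subset_left).smul_measure (ENNReal.inv_ne_top.2 hA0)
  have hgrad : ∀ (f : X → X) (c : ℝ), ContDiff ℝ 1 f → 0 ≤ c → DissipationBound d v f c →
      ∫⁻ x in A', ∑ k, ‖fderiv ℝ f (ζ x) (Y k x)‖ₑ ^ 2 ≤ ENNReal.ofReal (c * ∫ x in A', D x) := by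
    intro f c hf hc hfc
    rw [← integral_const_mul, ofReal_integral_eq_lintegral_ofReal
      ((hst.integrable_dissipation.mono_set inter_subset_left).const_mul c)]
    · refine lintegral_mono_ae ?_
      filter_upwards [ae_restrict_of_ae_restrict_of_subset inter_subset_left hst.adm] with x hx
      calc _ = ENNReal.ofReal (∑ k, ‖fderiv ℝ f (ζ x) (Y k x)‖ ^ 2) := by
            rw [ENNReal.ofReal_sum_of_nonneg fun k _ => by positivity]
            refine Finset.sum_congr rfl fun k _ => ?_
            rw [ENNReal.ofReal_pow (norm_nonneg _), ofReal_norm]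
        _ ≤ _ := ENNReal.ofReal_le_ofReal (hfc _ _ _ hx)
    · filter_upwards [ae_restrict_of_ae_restrict_of_subset inter_subset_left hdnn] with x hx
      exact mul_nonneg hc hx
  -- The local Poincaré bound for the normalized measure. One factor of the volume is returned by
  -- the mean of `‖ζ‖`, the other cancels `ε ^ d`, and `ε ^ 2` remains.
  set W : ℝ := (volume A).toReal⁻¹ ^ 2 * (Cp.toReal * (6 * ε) ^ (d + 2) * ∫ x in A', D x) with hW
  have hW0 : 0 ≤ W := by positivity
  have hmain := hclus (ProbabilityTheory.cond volume A) ζ W hst.stronglyMeasurable hζi hW0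
    (hcond (by filter_upwards [hst.adm] with x hx using hx.cone)) ?_ p q hp hq
  · rw [hpe, hqe, integral_cond_eq, smul_eq_mul, mul_left_comm, inv_mul_le_iff₀ hvA] at hmain
    refine hmain.trans ?_
    rw [hW]
    calc (volume A).toReal * (C * ((volume A).toReal⁻¹ ^ 2 *
          (Cp.toReal * (6 * ε) ^ (d + 2) * ∫ x in A', D x)))
        = ε ^ 2 * (C * ((ε ^ d / (volume A).toReal) * (Cp.toReal * 6 ^ (d + 2)))
            * ∫ x in A', D x) := by
          rw [mul_pow, pow_add ε]; field_simp
      _ ≤ ε ^ 2 * (C * (Cφ * (Cp.toReal * 6 ^ (d + 2))) * ∫ x in A', D x) := by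
          gcongr
          rwa [div_le_iff₀ hvA]
  · intro f c hf hc hfc
    have h1 := hloc b (hφ.mem b hb) (6 * ε) (by positivity) (by linarith) _ _
      (hf.continuous.comp_stronglyMeasurable hst.stronglyMeasurable) (hst.transEst f hf)
    rw [← mul_assoc R] at h1
    simp_rw [lintegral_cond_eq]
    rw [lintegral_const_mul' _ _ (ENNReal.inv_ne_top.2 hA0), ← mul_assoc]
    calc _ ≤ (volume A)⁻¹ * (volume A)⁻¹ * (Cp * ENNReal.ofReal ((6 * ε) ^ (d + 2)) *
          ENNReal.ofReal (c * ∫ x in A', D x)) := by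
          gcongr
          refine h1.trans ?_
          gcongr
          exact hgrad f c hf hc hfc
      _ = ENNReal.ofReal (c * W) := by
          rw [hW, ← ENNReal.ofReal_toReal (ENNReal.inv_ne_top.2 hA0), ← ENNReal.ofReal_toReal hCp,
            ← ENNReal.ofReal_mul (by positivity), ← ENNReal.ofReal_mul (by positivity),
            ← ENNReal.ofReal_mul (by positivity), ← ENNReal.ofReal_mul (by positivity),
            ENNReal.toReal_inv, ENNReal.toReal_ofReal (by positivity)]
          congr 1
          ring

theorem IsPartition.sum_fderiv_eq_zero {Ω : Set (Euc d)} {ε C : ℝ} {Z : Finset (Euc d)}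
    {φ : Euc d → Euc d → ℝ} (hφ : IsPartition Ω ε C Z φ) (hΩ : IsOpen Ω) {x : Euc d} (hx : x ∈ Ω) :
    ∑ z ∈ Z, fderiv ℝ (φ z) x = 0 := by
  have h1 : HasFDerivAt (fun y => ∑ z ∈ Z, φ z y) (∑ z ∈ Z, fderiv ℝ (φ z) x) x :=
    HasFDerivAt.fun_sum fun z _ => (((hφ.contDiff z).differentiable (by simp)) x).hasFDerivAt
  have h2 : (fun y => ∑ z ∈ Z, φ z y) =ᶠ[𝓝 x] fun _ => 1 := by
    filter_upwards [hΩ.mem_nhds hx] with y hy using hφ.sum_eq_one y hy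
  exact h1.unique ((hasFDerivAt_const (1 : ℝ) x).congr_of_eventuallyEq h2)

theorem IsPartition.fderiv_eq_zero {Ω : Set (Euc d)} {ε C : ℝ} {Z : Finset (Euc d)}
    {φ : Euc d → Euc d → ℝ} (hφ : IsPartition Ω ε C Z φ) {z x : Euc d} (hx : 2 * ε < dist x z) :
    fderiv ℝ (φ z) x = 0 := by
  have h2 : φ z =ᶠ[𝓝 x] fun _ => 0 := by
    have hc : Continuous fun y => dist y z := by fun_prop
    filter_upwards [hc.continuousAt.eventually_const_lt hx] with y hy using hφ.support z y hy.le
  rw [h2.fderiv_eq]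
  simp

theorem sum_integral_inter_ball_le {Ω : Set (Euc d)} {Z : Finset (Euc d)} {ε R : ℝ} (hε : 0 < ε)
    (hR : 0 ≤ R) (hsep : ∀ z ∈ Z, ∀ z' ∈ Z, z ≠ z' → ε ≤ dist z z') {D : Euc d → ℝ}
    (hD : IntegrableOn D Ω) (hD0 : ∀ᵐ x ∂(volume.restrict Ω), 0 ≤ D x) :
    ∑ b ∈ Z, ∫ x in Ω ∩ Metric.ball b (R * ε), D x ≤ (2 * R + 1) ^ d * ∫ x in Ω, D x := by
  simp_rw [← setIntegral_indicator Metric.isOpen_ball.measurableSet]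
  rw [← integral_finsetSum _ fun b _ => hD.indicator Metric.isOpen_ball.measurableSet,
    ← integral_const_mul]
  refine integral_mono_ae
    (integrable_finsetSum _ fun b _ => hD.indicator Metric.isOpen_ball.measurableSet)
    (hD.const_mul _) ?_
  filter_upwards [hD0] with x hx
  have h1 := card_filter_dist_le hε hR hsep x
  calc ∑ b ∈ Z, (Metric.ball b (R * ε)).indicator D x
      = ∑ b ∈ Z.filter (fun z => dist z x < R * ε), D x := by
        rw [Finset.sum_filter]
        refine Finset.sum_congr rfl fun b _ => ?_
        simp only [indicator, Metric.mem_ball, dist_comm x b]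
    _ = (Z.filter (fun z => dist z x < R * ε)).card * D x := by
        rw [Finset.sum_const, nsmul_eq_mul]
    _ ≤ _ := by gcongr

theorem le_half_add_of_sq_le {p x y : ℝ} (hx : 0 ≤ x) (hy : 0 ≤ y) (h : p ^ 2 ≤ x * y) :
    p ≤ (x + y) / 2 :=
  (le_abs_self p).trans (abs_le_of_sq_le_sq (by nlinarith [sq_nonneg (x - y)]) (by positivity))

theorem IsFluxState.integrable_flux {Ω : Set (Euc d)} {v : ι → X} {K : ℝ} (hK : 0 ≤ K)
    {ζ : Euc d → X} {Y : Fin d → Euc d → X} {D : Euc d → ℝ} {J : Fin d → Euc d → X}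
    (h : IsFluxState Ω v K ζ Y D J) (k : Fin d) : IntegrableOn (J k) Ω := by
  refine Integrable.mono'
    (((h.integrable_dissipation.const_mul K).add h.integrable.norm).div_const 2)
    (h.flux_aestronglyMeasurable k) ?_
  filter_upwards [h.flux_le, h.adm] with x hx hxa
  exact le_half_add_of_sq_le (mul_nonneg hK hxa.nonneg) (norm_nonneg _) (hx k)

/-- Pointwise antisymmetrization of the flux term. -/
theorem IsPartition.abs_sum_fderiv_le {X : Type*} [NormedAddCommGroup X] [NormedSpace ℝ X]
    {Ω : Set (Euc d)} {ε C : ℝ} {Z : Finset (Euc d)}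
    {φ : Euc d → Euc d → ℝ} (hφ : IsPartition Ω ε C Z φ) (hΩ : IsOpen Ω) (hε : 0 < ε) (hC : 0 ≤ C)
    (G : Euc d → X →L[ℝ] ℝ) {x : Euc d} (hx : x ∈ Ω) (e : Fin d → Euc d) (he : ∀ k, ‖e k‖ ≤ 1)
    (J : Fin d → X) {D z : ℝ} (hD : 0 ≤ D) (hz : 0 ≤ z) (hJ : ∀ k, ‖J k‖ ^ 2 ≤ D * z) :
    |∑ a ∈ Z, ∑ k, G a (fderiv ℝ (φ a) x (e k) • J k)| ≤
      ∑ b ∈ Z, ∑ a ∈ Z.filter (fun a => dist a b < 4 * ε), (Metric.ball b (6 * ε)).indicator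
        (fun _ => d * C * ((D + (ε ^ 2)⁻¹ * ‖G a - G b‖ ^ 2 * z) / 2)) x := by
  have h0 : ∀ b k, ∑ a ∈ Z, fderiv ℝ (φ a) x (e k) * G b (J k) = 0 := by
    intro b k
    rw [← Finset.sum_mul, ← sum_apply, hφ.sum_fderiv_eq_zero hΩ hx, zero_apply,
      zero_mul]
  -- As the derivatives of the partition functions sum to zero, any `G b` may be subtracted.
  -- Averaging over `b` with weights `φ b x` then leaves only pairs with intersecting supports.
  have h1 : ∀ b, ∑ a ∈ Z, ∑ k, G a (fderiv ℝ (φ a) x (e k) • J k)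
      = ∑ a ∈ Z, ∑ k, fderiv ℝ (φ a) x (e k) * (G a - G b) (J k) := by
    intro b
    have h2 : ∑ a ∈ Z, ∑ k, fderiv ℝ (φ a) x (e k) * G b (J k) = 0 := by
      rw [Finset.sum_comm]
      exact Finset.sum_eq_zero fun k _ => h0 b k
    rw [← sub_zero (∑ a ∈ Z, _), ← h2, ← Finset.sum_sub_distrib]
    refine Finset.sum_congr rfl fun a _ => ?_
    rw [← Finset.sum_sub_distrib]
    refine Finset.sum_congr rfl fun k _ => ?_
    rw [map_smul, smul_eq_mul, sub_apply, mul_sub]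
  have h2 : ∑ a ∈ Z, ∑ k, G a (fderiv ℝ (φ a) x (e k) • J k)
      = ∑ b ∈ Z, φ b x * ∑ a ∈ Z, ∑ k, fderiv ℝ (φ a) x (e k) * (G a - G b) (J k) := by
    simp_rw [← h1]
    rw [← Finset.sum_mul, hφ.sum_eq_one x hx, one_mul]
  rw [h2]
  refine (Finset.abs_sum_le_sum_abs _ _).trans (Finset.sum_le_sum fun b hb => ?_)
  rw [Finset.mul_sum, Finset.sum_filter]
  refine (Finset.abs_sum_le_sum_abs _ _).trans (Finset.sum_le_sum fun a _ => ?_)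
  rw [abs_mul, abs_of_nonneg (hφ.nonneg b x)]
  by_cases hxb : 2 * ε ≤ dist x b
  · rw [hφ.support b x hxb, zero_mul]
    split_ifs
    · exact indicator_nonneg (fun _ _ => by positivity) _
    · exact le_rfl
  push Not at hxb
  split_ifs with hab
  · rw [indicator_of_mem (by rw [Metric.mem_ball]; linarith)]
    have h3 : ∀ k, |fderiv ℝ (φ a) x (e k) * (G a - G b) (J k)|
        ≤ C * ((D + (ε ^ 2)⁻¹ * ‖G a - G b‖ ^ 2 * z) / 2) := by
      intro k
      -- The square of the left side is at most the product of the two summands because `‖J k‖² ≤ D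
      -- z`; the second summand has the form treated by the pair estimate.
      have h4 : ε⁻¹ * ‖G a - G b‖ * ‖J k‖ ≤ (D + (ε ^ 2)⁻¹ * ‖G a - G b‖ ^ 2 * z) / 2 := by
        refine le_half_add_of_sq_le hD (by positivity) ?_
        calc (ε⁻¹ * ‖G a - G b‖ * ‖J k‖) ^ 2 = (ε ^ 2)⁻¹ * ‖G a - G b‖ ^ 2 * ‖J k‖ ^ 2 := by
              rw [mul_pow, mul_pow, inv_pow]
          _ ≤ (ε ^ 2)⁻¹ * ‖G a - G b‖ ^ 2 * (D * z) := by gcongr; exact hJ k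
          _ = _ := by ring
      rw [abs_mul]
      have h5 : |fderiv ℝ (φ a) x (e k)| ≤ C / ε := by
        have := ContinuousLinearMap.le_of_opNorm_le_of_le _ (hφ.norm_fderiv_le a x) (he k)
        simpa using this
      have h6 : |(G a - G b) (J k)| ≤ ‖G a - G b‖ * ‖J k‖ := (G a - G b).le_opNorm (J k)
      calc _ ≤ C / ε * (‖G a - G b‖ * ‖J k‖) := by gcongr
        _ = C * (ε⁻¹ * ‖G a - G b‖ * ‖J k‖) := by ring
        _ ≤ _ := by gcongr
    calc φ b x * |∑ k, fderiv ℝ (φ a) x (e k) * (G a - G b) (J k)|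
        ≤ 1 * ∑ _k : Fin d, C * ((D + (ε ^ 2)⁻¹ * ‖G a - G b‖ ^ 2 * z) / 2) := by
          gcongr
          · exact hφ.le_one hb hx
          · exact (Finset.abs_sum_le_sum_abs _ _).trans (Finset.sum_le_sum fun k _ => h3 k)
      _ = _ := by rw [one_mul, Finset.sum_const, Finset.card_univ, Fintype.card_fin,
            nsmul_eq_mul]; ring
  · push Not at hab
    rw [hφ.fderiv_eq_zero (z := a) (x := x) (by linarith [dist_triangle a x b, dist_comm a x])]
    simp

/-- The flux term of the discretized potential is bounded by the dissipation. -/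
theorem IsFlatPotential.exists_flux_bound (hd : 1 ≤ d) {Ω : Set (Euc d)}
    (hΩ : IsBoundedLipschitzDomain Ω) {v : ι → X} (hv : ∀ i j, 0 ≤ inner ℝ (v i) (v j))
    (hv0 : ∀ i, v i ≠ 0) {α L K : ℝ} {zb : X} {Ψ : X → ℝ} (hα : 0 < α)
    (hΨ : IsFlatPotential (spanFlat v) α zb L K Ψ) {Cφ : ℝ} (hCφ : 0 ≤ Cφ) {K' : ℝ} (hK' : 0 ≤ K') :
    ∃ ε₀ C : ℝ, 0 < ε₀ ∧ 0 ≤ C ∧ ∀ (ε : ℝ) (Z : Finset (Euc d)) (φ : Euc d → Euc d → ℝ),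
      0 < ε → ε ≤ ε₀ → IsPartition Ω ε Cφ Z φ →
      ∀ ζ Y D J, IsFluxState Ω v K' ζ Y D J →
        |∑ a ∈ Z, ∑ k, fderiv ℝ Ψ (weightedMean Ω (φ a) ζ)
            (∫ x in Ω, fderiv ℝ (φ a) x (EuclideanSpace.single k 1) • J k x)|
          ≤ C * ∫ x in Ω, D x := by
  obtain ⟨ε₀, R, C, hε₀, hR, hC, hpair⟩ := hΨ.exists_pair_bound hd hΩ hv hv0 hα hCφ K'
  refine ⟨ε₀, d * Cφ / 2 * 9 ^ d * (K' * (2 * 6 + 1) ^ d + C * (2 * R + 1) ^ d), hε₀,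
    by positivity, ?_⟩
  intro ε Z φ hε hεε hφ ζ Y D J hst
  have hball : ∀ (b : Euc d) (r : ℝ), MeasurableSet (Metric.ball b r) := fun b r =>
    Metric.isOpen_ball.measurableSet
  have hD0 : ∀ᵐ x ∂(volume.restrict Ω), 0 ≤ D x := by
    filter_upwards [hst.adm] with x hx using hx.nonneg
  generalize hG : (fun a => fderiv ℝ Ψ (weightedMean Ω (φ a) ζ)) = G
  have hGa : ∀ a, fderiv ℝ Ψ (weightedMean Ω (φ a) ζ) = G a := fun a => by rw [← hG]
  simp_rw [hGa]
  have hint : ∀ a k,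
      IntegrableOn (fun x => fderiv ℝ (φ a) x (EuclideanSpace.single k 1) • J k x) Ω := by
    intro a k
    refine (hst.integrable_flux hK' k).bdd_smul (Cφ / ε) ?_ (Eventually.of_forall fun x => ?_)
    · exact (((hφ.contDiff a).continuous_fderiv (by simp)).clm_apply
        continuous_const).aestronglyMeasurable
    · refine (ContinuousLinearMap.le_of_opNorm_le _ (hφ.norm_fderiv_le a x) _).trans ?_
      simp
  have hint' : ∀ a k, IntegrableOn
      (fun x => G a (fderiv ℝ (φ a) x (EuclideanSpace.single k 1) • J k x)) Ω := fun a k =>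
    (G a).integrable_comp (hint a k)
  have e1 : ∑ a ∈ Z, ∑ k, G a (∫ x in Ω, fderiv ℝ (φ a) x (EuclideanSpace.single k 1) • J k x)
      = ∫ x in Ω, ∑ a ∈ Z, ∑ k, G a (fderiv ℝ (φ a) x (EuclideanSpace.single k 1) • J k x) := by
    rw [integral_finsetSum _ fun a _ => integrable_finsetSum _ fun k _ => hint' a k]
    refine Finset.sum_congr rfl fun a _ => ?_
    rw [integral_finsetSum _ fun k _ => hint' a k]
    exact Finset.sum_congr rfl fun k _ => ((G a).integral_comp_comm (hint a k)).symm
  rw [e1]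
  have hbi : ∀ a b, IntegrableOn (fun x => d * Cφ *
      ((K' * D x + (ε ^ 2)⁻¹ * ‖G a - G b‖ ^ 2 * ‖ζ x‖) / 2)) Ω := fun a b =>
    (((hst.integrable_dissipation.const_mul K').add (hst.integrable.norm.const_mul _)).div_const
      2).const_mul _
  calc |∫ x in Ω, ∑ a ∈ Z, ∑ k, G a (fderiv ℝ (φ a) x (EuclideanSpace.single k 1) • J k x)|
      ≤ ∫ x in Ω, ∑ b ∈ Z, ∑ a ∈ Z.filter (fun a => dist a b < 4 * ε),
          (Metric.ball b (6 * ε)).indicator (fun x => d * Cφ *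
            ((K' * D x + (ε ^ 2)⁻¹ * ‖G a - G b‖ ^ 2 * ‖ζ x‖) / 2)) x := by
        rw [← Real.norm_eq_abs]
        refine norm_integral_le_of_norm_le (integrable_finsetSum _ fun b _ =>
          integrable_finsetSum _ fun a _ => (hbi a b).indicator (hball _ _)) ?_
        filter_upwards [hst.flux_le, hst.adm, ae_restrict_mem hΩ.isOpen.measurableSet]
          with x hx hxa hxΩ
        exact hφ.abs_sum_fderiv_le hΩ.isOpen hε hCφ G hxΩ _ (fun k => by simp) (fun k => J k x)
          (mul_nonneg hK' hxa.nonneg) (norm_nonneg _) hx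
    _ = ∑ b ∈ Z, ∑ a ∈ Z.filter (fun a => dist a b < 4 * ε), d * Cφ / 2 *
          (K' * (∫ x in Ω ∩ Metric.ball b (6 * ε), D x) + (ε ^ 2)⁻¹ *
            (‖G a - G b‖ ^ 2 * ∫ x in Ω ∩ Metric.ball b (6 * ε), ‖ζ x‖)) := by
        rw [integral_finsetSum _ fun b _ => integrable_finsetSum _ fun a _ =>
          (hbi a b).indicator (hball _ _)]
        refine Finset.sum_congr rfl fun b _ => ?_
        rw [integral_finsetSum _ fun a _ => (hbi a b).indicator (hball _ _)]
        refine Finset.sum_congr rfl fun a _ => ?_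
        rw [setIntegral_indicator (hball _ _), integral_const_mul, integral_div, integral_add
          ((hst.integrable_dissipation.mono_set inter_subset_left).const_mul K')
          ((hst.integrable.mono_set inter_subset_left).norm.const_mul _), integral_const_mul,
          integral_const_mul]
        ring
    _ ≤ ∑ b ∈ Z, 9 ^ d * (d * Cφ / 2 * (K' * (∫ x in Ω ∩ Metric.ball b (6 * ε), D x)
          + C * ∫ x in Ω ∩ Metric.ball b (R * ε), D x)) := by
        refine Finset.sum_le_sum fun b hb => ?_
        have hDb : ∀ r, 0 ≤ ∫ x in Ω ∩ Metric.ball b r, D x := fun r =>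
          integral_nonneg_of_ae (ae_restrict_of_ae_restrict_of_subset inter_subset_left hD0)
        have hcard := card_filter_dist_le hε (by norm_num : (0 : ℝ) ≤ 4) hφ.separated b
        have h6 := hDb (6 * ε)
        have h7 := hDb (R * ε)
        calc _ ≤ ∑ a ∈ Z.filter (fun a => dist a b < 4 * ε), d * Cφ / 2 *
              (K' * (∫ x in Ω ∩ Metric.ball b (6 * ε), D x)
                + C * ∫ x in Ω ∩ Metric.ball b (R * ε), D x) := by
              refine Finset.sum_le_sum fun a ha => ?_
              rw [Finset.mem_filter] at ha
              -- The `ε ^ 2` gained here cancels the `(ε ^ 2)⁻¹` from the two derivatives of the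
              -- partition; bounded overlap then sums the balls, and the constant is free of `ε`.
              have h8 := hpair ε Z φ hε hεε hφ ζ Y D J hst a ha.1 b hb ha.2
              rw [hGa, hGa] at h8
              rw [← inv_mul_le_iff₀ (by positivity)] at h8
              gcongr
          _ ≤ _ := by
              rw [Finset.sum_const, nsmul_eq_mul]
              gcongr
              norm_num at hcard
              exact hcard
    _ = d * Cφ / 2 * 9 ^ d * (K' * (∑ b ∈ Z, ∫ x in Ω ∩ Metric.ball b (6 * ε), D x)
          + C * ∑ b ∈ Z, ∫ x in Ω ∩ Metric.ball b (R * ε), D x) := by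
        rw [← Finset.mul_sum, ← Finset.mul_sum, Finset.sum_add_distrib, ← Finset.mul_sum,
          ← Finset.mul_sum]
        ring
    _ ≤ d * Cφ / 2 * 9 ^ d * (K' * ((2 * 6 + 1) ^ d * ∫ x in Ω, D x)
          + C * ((2 * R + 1) ^ d * ∫ x in Ω, D x)) := by
        have h9 := sum_integral_inter_ball_le hε (by norm_num : (0 : ℝ) ≤ 6) hφ.separated
          hst.integrable_dissipation hD0
        have h10 := sum_integral_inter_ball_le hε (by linarith : 0 ≤ R) hφ.separated
          hst.integrable_dissipation hD0
        gcongr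
    _ = _ := by ring

end FluxState


/-! ### A root of the matrix and the projection onto `Lᗮ` -/

section Root

variable {n d : ℕ} {B : Matrix (Fin n) (Fin n) ℝ} {T : Euc n →L[ℝ] Euc n}

/-- `Tᵀ T = B`. -/
def IsMatrixRoot (B : Matrix (Fin n) (Fin n) ℝ) (T : Euc n →L[ℝ] Euc n) : Prop :=
  ∀ a i, inner ℝ (T (EuclideanSpace.single i 1)) (T a) = mulB B a i

theorem Matrix.PosSemidef.exists_isMatrixRoot (hB : B.PosSemidef) :
    ∃ T : Euc n →L[ℝ] Euc n, IsMatrixRoot B T := by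
  classical
  obtain ⟨C, hC⟩ : ∃ C : Matrix (Fin n) (Fin n) ℝ, B = C.conjTranspose * C := by
    open scoped MatrixOrder in
    exact CStarAlgebra.nonneg_iff_eq_star_mul_self.1 hB.nonneg
  refine ⟨(Matrix.toEuclideanLin C).toContinuousLinearMap, fun a i => ?_⟩
  simp only [mulB, hC, LinearMap.coe_toContinuousLinearMap', Matrix.toLpLin_apply,
    EuclideanSpace.inner_eq_star_dotProduct, PiLp.ofLp_single, Matrix.mulVec_single,
    ← Matrix.mulVec_mulVec]
  simp [Matrix.mulVec, dotProduct, mul_comm]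

theorem clm_apply_eq_sum (T : Euc n →L[ℝ] Euc n) (a : Euc n) :
    T a = ∑ i, a i • T (EuclideanSpace.single i 1) := by
  conv_lhs => rw [← sum_smul_single a]
  simp

namespace IsMatrixRoot

variable (hT : IsMatrixRoot B T)
include hT

theorem inner_single (i j : Fin n) :
    inner ℝ (T (EuclideanSpace.single i 1)) (T (EuclideanSpace.single j 1)) = B i j := by
  rw [hT]
  simp [mulB]

theorem inner_apply (a b : Euc n) : inner ℝ (T a) (T b) = ∑ i, a i * mulB B b i := by
  rw [clm_apply_eq_sum T a, sum_inner]
  exact Finset.sum_congr rfl fun i _ => by rw [real_inner_smul_left, hT b i]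

theorem norm_sq (a : Euc n) : ‖T a‖ ^ 2 = quadB B a := by
  rw [← real_inner_self_eq_norm_sq, hT.inner_apply, quadB]
  refine Finset.sum_congr rfl fun i _ => ?_
  simp only [mulB, Matrix.mulVec, dotProduct, Finset.mul_sum]
  exact Finset.sum_congr rfl fun j _ => by ring

theorem mem_ker_iff (a : Euc n) : a ∈ kerB B ↔ T a = 0 := by
  constructor
  · intro h
    have h1 : mulB B a = 0 := h
    rw [← inner_self_eq_zero (𝕜 := ℝ), hT.inner_apply, h1]
    simp
  · intro h
    change mulB B a = 0
    ext i
    rw [← hT a i, h, inner_zero_right]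
    rfl

theorem apply_hatB (a : Euc n) : T (hatB B a) = T a := by
  have h1 : hatB B a = a - (kerB B).starProjection a := by
    rw [hatB, Submodule.starProjection_orthogonal_val]
  rw [h1, map_sub, (hT.mem_ker_iff _).1 (Submodule.starProjection_apply_mem _ a), sub_zero]

/-- The kernel of `T` is `L`, so `T` is bounded below on `Lᗮ`; convergence of `T u` therefore gives
convergence of `û`. -/
theorem exists_norm_hatB_le : ∃ C : ℝ, 0 ≤ C ∧ ∀ a, ‖hatB B a‖ ≤ C * ‖T a‖ := by
  let f : (kerB B)ᗮ →ₗ[ℝ] Euc n := T.toLinearMap ∘ₗ (kerB B)ᗮ.subtype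
  have hf : LinearMap.ker f = ⊥ := by
    rw [LinearMap.ker_eq_bot']
    intro m hm
    have h1 : (m : Euc n) ∈ kerB B := (hT.mem_ker_iff _).2 hm
    have h2 := (Submodule.mem_orthogonal _ _).1 m.2 _ h1
    exact Subtype.ext (inner_self_eq_zero.1 h2)
  obtain ⟨K, hK, hKf⟩ := f.exists_antilipschitzWith hf
  refine ⟨K, K.2, fun a => ?_⟩
  have h1 := hKf.le_mul_dist ⟨hatB B a, Submodule.starProjection_apply_mem _ a⟩ 0
  rw [dist_zero_right, map_zero, dist_zero_right] at h1
  rw [← hT.apply_hatB a]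
  exact h1

end IsMatrixRoot

theorem hatB_hatB (a : Euc n) : hatB B (hatB B a) = hatB B a :=
  Submodule.starProjection_eq_self_iff.2 (Submodule.starProjection_apply_mem _ a)

theorem hatB_projKerB (a : Euc n) : hatB B (projKerB B a) = 0 := by
  rw [hatB, projKerB, Submodule.starProjection_apply_eq_zero_iff, Submodule.orthogonal_orthogonal]
  exact Submodule.starProjection_apply_mem _ a

theorem continuous_hatB : Continuous (hatB B) := (kerB B)ᗮ.starProjection.continuous

theorem continuous_mulB : Continuous (mulB B) := by
  unfold mulB
  fun_prop

theorem continuous_quadB : Continuous (quadB B) := by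
  unfold quadB
  fun_prop

end Root

/-! ### The `ŝ`-component of the measures is deterministic -/

section Separation

variable {n d : ℕ} {B : Matrix (Fin n) (Fin n) ℝ}

/-- The bump function in the phase space used to detect the range of `ŝ`. -/
noncomputable def hatBump (B : Matrix (Fin n) (Fin n) ℝ) (d : ℕ) (q : Euc n) (r R : ℝ) :
    C₀(Phase n d, ℝ) where
  toFun w := max (r - dist (hatB B w.1) q) 0 * max (R - ‖w‖) 0
  continuous_toFun := by
    have := continuous_hatB (B := B)
    fun_prop
  zero_at_infty' := by
    refine HasCompactSupport.is_zero_at_infty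
      (HasCompactSupport.intro (isCompact_closedBall (0 : Phase n d) R) fun w hw => ?_)
    rw [mem_closedBall_zero_iff, not_le] at hw
    rw [max_eq_right (a := R - ‖w‖) (by linarith), mul_zero]

theorem hatBump_apply (q : Euc n) (r R : ℝ) (w : Phase n d) :
    hatBump B d q r R w = max (r - dist (hatB B w.1) q) 0 * max (R - ‖w‖) 0 := rfl

/-- Test the separation identity with nonnegative bumps in `ŝ` that vanish at `û`: the right side is
zero, so the measure does not charge the bump. Countably many bumps, with dense centres, rational
radii and integer cut-offs in the phase space, detect every other value of `ŝ`. -/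
theorem IsDissipativeMVSolution.ae_hatB_eq {Ω : Set (Euc d)} {uin : Euc d → Euc n}
    {μ : Kernel (Euc d × ℝ) (Phase n d)} (hμ : IsDissipativeMVSolution Ω B uin μ) :
    ∀ᵐ z ∂(spaceTime Ω), ∀ᵐ w ∂(μ z), hatB B w.1 = hatB B (baryS μ z.1 z.2) := by
  have := hμ.prob
  have h1 : ∀ᵐ z ∂(spaceTime Ω), ∀ (k : ℕ) (r : ℚ) (R : ℕ),
      ∫ w, hatBump B d (TopologicalSpace.denseSeq (Euc n) k) r R w ∂(μ z)
        = ∫ w, hatBump B d (TopologicalSpace.denseSeq (Euc n) k) r R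
            (hatB B (baryS μ z.1 z.2) + projKerB B w.1, w.2) ∂(μ z) :=
    ae_all_iff.2 fun k => ae_all_iff.2 fun r => ae_all_iff.2 fun R => hμ.separation _
  filter_upwards [h1] with z hz
  set U := hatB B (baryS μ z.1 z.2) with hU
  have h2 : ∀ (k : ℕ) (r : ℚ) (R : ℕ), (r : ℝ) ≤ dist U (TopologicalSpace.denseSeq (Euc n) k) →
      ∀ᵐ w ∂(μ z), hatBump B d (TopologicalSpace.denseSeq (Euc n) k) r R w = 0 := by
    intro k r R hr
    have h3 : ∫ w, hatBump B d (TopologicalSpace.denseSeq (Euc n) k) r R w ∂(μ z) = 0 := by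
      rw [hz]
      refine (integral_congr_ae (Eventually.of_forall fun w => ?_)).trans (integral_zero _ _)
      have h4 : hatB B (U + projKerB B w.1) = U := by
        have h5 : hatB B (U + projKerB B w.1) = hatB B U + hatB B (projKerB B w.1) :=
          map_add (kerB B)ᗮ.starProjection _ _
        rw [h5, hatB_projKerB, add_zero, hU, hatB_hatB]
      simp only [hatBump_apply, h4]
      rw [max_eq_right (by linarith), zero_mul]
    refine (integral_eq_zero_iff_of_nonneg (fun w => ?_) ?_).1 h3
    · rw [hatBump_apply]; positivity
    · exact (hatBump B d (TopologicalSpace.denseSeq (Euc n) k) r R).toBCF.integrable (μ z)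
  have h6 : ∀ᵐ w ∂(μ z), ∀ (k : ℕ) (r : ℚ) (R : ℕ),
      (r : ℝ) ≤ dist U (TopologicalSpace.denseSeq (Euc n) k) →
      hatBump B d (TopologicalSpace.denseSeq (Euc n) k) r R w = 0 :=
    ae_all_iff.2 fun k => ae_all_iff.2 fun r => ae_all_iff.2 fun R => by
      by_cases h : (r : ℝ) ≤ dist U (TopologicalSpace.denseSeq (Euc n) k)
      · filter_upwards [h2 k r R h] with w hw _ using hw
      · exact Eventually.of_forall fun w h' => absurd h' h
  filter_upwards [h6] with w hw
  by_contra hne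
  have hpos : 0 < dist (hatB B w.1) U := dist_pos.2 hne
  obtain ⟨q, hq, k, rfl⟩ := Metric.dense_iff.1 (TopologicalSpace.denseRange_denseSeq (Euc n))
    (hatB B w.1) (dist (hatB B w.1) U / 2) (half_pos hpos)
  rw [Metric.mem_ball, dist_comm] at hq
  have h7 : dist (hatB B w.1) (TopologicalSpace.denseSeq (Euc n) k)
      < dist U (TopologicalSpace.denseSeq (Euc n) k) := by
    have := dist_triangle_right (hatB B w.1) U (TopologicalSpace.denseSeq (Euc n) k)
    linarith
  obtain ⟨r, hr0, hr1⟩ := exists_rat_btwn h7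
  obtain ⟨R, hR⟩ := exists_nat_gt ‖w‖
  have h8 := hw k r R hr1.le
  rw [hatBump_apply, max_eq_left (by linarith), max_eq_left (by linarith)] at h8
  have h9 : 0 < (r - dist (hatB B w.1) (TopologicalSpace.denseSeq (Euc n) k)) * (R - ‖w‖) :=
    mul_pos (by linarith) (by linarith)
  exact h9.ne' h8

end Separation


/-! ### Pointwise consequences: admissibility and the flux bound -/

section Pointwise

variable {n d : ℕ} {B : Matrix (Fin n) (Fin n) ℝ} {T : Euc n →L[ℝ] Euc n}

/-- The Rao part of the dissipation density. -/
noncomputable def raoDensity (B : Matrix (Fin n) (Fin n) ℝ) (w : Phase n d) : ℝ :=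
  ∑ i, w.1 i * ∑ k, mulB B (w.2 k) i ^ 2

/-- The Shannon part of the dissipation density. -/
noncomputable def shannonDensity (B : Matrix (Fin n) (Fin n) ℝ) (w : Phase n d) : ℝ :=
  ∑ k, quadB B (w.2 k)

theorem continuous_raoDensity : Continuous (raoDensity B : Phase n d → ℝ) := by
  have := continuous_mulB (B := B)
  unfold raoDensity
  fun_prop

theorem continuous_shannonDensity : Continuous (shannonDensity B : Phase n d → ℝ) := by
  have := continuous_quadB (B := B)
  unfold shannonDensity
  fun_prop

theorem raoDensity_nonneg {w : Phase n d} (hw : ∀ i, 0 ≤ w.1 i) : 0 ≤ raoDensity B w :=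
  Finset.sum_nonneg fun i _ => mul_nonneg (hw i) (by positivity)

theorem IsMatrixRoot.shannonDensity_eq (hT : IsMatrixRoot B T) (w : Phase n d) :
    shannonDensity B w = ∑ k, ‖T (w.2 k)‖ ^ 2 :=
  Finset.sum_congr rfl fun _ _ => (hT.norm_sq _).symm

theorem IsMatrixRoot.shannonDensity_nonneg (hT : IsMatrixRoot B T) (w : Phase n d) :
    0 ≤ shannonDensity B w := by
  rw [hT.shannonDensity_eq]
  positivity

theorem IsMatrixRoot.integral_shannon_nonneg (hT : IsMatrixRoot B T) {m : Measure (Phase n d)} :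
    0 ≤ ∫ w, shannonDensity B w ∂m :=
  integral_nonneg fun w => hT.shannonDensity_nonneg w

theorem sq_norm_integral_le {S E : Type*} [MeasurableSpace S] [NormedAddCommGroup E]
    [NormedSpace ℝ E] {m : Measure S} [IsProbabilityMeasure m] {f : S → E}
    (hf2 : Integrable (fun x => ‖f x‖ ^ 2) m) :
    ‖∫ x, f x ∂m‖ ^ 2 ≤ ∫ x, ‖f x‖ ^ 2 ∂m := by
  by_cases hf : Integrable f m
  · have h1 := norm_integral_le_integral_norm (μ := m) f
    have h2 : 0 ≤ ∫ x, (‖f x‖ - ∫ y, ‖f y‖ ∂m) ^ 2 ∂m := integral_nonneg fun x => sq_nonneg _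
    have h3 : ∫ x, (‖f x‖ - ∫ y, ‖f y‖ ∂m) ^ 2 ∂m
        = (∫ x, ‖f x‖ ^ 2 ∂m) - (∫ y, ‖f y‖ ∂m) ^ 2 := by
      have h4 : ∀ x, (‖f x‖ - ∫ y, ‖f y‖ ∂m) ^ 2
          = ‖f x‖ ^ 2 - 2 * (∫ y, ‖f y‖ ∂m) * ‖f x‖ + (∫ y, ‖f y‖ ∂m) ^ 2 := fun x => by ring
      have h5 : Integrable (fun x => 2 * (∫ y, ‖f y‖ ∂m) * ‖f x‖) m := hf.norm.const_mul _
      have h6 : Integrable (fun x => ‖f x‖ ^ 2 - 2 * (∫ y, ‖f y‖ ∂m) * ‖f x‖) m := hf2.sub h5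
      simp_rw [h4]
      rw [integral_add h6 (integrable_const _), integral_sub hf2 h5, integral_const_mul,
        integral_const, probReal_univ, one_smul]
      ring
    have h7 : ‖∫ x, f x ∂m‖ ^ 2 ≤ (∫ x, ‖f x‖ ∂m) ^ 2 := by gcongr
    linarith
  · rw [integral_undef hf]
    simp only [norm_zero, ne_eq, OfNat.ofNat_ne_zero, not_false_eq_true, zero_pow]
    exact integral_nonneg fun x => by positivity

/-- Weighted Cauchy–Schwarz from the discriminant of `r ↦ ∫ s (r - b)²`. When `s b` is not
integrable the left side is `0` by convention. -/
theorem sq_integral_mul_le {S : Type*} [MeasurableSpace S] {m : Measure S} {s b : S → ℝ}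
    (hs : Integrable s m) (hs0 : ∀ᵐ x ∂m, 0 ≤ s x) (hsb : Integrable (fun x => s x * b x ^ 2) m) :
    (∫ x, s x * b x ∂m) ^ 2 ≤ (∫ x, s x ∂m) * ∫ x, s x * b x ^ 2 ∂m := by
  by_cases h : Integrable (fun x => s x * b x) m
  · have key : ∀ r : ℝ, 0 ≤ (∫ x, s x ∂m) * (r * r) + (-2 * ∫ x, s x * b x ∂m) * r
        + ∫ x, s x * b x ^ 2 ∂m := by
      intro r
      have h1 : 0 ≤ ∫ x, s x * (r - b x) ^ 2 ∂m := by
        refine integral_nonneg_of_ae ?_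
        filter_upwards [hs0] with x hx
        exact mul_nonneg hx (sq_nonneg _)
      have h2 : ∀ x, s x * (r - b x) ^ 2 = r * r * s x + (-2 * r) * (s x * b x) + s x * b x ^ 2 :=
        fun x => by ring
      have h3 : Integrable (fun x => r * r * s x + (-2 * r) * (s x * b x)) m :=
        (hs.const_mul _).add (h.const_mul _)
      simp_rw [h2] at h1
      rw [integral_add h3 hsb, integral_add (hs.const_mul _) (h.const_mul _), integral_const_mul,
        integral_const_mul] at h1
      linarith
    have := discrim_le_zero key
    rw [discrim] at this
    nlinarith
  · rw [integral_undef h]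
    simp only [ne_eq, OfNat.ofNat_ne_zero, not_false_eq_true, zero_pow]
    refine mul_nonneg (integral_nonneg_of_ae hs0) (integral_nonneg_of_ae ?_)
    filter_upwards [hs0] with x hx
    exact mul_nonneg hx (sq_nonneg _)

theorem integral_euc_apply {S : Type*} [MeasurableSpace S] {m : Measure S} {f : S → Euc n}
    (hf : Integrable f m) (i : Fin n) : (∫ x, f x ∂m) i = ∫ x, f x i ∂m :=
  ((EuclideanSpace.proj (𝕜 := ℝ) i).integral_comp_comm hf).symm

theorem integrable_euc_apply {S : Type*} [MeasurableSpace S] {m : Measure S} {f : S → Euc n}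
    (hf : Integrable f m) (i : Fin n) : Integrable (fun x => f x i) m :=
  (EuclideanSpace.proj (𝕜 := ℝ) i).integrable_comp hf

variable {m : Measure (Phase n d)}

/-- The flux `⟨m, sᵢ (B p_k)ᵢ⟩`, mapped to the range of `T`. -/
noncomputable def rootFlux (B : Matrix (Fin n) (Fin n) ℝ) (T : Euc n →L[ℝ] Euc n)
    (m : Measure (Phase n d)) (k : Fin d) : Euc n :=
  ∑ i, (∫ w, w.1 i * mulB B (w.2 k) i ∂m) • T (EuclideanSpace.single i 1)

/-- The properties of the measures `μ_{x,t}` that hold almost everywhere. -/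
structure IsRegularAt (B : Matrix (Fin n) (Fin n) ℝ) (m : Measure (Phase n d)) : Prop where
  prob : IsProbabilityMeasure m
  nonneg : ∀ᵐ w ∂m, ∀ i, 0 ≤ w.1 i
  integrable_s : Integrable (fun w => w.1) m
  integrable_p : ∀ k, Integrable (fun w => w.2 k) m
  integrable_rao : Integrable (raoDensity B) m
  integrable_shannon : Integrable (shannonDensity B) m
  hatB_eq : ∀ᵐ w ∂m, hatB B w.1 = hatB B (∫ w, w.1 ∂m)

namespace IsRegularAt

variable (hm : IsRegularAt B m) (hT : IsMatrixRoot B T)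
include hm

theorem bary_nonneg (i : Fin n) : 0 ≤ (∫ w, w.1 ∂m) i := by
  rw [integral_euc_apply hm.integrable_s]
  exact integral_nonneg_of_ae (by filter_upwards [hm.nonneg] with w hw using hw i)

theorem integral_rao_nonneg : 0 ≤ ∫ w, raoDensity B w ∂m :=
  integral_nonneg_of_ae (by filter_upwards [hm.nonneg] with w hw using raoDensity_nonneg hw)

theorem sq_flux_le (i : Fin n) (k : Fin d) : (∫ w, w.1 i * mulB B (w.2 k) i ∂m) ^ 2
    ≤ (∫ w, w.1 ∂m) i * ∫ w, raoDensity B w ∂m := by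
  have hle : ∀ᵐ w ∂m, w.1 i * mulB B (w.2 k) i ^ 2 ≤ raoDensity B w := by
    filter_upwards [hm.nonneg] with w hw
    calc w.1 i * mulB B (w.2 k) i ^ 2 ≤ w.1 i * ∑ k, mulB B (w.2 k) i ^ 2 := by
          have := hw i
          gcongr
          exact Finset.single_le_sum (f := fun k => mulB B (w.2 k) i ^ 2)
            (fun _ _ => by positivity) (Finset.mem_univ k)
      _ ≤ _ := Finset.single_le_sum (f := fun i => w.1 i * ∑ k, mulB B (w.2 k) i ^ 2)
          (fun i _ => mul_nonneg (hw i) (by positivity)) (Finset.mem_univ i)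
  have hint : Integrable (fun w : Phase n d => w.1 i * mulB B (w.2 k) i ^ 2) m := by
    refine hm.integrable_rao.mono' ?_ ?_
    · have := continuous_mulB (B := B)
      exact (by fun_prop : Continuous fun w : Phase n d =>
        w.1 i * mulB B (w.2 k) i ^ 2).aestronglyMeasurable
    · filter_upwards [hm.nonneg, hle] with w hw h
      rwa [Real.norm_of_nonneg (mul_nonneg (hw i) (sq_nonneg _))]
  have h1 := sq_integral_mul_le (integrable_euc_apply hm.integrable_s i)
    (by filter_upwards [hm.nonneg] with w hw using hw i) hint
  rw [← integral_euc_apply hm.integrable_s] at h1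
  exact h1.trans (mul_le_mul_of_nonneg_left (integral_mono_ae hint hm.integrable_rao hle)
    (hm.bary_nonneg i))

include hT

theorem integrable_norm_sq (k : Fin d) : Integrable (fun w => ‖T (w.2 k)‖ ^ 2) m := by
  refine hm.integrable_shannon.mono' (by fun_prop) (Eventually.of_forall fun w => ?_)
  rw [Real.norm_of_nonneg (by positivity), hT.shannonDensity_eq]
  exact Finset.single_le_sum (f := fun k => ‖T (w.2 k)‖ ^ 2) (fun _ _ => by positivity)
    (Finset.mem_univ k)

/-- The first bound is Jensen's inequality for the Shannon part. For the second, almost every `s` is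
a nonnegative representation of the same vector `T u`, so a coercivity constant valid for all such
representations bounds the Rao density pointwise by the squared projections of `T p`; Jensen's
inequality then passes to the barycenter. -/
theorem isAdm : IsAdm (fun i => T (EuclideanSpace.single i 1)) (T (∫ w, w.1 ∂m))
    (fun k => T (∫ w, w.2 k ∂m)) ((∫ w, raoDensity B w ∂m) + ∫ w, shannonDensity B w ∂m) := by
  have := hm.prob
  have hcomm : ∀ k, T (∫ w, w.2 k ∂m) = ∫ w, T (w.2 k) ∂m := fun k =>
    (T.integral_comp_comm (hm.integrable_p k)).symm
  refine ⟨⟨_, hm.bary_nonneg, (clm_apply_eq_sum T _).symm⟩, ?_, ?_⟩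
  · have h1 : ∑ k, ‖T (∫ w, w.2 k ∂m)‖ ^ 2 ≤ ∫ w, shannonDensity B w ∂m := by
      simp_rw [hT.shannonDensity_eq]
      rw [integral_finsetSum _ fun k _ => hm.integrable_norm_sq hT k]
      refine Finset.sum_le_sum fun k _ => ?_
      rw [hcomm]
      exact sq_norm_integral_le (hm.integrable_norm_sq hT k)
    linarith [hm.integral_rao_nonneg]
  · intro F c hc H
    have hFi : ∀ k, Integrable (fun w => ‖F.starProjection (T (w.2 k))‖ ^ 2) m := by
      intro k
      refine (hm.integrable_norm_sq hT k).mono' (by fun_prop) (Eventually.of_forall fun w => ?_)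
      rw [Real.norm_of_nonneg (by positivity)]
      gcongr
      exact Submodule.norm_starProjection_apply_le F _
    have h1 : c * ∑ k, ‖F.starProjection (T (∫ w, w.2 k ∂m))‖ ^ 2
        ≤ ∫ w, c * ∑ k, ‖F.starProjection (T (w.2 k))‖ ^ 2 ∂m := by
      rw [integral_const_mul, integral_finsetSum _ fun k _ => hFi k]
      gcongr with k
      rw [hcomm, ← F.starProjection.integral_comp_comm (T.integrable_comp (hm.integrable_p k))]
      exact sq_norm_integral_le (hFi k)
    have h2 : ∫ w, c * ∑ k, ‖F.starProjection (T (w.2 k))‖ ^ 2 ∂m ≤ ∫ w, raoDensity B w ∂m := by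
      refine integral_mono_ae ((integrable_finsetSum _ fun k _ => hFi k).const_mul c)
        hm.integrable_rao ?_
      filter_upwards [hm.nonneg, hm.hatB_eq] with w hw hhat
      have h3 : ∑ i, w.1 i • T (EuclideanSpace.single i 1) = T (∫ w, w.1 ∂m) := by
        rw [← clm_apply_eq_sum, ← hT.apply_hatB, hhat, hT.apply_hatB]
      have h4 := fun k => H _ hw h3 (T (w.2 k))
      calc c * ∑ k, ‖F.starProjection (T (w.2 k))‖ ^ 2
          = ∑ k, c * ‖F.starProjection (T (w.2 k))‖ ^ 2 := Finset.mul_sum _ _ _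
        _ ≤ ∑ k, ∑ i, w.1 i * inner ℝ (T (EuclideanSpace.single i 1)) (T (w.2 k)) ^ 2 :=
            Finset.sum_le_sum fun k _ => h4 k
        _ = raoDensity B w := by
            rw [Finset.sum_comm, raoDensity]
            refine Finset.sum_congr rfl fun i _ => ?_
            rw [Finset.mul_sum]
            exact Finset.sum_congr rfl fun k _ => by rw [hT]
    linarith [hT.integral_shannon_nonneg (m := m)]

/-- By nonnegativity nothing cancels in `(B u)ᵢ = ⟨T eᵢ, T u⟩`. Hence `‖T u‖` controls all of `u`,
including the component in `L` that `T` does not see. -/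
theorem diag_mul_bary_le (hB : ∀ i j, 0 ≤ B i j) (i : Fin n) :
    B i i * (∫ w, w.1 ∂m) i ≤ ‖T (EuclideanSpace.single i 1)‖ * ‖T (∫ w, w.1 ∂m)‖ := by
  refine le_trans ?_ (real_inner_le_norm _ _)
  rw [hT]
  simp only [mulB, Matrix.mulVec, dotProduct]
  exact Finset.single_le_sum (f := fun j => B i j * (∫ w, w.1 ∂m) j)
    (fun j _ => mul_nonneg (hB i j) (hm.bary_nonneg j)) (Finset.mem_univ i)

end IsRegularAt

/-- Cauchy–Schwarz bounds the square of each flux component by `uᵢ` times the Rao density, and `uᵢ`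
is bounded by a multiple of `‖T u‖`. -/
theorem exists_norm_rootFlux_le (hT : IsMatrixRoot B T) (hB : ∀ i j, 0 ≤ B i j)
    (hB0 : ∀ i, 0 < B i i) : ∃ K : ℝ, 0 ≤ K ∧ ∀ m : Measure (Phase n d), IsRegularAt B m → ∀ k,
      ‖rootFlux B T m k‖ ^ 2
        ≤ K * ((∫ w, raoDensity B w ∂m) + ∫ w, shannonDensity B w ∂m) * ‖T (∫ w, w.1 ∂m)‖ := by
  refine ⟨n * ∑ i, ‖T (EuclideanSpace.single i 1)‖ ^ 2 *
    (‖T (EuclideanSpace.single i 1)‖ / B i i), ?_, fun m hm k => ?_⟩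
  · exact mul_nonneg (Nat.cast_nonneg _) (Finset.sum_nonneg fun i _ =>
      mul_nonneg (sq_nonneg _) (div_nonneg (norm_nonneg _) (hB0 i).le))
  have h0 := hm.integral_rao_nonneg
  have h0' := hT.integral_shannon_nonneg (m := m)
  have hj : ∀ i, (∫ w, w.1 i * mulB B (w.2 k) i ∂m) ^ 2
      ≤ ‖T (EuclideanSpace.single i 1)‖ / B i i * ‖T (∫ w, w.1 ∂m)‖ *
        ((∫ w, raoDensity B w ∂m) + ∫ w, shannonDensity B w ∂m) := by
    intro i
    have h2 : (∫ w, w.1 ∂m) i ≤ ‖T (EuclideanSpace.single i 1)‖ / B i i * ‖T (∫ w, w.1 ∂m)‖ := by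
      rw [div_mul_eq_mul_div, le_div_iff₀ (hB0 i), mul_comm]
      exact hm.diag_mul_bary_le hT hB i
    have h3 := hm.bary_nonneg i
    exact (hm.sq_flux_le i k).trans (mul_le_mul h2 (by linarith) h0 (h3.trans h2))
  calc ‖rootFlux B T m k‖ ^ 2
      ≤ (∑ i, ‖(∫ w, w.1 i * mulB B (w.2 k) i ∂m) • T (EuclideanSpace.single i 1)‖) ^ 2 := by
        gcongr
        exact norm_sum_le _ _
    _ ≤ n * ∑ i, ‖(∫ w, w.1 i * mulB B (w.2 k) i ∂m) • T (EuclideanSpace.single i 1)‖ ^ 2 := by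
        simpa using sq_sum_le_card_mul_sum_sq (s := Finset.univ)
          (f := fun i => ‖(∫ w, w.1 i * mulB B (w.2 k) i ∂m) • T (EuclideanSpace.single i 1)‖)
    _ ≤ n * ∑ i, (‖T (EuclideanSpace.single i 1)‖ / B i i * ‖T (∫ w, w.1 ∂m)‖ *
        ((∫ w, raoDensity B w ∂m) + ∫ w, shannonDensity B w ∂m)) *
          ‖T (EuclideanSpace.single i 1)‖ ^ 2 := by
        gcongr with i
        rw [norm_smul, mul_pow, Real.norm_eq_abs, sq_abs]
        gcongr
        exact hj i
    _ = _ := by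
        rw [mul_assoc (n : ℝ), mul_assoc, mul_assoc, Finset.sum_mul]
        congr 1
        exact Finset.sum_congr rfl fun i _ => by ring

end Pointwise


/-! ### From the definition of a solution to flux states at almost every time -/

section Extraction

theorem setLIntegral_Ioi_le_of_ae {f : ℝ → ℝ≥0∞} {M : ℝ≥0∞}
    (h : ∀ᵐ t ∂(volume.restrict (Ioi (0 : ℝ))), ∫⁻ τ in Ioo 0 t, f τ ≤ M) :
    ∫⁻ τ in Ioi 0, f τ ≤ M := by
  have h1 : ∀ k : ℕ, ∃ t : ℝ, (k : ℝ) < t ∧ ∫⁻ τ in Ioo 0 t, f τ ≤ M := by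
    intro k
    have h2 : ∀ᵐ t ∂(volume.restrict (Ioi (k : ℝ))), ∫⁻ τ in Ioo 0 t, f τ ≤ M :=
      ae_restrict_of_ae_restrict_of_subset (Ioi_subset_Ioi (Nat.cast_nonneg k)) h
    have : (ae (volume.restrict (Ioi (k : ℝ)))).NeBot := by
      rw [ae_neBot]
      intro h3
      simpa using Measure.restrict_eq_zero.1 h3
    obtain ⟨t, ht1, ht2⟩ := (h2.and (ae_restrict_mem measurableSet_Ioi)).exists
    exact ⟨t, ht2, ht1⟩
  have h2 : Ioi (0 : ℝ) = ⋃ k : ℕ, Ioo 0 (k : ℝ) := by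
    ext t
    simp only [mem_Ioi, mem_iUnion, mem_Ioo]
    exact ⟨fun ht => (exists_nat_gt t).imp fun k hk => ⟨ht, hk⟩, fun ⟨k, hk⟩ => hk.1⟩
  rw [h2, setLIntegral_iUnion_of_directed]
  · refine iSup_le fun k => ?_
    obtain ⟨t, ht, hM⟩ := h1 k
    exact (lintegral_mono_set (Ioo_subset_Ioo_right ht.le)).trans hM
  · refine Monotone.directed_le fun k l hkl => ?_
    exact Ioo_subset_Ioo_right (Nat.cast_le.2 hkl)

variable {n d : ℕ} {B : Matrix (Fin n) (Fin n) ℝ} {T : Euc n →L[ℝ] Euc n} {Ω : Set (Euc d)}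
  {uin : Euc d → Euc n} {μ : Kernel (Euc d × ℝ) (Phase n d)}

theorem ae_ae_of_ae_spaceTime {p : Euc d → ℝ → Prop} (h : ∀ᵐ z ∂(spaceTime Ω), p z.1 z.2) :
    ∀ᵐ t ∂(volume.restrict (Ioi (0 : ℝ))), ∀ᵐ x ∂(volume.restrict Ω), p x t := by
  have h1 : ∀ᵐ z ∂((volume.restrict (Ioi (0 : ℝ))).prod (volume.restrict Ω)), p z.2 z.1 :=
    Measure.measurePreserving_swap.quasiMeasurePreserving.ae h
  exact Measure.ae_ae_of_ae_prod h1

theorem lintegral_spaceTime {f : Euc d × ℝ → ℝ≥0∞} (hf : Measurable f) :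
    ∫⁻ z, f z ∂(spaceTime Ω) = ∫⁻ t in Ioi 0, ∫⁻ x in Ω, f (x, t) :=
  lintegral_prod_symm _ hf.aemeasurable

theorem integrable_norm_sq_of_memLp_two {S E : Type*} [MeasurableSpace S] [NormedAddCommGroup E]
    {m : Measure S} {f : S → E} (hf : MemLp f 2 m) : Integrable (fun x => ‖f x‖ ^ 2) m :=
  hf.integrable_norm_pow (by simp)

namespace IsDissipativeMVSolution

variable (hμ : IsDissipativeMVSolution Ω B uin μ)
include hμ

/-- Since `log s ≤ s - 1`, the Shannon density is at most `∑ (sᵢ² + 1)`, so square integrability of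
the initial datum on a set of finite volume suffices. -/
theorem lintegral_hS_lt_top (hΩ : volume Ω < ⊤) : ∫⁻ x in Ω, ENNReal.ofReal (hS (uin x)) < ⊤ := by
  have : IsFiniteMeasure (volume.restrict Ω) := ⟨by simpa using hΩ⟩
  have h1 : Integrable (fun x => ‖uin x‖ ^ 2 + n) (volume.restrict Ω) :=
    (integrable_norm_sq_of_memLp_two hμ.uin_memLp).add (integrable_const _)
  refine lt_of_le_of_lt (lintegral_mono_ae ?_) h1.lintegral_lt_top
  filter_upwards [hμ.uin_nonneg] with x hx
  refine ENNReal.ofReal_le_ofReal ?_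
  calc hS (uin x) ≤ ∑ i, (uin x i ^ 2 + 1) := by
        refine Finset.sum_le_sum fun i _ => ?_
        rcases (hx i).eq_or_lt with h0 | h0
        · rw [← h0]; simp
        · have := Real.log_le_sub_one_of_pos h0
          nlinarith
    _ = _ := by
        rw [Finset.sum_add_distrib, EuclideanSpace.norm_sq_eq]
        simp

theorem lintegral_hR_lt_top (hT : IsMatrixRoot B T) :
    ∫⁻ x in Ω, ENNReal.ofReal (hR B (uin x)) < ⊤ := by
  refine lt_of_le_of_lt (lintegral_mono fun x => ?_)
    ((integrable_norm_sq_of_memLp_two hμ.uin_memLp).const_mul (‖T‖ ^ 2)).lintegral_lt_top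
  refine ENNReal.ofReal_le_ofReal ?_
  rw [hR, ← hT.norm_sq, ← mul_pow]
  have h1 : ‖T (uin x)‖ ^ 2 ≤ (‖T‖ * ‖uin x‖) ^ 2 := by gcongr; exact T.le_opNorm _
  nlinarith [sq_nonneg ‖T (uin x)‖]

theorem lintegral_shannonDensity_lt_top (hΩ : volume Ω < ⊤) :
    ∫⁻ z, ∫⁻ w, ENNReal.ofReal (shannonDensity B w) ∂(μ z) ∂(spaceTime Ω) < ⊤ := by
  have := hμ.prob
  rw [lintegral_spaceTime (Measurable.lintegral_kernel
    (continuous_shannonDensity.measurable.ennreal_ofReal))]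
  refine lt_of_le_of_lt (setLIntegral_Ioi_le_of_ae ?_) (hμ.lintegral_hS_lt_top hΩ)
  filter_upwards [hμ.shannon] with t ht
  exact le_add_self.trans ht

theorem lintegral_raoDensity_lt_top (hT : IsMatrixRoot B T) :
    ∫⁻ z, ∫⁻ w, ENNReal.ofReal (raoDensity B w) ∂(μ z) ∂(spaceTime Ω) < ⊤ := by
  have := hμ.prob
  have hc : ∀ i, Continuous fun w : Phase n d => w.1 i * ∑ k, mulB B (w.2 k) i ^ 2 := by
    intro i
    have := continuous_mulB (B := B)
    fun_prop
  have hm : ∀ i, Measurable fun z => ∫⁻ w,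
      ENNReal.ofReal (w.1 i * ∑ k, mulB B (w.2 k) i ^ 2) ∂(μ z) := fun i =>
    Measurable.lintegral_kernel (hc i).measurable.ennreal_ofReal
  have h1 : ∀ i, ∫⁻ z, ∫⁻ w, ENNReal.ofReal (w.1 i * ∑ k, mulB B (w.2 k) i ^ 2) ∂(μ z)
      ∂(spaceTime Ω) < ⊤ := by
    intro i
    rw [lintegral_spaceTime (hm i)]
    refine lt_of_le_of_lt (setLIntegral_Ioi_le_of_ae ?_) (hμ.lintegral_hR_lt_top hT)
    filter_upwards [hμ.rao] with t ht
    refine le_trans ?_ (le_add_self.trans ht)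
    exact Finset.single_le_sum (f := fun i => ∫⁻ τ in Ioo 0 t, ∫⁻ x in Ω, ∫⁻ w,
      ENNReal.ofReal (w.1 i * ∑ k, mulB B (w.2 k) i ^ 2) ∂(μ (x, τ))) (fun _ _ => zero_le)
      (Finset.mem_univ i)
  calc ∫⁻ z, ∫⁻ w, ENNReal.ofReal (raoDensity B w) ∂(μ z) ∂(spaceTime Ω)
      ≤ ∫⁻ z, ∑ i, ∫⁻ w, ENNReal.ofReal (w.1 i * ∑ k, mulB B (w.2 k) i ^ 2) ∂(μ z)
          ∂(spaceTime Ω) := by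
        refine lintegral_mono fun z => ?_
        rw [← lintegral_finsetSum _ fun i _ => (hc i).measurable.ennreal_ofReal]
        refine lintegral_mono fun w => ?_
        exact Finset.le_sum_of_subadditive ENNReal.ofReal ENNReal.ofReal_zero.le
          (fun a b => ENNReal.ofReal_add_le) _ _
    _ = ∑ i, ∫⁻ z, ∫⁻ w, ENNReal.ofReal (w.1 i * ∑ k, mulB B (w.2 k) i ^ 2) ∂(μ z)
          ∂(spaceTime Ω) := lintegral_finsetSum _ fun i _ => hm i
    _ < ⊤ := ENNReal.sum_lt_top.2 fun i _ => h1 i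

theorem ae_isRegularAt (hΩ : volume Ω < ⊤) (hT : IsMatrixRoot B T) :
    ∀ᵐ z ∂(spaceTime Ω), IsRegularAt B (μ z) := by
  have := hμ.prob
  filter_upwards [hμ.concentrated, hμ.integrable_s, hμ.integrable_p, hμ.ae_hatB_eq,
    ae_lt_top (Measurable.lintegral_kernel (continuous_shannonDensity.measurable.ennreal_ofReal))
      (hμ.lintegral_shannonDensity_lt_top hΩ).ne,
    ae_lt_top (Measurable.lintegral_kernel (continuous_raoDensity.measurable.ennreal_ofReal))
      (hμ.lintegral_raoDensity_lt_top hT).ne] with z h1 h2 h3 h4 h5 h6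
  have hnn : ∀ᵐ w ∂(μ z), ∀ i, 0 ≤ w.1 i := by
    filter_upwards [mem_ae_iff.2 h1] with w hw using hw.1
  refine ⟨inferInstance, hnn, h2, h3, ?_, ?_, h4⟩
  · refine ⟨continuous_raoDensity.aestronglyMeasurable, ?_⟩
    rwa [hasFiniteIntegral_iff_ofReal]
    filter_upwards [hnn] with w hw using raoDensity_nonneg hw
  · refine ⟨continuous_shannonDensity.aestronglyMeasurable, ?_⟩
    rwa [hasFiniteIntegral_iff_ofReal]
    exact Eventually.of_forall fun w => hT.shannonDensity_nonneg w

theorem integrable_dissipation (hΩ : volume Ω < ⊤) (hT : IsMatrixRoot B T) :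
    Integrable (fun z => (∫ w, raoDensity B w ∂(μ z)) + ∫ w, shannonDensity B w ∂(μ z))
      (spaceTime Ω) := by
  have := hμ.prob
  refine Integrable.add ?_ ?_
  · refine ⟨(continuous_raoDensity.stronglyMeasurable.integral_kernel).aestronglyMeasurable, ?_⟩
    refine lt_of_le_of_lt (lintegral_mono_ae ?_) (hμ.lintegral_raoDensity_lt_top hT)
    filter_upwards [hμ.ae_isRegularAt hΩ hT] with z hz
    rw [Real.enorm_of_nonneg hz.integral_rao_nonneg, ofReal_integral_eq_lintegral_ofReal
      hz.integrable_rao (by filter_upwards [hz.nonneg] with w hw using raoDensity_nonneg hw)]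
  · refine ⟨(continuous_shannonDensity.stronglyMeasurable.integral_kernel).aestronglyMeasurable, ?_⟩
    refine lt_of_le_of_lt (lintegral_mono_ae ?_) (hμ.lintegral_shannonDensity_lt_top hΩ)
    filter_upwards [hμ.ae_isRegularAt hΩ hT] with z hz
    rw [Real.enorm_of_nonneg hT.integral_shannon_nonneg, ofReal_integral_eq_lintegral_ofReal
      hz.integrable_shannon (Eventually.of_forall fun w => hT.shannonDensity_nonneg w)]

theorem stronglyMeasurable_baryS : StronglyMeasurable fun z : Euc d × ℝ => baryS μ z.1 z.2 := by
  have := hμ.prob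
  exact (continuous_fst.stronglyMeasurable (α := Phase n d)).integral_kernel

theorem stronglyMeasurable_baryP (k : Fin d) :
    StronglyMeasurable fun z : Euc d × ℝ => baryP μ z.1 z.2 k := by
  have := hμ.prob
  exact ((by fun_prop : Continuous fun w : Phase n d => w.2 k).stronglyMeasurable).integral_kernel

theorem stronglyMeasurable_rootFlux (k : Fin d) :
    StronglyMeasurable fun z : Euc d × ℝ => rootFlux B T (μ z) k := by
  have := hμ.prob
  have := continuous_mulB (B := B)
  refine Finset.stronglyMeasurable_fun_sum _ fun i _ => StronglyMeasurable.smul_const ?_ _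
  exact ((by fun_prop : Continuous fun w : Phase n d =>
    w.1 i * mulB B (w.2 k) i).stronglyMeasurable).integral_kernel

theorem ae_memLp_baryP (k : Fin d) : ∀ᵐ t ∂(volume.restrict (Ioi (0 : ℝ))),
    MemLp (fun x => baryP μ x t k) 2 (volume.restrict Ω) := by
  have h1 : ∀ N : ℕ, ∀ᵐ t ∂(volume.restrict (Ioo (0 : ℝ) (N + 1))),
      MemLp (fun x => baryP μ x t k) 2 (volume.restrict Ω) := by
    intro N
    have h2 := integrable_norm_sq_of_memLp_two (hμ.regularity_y (N + 1) (by positivity) k)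
    filter_upwards [h2.prod_left_ae] with t ht
    have hm : AEStronglyMeasurable (fun x => baryP μ x t k) (volume.restrict Ω) :=
      ((hμ.stronglyMeasurable_baryP k).comp_measurable
        (measurable_prodMk_right (y := t))).aestronglyMeasurable
    exact (memLp_two_iff_integrable_sq_norm hm).2 ht
  have h3 : Ioi (0 : ℝ) = ⋃ N : ℕ, Ioo 0 ((N : ℝ) + 1) := by
    ext t
    simp only [mem_Ioi, mem_iUnion, mem_Ioo]
    refine ⟨fun ht => (exists_nat_gt t).imp fun k hk => ⟨ht, by linarith⟩, fun ⟨k, hk⟩ => hk.1⟩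
  rw [h3, ae_restrict_iUnion_iff]
  exact h1

theorem ae_memLp_baryS : ∀ᵐ t ∂(volume.restrict (Ioi (0 : ℝ))),
    MemLp (fun x => baryS μ x t) 2 (volume.restrict Ω) := by
  obtain ⟨C, hC, h⟩ := hμ.regularity_u
  filter_upwards [h] with t ht using ⟨ht.1, ht.2.trans_lt hC⟩

theorem exists_isFluxState (hΩ : MeasurableSet Ω) (hΩ' : volume Ω < ⊤) (hT : IsMatrixRoot B T)
    (hB : ∀ i j, 0 ≤ B i j) (hB0 : ∀ i, 0 < B i i) :
    ∃ K : ℝ, 0 ≤ K ∧ ∀ᵐ t ∂(volume.restrict (Ioi (0 : ℝ))),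
      IsFluxState Ω (fun i => T (EuclideanSpace.single i 1)) K (fun x => T (baryS μ x t))
        (fun k x => T (baryP μ x t k))
        (fun x => (∫ w, raoDensity B w ∂(μ (x, t))) + ∫ w, shannonDensity B w ∂(μ (x, t)))
        (fun k x => rootFlux B T (μ (x, t)) k) := by
  have : IsFiniteMeasure (volume.restrict Ω) := ⟨by simpa using hΩ'⟩
  obtain ⟨K, hK, hflux⟩ := exists_norm_rootFlux_le (d := d) hT hB hB0
  refine ⟨K, hK, ?_⟩
  filter_upwards [ae_ae_of_ae_spaceTime (p := fun x t => IsRegularAt B (μ (x, t)))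
      (hμ.ae_isRegularAt hΩ' hT), (hμ.integrable_dissipation hΩ' hT).prod_left_ae,
    ae_all_iff.2 hμ.ae_memLp_baryP, hμ.ae_memLp_baryS, hμ.grad_eq] with t hreg hD hp hs hg
  refine ⟨?_, ?_, hD, ?_, ?_, ?_, ?_⟩
  · exact T.continuous.comp_stronglyMeasurable
      (hμ.stronglyMeasurable_baryS.comp_measurable (measurable_prodMk_right (y := t)))
  · exact T.integrable_comp (hs.integrable (by norm_num))
  · filter_upwards [hreg] with x hx using hx.isAdm hT
  · intro f hf
    -- Only `û` has a weak gradient, not `u`; this is enough because `T û = T u`.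
    have h1 := transEst_comp hΩ (f := fun s => f (T s)) (hf.comp T.contDiff)
      (w := fun x => hatB B (baryS μ x t)) (Y := fun k x => baryP μ x t k)
      ((kerB B)ᗮ.starProjection.integrable_comp (hs.integrable (by norm_num)))
      (fun k => (hp k).integrable (by norm_num)) hg
    have h2 : ∀ s y, fderiv ℝ (fun s => f (T s)) s y = fderiv ℝ f (T s) (T y) := by
      intro s y
      have h3 : HasFDerivAt (fun s => f (T s)) ((fderiv ℝ f (T s)).comp T) s :=
        ((hf.differentiable (by simp)) (T s)).hasFDerivAt.comp s T.hasFDerivAt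
      rw [h3.fderiv]
      rfl
    simpa only [h2, hT.apply_hatB] using h1
  · intro k
    exact ((hμ.stronglyMeasurable_rootFlux k).comp_measurable
      (measurable_prodMk_right (y := t))).aestronglyMeasurable
  · filter_upwards [hreg] with x hx k using hflux _ hx k

end IsDissipativeMVSolution

end Extraction


/-! ### Evolution of weighted integrals in time -/

section TimeEvolution

theorem integral_primitive_mul {ψ h : ℝ → ℝ} {S : ℝ} (hψ : Continuous ψ)
    (hh : IntervalIntegrable h volume 0 S) :
    ∫ t in 0..S, h t * ((∫ τ in 0..t, ψ τ) - ∫ τ in 0..S, ψ τ)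
      = - ∫ t in 0..S, (∫ τ in 0..t, h τ) * ψ t := by
  have hΦd : ∀ t, HasDerivAt (fun t => (∫ τ in 0..t, ψ τ) - ∫ τ in 0..S, ψ τ) (ψ t) t := fun t =>
    (hψ.integral_hasStrictDerivAt 0 t).hasDerivAt.sub_const _
  have hΦ : ContDiff ℝ 1 (fun t => (∫ τ in 0..t, ψ τ) - ∫ τ in 0..S, ψ τ) := by
    rw [contDiff_one_iff_deriv]
    refine ⟨fun t => (hΦd t).differentiableAt, ?_⟩
    rwa [funext fun t => (hΦd t).deriv]
  have h1 := (hΦ.contDiffOn (s := uIcc 0 S)).absolutelyContinuousOnInterval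
  have h2 := hh.absolutelyContinuousOnInterval_intervalIntegral (c := 0) left_mem_uIcc
  have h3 := h2.integral_mul_deriv_eq_deriv_mul h1
  have h4 : ∫ t in 0..S, (∫ τ in 0..t, h τ)
        * deriv (fun t => (∫ τ in 0..t, ψ τ) - ∫ τ in 0..S, ψ τ) t
      = ∫ t in 0..S, (∫ τ in 0..t, h τ) * ψ t := by
    simp_rw [fun t => (hΦd t).deriv]
  have h5 : ∫ t in 0..S, deriv (fun t => ∫ τ in 0..t, h τ) t
        * ((∫ τ in 0..t, ψ τ) - ∫ τ in 0..S, ψ τ)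
      = ∫ t in 0..S, h t * ((∫ τ in 0..t, ψ τ) - ∫ τ in 0..S, ψ τ) := by
    refine intervalIntegral.integral_congr_ae ?_
    filter_upwards [hh.ae_hasDerivAt_integral] with t ht hts
    rw [(ht (uIoc_subset_uIcc hts) 0 left_mem_uIcc).deriv]
  rw [h4, h5] at h3
  simp only [sub_self, mul_zero, intervalIntegral.integral_same, zero_mul, zero_sub] at h3
  linarith

/-- The weak form of `g' = -h`, `g 0 = c`. -/
theorem ae_eq_sub_integral_of_weak {g h : ℝ → ℝ} {c S : ℝ} (hS : 0 < S)
    (hg : IntegrableOn g (Ioo 0 S)) (hh : IntegrableOn h (Ioo 0 S))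
    (H : ∀ θ : ℝ → ℝ, ContDiff ℝ 1 θ → HasCompactSupport θ → tsupport θ ⊆ Iio S →
      (∫ t in Ioo 0 S, g t * deriv θ t) + c * θ 0 = ∫ t in Ioo 0 S, h t * θ t) :
    ∀ᵐ t ∂(volume.restrict (Ioo 0 S)), g t = c - ∫ τ in 0..t, h τ := by
  have hioc : ∀ f : ℝ → ℝ, ∫ t in Ioo 0 S, f t = ∫ t in 0..S, f t := fun f => by
    rw [intervalIntegral.integral_of_le hS.le, integral_Ioc_eq_integral_Ioo]
  have hgi : IntervalIntegrable g volume 0 S := by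
    rwa [intervalIntegrable_iff_integrableOn_Ioo_of_le hS.le]
  have hhi : IntervalIntegrable h volume 0 S := by
    rwa [intervalIntegrable_iff_integrableOn_Ioo_of_le hS.le]
  have hHc : ContinuousOn (fun t => ∫ τ in 0..t, h τ) (uIcc 0 S) :=
    intervalIntegral.continuousOn_primitive_interval' hhi left_mem_uIcc
  have hHi : IntervalIntegrable (fun t => ∫ τ in 0..t, h τ) volume 0 S := hHc.intervalIntegrable
  have hGi : IntervalIntegrable (fun t => g t - (c - ∫ τ in 0..t, h τ)) volume 0 S :=
    hgi.sub (intervalIntegrable_const.sub hHi)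
  have key : ∀ ψ : ℝ → ℝ, ContDiff ℝ ∞ ψ → HasCompactSupport ψ → tsupport ψ ⊆ Ioo 0 S →
      ∫ t, ψ t • (g t - (c - ∫ τ in 0..t, h τ)) = 0 := by
    intro ψ hψ hψc hψs
    have hψ0 : ∀ t, t ∉ Ioo 0 S → ψ t = 0 := fun t ht =>
      image_eq_zero_of_notMem_tsupport fun h => ht (hψs h)
    obtain ⟨b, hbS, hb0, hb⟩ : ∃ b < S, 0 < b ∧ ∀ t, b ≤ t → ψ t = 0 := by
      obtain ⟨b, hb1, hb2⟩ : ∃ b < S, tsupport ψ ⊆ Iio b := by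
        rcases (tsupport ψ).eq_empty_or_nonempty with h0 | h0
        · exact ⟨S / 2, by linarith, by rw [h0]; exact empty_subset _⟩
        · obtain ⟨m, hm, hm2⟩ := hψc.isCompact.exists_isGreatest h0
          have hmS := (hψs hm).2
          exact ⟨(m + S) / 2, by linarith, fun t ht => by
            have := hm2 ht
            simp only [mem_Iio]; linarith⟩
      refine ⟨max b (S / 2), by rw [max_lt_iff]; exact ⟨hb1, by linarith⟩,
        lt_max_of_lt_right (by linarith), fun t ht => ?_⟩
      refine image_eq_zero_of_notMem_tsupport fun h => ?_
      have h1 := hb2 h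
      simp only [mem_Iio] at h1
      linarith [le_max_left b (S / 2)]
    -- The primitive of `ψ` that vanishes near `S`. Its value at `0` is minus the integral of `ψ`,
    -- which brings the initial value `c` into the identity.
    set Φ : ℝ → ℝ := fun t => (∫ τ in 0..t, ψ τ) - ∫ τ in 0..S, ψ τ with hΦdef
    have hΦd : ∀ t, HasDerivAt Φ (ψ t) t := fun t =>
      (hψ.continuous.integral_hasStrictDerivAt 0 t).hasDerivAt.sub_const _
    have hΦ : ContDiff ℝ 1 Φ := by
      rw [contDiff_one_iff_deriv]
      refine ⟨fun t => (hΦd t).differentiableAt, ?_⟩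
      rw [funext fun t => (hΦd t).deriv]
      exact hψ.continuous
    have hΦb : ∀ t, b ≤ t → Φ t = 0 := by
      intro t ht
      have h1 : Φ t = ∫ τ in S..t, ψ τ := by
        simp only [hΦdef]
        exact intervalIntegral.integral_interval_sub_left (hψ.continuous.intervalIntegrable _ _)
          (hψ.continuous.intervalIntegrable _ _)
      rw [h1]
      refine (intervalIntegral.integral_congr (g := fun _ => 0) fun τ hτ => hb τ ?_).trans (by simp)
      rw [mem_uIcc] at hτ
      rcases hτ with h | h <;> linarith [h.1]
    -- Cut off at negative times only, to make the support compact; on `[0, S)` nothing changes.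
    let θ : ℝ → ℝ := fun t => Real.smoothTransition (t + 1) * Φ t
    have hχ : ContDiff ℝ 1 fun t : ℝ => Real.smoothTransition (t + 1) :=
      Real.smoothTransition.contDiff.comp (contDiff_id.add contDiff_const)
    have hθ : ContDiff ℝ 1 θ := hχ.mul hΦ
    have hθ0 : ∀ t, t ∉ Icc (-1) b → θ t = 0 := by
      intro t ht
      simp only [mem_Icc, not_and_or, not_le] at ht
      rcases ht with ht | ht
      · simp only [θ]
        rw [Real.smoothTransition.zero_of_nonpos (by linarith), zero_mul]
      · simp only [θ]
        rw [hΦb t ht.le, mul_zero]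
    have hθs : tsupport θ ⊆ Icc (-1) b :=
      closure_minimal (fun t ht => by by_contra h; exact ht (hθ0 t h)) isClosed_Icc
    have hθΦ : ∀ t, 0 ≤ t → θ t = Φ t := fun t ht => by
      simp only [θ]
      rw [Real.smoothTransition.one_of_one_le (by linarith), one_mul]
    have hθd : ∀ t ∈ Ioo 0 S, deriv θ t = ψ t := by
      intro t ht
      rw [← (hΦd t).deriv]
      refine Filter.EventuallyEq.deriv_eq ?_
      filter_upwards [Ioi_mem_nhds ht.1] with s hs using hθΦ s hs.le
    have h1 := H θ hθ (HasCompactSupport.of_support_subset_isCompact isCompact_Icc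
      (subset_closure.trans hθs)) fun t ht => lt_of_le_of_lt (hθs ht).2 hbS
    have h2 : ∫ t in Ioo 0 S, g t * deriv θ t = ∫ t in 0..S, g t * ψ t := by
      rw [← hioc]
      exact setIntegral_congr_fun measurableSet_Ioo fun t ht => by simp only [hθd t ht]
    have h3 : ∫ t in Ioo 0 S, h t * θ t = ∫ t in 0..S, h t * Φ t := by
      rw [← hioc]
      exact setIntegral_congr_fun measurableSet_Ioo fun t ht => by simp only [hθΦ t ht.1.le]
    have h4 : θ 0 = - ∫ t in 0..S, ψ t := by
      rw [hθΦ 0 le_rfl]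
      simp [hΦdef]
    have h5 := integral_primitive_mul hψ.continuous hhi
    have h6 : ∫ t, ψ t • (g t - (c - ∫ τ in 0..t, h τ))
        = ∫ t in 0..S, ψ t * (g t - (c - ∫ τ in 0..t, h τ)) := by
      rw [← hioc]
      refine (setIntegral_eq_integral_of_forall_compl_eq_zero fun t ht => ?_).symm
      rw [hψ0 t ht, zero_smul]
    have h7 : IntervalIntegrable (fun t => g t * ψ t) volume 0 S :=
      hgi.mul_continuousOn hψ.continuous.continuousOn
    have h8 : IntervalIntegrable (fun t => (∫ τ in 0..t, h τ) * ψ t) volume 0 S :=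
      hHi.mul_continuousOn hψ.continuous.continuousOn
    have h9 : IntervalIntegrable (fun t => c * ψ t) volume 0 S :=
      (hψ.continuous.intervalIntegrable _ _).const_mul c
    have h10 : ∀ t, ψ t * (g t - (c - ∫ τ in 0..t, h τ))
        = g t * ψ t - c * ψ t + (∫ τ in 0..t, h τ) * ψ t := fun t => by ring
    rw [h6]
    simp_rw [h10]
    rw [intervalIntegral.integral_add (h7.sub h9) h8, intervalIntegral.integral_sub h7 h9,
      intervalIntegral.integral_const_mul]
    rw [h2, h3, h4, h5] at h1
    linarith
  have hloc : LocallyIntegrableOn (fun t => g t - (c - ∫ τ in 0..t, h τ)) (Ioo 0 S) := by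
    refine IntegrableOn.locallyIntegrableOn ?_
    rwa [← intervalIntegrable_iff_integrableOn_Ioo_of_le hS.le]
  have h := isOpen_Ioo.ae_eq_zero_of_integral_contDiff_smul_eq_zero hloc key
  rw [ae_restrict_iff' measurableSet_Ioo]
  filter_upwards [h] with t ht hts
  linarith [ht hts]

variable {n d : ℕ} {B : Matrix (Fin n) (Fin n) ℝ} {T : Euc n →L[ℝ] Euc n} {Ω : Set (Euc d)}
  {uin : Euc d → Euc n} {μ : Kernel (Euc d × ℝ) (Phase n d)}

theorem integrable_bdd_mul_comp_fst {S : ℝ} {f : Euc d × ℝ → ℝ}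
    (hf : Integrable f ((volume.restrict Ω).prod (volume.restrict (Ioo 0 S)))) {φ : Euc d → ℝ}
    (hφ : Continuous φ) {C : ℝ} (hC : ∀ x, ‖φ x‖ ≤ C) :
    Integrable (fun z => f z * φ z.1) ((volume.restrict Ω).prod (volume.restrict (Ioo 0 S))) :=
  hf.mul_bdd (c := C) (hφ.comp continuous_fst).aestronglyMeasurable
    (Eventually.of_forall fun z => hC z.1)

namespace IsDissipativeMVSolution

variable (hμ : IsDissipativeMVSolution Ω B uin μ)
include hμ

theorem integrable_baryS (hΩ : volume Ω < ⊤) (S : ℝ) :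
    Integrable (fun z : Euc d × ℝ => baryS μ z.1 z.2)
      ((volume.restrict Ω).prod (volume.restrict (Ioo 0 S))) := by
  obtain ⟨C, hC, h⟩ := hμ.regularity_u
  refine ⟨hμ.stronglyMeasurable_baryS.aestronglyMeasurable, ?_⟩
  rw [HasFiniteIntegral, lintegral_prod_symm _ hμ.stronglyMeasurable_baryS.enorm.aemeasurable]
  have h1 : ∀ᵐ t ∂(volume.restrict (Ioo 0 S)), ∫⁻ x in Ω, ‖baryS μ x t‖ₑ
      ≤ C * volume Ω ^ (1 / (1 : ℝ≥0∞).toReal - 1 / (2 : ℝ≥0∞).toReal) := by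
    filter_upwards [ae_restrict_of_ae_restrict_of_subset Ioo_subset_Ioi_self h] with t ht
    have h2 := eLpNorm_le_eLpNorm_mul_rpow_measure_univ (p := 1) (q := 2) (by norm_num) ht.1
    rw [eLpNorm_one_eq_lintegral_enorm, Measure.restrict_apply_univ] at h2
    exact h2.trans (by gcongr; exact ht.2)
  refine (lintegral_mono_ae h1).trans_lt ?_
  rw [lintegral_const, Measure.restrict_apply_univ, Real.volume_Ioo]
  refine ENNReal.mul_lt_top (ENNReal.mul_lt_top hC (ENNReal.rpow_lt_top_of_nonneg ?_ hΩ.ne))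
    ENNReal.ofReal_lt_top
  norm_num

theorem integrable_flux (hΩ : volume Ω < ⊤) (hT : IsMatrixRoot B T) (S : ℝ) (i : Fin n)
    (k : Fin d) : Integrable (fun z : Euc d × ℝ => ∫ w, w.1 i * mulB B (w.2 k) i ∂(μ z))
      ((volume.restrict Ω).prod (volume.restrict (Ioo 0 S))) := by
  have := hμ.prob
  have hsub : (volume.restrict Ω).prod (volume.restrict (Ioo 0 S)) ≤ spaceTime Ω := by
    rw [spaceTime, Measure.prod_restrict, Measure.prod_restrict]
    exact Measure.restrict_mono (prod_mono_right Ioo_subset_Ioi_self) le_rfl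
  have hc : Continuous fun w : Phase n d => w.1 i * mulB B (w.2 k) i := by
    have := continuous_mulB (B := B)
    fun_prop
  refine Integrable.mono' (((integrable_euc_apply (hμ.integrable_baryS hΩ S) i).add
    ((hμ.integrable_dissipation hΩ hT).mono_measure hsub)).div_const 2)
    hc.stronglyMeasurable.integral_kernel.aestronglyMeasurable ?_
  filter_upwards [(Measure.absolutelyContinuous_of_le hsub).ae_le (hμ.ae_isRegularAt hΩ hT)]
    with z hz
  have h1 := hz.sq_flux_le i k
  have h2 := hT.integral_shannon_nonneg (m := μ z)
  have h3 := hz.integral_rao_nonneg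
  rw [Real.norm_eq_abs]
  refine le_half_add_of_sq_le (hz.bary_nonneg i) (by positivity) ?_
  rw [sq_abs]
  refine h1.trans (mul_le_mul_of_nonneg_left ?_ (hz.bary_nonneg i))
  linarith

theorem ae_weighted_component_eq (hΩ : volume Ω < ⊤) (hT : IsMatrixRoot B T) {φ : Euc d → ℝ}
    (hφ : ContDiff ℝ 1 φ) (hφc : HasCompactSupport φ) {S : ℝ} (hS : 0 < S) (i : Fin n) :
    IntegrableOn (fun t => ∑ k, ∫ x in Ω, (∫ w, w.1 i * mulB B (w.2 k) i ∂(μ (x, t)))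
        * fderiv ℝ φ x (EuclideanSpace.single k 1)) (Ioo 0 S) ∧
    ∀ᵐ t ∂(volume.restrict (Ioo 0 S)), ∫ x in Ω, baryS μ x t i * φ x
      = (∫ x in Ω, uin x i * φ x) - ∫ τ in 0..t, ∑ k, ∫ x in Ω,
        (∫ w, w.1 i * mulB B (w.2 k) i ∂(μ (x, τ)))
          * fderiv ℝ φ x (EuclideanSpace.single k 1) := by
  obtain ⟨C, hC⟩ := hφc.exists_bound_of_continuous hφ.continuous
  have hφd := fun k : Fin d => (hφ.continuous_fderiv (by simp)).clm_apply
    (continuous_const (y := EuclideanSpace.single k (1 : ℝ)))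
  have hCk : ∀ k : Fin d, ∃ C, ∀ x, ‖fderiv ℝ φ x (EuclideanSpace.single k 1)‖ ≤ C := fun k =>
    (hφc.fderiv_apply (𝕜 := ℝ) _).exists_bound_of_continuous (hφd k)
  choose Ck hCk using hCk
  have hui := integrable_bdd_mul_comp_fst (integrable_euc_apply (hμ.integrable_baryS hΩ S) i)
    hφ.continuous hC
  have hji := fun k => integrable_bdd_mul_comp_fst (hμ.integrable_flux hΩ hT S i k) (hφd k) (hCk k)
  have hh : IntegrableOn (fun t => ∑ k, ∫ x in Ω, (∫ w, w.1 i * mulB B (w.2 k) i ∂(μ (x, t)))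
      * fderiv ℝ φ x (EuclideanSpace.single k 1)) (Ioo 0 S) :=
    integrable_finsetSum _ fun k _ => (hji k).integral_prod_right
  refine ⟨hh, ae_eq_sub_integral_of_weak hS hui.integral_prod_right hh fun θ hθ hθc hθs => ?_⟩
  have hev := hμ.evolution i S hS (fun z => θ z.2 * φ z.1)
    ((hθ.comp contDiff_snd).mul (hφ.comp contDiff_fst)) ?_ ?_
  · have hfd : ∀ (x : Euc d) (t : ℝ) (y : Euc d × ℝ),
        fderiv ℝ (fun z : Euc d × ℝ => θ z.2 * φ z.1) (x, t) y
          = θ t * fderiv ℝ φ x y.1 + φ x * (y.2 * deriv θ t) := by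
      intro x t y
      have h1 : HasFDerivAt (fun z : Euc d × ℝ => θ z.2) _ (x, t) :=
        ((hθ.differentiable (by simp)) t).hasFDerivAt.comp (x, t) hasFDerivAt_snd
      have h2 : HasFDerivAt (fun z : Euc d × ℝ => φ z.1) _ (x, t) :=
        ((hφ.differentiable (by simp)) x).hasFDerivAt.comp (x, t) hasFDerivAt_fst
      have h3 : HasFDerivAt (fun z : Euc d × ℝ => θ z.2 * φ z.1) _ (x, t) := h1.mul h2
      rw [h3.fderiv]
      simp
    simp only [hfd, map_zero, mul_zero, zero_add, one_mul, zero_mul, add_zero] at hev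
    have e1 : ∀ t, ∫ x in Ω, baryS μ x t i * (φ x * deriv θ t)
        = (∫ x in Ω, baryS μ x t i * φ x) * deriv θ t := by
      intro t
      rw [← integral_mul_const]
      congr 1
      funext x
      ring
    have e2 : ∫ x in Ω, uin x i * (θ 0 * φ x) = (∫ x in Ω, uin x i * φ x) * θ 0 := by
      rw [← integral_mul_const]
      congr 1
      funext x
      ring
    have e3 : ∀ᵐ t ∂(volume.restrict (Ioo 0 S)),
        ∫ x in Ω, ∑ k, (∫ w, w.1 i * mulB B (w.2 k) i ∂(μ (x, t)))
            * (θ t * fderiv ℝ φ x (EuclideanSpace.single k 1))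
          = (∑ k, ∫ x in Ω, (∫ w, w.1 i * mulB B (w.2 k) i ∂(μ (x, t)))
            * fderiv ℝ φ x (EuclideanSpace.single k 1)) * θ t := by
      filter_upwards [ae_all_iff.2 fun k => (hji k).prod_left_ae] with t ht
      rw [← integral_finsetSum _ fun k _ => ht k, ← integral_mul_const]
      congr 1
      funext x
      rw [Finset.sum_mul]
      exact Finset.sum_congr rfl fun k _ => by ring
    rw [integral_congr_ae e3] at hev
    simp only [e1, e2] at hev
    exact hev
  · refine HasCompactSupport.intro (hφc.isCompact.prod hθc.isCompact) fun z hz => ?_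
    by_contra h
    exact hz ⟨subset_tsupport _ fun h0 => h (by simp [h0]),
      subset_tsupport _ fun h0 => h (by simp [h0])⟩
  · have h1 : tsupport (fun z : Euc d × ℝ => θ z.2 * φ z.1) ⊆ univ ×ˢ tsupport θ := by
      refine closure_minimal (fun z hz => ⟨trivial, subset_tsupport _ fun h0 => hz ?_⟩)
        (isClosed_univ.prod (isClosed_tsupport θ))
      simp only [h0, zero_mul]
    exact h1.trans (prod_mono_right hθs)

/-- The evolution of weighted integrals of `T u`. -/
theorem ae_weighted_integral_eq (hΩ : volume Ω < ⊤) (hT : IsMatrixRoot B T) {φ : Euc d → ℝ}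
    (hφ : ContDiff ℝ 1 φ) (hφc : HasCompactSupport φ) {S : ℝ} (hS : 0 < S) :
    IntegrableOn (fun t => ∑ k, ∫ x in Ω, fderiv ℝ φ x (EuclideanSpace.single k 1) •
        rootFlux B T (μ (x, t)) k) (Ioo 0 S) ∧
    ∀ᵐ t ∂(volume.restrict (Ioo 0 S)), ∫ x in Ω, φ x • T (baryS μ x t)
      = (∫ x in Ω, φ x • T (uin x)) - ∫ τ in 0..t, ∑ k, ∫ x in Ω,
        fderiv ℝ φ x (EuclideanSpace.single k 1) • rootFlux B T (μ (x, τ)) k := by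
  have hcomp := fun i => hμ.ae_weighted_component_eq hΩ hT hφ hφc hS i
  obtain ⟨C, hC⟩ := hφc.exists_bound_of_continuous hφ.continuous
  have hφd := fun k : Fin d => (hφ.continuous_fderiv (by simp)).clm_apply
    (continuous_const (y := EuclideanSpace.single k (1 : ℝ)))
  have hCk : ∀ k : Fin d, ∃ C, ∀ x, ‖fderiv ℝ φ x (EuclideanSpace.single k 1)‖ ≤ C := fun k =>
    (hφc.fderiv_apply (𝕜 := ℝ) _).exists_bound_of_continuous (hφd k)
  choose Ck hCk using hCk
  have hwsum : ∀ w : Euc d → Euc n, IntegrableOn w Ω → ∫ x in Ω, φ x • T (w x)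
      = ∑ i, (∫ x in Ω, w x i * φ x) • T (EuclideanSpace.single i 1) := by
    intro w hw
    have h1 : ∀ i, IntegrableOn (fun x => w x i * φ x) Ω := fun i =>
      (integrable_euc_apply hw i).mul_bdd (c := C) hφ.continuous.aestronglyMeasurable
        (Eventually.of_forall hC)
    simp_rw [← integral_smul_const]
    rw [← integral_finsetSum _ fun i _ => (h1 i).smul_const _]
    congr 1
    funext x
    rw [clm_apply_eq_sum T (w x), Finset.smul_sum]
    exact Finset.sum_congr rfl fun i _ => by rw [smul_smul, mul_comm]
  have hflux : ∀ᵐ t ∂(volume.restrict (Ioo 0 S)), ∑ k, ∫ x in Ω,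
      fderiv ℝ φ x (EuclideanSpace.single k 1) • rootFlux B T (μ (x, t)) k
      = ∑ i, (∑ k, ∫ x in Ω, (∫ w, w.1 i * mulB B (w.2 k) i ∂(μ (x, t)))
        * fderiv ℝ φ x (EuclideanSpace.single k 1)) • T (EuclideanSpace.single i 1) := by
    filter_upwards [ae_all_iff.2 fun i => ae_all_iff.2 fun k => (integrable_bdd_mul_comp_fst
      (hμ.integrable_flux hΩ hT S i k) (hφd k) (hCk k)).prod_left_ae] with t ht
    simp_rw [Finset.sum_smul]
    rw [Finset.sum_comm]
    refine Finset.sum_congr rfl fun k _ => ?_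
    simp_rw [← integral_smul_const]
    rw [← integral_finsetSum _ fun i _ => (ht i k).smul_const _]
    congr 1
    funext x
    rw [rootFlux, Finset.smul_sum]
    exact Finset.sum_congr rfl fun i _ => by rw [smul_smul, mul_comm]
  have hint : IntegrableOn (fun t => ∑ i, (∑ k, ∫ x in Ω,
      (∫ w, w.1 i * mulB B (w.2 k) i ∂(μ (x, t))) * fderiv ℝ φ x (EuclideanSpace.single k 1))
        • T (EuclideanSpace.single i 1)) (Ioo 0 S) :=
    integrable_finsetSum _ fun i _ => (hcomp i).1.smul_const _
  refine ⟨hint.congr (by filter_upwards [hflux] with t ht using ht.symm), ?_⟩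
  have : IsFiniteMeasure (volume.restrict Ω) := ⟨by simpa using hΩ⟩
  filter_upwards [ae_all_iff.2 fun i => (hcomp i).2, ae_restrict_mem measurableSet_Ioo,
    ae_restrict_of_ae_restrict_of_subset Ioo_subset_Ioi_self hμ.ae_memLp_baryS] with t ht htS htu
  rw [hwsum _ (htu.integrable (by norm_num)), hwsum _ (hμ.uin_memLp.integrable (by norm_num))]
  have h0 : ∫ τ in 0..t, ∑ k, ∫ x in Ω,
      fderiv ℝ φ x (EuclideanSpace.single k 1) • rootFlux B T (μ (x, τ)) k
      = ∫ τ in 0..t, ∑ i, (∑ k, ∫ x in Ω, (∫ w, w.1 i * mulB B (w.2 k) i ∂(μ (x, τ)))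
        * fderiv ℝ φ x (EuclideanSpace.single k 1)) • T (EuclideanSpace.single i 1) := by
    rw [intervalIntegral.integral_of_le htS.1.le, intervalIntegral.integral_of_le htS.1.le]
    refine integral_congr_ae (ae_restrict_of_ae_restrict_of_subset ?_ hflux)
    exact fun s hs => ⟨hs.1, hs.2.trans_lt htS.2⟩
  have h1 : ∀ i, IntervalIntegrable (fun τ => ∑ k, ∫ x in Ω,
      (∫ w, w.1 i * mulB B (w.2 k) i ∂(μ (x, τ))) * fderiv ℝ φ x (EuclideanSpace.single k 1))
      volume 0 t := fun i => by
    rw [intervalIntegrable_iff_integrableOn_Ioo_of_le htS.1.le]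
    exact (hcomp i).1.mono_set (Ioo_subset_Ioo_right htS.2.le)
  rw [h0, intervalIntegral.integral_finsetSum fun i _ =>
    ⟨(h1 i).1.smul_const _, (h1 i).2.smul_const _⟩,
    ← Finset.sum_sub_distrib]
  refine Finset.sum_congr rfl fun i _ => ?_
  rw [intervalIntegral.integral_smul_const, ht i, sub_smul]

end IsDissipativeMVSolution

end TimeEvolution


/-! ### Oscillation around weighted means -/

section MeanOscillation

variable {X ι : Type*} [NormedAddCommGroup X] [InnerProductSpace ℝ X] [FiniteDimensional ℝ X]
  [Fintype ι] {d : ℕ} {Ω : Set (Euc d)}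

/-- Expand the square around the weighted mean: the cross term integrates to zero and the variance
is nonnegative. -/
theorem mass_mul_norm_weightedMean_sub_le {φ : Euc d → ℝ} {ζ : Euc d → X}
    (hφm : Measurable φ) (hφ0 : ∀ x, 0 ≤ φ x) {M : ℝ} (hφM : ∀ᵐ x ∂(volume.restrict Ω), φ x ≤ M)
    (hφi : 0 < ∫ x in Ω, φ x) (hΩ : volume Ω < ⊤) (hζ : MemLp ζ 2 (volume.restrict Ω)) (z : X) :
    (∫ x in Ω, φ x) * ‖weightedMean Ω φ ζ - z‖ ^ 2 ≤ ∫ x in Ω, φ x * ‖ζ x - z‖ ^ 2 := by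
  have : IsFiniteMeasure (volume.restrict Ω) := ⟨by simpa using hΩ⟩
  set m := ∫ x in Ω, φ x with hm
  set c := weightedMean Ω φ ζ with hc
  have hbd : ∀ᵐ x ∂(volume.restrict Ω), ‖φ x‖ ≤ M := by
    filter_upwards [hφM] with x hx
    rwa [Real.norm_of_nonneg (hφ0 x)]
  have hsm : ∀ {g : Euc d → X}, IntegrableOn g Ω → IntegrableOn (fun x => φ x • g x) Ω :=
    fun hg => hg.bdd_smul M hφm.aestronglyMeasurable hbd
  have hsm' : ∀ {g : Euc d → ℝ}, IntegrableOn g Ω → IntegrableOn (fun x => φ x * g x) Ω :=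
    fun hg => hg.bdd_mul hφm.aestronglyMeasurable hbd
  have hζi : IntegrableOn ζ Ω := hζ.integrable (by norm_num)
  have hsq : ∀ w : X, IntegrableOn (fun x => ‖ζ x - w‖ ^ 2) Ω := fun w =>
    integrable_norm_sq_of_memLp_two (hζ.sub (memLp_const w))
  have hmc : m • c = ∫ x in Ω, φ x • ζ x := by
    rw [hc, weightedMean, smul_smul, mul_inv_cancel₀ hφi.ne', one_smul]
  have h0 : ∫ x in Ω, φ x • (ζ x - c) = 0 := by
    simp_rw [smul_sub]
    rw [integral_sub (hsm hζi) (hsm (integrable_const c)), integral_smul_const, ← hmc, sub_self]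
  have hcr : IntegrableOn (fun x => φ x * (2 * inner ℝ (c - z) (ζ x - c))) Ω :=
    hsm' (((hζi.sub (integrable_const c)).const_inner (c - z)).const_mul 2)
  have hcross : ∫ x in Ω, φ x * (2 * inner ℝ (c - z) (ζ x - c)) = 0 := by
    have h1 : ∀ x, φ x * (2 * inner ℝ (c - z) (ζ x - c))
        = 2 * inner ℝ (c - z) (φ x • (ζ x - c)) := fun x => by rw [real_inner_smul_right]; ring
    simp_rw [h1]
    have h2 : IntegrableOn (fun x => φ x • (ζ x - c)) Ω := hsm (hζi.sub (integrable_const c))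
    rw [integral_const_mul, integral_inner h2, h0,
      inner_zero_right, mul_zero]
  have hexp : ∀ x, φ x * ‖ζ x - z‖ ^ 2 = φ x * ‖ζ x - c‖ ^ 2
      + φ x * (2 * inner ℝ (c - z) (ζ x - c)) + φ x * ‖c - z‖ ^ 2 := by
    intro x
    have h1 : ζ x - z = (ζ x - c) + (c - z) := by abel
    rw [h1, norm_add_sq_real, real_inner_comm]
    ring
  have h2 : IntegrableOn (fun x => φ x * ‖ζ x - c‖ ^ 2 + φ x * (2 * inner ℝ (c - z) (ζ x - c))) Ω :=
    (hsm' (hsq c)).add hcr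
  simp_rw [hexp]
  rw [integral_add h2 (hsm' (integrable_const _)), integral_add (hsm' (hsq c)) hcr, hcross,
    integral_mul_const, ← hm, add_zero]
  have : 0 ≤ ∫ x in Ω, φ x * ‖ζ x - c‖ ^ 2 :=
    integral_nonneg fun x => mul_nonneg (hφ0 x) (sq_nonneg _)
  linarith

theorem ofReal_mass_mul_le_lintegral {φ : Euc d → ℝ} {ζ : Euc d → X}
    (hφm : Measurable φ) (hφ0 : ∀ x, 0 ≤ φ x) {M : ℝ} (hφM : ∀ᵐ x ∂(volume.restrict Ω), φ x ≤ M)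
    (hφi : 0 < ∫ x in Ω, φ x) (hΩ : volume Ω < ⊤) (hζ : MemLp ζ 2 (volume.restrict Ω)) (z : X) :
    ENNReal.ofReal ((∫ x in Ω, φ x) * ‖weightedMean Ω φ ζ - z‖ ^ 2)
      ≤ ∫⁻ x in Ω, ENNReal.ofReal (φ x) * ‖ζ x - z‖ₑ ^ 2 := by
  have : IsFiniteMeasure (volume.restrict Ω) := ⟨by simpa using hΩ⟩
  refine (ENNReal.ofReal_le_ofReal
    (mass_mul_norm_weightedMean_sub_le hφm hφ0 hφM hφi hΩ hζ z)).trans (le_of_eq ?_)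
  rw [ofReal_integral_eq_lintegral_ofReal]
  · refine lintegral_congr fun x => ?_
    rw [ENNReal.ofReal_mul (hφ0 x), ENNReal.ofReal_pow (norm_nonneg _), ofReal_norm]
  · refine (integrable_norm_sq_of_memLp_two (hζ.sub (memLp_const z))).bdd_mul (c := M)
      hφm.aestronglyMeasurable ?_
    filter_upwards [hφM] with x hx
    rwa [Real.norm_of_nonneg (hφ0 x)]
  · exact Eventually.of_forall fun x => mul_nonneg (hφ0 x) (sq_nonneg _)

theorem IsFluxState.lintegral_gradient_le {v : ι → X} {K : ℝ} {ζ : Euc d → X}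
    {Y : Fin d → Euc d → X} {D : Euc d → ℝ} {J : Fin d → Euc d → X}
    (h : IsFluxState Ω v K ζ Y D J) {A : Set (Euc d)} (hA : A ⊆ Ω) :
    ∫⁻ x in A, ∑ k, ‖fderiv ℝ (fun z : X => z) (ζ x) (Y k x)‖ₑ ^ 2
      ≤ ENNReal.ofReal (∫ x in A, D x) := by
  rw [ofReal_integral_eq_lintegral_ofReal (h.integrable_dissipation.mono_set hA)]
  · refine lintegral_mono_ae ?_
    filter_upwards [ae_restrict_of_ae_restrict_of_subset hA h.adm] with x hx
    calc _ = ENNReal.ofReal (∑ k, ‖Y k x‖ ^ 2) := by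
          rw [ENNReal.ofReal_sum_of_nonneg fun k _ => by positivity]
          refine Finset.sum_congr rfl fun k _ => ?_
          rw [ENNReal.ofReal_pow (norm_nonneg _), ofReal_norm]
          simp
      _ ≤ _ := ENNReal.ofReal_le_ofReal hx.sum_le
  · filter_upwards [ae_restrict_of_ae_restrict_of_subset hA h.adm] with x hx using hx.nonneg

/-- The Wirtinger inequality for flux states. -/
theorem exists_lintegral_sub_mean_le (hd : 1 ≤ d) (hΩ : IsBoundedLipschitzDomain Ω) (v : ι → X)
    (K : ℝ) : ∃ C : ℝ, 0 ≤ C ∧ ∀ ζ Y D J, IsFluxState Ω v K ζ Y D J →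
      MemLp ζ 2 (volume.restrict Ω) → ∫⁻ x in Ω, ‖ζ x - weightedMean Ω (fun _ => 1) ζ‖ₑ ^ 2
        ≤ ENNReal.ofReal (C * ∫ x in Ω, D x) := by
  obtain ⟨C, hC, hpoin⟩ := hΩ.exists_poincare X hd
  have hfin : volume Ω < ⊤ := hΩ.isBounded.measure_lt_top
  have hpos : 0 < volume Ω := hΩ.isOpen.measure_pos _ hΩ.isConnected.nonempty
  have : IsFiniteMeasure (volume.restrict Ω) := ⟨by simpa using hfin⟩
  have hv : 0 < (volume Ω).toReal := ENNReal.toReal_pos hpos.ne' hfin.ne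
  refine ⟨(volume Ω).toReal⁻¹ * C.toReal, by positivity, fun ζ Y D J hst hζ => ?_⟩
  have h1 := hpoin ζ _ hst.stronglyMeasurable (hst.transEst _ contDiff_id)
  have hone : ∫ x in Ω, (1 : ℝ) = (volume Ω).toReal := by simp [Measure.real]
  have h2 : ∀ x, ENNReal.ofReal (volume Ω).toReal * ‖ζ x - weightedMean Ω (fun _ => 1) ζ‖ₑ ^ 2
      ≤ ∫⁻ y in Ω, ‖ζ x - ζ y‖ₑ ^ 2 := by
    intro x
    have h3 := ofReal_mass_mul_le_lintegral (φ := fun _ => 1) measurable_const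
      (fun _ => zero_le_one) (M := 1) (Eventually.of_forall fun _ => le_rfl) (by rwa [hone]) hfin
      hζ (ζ x)
    rw [hone, ENNReal.ofReal_mul hv.le, ENNReal.ofReal_pow (norm_nonneg _), ofReal_norm,
      enorm_sub_rev] at h3
    refine h3.trans (le_of_eq (lintegral_congr fun y => ?_))
    rw [ENNReal.ofReal_one, one_mul, enorm_sub_rev]
  have h4 : ENNReal.ofReal (volume Ω).toReal * ∫⁻ x in Ω, ‖ζ x - weightedMean Ω (fun _ => 1) ζ‖ₑ ^ 2
      ≤ C * ENNReal.ofReal (∫ x in Ω, D x) := by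
    rw [← lintegral_const_mul' _ _ ENNReal.ofReal_ne_top]
    refine (lintegral_mono h2).trans (h1.trans ?_)
    gcongr
    exact hst.lintegral_gradient_le subset_rfl
  rw [mul_assoc, ENNReal.ofReal_mul (by positivity), ENNReal.ofReal_mul (by positivity),
    ENNReal.ofReal_toReal hC, ENNReal.ofReal_inv_of_pos hv]
  rwa [← ENNReal.mul_le_iff_le_inv (by simpa using hv) ENNReal.ofReal_ne_top]

/-- The oscillation around the means of a partition of unity at the scale `ε`. -/
theorem exists_sum_lintegral_sub_weightedMean_le (hd : 1 ≤ d) (hΩ : IsBoundedLipschitzDomain Ω)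
    (v : ι → X) (K : ℝ) {Cφ : ℝ} (hCφ : 0 ≤ Cφ) :
    ∃ ε₀ C : ℝ, 0 < ε₀ ∧ 0 ≤ C ∧ ∀ (ε : ℝ) (Z : Finset (Euc d)) (φ : Euc d → Euc d → ℝ),
      0 < ε → ε ≤ ε₀ → IsPartition Ω ε Cφ Z φ → ∀ ζ Y D J, IsFluxState Ω v K ζ Y D J →
      MemLp ζ 2 (volume.restrict Ω) →
      ∑ a ∈ Z, ∫⁻ x in Ω, ENNReal.ofReal (φ a x) * ‖ζ x - weightedMean Ω (φ a) ζ‖ₑ ^ 2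
        ≤ ENNReal.ofReal (C * ε ^ 2 * ∫ x in Ω, D x) := by
  obtain ⟨ε₀, R, Cp, hε₀, hR, hCp, hloc⟩ := hΩ.exists_local_poincare X hd
  refine ⟨ε₀ / 2, Cφ * (Cp.toReal * 2 ^ (d + 2)) * (2 * (R * 2) + 1) ^ d, by positivity,
    by positivity, ?_⟩
  intro ε Z φ hε hεε hφ ζ Y D J hst hζ
  have hfin : volume Ω < ⊤ := hΩ.isBounded.measure_lt_top
  have hball : ∀ (b : Euc d) (r : ℝ), MeasurableSet (Metric.ball b r) := fun b r =>
    Metric.isOpen_ball.measurableSet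
  have hD0 : ∀ᵐ x ∂(volume.restrict Ω), 0 ≤ D x := by
    filter_upwards [hst.adm] with x hx using hx.nonneg
  have hDb : ∀ b r, 0 ≤ ∫ x in Ω ∩ Metric.ball b r, D x := fun b r =>
    integral_nonneg_of_ae (ae_restrict_of_ae_restrict_of_subset inter_subset_left hD0)
  have hcut : ∀ a ∈ Z, ∀ f : Euc d → ℝ≥0∞, ∫⁻ x in Ω, ENNReal.ofReal (φ a x) * f x
      ≤ ∫⁻ x in Ω ∩ Metric.ball a (2 * ε), f x := by
    intro a ha f
    rw [inter_comm, ← Measure.restrict_restrict (hball a _), ← lintegral_indicator (hball a _)]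
    refine lintegral_mono_ae ?_
    filter_upwards [ae_restrict_mem hΩ.isOpen.measurableSet] with x hx
    by_cases hxa : x ∈ Metric.ball a (2 * ε)
    · rw [indicator_of_mem hxa]
      calc _ ≤ 1 * f x := by
            gcongr
            exact ENNReal.ofReal_le_one.2 (hφ.le_one ha hx)
        _ = f x := one_mul _
    · rw [hφ.support a x (by simpa [Metric.mem_ball] using hxa)]
      simp
  have hterm : ∀ a ∈ Z, ∫⁻ x in Ω, ENNReal.ofReal (φ a x) * ‖ζ x - weightedMean Ω (φ a) ζ‖ₑ ^ 2
      ≤ ENNReal.ofReal (Cφ * (Cp.toReal * 2 ^ (d + 2)) * ε ^ 2 *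
          ∫ x in Ω ∩ Metric.ball a (R * 2 * ε), D x) := by
    intro a ha
    have hm := hφ.mass_pos hε hCφ ha
    have hmass := hφ.mass a ha
    set m := ∫ x in Ω, φ a x with hmdef
    have hle : ∀ᵐ y ∂(volume.restrict Ω), φ a y ≤ 1 := by
      filter_upwards [ae_restrict_mem hΩ.isOpen.measurableSet] with y hy
      exact hφ.le_one ha hy
    refine (hcut a ha _).trans ?_
    -- Jensen's inequality replaces the mean by an average over `y`, which produces the double
    -- integral of the local Poincaré inequality. The mass in the denominator is at least of order
    -- `ε ^ d`, so a factor `ε ^ 2` is left.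
    have h2 : ∀ x, ‖ζ x - weightedMean Ω (φ a) ζ‖ₑ ^ 2
        ≤ ENNReal.ofReal m⁻¹ * ∫⁻ y in Ω ∩ Metric.ball a (2 * ε), ‖ζ x - ζ y‖ₑ ^ 2 := by
      intro x
      have h3 := ofReal_mass_mul_le_lintegral (hφ.contDiff a).continuous.measurable (hφ.nonneg a)
        hle hm hfin hζ (ζ x)
      rw [ENNReal.ofReal_mul hm.le, ENNReal.ofReal_pow (norm_nonneg _), ofReal_norm,
        enorm_sub_rev] at h3
      rw [ENNReal.ofReal_inv_of_pos hm, ← ENNReal.mul_le_iff_le_inv (by simpa using hm)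
        ENNReal.ofReal_ne_top]
      refine h3.trans ((hcut a ha _).trans (le_of_eq (lintegral_congr fun y => ?_)))
      rw [enorm_sub_rev]
    calc ∫⁻ x in Ω ∩ Metric.ball a (2 * ε), ‖ζ x - weightedMean Ω (φ a) ζ‖ₑ ^ 2
        ≤ ENNReal.ofReal m⁻¹ * ∫⁻ x in Ω ∩ Metric.ball a (2 * ε),
            ∫⁻ y in Ω ∩ Metric.ball a (2 * ε), ‖ζ x - ζ y‖ₑ ^ 2 := by
          rw [← lintegral_const_mul' _ _ ENNReal.ofReal_ne_top]
          exact lintegral_mono h2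
      _ ≤ ENNReal.ofReal m⁻¹ * (Cp * ENNReal.ofReal ((2 * ε) ^ (d + 2)) *
            ENNReal.ofReal (∫ x in Ω ∩ Metric.ball a (R * 2 * ε), D x)) := by
          gcongr
          refine (hloc a (hφ.mem a ha) (2 * ε) (by positivity) (by linarith) ζ _
            hst.stronglyMeasurable (hst.transEst _ contDiff_id)).trans ?_
          rw [← mul_assoc R]
          gcongr
          exact hst.lintegral_gradient_le inter_subset_left
      _ = ENNReal.ofReal (m⁻¹ * (Cp.toReal * (2 * ε) ^ (d + 2) *
            ∫ x in Ω ∩ Metric.ball a (R * 2 * ε), D x)) := by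
          rw [ENNReal.ofReal_mul (by positivity), ENNReal.ofReal_mul (by positivity),
            ENNReal.ofReal_mul (by positivity), ENNReal.ofReal_toReal hCp]
      _ ≤ _ := by
          refine ENNReal.ofReal_le_ofReal ?_
          have := hDb a (R * 2 * ε)
          calc _ = ε ^ d / m * (Cp.toReal * 2 ^ (d + 2) * ε ^ 2 *
                ∫ x in Ω ∩ Metric.ball a (R * 2 * ε), D x) := by
                rw [mul_pow, pow_add ε]; field_simp
            _ ≤ Cφ * (Cp.toReal * 2 ^ (d + 2) * ε ^ 2 *
                ∫ x in Ω ∩ Metric.ball a (R * 2 * ε), D x) := by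
                gcongr
                rwa [div_le_iff₀ hm]
            _ = _ := by ring
  calc _ ≤ ∑ a ∈ Z, ENNReal.ofReal (Cφ * (Cp.toReal * 2 ^ (d + 2)) * ε ^ 2 *
          ∫ x in Ω ∩ Metric.ball a (R * 2 * ε), D x) := Finset.sum_le_sum hterm
    _ = ENNReal.ofReal (Cφ * (Cp.toReal * 2 ^ (d + 2)) * ε ^ 2 *
          ∑ a ∈ Z, ∫ x in Ω ∩ Metric.ball a (R * 2 * ε), D x) := by
        rw [← ENNReal.ofReal_sum_of_nonneg fun a _ => mul_nonneg (by positivity) (hDb _ _),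
          Finset.mul_sum]
    _ ≤ _ := by
        refine ENNReal.ofReal_le_ofReal ?_
        have h9 := sum_integral_inter_ball_le hε (by linarith : 0 ≤ R * 2) hφ.separated
          hst.integrable_dissipation hD0
        calc _ ≤ Cφ * (Cp.toReal * 2 ^ (d + 2)) * ε ^ 2 *
              ((2 * (R * 2) + 1) ^ d * ∫ x in Ω, D x) := by gcongr
          _ = _ := by ring

/-- Comparison of the deviation from `z` with that of the means. -/
theorem IsPartition.lintegral_enorm_sub_le {X : Type*} [NormedAddCommGroup X] [NormedSpace ℝ X]
    {ε C : ℝ} {Z : Finset (Euc d)}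
    {φ : Euc d → Euc d → ℝ} (hφ : IsPartition Ω ε C Z φ) (hΩ : MeasurableSet Ω)
    (hfin : volume Ω < ⊤) {ζ : Euc d → X} (hζm : StronglyMeasurable ζ) (z : X) :
    ∫⁻ x in Ω, ‖ζ x - z‖ₑ ^ 2
      ≤ 2 * ((∑ a ∈ Z, ∫⁻ x in Ω, ENNReal.ofReal (φ a x) * ‖ζ x - weightedMean Ω (φ a) ζ‖ₑ ^ 2)
        + ENNReal.ofReal (∑ a ∈ Z, (∫ x in Ω, φ a x) * ‖weightedMean Ω (φ a) ζ - z‖ ^ 2)) := by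
  have : IsFiniteMeasure (volume.restrict Ω) := ⟨by simpa using hfin⟩
  have hm : ∀ a, Measurable fun x => ENNReal.ofReal (φ a x) := fun a =>
    (hφ.contDiff a).continuous.measurable.ennreal_ofReal
  have hm2 : ∀ a,
      Measurable fun x => ENNReal.ofReal (φ a x) * ‖ζ x - weightedMean Ω (φ a) ζ‖ₑ ^ 2 :=
    fun a => (hm a).mul ((hζm.sub stronglyMeasurable_const).enorm.pow_const 2)
  have hpt : ∀ᵐ x ∂(volume.restrict Ω), ‖ζ x - z‖ₑ ^ 2 ≤
      2 * ((∑ a ∈ Z, ENNReal.ofReal (φ a x) * ‖ζ x - weightedMean Ω (φ a) ζ‖ₑ ^ 2)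
        + ∑ a ∈ Z, ENNReal.ofReal (φ a x) * ‖weightedMean Ω (φ a) ζ - z‖ₑ ^ 2) := by
    filter_upwards [ae_restrict_mem hΩ] with x hx
    have h1 : ∑ a ∈ Z, ENNReal.ofReal (φ a x) = 1 := by
      rw [← ENNReal.ofReal_sum_of_nonneg fun a _ => hφ.nonneg a x, hφ.sum_eq_one x hx,
        ENNReal.ofReal_one]
    calc ‖ζ x - z‖ₑ ^ 2 = ∑ a ∈ Z, ENNReal.ofReal (φ a x) * ‖ζ x - z‖ₑ ^ 2 := by
          rw [← Finset.sum_mul, h1, one_mul]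
      _ ≤ ∑ a ∈ Z, ENNReal.ofReal (φ a x) * (2 * (‖ζ x - weightedMean Ω (φ a) ζ‖ₑ ^ 2
            + ‖weightedMean Ω (φ a) ζ - z‖ₑ ^ 2)) := by
          gcongr
          exact enorm_sub_sq_le_two _ _ _
      _ = _ := by
          rw [← Finset.sum_add_distrib, Finset.mul_sum]
          exact Finset.sum_congr rfl fun a _ => by ring
  refine (lintegral_mono_ae hpt).trans (le_of_eq ?_)
  rw [lintegral_const_mul' _ _ (by simp), lintegral_add_left
    (Finset.measurable_fun_sum _ fun a _ => hm2 a), lintegral_finsetSum _ fun a _ => hm2 a,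
    lintegral_finsetSum _ fun a _ => (hm a).mul_const _]
  congr 2
  rw [ENNReal.ofReal_sum_of_nonneg fun a _ => mul_nonneg
    (integral_nonneg fun x => hφ.nonneg a x) (sq_nonneg _)]
  refine Finset.sum_congr rfl fun a ha => ?_
  rw [lintegral_mul_const _ (hm a), ENNReal.ofReal_mul (integral_nonneg fun x => hφ.nonneg a x),
    ENNReal.ofReal_pow (norm_nonneg _), ofReal_norm, ofReal_integral_eq_lintegral_ofReal]
  · refine Integrable.of_bound (C := 1) (hφ.contDiff a).continuous.aestronglyMeasurable ?_
    filter_upwards [ae_restrict_mem hΩ] with x hx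
    rw [Real.norm_of_nonneg (hφ.nonneg a x)]
    exact hφ.le_one ha hx
  · exact Eventually.of_forall fun x => hφ.nonneg a x

/-- Jensen's inequality for each weight; the weights sum to one on `Ω`. -/
theorem IsPartition.sum_mass_mul_le {ε C : ℝ} {Z : Finset (Euc d)}
    {φ : Euc d → Euc d → ℝ} (hφ : IsPartition Ω ε C Z φ) (hε : 0 < ε) (hC : 0 ≤ C)
    (hΩ : MeasurableSet Ω) (hfin : volume Ω < ⊤) {ζ : Euc d → X} (hζm : StronglyMeasurable ζ)
    (hζ : MemLp ζ 2 (volume.restrict Ω)) (z : X) :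
    ENNReal.ofReal (∑ a ∈ Z, (∫ x in Ω, φ a x) * ‖weightedMean Ω (φ a) ζ - z‖ ^ 2)
      ≤ ∫⁻ x in Ω, ‖ζ x - z‖ₑ ^ 2 := by
  have hm : ∀ a, Measurable fun x => ENNReal.ofReal (φ a x) := fun a =>
    (hφ.contDiff a).continuous.measurable.ennreal_ofReal
  rw [ENNReal.ofReal_sum_of_nonneg fun a _ => mul_nonneg
    (integral_nonneg fun x => hφ.nonneg a x) (sq_nonneg _)]
  calc _ ≤ ∑ a ∈ Z, ∫⁻ x in Ω, ENNReal.ofReal (φ a x) * ‖ζ x - z‖ₑ ^ 2 :=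
        Finset.sum_le_sum fun a ha => ofReal_mass_mul_le_lintegral
          (hφ.contDiff a).continuous.measurable (hφ.nonneg a) (M := 1)
          (by filter_upwards [ae_restrict_mem hΩ] with y hy using hφ.le_one ha hy)
          (hφ.mass_pos hε hC ha) hfin hζ z
    _ = ∫⁻ x in Ω, ∑ a ∈ Z, ENNReal.ofReal (φ a x) * ‖ζ x - z‖ₑ ^ 2 :=
        (lintegral_finsetSum _ fun a _ =>
          (hm a).mul ((hζm.sub stronglyMeasurable_const).enorm.pow_const 2)).symm
    _ = _ := by
        refine lintegral_congr_ae ?_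
        filter_upwards [ae_restrict_mem hΩ] with x hx
        rw [← Finset.sum_mul, ← ENNReal.ofReal_sum_of_nonneg fun a _ => hφ.nonneg a x,
          hφ.sum_eq_one x hx, ENNReal.ofReal_one, one_mul]

end MeanOscillation


/-! ### Conservation of mass and the discretized energy inequality -/

section FluxEvolution

theorem one_le_infty : (1 : WithTop ℕ∞) ≤ ((⊤ : ℕ∞) : WithTop ℕ∞) :=
  WithTop.coe_le_coe.2 (le_top : (1 : ℕ∞) ≤ ⊤)

variable {X ι : Type*} [NormedAddCommGroup X] [InnerProductSpace ℝ X] [FiniteDimensional ℝ X]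
  [Fintype ι] {d : ℕ} {Ω : Set (Euc d)}

/-- The flux through the gradient of a weight `φ`. -/
noncomputable def fluxTerm (Ω : Set (Euc d)) (φ : Euc d → ℝ) (J : ℝ → Fin d → Euc d → X) (t : ℝ) :
    X := ∑ k, ∫ x in Ω, fderiv ℝ φ x (EuclideanSpace.single k 1) • J t k x

/-- A family of states with integrable dissipation that evolves according to its flux. -/
structure IsFluxEvolution (Ω : Set (Euc d)) (v : ι → X) (K : ℝ) (ζ₀ : Euc d → X)
    (ζ : ℝ → Euc d → X) (Y : ℝ → Fin d → Euc d → X) (D : ℝ → Euc d → ℝ)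
    (J : ℝ → Fin d → Euc d → X) : Prop where
  integrable_init : IntegrableOn ζ₀ Ω
  state : ∀ᵐ t ∂(volume.restrict (Ioi (0 : ℝ))), IsFluxState Ω v K (ζ t) (Y t) (D t) (J t)
  memLp : ∀ᵐ t ∂(volume.restrict (Ioi (0 : ℝ))), MemLp (ζ t) 2 (volume.restrict Ω)
  integrable_dissipation : IntegrableOn (fun t => ∫ x in Ω, D t x) (Ioi 0)
  integrable_fluxTerm : ∀ φ : Euc d → ℝ, ContDiff ℝ 1 φ → HasCompactSupport φ → ∀ S : ℝ, 0 < S →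
    IntegrableOn (fluxTerm Ω φ J) (Ioo 0 S)
  weighted_eq : ∀ φ : Euc d → ℝ, ContDiff ℝ 1 φ → HasCompactSupport φ → ∀ S : ℝ, 0 < S →
    ∀ᵐ t ∂(volume.restrict (Ioo 0 S)), ∫ x in Ω, φ x • ζ t x
      = (∫ x in Ω, φ x • ζ₀ x) - ∫ τ in 0..t, fluxTerm Ω φ J τ

theorem ae_restrict_Ioi_of_forall_Ioo {p : ℝ → Prop}
    (h : ∀ S : ℝ, 0 < S → ∀ᵐ t ∂(volume.restrict (Ioo 0 S)), p t) :
    ∀ᵐ t ∂(volume.restrict (Ioi (0 : ℝ))), p t := by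
  have h3 : Ioi (0 : ℝ) = ⋃ N : ℕ, Ioo 0 ((N : ℝ) + 1) := by
    ext t
    simp only [mem_Ioi, mem_iUnion, mem_Ioo]
    refine ⟨fun ht => (exists_nat_gt t).imp fun k hk => ⟨ht, by linarith⟩, fun ⟨k, hk⟩ => hk.1⟩
  rw [h3, ae_restrict_iUnion_iff]
  exact fun N => h _ (by positivity)

theorem IsPartition.hasCompactSupport {ε C : ℝ} {Z : Finset (Euc d)} {φ : Euc d → Euc d → ℝ}
    (hφ : IsPartition Ω ε C Z φ) (a : Euc d) : HasCompactSupport (φ a) :=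
  HasCompactSupport.intro (isCompact_closedBall a (2 * ε)) fun x hx => by
    rw [Metric.mem_closedBall, not_le] at hx
    exact hφ.support a x hx.le

theorem intervalIntegrable_clm_apply {E E' : Type*} [NormedAddCommGroup E] [NormedSpace ℝ E]
    [FiniteDimensional ℝ E] [NormedAddCommGroup E'] [NormedSpace ℝ E'] [FiniteDimensional ℝ E']
    {L : ℝ → E →L[ℝ] E'} {η : ℝ → E} {p q : ℝ}
    (hL : ContinuousOn L (uIcc p q)) (hη : IntervalIntegrable η volume p q) :
    IntervalIntegrable (fun s => L s (η s)) volume p q := by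
  obtain ⟨C, hC⟩ := isCompact_uIcc.exists_bound_of_continuousOn hL
  refine (hη.norm.const_mul C).mono_fun ?_ ?_
  · have h2 : AEStronglyMeasurable L (volume.restrict (uIoc p q)) :=
      (hL.mono uIoc_subset_uIcc).aestronglyMeasurable measurableSet_uIoc
    exact (ContinuousLinearMap.apply ℝ E' :
      E →L[ℝ] (E →L[ℝ] E') →L[ℝ] E').aestronglyMeasurable_comp₂
      hη.def'.aestronglyMeasurable h2
  · refine (ae_restrict_iff' measurableSet_uIoc).2 (Eventually.of_forall fun s hs => ?_)
    refine (ContinuousLinearMap.le_of_opNorm_le _ (hC s (uIoc_subset_uIcc hs)) _).trans ?_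
    exact le_abs_self _

namespace IsFluxEvolution

variable {v : ι → X} {K : ℝ} {ζ₀ : Euc d → X} {ζ : ℝ → Euc d → X} {Y : ℝ → Fin d → Euc d → X}
  {D : ℝ → Euc d → ℝ} {J : ℝ → Fin d → Euc d → X} (h : IsFluxEvolution Ω v K ζ₀ ζ Y D J)
include h

theorem ae_weighted_eq {ε C : ℝ} {Z : Finset (Euc d)} {φ : Euc d → Euc d → ℝ}
    (hφ : IsPartition Ω ε C Z φ) : ∀ᵐ t ∂(volume.restrict (Ioi (0 : ℝ))), ∀ a,  a ∈ Z →
      ∫ x in Ω, φ a x • ζ t x = (∫ x in Ω, φ a x • ζ₀ x) - ∫ τ in 0..t, fluxTerm Ω (φ a) J τ :=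
  (ae_ball_iff Z.countable_toSet).2 fun a _ => ae_restrict_Ioi_of_forall_Ioo
    (h.weighted_eq _ ((hφ.contDiff a).of_le one_le_infty) (hφ.hasCompactSupport a))

theorem ae_dissipation_nonneg : ∀ᵐ t ∂(volume.restrict (Ioi (0 : ℝ))), 0 ≤ ∫ x in Ω, D t x := by
  filter_upwards [h.state] with t ht
  refine integral_nonneg_of_ae ?_
  filter_upwards [ht.adm] with x hx using hx.nonneg

/-- Conservation of mass. -/
theorem ae_integral_eq (hd : 1 ≤ d) (hΩ : IsBoundedLipschitzDomain Ω) (hK : 0 ≤ K) :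
    ∀ᵐ t ∂(volume.restrict (Ioi (0 : ℝ))), ∫ x in Ω, ζ t x = ∫ x in Ω, ζ₀ x := by
  obtain ⟨ε, C, hε, hC, hpart⟩ := hΩ.exists_partition hd
  obtain ⟨Z, φ, hφ⟩ := hpart ε hε le_rfl
  have hsum : ∀ w : Euc d → X, IntegrableOn w Ω →
      ∑ a ∈ Z, ∫ x in Ω, φ a x • w x = ∫ x in Ω, w x := by
    intro w hw
    rw [← integral_finsetSum]
    · refine setIntegral_congr_fun hΩ.isOpen.measurableSet fun x hx => ?_
      simp only [← Finset.sum_smul, hφ.sum_eq_one x hx, one_smul]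
    · intro a ha
      refine hw.bdd_smul 1 (hφ.contDiff a).continuous.aestronglyMeasurable ?_
      filter_upwards [ae_restrict_mem hΩ.isOpen.measurableSet] with x hx
      rw [Real.norm_of_nonneg (hφ.nonneg a x)]
      exact hφ.le_one ha hx
  -- The partition functions serve as compactly supported test functions with sum one on `Ω`; their
  -- gradients, and so the flux terms, cancel there.
  have hflux : ∀ᵐ t ∂(volume.restrict (Ioi (0 : ℝ))), ∑ a ∈ Z, fluxTerm Ω (φ a) J t = 0 := by
    filter_upwards [h.state] with t ht
    simp_rw [fluxTerm]
    rw [Finset.sum_comm]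
    refine Finset.sum_eq_zero fun k _ => ?_
    rw [← integral_finsetSum]
    · refine (setIntegral_congr_fun hΩ.isOpen.measurableSet fun x hx => ?_).trans
        (integral_zero _ _)
      simp only [← Finset.sum_smul, ← sum_apply, hφ.sum_fderiv_eq_zero hΩ.isOpen hx,
        zero_apply, zero_smul]
    · intro a _
      refine (ht.integrable_flux hK k).bdd_smul (C / ε) ?_ (Eventually.of_forall fun x => ?_)
      · exact (((hφ.contDiff a).continuous_fderiv (by simp)).clm_apply
          continuous_const).aestronglyMeasurable
      · refine (ContinuousLinearMap.le_of_opNorm_le _ (hφ.norm_fderiv_le a x) _).trans ?_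
        simp
  filter_upwards [h.ae_weighted_eq hφ, h.state, ae_restrict_mem measurableSet_Ioi] with t ht hst ht0
  rw [← hsum _ hst.integrable, ← hsum _ h.integrable_init, Finset.sum_congr rfl ht,
    Finset.sum_sub_distrib, ← intervalIntegral.integral_finsetSum, sub_eq_self,
    intervalIntegral.integral_of_le (le_of_lt ht0)]
  · refine (integral_congr_ae (ae_restrict_of_ae_restrict_of_subset ?_ hflux)).trans
      (integral_zero _ _)
    exact Ioc_subset_Ioi_self
  · intro a _
    rw [intervalIntegrable_iff_integrableOn_Ioo_of_le (le_of_lt ht0)]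
    exact h.integrable_fluxTerm _ ((hφ.contDiff a).of_le one_le_infty)
      (hφ.hasCompactSupport a) t ht0

/-- The discretized potential can only increase by the dissipation. -/
theorem exists_energy_inequality (hd : 1 ≤ d) (hΩ : IsBoundedLipschitzDomain Ω)
    (hv : ∀ i j, 0 ≤ inner ℝ (v i) (v j)) (hv0 : ∀ i, v i ≠ 0) {α L K₀ : ℝ} {zb : X} {Ψ : X → ℝ}
    (hα : 0 < α) (hΨ : IsFlatPotential (spanFlat v) α zb L K₀ Ψ) {Cφ : ℝ} (hCφ : 0 ≤ Cφ)
    (hK : 0 ≤ K) : ∃ ε₀ C : ℝ, 0 < ε₀ ∧ 0 ≤ C ∧ ∀ (ε : ℝ) (Z : Finset (Euc d))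
      (φ : Euc d → Euc d → ℝ), 0 < ε → ε ≤ ε₀ → IsPartition Ω ε Cφ Z φ →
      ∃ G ∈ ae (volume.restrict (Ioi (0 : ℝ))), ∀ t₀ ∈ G, ∀ t ∈ G, t₀ ≤ t →
        ∑ a ∈ Z, (∫ x in Ω, φ a x) * Ψ (weightedMean Ω (φ a) (ζ t))
          ≤ ∑ a ∈ Z, (∫ x in Ω, φ a x) * Ψ (weightedMean Ω (φ a) (ζ t₀))
            + C * ∫ τ in Ioi t₀, ∫ x in Ω, D τ x := by
  obtain ⟨ε₀, C, hε₀, hC, hflux⟩ := hΨ.exists_flux_bound hd hΩ hv hv0 hα hCφ hK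
  refine ⟨ε₀, C, hε₀, hC, fun ε Z φ hε hεε hφ => ⟨_, (h.ae_weighted_eq hφ).and
    (ae_restrict_mem measurableSet_Ioi), ?_⟩⟩
  intro t₀ ht₀ t ht htt
  have ht₀0 : 0 < t₀ := ht₀.2
  have ht0 : 0 < t := ht.2
  have hFi : ∀ a s, 0 ≤ s → IntervalIntegrable (fluxTerm Ω (φ a) J) volume 0 s := by
    intro a s hs
    rw [intervalIntegrable_iff_integrableOn_Ioo_of_le hs]
    exact (h.integrable_fluxTerm _ ((hφ.contDiff a).of_le one_le_infty)
      (hφ.hasCompactSupport a) (s + 1) (by linarith)).mono_set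
      (Ioo_subset_Ioo_right (by linarith))
  have hΨ1 : ContDiff ℝ 1 Ψ := hΨ.contDiff.of_le one_le_infty
  set m : Euc d → ℝ := fun a => ∫ x in Ω, φ a x with hm
  -- The absolutely continuous representative of the mean. It equals the mean at almost every time,
  -- in particular at `t₀` and `t`, and the chain rule applies to it.
  let w : Euc d → ℝ → X := fun a s => (m a)⁻¹ • ((∫ x in Ω, φ a x • ζ₀ x)
    - ∫ τ in 0..s, fluxTerm Ω (φ a) J τ)
  let η : Euc d → ℝ → X := fun a s => -(m a)⁻¹ • fluxTerm Ω (φ a) J s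
  have hηi : ∀ a, IntervalIntegrable (η a) volume t₀ t := fun a =>
    ((hFi a t₀ ht₀0.le).symm.trans (hFi a t ht0.le)).smul _
  have hw : ∀ s, 0 ≤ s → ∀ a, w a s = w a t₀ + ∫ τ in t₀..s, η a τ := by
    intro s hs a
    simp only [w, η]
    rw [intervalIntegral.integral_smul, ← intervalIntegral.integral_interval_sub_left (hFi a s hs)
      (hFi a t₀ ht₀0.le), neg_smul, ← sub_eq_add_neg, ← smul_sub]
    congr 1
    abel
  have hwc : ∀ a, ContinuousOn (w a) (uIcc t₀ t) := fun a =>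
    (continuousOn_const.add (intervalIntegral.continuousOn_primitive_interval' (hηi a)
      left_mem_uIcc)).congr fun s hs => hw s (by
        rw [uIcc_of_le htt] at hs; linarith [hs.1]) a
  have hgi : ∀ a, IntervalIntegrable (fun s => fderiv ℝ Ψ (w a s) (η a s)) volume t₀ t := fun a =>
    intervalIntegrable_clm_apply ((hΨ1.continuous_fderiv (by simp)).comp_continuousOn (hwc a))
      (hηi a)
  have hmean : ∀ s, (∀ a ∈ Z, ∫ x in Ω, φ a x • ζ s x
      = (∫ x in Ω, φ a x • ζ₀ x) - ∫ τ in 0..s, fluxTerm Ω (φ a) J τ) →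
      ∀ a ∈ Z, weightedMean Ω (φ a) (ζ s) = w a s := fun s hs a ha => by
    simp only [weightedMean, hs a ha, w, hm]
  have hchain : ∀ a, Ψ (w a t) - Ψ (w a t₀) = ∫ s in t₀..t, fderiv ℝ Ψ (w a s) (η a s) := by
    intro a
    rw [hw t ht0.le a, ← integral_fderiv_primitive hΨ1 (hηi a)]
    refine intervalIntegral.integral_congr fun s hs => ?_
    rw [uIcc_of_le htt] at hs
    simp only [hw s (by linarith [hs.1]) a]
  have hDi : IntegrableOn (fun τ => ∫ x in Ω, D τ x) (Ioi t₀) :=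
    h.integrable_dissipation.mono_set (Ioi_subset_Ioi ht₀0.le)
  have hsum : ∑ a ∈ Z, m a * (Ψ (w a t) - Ψ (w a t₀)) ≤ C * ∫ τ in Ioi t₀, ∫ x in Ω, D τ x := by
    calc ∑ a ∈ Z, m a * (Ψ (w a t) - Ψ (w a t₀))
        = ∫ s in t₀..t, ∑ a ∈ Z, m a * fderiv ℝ Ψ (w a s) (η a s) := by
          rw [intervalIntegral.integral_finsetSum fun a _ => (hgi a).const_mul _]
          refine Finset.sum_congr rfl fun a _ => ?_
          rw [hchain, intervalIntegral.integral_const_mul]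
      _ = ∫ s in Ioc t₀ t, ∑ a ∈ Z, m a * fderiv ℝ Ψ (w a s) (η a s) :=
          intervalIntegral.integral_of_le htt
      _ ≤ ∫ s in Ioc t₀ t, C * ∫ x in Ω, D s x := by
          refine integral_mono_ae (integrable_finsetSum _ fun a _ => ((hgi a).const_mul _).1)
            ((hDi.mono_set Ioc_subset_Ioi_self).const_mul C) ?_
          have hsub : Ioc t₀ t ⊆ Ioi 0 := fun s hs => ht₀0.trans hs.1
          filter_upwards [ae_restrict_of_ae_restrict_of_subset hsub (h.ae_weighted_eq hφ),
            ae_restrict_of_ae_restrict_of_subset hsub h.state] with s hs hst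
          refine le_trans ?_ ((le_abs_self _).trans ((abs_neg _).trans_le
            (hflux ε Z φ hε hεε hφ _ _ _ _ hst)))
          rw [← Finset.sum_neg_distrib]
          refine (Finset.sum_congr rfl fun a ha => ?_).le
          rw [hmean s hs a ha, ← map_sum]
          simp only [η, map_smul, smul_eq_mul]
          rw [← mul_assoc, mul_neg, mul_inv_cancel₀ (hφ.mass_pos hε hCφ ha).ne', neg_one_mul]
          rfl
      _ = C * ∫ s in Ioc t₀ t, ∫ x in Ω, D s x := integral_const_mul _ _
      _ ≤ C * ∫ τ in Ioi t₀, ∫ x in Ω, D τ x := by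
          refine mul_le_mul_of_nonneg_left (setIntegral_mono_set hDi ?_
            Ioc_subset_Ioi_self.eventuallyLE) hC
          exact ae_restrict_of_ae_restrict_of_subset (Ioi_subset_Ioi ht₀0.le)
            h.ae_dissipation_nonneg
  have e1 : ∀ s, (∀ a ∈ Z, weightedMean Ω (φ a) (ζ s) = w a s) →
      ∑ a ∈ Z, m a * Ψ (weightedMean Ω (φ a) (ζ s)) = ∑ a ∈ Z, m a * Ψ (w a s) := fun s hs =>
    Finset.sum_congr rfl fun a ha => by rw [hs a ha]
  rw [e1 t (hmean t ht.1), e1 t₀ (hmean t₀ ht₀.1)]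
  simp_rw [mul_sub] at hsum
  rw [Finset.sum_sub_distrib] at hsum
  linarith

end IsFluxEvolution

end FluxEvolution


/-! ### Stability and convergence to the mean -/

section Convergence

variable {X ι : Type*} [NormedAddCommGroup X] [InnerProductSpace ℝ X] [FiniteDimensional ℝ X]
  [Fintype ι] {d : ℕ} {Ω : Set (Euc d)} {v : ι → X} {K : ℝ} {ζ₀ : Euc d → X} {ζ : ℝ → Euc d → X}
  {Y : ℝ → Fin d → Euc d → X} {D : ℝ → Euc d → ℝ} {J : ℝ → Fin d → Euc d → X}

namespace IsFluxEvolution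

variable (h : IsFluxEvolution Ω v K ζ₀ ζ Y D J)
include h

/-- The distance to a constant is controlled by its earlier values and the dissipation. -/
theorem exists_stability (hd : 1 ≤ d) (hΩ : IsBoundedLipschitzDomain Ω)
    (hv : ∀ i j, 0 ≤ inner ℝ (v i) (v j)) (hv0 : ∀ i, v i ≠ 0) (hK : 0 ≤ K) (z : X) :
    ∃ C : ℝ, 0 ≤ C ∧ ∃ G ∈ ae (volume.restrict (Ioi (0 : ℝ))), ∀ t₀ ∈ G, ∀ t ∈ G, t₀ ≤ t →
      ∫⁻ x in Ω, ‖ζ t x - z‖ₑ ^ 2 ≤ ENNReal.ofReal C * ((∫⁻ x in Ω, ‖ζ t₀ x - z‖ₑ ^ 2)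
        + ENNReal.ofReal (∫ τ in Ioi t₀, ∫ x in Ω, D τ x)) := by
  classical
  obtain ⟨α, ρ, hρ⟩ := exists_retraction (spanFlat v)
    (fun S S' => spanFlat_inf v S S') (exists_spanFlat_eq_top v) (one_half_pos (α := ℝ))
  obtain ⟨L, K₀, Ψ, hΨ⟩ := hρ.exists_potential z
  obtain ⟨ε₁, Cφ, hε₁, hCφ, hpart⟩ := hΩ.exists_partition hd
  obtain ⟨ε₂, C₁, hε₂, hC₁, henergy⟩ := h.exists_energy_inequality hd hΩ hv hv0 hρ.pos hΨ hCφ.le hK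
  obtain ⟨ε₃, C₂, hε₃, hC₂, hosc⟩ := exists_sum_lintegral_sub_weightedMean_le hd hΩ v K hCφ.le
  have hfin : volume Ω < ⊤ := hΩ.isBounded.measure_lt_top
  -- A sequence of scales tending to zero; countability allows one common null set of exceptional
  -- times.
  let ε : ℕ → ℝ := fun k => min ε₁ (min ε₂ ε₃) / (k + 1)
  have hε : ∀ k, 0 < ε k := fun k => by positivity
  have hεle : ∀ k, ε k ≤ min ε₁ (min ε₂ ε₃) := fun k =>
    div_le_self (by positivity) (by simp)
  have hεlim : Tendsto ε atTop (𝓝 0) :=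
    tendsto_const_nhds.div_atTop (tendsto_atTop_add_const_right _ _ tendsto_natCast_atTop_atTop)
  have hε1 : ∀ k, ε k ≤ ε₁ := fun k => (hεle k).trans (min_le_left _ _)
  have hε2 : ∀ k, ε k ≤ ε₂ := fun k => (hεle k).trans ((min_le_right _ _).trans (min_le_left _ _))
  have hε3 : ∀ k, ε k ≤ ε₃ := fun k => (hεle k).trans ((min_le_right _ _).trans (min_le_right _ _))
  choose Z φ hφ using fun k => hpart (ε k) (hε k) (hε1 k)
  choose G hG hGE using fun k => henergy (ε k) (Z k) (φ k) (hε k) (hε2 k) (hφ k)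
  refine ⟨2 * (81 + 9 * C₁), by positivity, _, inter_mem (countable_iInter_mem.2 hG)
    (inter_mem h.state h.memLp), ?_⟩
  rintro t₀ ⟨ht₀G, ht₀s, ht₀m⟩ t ⟨htG, hts, htm⟩ htt
  rw [mem_iInter] at ht₀G htG
  set I := ∫ τ in Ioi t₀, ∫ x in Ω, D τ x
  set Dt := ∫ x in Ω, D t x
  set P₀ := ∫⁻ x in Ω, ‖ζ t₀ x - z‖ₑ ^ 2
  -- The deviation at time `t` is split into the oscillation around the means and the deviation of
  -- the means. The latter is transported from `t₀` to `t` by the energy inequality; passing from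
  -- the squared distance to `Ψ` and back costs `9 * 9 = 81`.
  have hbound : ∀ k, ∫⁻ x in Ω, ‖ζ t x - z‖ₑ ^ 2
      ≤ 2 * (ENNReal.ofReal (C₂ * ε k ^ 2 * Dt)
        + (81 * P₀ + ENNReal.ofReal (9 * C₁ * I))) := by
    intro k
    refine ((hφ k).lintegral_enorm_sub_le hΩ.isOpen.measurableSet hfin
      hts.stronglyMeasurable z).trans ?_
    refine mul_le_mul' le_rfl (add_le_add (hosc _ _ _ (hε k) (hε3 k) (hφ k) _ _ _ _ hts htm) ?_)
    have hm : ∀ a ∈ Z k, 0 ≤ ∫ x in Ω, φ k a x := fun a ha =>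
      ((hφ k).mass_pos (hε k) hCφ.le ha).le
    have hle : ∑ a ∈ Z k, (∫ x in Ω, φ k a x) * ‖weightedMean Ω (φ k a) (ζ t) - z‖ ^ 2
        ≤ 81 * (∑ a ∈ Z k, (∫ x in Ω, φ k a x) * ‖weightedMean Ω (φ k a) (ζ t₀) - z‖ ^ 2)
          + 9 * C₁ * I := by
      have h1 := hGE k t₀ (ht₀G k) t (htG k) htt
      have h2 : ∑ a ∈ Z k, (∫ x in Ω, φ k a x) * ‖weightedMean Ω (φ k a) (ζ t) - z‖ ^ 2
          ≤ 9 * ∑ a ∈ Z k, (∫ x in Ω, φ k a x) * Ψ (weightedMean Ω (φ k a) (ζ t)) := by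
        rw [Finset.mul_sum]
        refine Finset.sum_le_sum fun a ha => ?_
        rw [mul_left_comm]
        exact mul_le_mul_of_nonneg_left (hΨ.ge _) (hm a ha)
      have h3 : ∑ a ∈ Z k, (∫ x in Ω, φ k a x) * Ψ (weightedMean Ω (φ k a) (ζ t₀))
          ≤ 9 * ∑ a ∈ Z k, (∫ x in Ω, φ k a x) * ‖weightedMean Ω (φ k a) (ζ t₀) - z‖ ^ 2 := by
        rw [Finset.mul_sum]
        refine Finset.sum_le_sum fun a ha => ?_
        rw [mul_left_comm]
        exact mul_le_mul_of_nonneg_left (hΨ.le _) (hm a ha)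
      linarith
    refine (ENNReal.ofReal_le_ofReal hle).trans (ENNReal.ofReal_add_le.trans ?_)
    refine add_le_add ?_ le_rfl
    rw [ENNReal.ofReal_mul (by norm_num)]
    refine mul_le_mul' (by simp) ?_
    exact (hφ k).sum_mass_mul_le (hε k) hCφ.le hΩ.isOpen.measurableSet hfin
      ht₀s.stronglyMeasurable ht₀m z
  -- At a fixed time the dissipation `Dt` is a fixed number, possibly large, so the oscillation term
  -- disappears with `ε ^ 2`; all other constants are independent of the scale.
  have hlim : Tendsto (fun k => 2 * (ENNReal.ofReal (C₂ * ε k ^ 2 * Dt)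
        + (81 * P₀ + ENNReal.ofReal (9 * C₁ * I)))) atTop
      (𝓝 (2 * (ENNReal.ofReal (C₂ * 0 ^ 2 * Dt) + (81 * P₀ + ENNReal.ofReal (9 * C₁ * I))))) := by
    refine ENNReal.Tendsto.const_mul (Tendsto.add (ENNReal.tendsto_ofReal
      (((hεlim.pow 2).const_mul C₂).mul_const Dt)) tendsto_const_nhds) (Or.inr (by simp))
  refine (ge_of_tendsto' hlim hbound).trans ?_
  have h81 : (2 : ℝ≥0∞) * 81 ≤ ENNReal.ofReal (2 * (81 + 9 * C₁)) := by
    rw [← ENNReal.ofReal_ofNat 81, ← ENNReal.ofReal_ofNat 2, ← ENNReal.ofReal_mul (by norm_num)]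
    exact ENNReal.ofReal_le_ofReal (by linarith)
  have h9 : 2 * ENNReal.ofReal (9 * C₁ * I)
      ≤ ENNReal.ofReal (2 * (81 + 9 * C₁)) * ENNReal.ofReal I := by
    rw [← ENNReal.ofReal_ofNat 2, ENNReal.ofReal_mul (by positivity : 0 ≤ 9 * C₁), ← mul_assoc,
      ← ENNReal.ofReal_mul (by norm_num)]
    exact mul_le_mul' (ENNReal.ofReal_le_ofReal (by linarith)) le_rfl
  generalize 2 * (81 + 9 * C₁) = C at h81 h9 ⊢
  rw [zero_pow two_ne_zero, mul_zero, zero_mul, ENNReal.ofReal_zero, zero_add,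
    mul_add, mul_add, ← mul_assoc]
  exact add_le_add (mul_le_mul' h81 le_rfl) h9

/-- Convergence to the mean. -/
theorem eventually_lintegral_sub_mean_le (hd : 1 ≤ d) (hΩ : IsBoundedLipschitzDomain Ω)
    (hv : ∀ i j, 0 ≤ inner ℝ (v i) (v j)) (hv0 : ∀ i, v i ≠ 0) (hK : 0 ≤ K) {δ : ℝ} (hδ : 0 < δ) :
    ∃ S : ℝ, ∀ᵐ t, S < t →
      ∫⁻ x in Ω, ‖ζ t x - weightedMean Ω (fun _ => 1) ζ₀‖ₑ ^ 2 ≤ ENNReal.ofReal δ := by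
  obtain ⟨C, hC, G, hG, hstab⟩ := h.exists_stability hd hΩ hv hv0 hK
    (weightedMean Ω (fun _ => 1) ζ₀)
  obtain ⟨Cw, hCw, hwirt⟩ := exists_lintegral_sub_mean_le hd hΩ v K
  set z := weightedMean Ω (fun _ => 1) ζ₀ with hz
  -- By conservation of mass the mean at time `t` is always `z`, so the Wirtinger inequality refers
  -- to a fixed point.
  have hrest : ∀ᵐ t ∂(volume.restrict (Ioi (0 : ℝ))), ∫⁻ x in Ω, ‖ζ t x - z‖ₑ ^ 2
      ≤ ENNReal.ofReal (Cw * ∫ x in Ω, D t x) := by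
    filter_upwards [h.state, h.memLp, h.ae_integral_eq hd hΩ hK] with t ht htm htz
    have h1 : weightedMean Ω (fun _ => 1) (ζ t) = z := by
      simp only [hz, weightedMean, one_smul, htz]
    rw [← h1]
    exact hwirt _ _ _ _ ht htm
  obtain ⟨η, hη, hηδ⟩ : ∃ η : ℝ, 0 < η ∧ C * (Cw * η + η) ≤ δ := by
    refine ⟨δ / (C * (Cw + 1) + 1), by positivity, ?_⟩
    rw [← add_one_mul, ← mul_assoc, mul_div_assoc', div_le_iff₀ (by positivity)]
    nlinarith
  have htail : Tendsto (fun N : ℕ => ∫ τ in Ioi (N : ℝ), ∫ x in Ω, D τ x) atTop (𝓝 0) := by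
    have h1 : Antitone fun N : ℕ => Ioi (N : ℝ) := fun a b hab => Ioi_subset_Ioi (Nat.cast_le.2 hab)
    have h2 := h1.tendsto_setIntegral (μ := volume) (f := fun τ => ∫ x in Ω, D τ x)
      (fun N => measurableSet_Ioi) (by simpa using h.integrable_dissipation)
    have h3 : ⋂ N : ℕ, Ioi (N : ℝ) = ∅ := by
      refine eq_empty_of_forall_notMem fun t ht => ?_
      obtain ⟨N, hN⟩ := exists_nat_gt t
      exact lt_asymm hN (mem_iInter.1 ht N)
    rwa [h3, setIntegral_empty] at h2
  obtain ⟨N, hN⟩ := (htail.eventually (gt_mem_nhds hη)).exists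
  have hsubN : Ioi (N : ℝ) ⊆ Ioi 0 := Ioi_subset_Ioi (Nat.cast_nonneg N)
  -- An integrable function cannot stay above `η` almost everywhere on a half-line. Such a time
  -- exists beyond `N`, where the remaining dissipation is also below `η`.
  obtain ⟨t₀, ht₀N, ht₀G, ht₀D, ht₀r⟩ : ∃ t₀, (N : ℝ) < t₀ ∧ t₀ ∈ G ∧ ∫ x in Ω, D t₀ x ≤ η ∧
      ∫⁻ x in Ω, ‖ζ t₀ x - z‖ₑ ^ 2 ≤ ENNReal.ofReal (Cw * ∫ x in Ω, D t₀ x) := by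
    by_contra! hcon
    have h1 : ∀ᵐ t ∂(volume.restrict (Ioi (N : ℝ))), ‖η‖ ≤ ∫ x in Ω, D t x := by
      filter_upwards [ae_restrict_of_ae_restrict_of_subset hsubN hG,
        ae_restrict_of_ae_restrict_of_subset hsubN hrest, ae_restrict_mem measurableSet_Ioi]
        with t htG htr htN
      rw [Real.norm_of_nonneg hη.le]
      by_contra! hlt
      exact absurd htr (not_le.2 (hcon t htN htG hlt.le))
    have h2 : IntegrableOn (fun _ : ℝ => η) (Ioi (N : ℝ)) :=
      (h.integrable_dissipation.mono_set hsubN).mono' aestronglyMeasurable_const h1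
    rw [IntegrableOn, integrable_const_iff] at h2
    rcases h2 with h2 | h2
    · exact hη.ne' h2
    · have := h2.measure_univ_lt_top
      simp at this
  have ht₀0 : 0 < t₀ := lt_of_le_of_lt (Nat.cast_nonneg N) ht₀N
  refine ⟨t₀, ?_⟩
  have hG' := (ae_restrict_iff' measurableSet_Ioi).1 hG
  filter_upwards [hG'] with t htG ht
  refine (hstab t₀ ht₀G t (htG (ht₀0.trans ht)) ht.le).trans ?_
  have htl : ∫ τ in Ioi t₀, ∫ x in Ω, D τ x ≤ η := by
    refine le_trans (setIntegral_mono_set (h.integrable_dissipation.mono_set hsubN)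
      (ae_restrict_of_ae_restrict_of_subset hsubN h.ae_dissipation_nonneg)
      (Ioi_subset_Ioi ht₀N.le).eventuallyLE) hN.le
  calc _ ≤ ENNReal.ofReal C * (ENNReal.ofReal (Cw * η) + ENNReal.ofReal η) := by
        exact mul_le_mul' le_rfl (add_le_add (ht₀r.trans (ENNReal.ofReal_le_ofReal (by gcongr)))
          (ENNReal.ofReal_le_ofReal htl))
    _ = ENNReal.ofReal (C * (Cw * η + η)) := by
        rw [← ENNReal.ofReal_add (by positivity) hη.le, ENNReal.ofReal_mul hC]
    _ ≤ _ := ENNReal.ofReal_le_ofReal hηδ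

end IsFluxEvolution

end Convergence


/-! ### Steady states -/

section SteadyStates

variable {n d : ℕ} {Ω : Set (Euc d)} {B : Matrix (Fin n) (Fin n) ℝ}

theorem hasWeakGrad_const (Ω : Set (Euc d)) (c : ℝ) :
    HasWeakGrad Ω (fun _ => c) (fun _ _ => 0) := by
  intro φ hφ hφc hφΩ k
  have h1 : Continuous fun x => fderiv ℝ φ x (EuclideanSpace.single k 1) :=
    (hφ.continuous_fderiv (by simp)).clm_apply continuous_const
  have h2 : ∀ x, x ∉ Ω → fderiv ℝ φ x (EuclideanSpace.single k 1) = 0 := fun x hx => by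
    rw [fderiv_of_notMem_tsupport (𝕜 := ℝ) fun h => hx (hφΩ h), zero_apply]
  have h3 := integral_mul_fderiv_eq_neg_fderiv_mul_of_integrable (𝕜 := ℝ) (μ := volume)
    (f := fun _ : Euc d => c) (g := φ) (v := EuclideanSpace.single k 1) (by simp)
    ((h1.integrable_of_hasCompactSupport (hφc.fderiv_apply (𝕜 := ℝ) _)).const_mul c)
    ((hφ.continuous.integrable_of_hasCompactSupport hφc).const_mul c)
    (fun x _ => differentiableAt_const c) (fun x _ => hφ.differentiable (by simp) x)
  rw [setIntegral_eq_integral_of_forall_compl_eq_zero fun x hx => by rw [h2 x hx, mul_zero], h3]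
  simp

/-- On a bounded Lipschitz domain, a function with vanishing weak gradient is constant. -/
theorem IsBoundedLipschitzDomain.exists_ae_eq_const (hΩ : IsBoundedLipschitzDomain Ω) (hd : 1 ≤ d)
    {w : Euc d → Euc n} (hw : Integrable w (volume.restrict Ω))
    (hg : ∀ i, HasWeakGrad Ω (fun x => w x i) (fun _ _ => 0)) :
    ∃ c, ∀ᵐ x ∂(volume.restrict Ω), w x = c := by
  have hw0 : Integrable (hw.1.mk w) (volume.restrict Ω) := hw.congr hw.1.ae_eq_mk
  have hm : StronglyMeasurable (hw.1.mk w) := hw.1.stronglyMeasurable_mk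
  have hg0 : ∀ i, HasWeakGrad Ω (fun x => hw.1.mk w x i)
      (fun k x => (fun _ _ => 0 : Fin d → Euc d → Euc n) k x i) := by
    intro i φ h1 h2 h3 k
    refine Eq.trans (integral_congr_ae ?_) (hg i φ h1 h2 h3 k)
    filter_upwards [hw.1.ae_eq_mk] with x hx
    simp only [hx]
  obtain ⟨C, -, hP⟩ := hΩ.exists_poincare (Euc n) hd
  -- With zero gradient the Poincaré inequality makes the double integral vanish, so almost every
  -- value of `w` agrees with its value at one suitable point.
  have h1 := hP _ _ hm (transEst_comp hΩ.isOpen.measurableSet (f := id) contDiff_id hw0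
    (fun k => integrableOn_zero) hg0)
  have h2 : Measurable fun p : Euc d × Euc d => ‖hw.1.mk w p.1 - hw.1.mk w p.2‖ₑ ^ 2 :=
    ((hm.comp_measurable measurable_fst).sub (hm.comp_measurable measurable_snd)).enorm.pow_const 2
  simp only [map_zero, enorm_zero, ne_eq, OfNat.ofNat_ne_zero, not_false_eq_true, zero_pow,
    Finset.sum_const_zero, lintegral_zero, mul_zero, nonpos_iff_eq_zero] at h1
  rw [lintegral_eq_zero_iff h2.lintegral_prod_right'] at h1
  have : (ae (volume.restrict Ω)).NeBot := by
    rw [ae_neBot]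
    intro h
    exact hΩ.isOpen.measure_ne_zero volume hΩ.isConnected.nonempty (Measure.restrict_eq_zero.1 h)
  obtain ⟨x, hx⟩ := h1.exists
  replace hx := (lintegral_eq_zero_iff (h2.comp measurable_prodMk_left)).1 hx
  refine ⟨hw.1.mk w x, ?_⟩
  filter_upwards [hx, hw.1.ae_eq_mk] with y hy hy'
  rw [hy']
  have h3 : ‖hw.1.mk w x - hw.1.mk w y‖ₑ ^ 2 = 0 := hy
  rw [sq_eq_zero_iff, enorm_eq_zero, sub_eq_zero] at h3
  exact h3.symm

/-- `B v` is a constant `c`, and since all entries and components are nonnegative, `bᵢᵢ vᵢ ≤ cᵢ`. -/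
theorem memLp_top_of_mem_steadyStates (hΩ : IsBoundedLipschitzDomain Ω) (hd : 1 ≤ d)
    (hB : ∀ i j, 0 ≤ B i j) (hB0 : ∀ i, 0 < B i i) {m : Euc n} {v : Euc d → Euc n}
    (hv : v ∈ steadyStates Ω B m) : MemLp v ⊤ (volume.restrict Ω) := by
  obtain ⟨hv2, hvn, -, hvg⟩ := hv
  have : IsFiniteMeasure (volume.restrict Ω) :=
    ⟨by simpa using hΩ.isBounded.measure_lt_top⟩
  let M : Euc n →L[ℝ] Euc n := (Matrix.toEuclideanLin B).toContinuousLinearMap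
  obtain ⟨c, hc⟩ := hΩ.exists_ae_eq_const hd (w := fun x => mulB B (v x))
    (M.integrable_comp (hv2.integrable (by norm_num))) hvg
  refine memLp_top_of_bound hv2.1 (∑ i, c i / B i i) ?_
  filter_upwards [hc, hvn] with x hx hxn
  rw [← sum_smul_single (v x)]
  refine (norm_sum_le _ _).trans (Finset.sum_le_sum fun i _ => ?_)
  rw [norm_smul, PiLp.norm_single, norm_one, mul_one, Real.norm_of_nonneg (hxn i),
    le_div_iff₀ (hB0 i), mul_comm, ← hx]
  exact Finset.single_le_sum (f := fun j => B i j * v x j)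
    (fun j _ => mul_nonneg (hB i j) (hxn j)) (Finset.mem_univ i)

/-- The constant with the mass of `w` is a steady state. -/
theorem const_mem_steadyStates (hΩ : IsBoundedLipschitzDomain Ω) {w : Euc d → Euc n}
    (hw : IntegrableOn w Ω) (hw0 : ∀ᵐ x ∂(volume.restrict Ω), ∀ i, 0 ≤ w x i) :
    (fun _ => (volume.real Ω)⁻¹ • ∫ x in Ω, w x) ∈ steadyStates Ω B (∫ x in Ω, w x) := by
  have : IsFiniteMeasure (volume.restrict Ω) :=
    ⟨by simpa using hΩ.isBounded.measure_lt_top⟩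
  refine ⟨memLp_const _, Eventually.of_forall fun x i => ?_, ?_, fun i => hasWeakGrad_const Ω _⟩
  · rw [PiLp.smul_apply, smul_eq_mul, integral_euc_apply hw]
    refine mul_nonneg (by positivity) (integral_nonneg_of_ae ?_)
    filter_upwards [hw0] with x hx using hx i
  · rw [setIntegral_const, smul_inv_smul₀]
    exact (ENNReal.toReal_pos (hΩ.isOpen.measure_ne_zero volume hΩ.isConnected.nonempty)
      hΩ.isBounded.measure_lt_top.ne).ne'

end SteadyStates


/-! ### Assembly -/

section Main

variable {n d : ℕ} {B : Matrix (Fin n) (Fin n) ℝ} {T : Euc n →L[ℝ] Euc n} {Ω : Set (Euc d)}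
  {uin : Euc d → Euc n} {μ : Kernel (Euc d × ℝ) (Phase n d)}

theorem IsDissipativeMVSolution.exists_isFluxEvolution (hμ : IsDissipativeMVSolution Ω B uin μ)
    (hΩ : MeasurableSet Ω) (hΩ' : volume Ω < ⊤) (hT : IsMatrixRoot B T)
    (hB : ∀ i j, 0 ≤ B i j) (hB0 : ∀ i, 0 < B i i) :
    ∃ K : ℝ, 0 ≤ K ∧ IsFluxEvolution Ω (fun i => T (EuclideanSpace.single i 1)) K
      (fun x => T (uin x)) (fun t x => T (baryS μ x t)) (fun t k x => T (baryP μ x t k))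
      (fun t x => (∫ w, raoDensity B w ∂(μ (x, t))) + ∫ w, shannonDensity B w ∂(μ (x, t)))
      (fun t k x => rootFlux B T (μ (x, t)) k) := by
  have : IsFiniteMeasure (volume.restrict Ω) := ⟨by simpa using hΩ'⟩
  obtain ⟨K, hK, hst⟩ := hμ.exists_isFluxState hΩ hΩ' hT hB hB0
  refine ⟨K, hK, T.integrable_comp (hμ.uin_memLp.integrable (by norm_num)), hst, ?_,
    (hμ.integrable_dissipation hΩ' hT).integral_prod_right,
    fun φ hφ hφc S hS => (hμ.ae_weighted_integral_eq hΩ' hT hφ hφc hS).1,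
    fun φ hφ hφc S hS => (hμ.ae_weighted_integral_eq hΩ' hT hφ hφc hS).2⟩
  filter_upwards [hμ.ae_memLp_baryS] with t ht using T.comp_memLp' ht

theorem IsMatrixRoot.exists_eLpNorm_hatB_sub_le (hT : IsMatrixRoot B T) (Ω : Set (Euc d)) :
    ∃ C : ℝ, 0 < C ∧ ∀ (f : Euc d → Euc n) (c : Euc n),
      eLpNorm (fun x => hatB B (f x) - hatB B c) 2 (volume.restrict Ω)
        ≤ ENNReal.ofReal C * (∫⁻ x in Ω, ‖T (f x) - T c‖ₑ ^ 2) ^ (2⁻¹ : ℝ) := by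
  obtain ⟨C, hC, hle⟩ := hT.exists_norm_hatB_le
  refine ⟨C + 1, by positivity, fun f c => ?_⟩
  have h1 : eLpNorm (fun x => hatB B (f x) - hatB B c) 2 (volume.restrict Ω)
      ≤ ENNReal.ofReal (C + 1) * eLpNorm (fun x => T (f x) - T c) 2 (volume.restrict Ω) := by
    refine eLpNorm_le_mul_eLpNorm_of_ae_le_mul (Eventually.of_forall fun x => ?_) 2
    have h2 : hatB B (f x) - hatB B c = hatB B (f x - c) :=
      (map_sub (kerB B)ᗮ.starProjection _ _).symm
    rw [h2, ← map_sub]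
    exact (hle _).trans (mul_le_mul_of_nonneg_right (by linarith) (norm_nonneg _))
  refine h1.trans (le_of_eq ?_)
  rw [eLpNorm_eq_lintegral_rpow_enorm_toReal two_ne_zero ENNReal.ofNat_ne_top]
  simp

end Main

theorem theorem2p5 {n d : ℕ} (hd : 1 ≤ d) (Ω : Set (Euc d)) (hΩ : IsBoundedLipschitzDomain Ω)
    (B : Matrix (Fin n) (Fin n) ℝ) (hB : B.PosSemidef) (hB_nonneg : ∀ i j, 0 ≤ B i j)
    (hB_diag : ∀ i, 0 < B i i) (uin : Euc d → Euc n) (μ : Kernel (Euc d × ℝ) (Phase n d))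
    (hμ : IsDissipativeMVSolution Ω B uin μ) :
    (∀ v ∈ steadyStates Ω B (∫ x in Ω, uin x), MemLp v ⊤ (volume.restrict Ω)) ∧
    ∃ ustar ∈ steadyStates Ω B (∫ x in Ω, uin x),
      Tendsto (fun t : ℝ => eLpNorm (fun x => hatB B (baryS μ x t) - hatB B (ustar x)) 2
        (volume.restrict Ω)) (atTop ⊓ ae volume) (𝓝 0) := by
  have hfin : volume Ω < ⊤ := hΩ.isBounded.measure_lt_top
  have : IsFiniteMeasure (volume.restrict Ω) := ⟨by simpa using hfin⟩
  have huin : Integrable uin (volume.restrict Ω) := hμ.uin_memLp.integrable (by norm_num)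
  refine ⟨fun v hv => memLp_top_of_mem_steadyStates hΩ hd hB_nonneg hB_diag hv, _,
    const_mem_steadyStates hΩ huin hμ.uin_nonneg, ?_⟩
  obtain ⟨T, hT⟩ := hB.exists_isMatrixRoot
  obtain ⟨K, hK, hevol⟩ :=
    hμ.exists_isFluxEvolution hΩ.isOpen.measurableSet hfin hT hB_nonneg hB_diag
  have hv : ∀ i j, 0 ≤ inner ℝ (T (EuclideanSpace.single i 1)) (T (EuclideanSpace.single j 1)) :=
    fun i j => (hT.inner_single i j).symm ▸ hB_nonneg i j
  have hv0 : ∀ i, T (EuclideanSpace.single i 1) ≠ 0 := fun i h0 => by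
    have h1 := hT.inner_single i i
    rw [h0, inner_zero_left] at h1
    exact (hB_diag i).ne h1
  obtain ⟨C, hC, hle⟩ := hT.exists_eLpNorm_hatB_sub_le Ω
  have hmean : T ((volume.real Ω)⁻¹ • ∫ x in Ω, uin x)
      = weightedMean Ω (fun _ => 1) fun x => T (uin x) := by
    simp [weightedMean, T.integral_comp_comm huin]
  rw [ENNReal.tendsto_nhds_zero]
  intro ε hε
  obtain ⟨r, hr, hrε⟩ : ∃ r : ℝ, 0 < r ∧ ENNReal.ofReal r ≤ ε := by
    obtain ⟨r, hr, hrε⟩ := ENNReal.lt_iff_exists_real_btwn.1 hε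
    exact ⟨r, ENNReal.ofReal_pos.1 hrε.1, hrε.2.le⟩
  -- The tolerance is chosen so that its square root, multiplied by the constant `C` of the passage
  -- from `T u` back to `û`, is exactly `r`.
  obtain ⟨S, hS⟩ := hevol.eventually_lintegral_sub_mean_le hd hΩ hv hv0 hK
    (δ := (r / C) ^ 2) (by positivity)
  filter_upwards [mem_inf_of_left (Ioi_mem_atTop S), mem_inf_of_right hS] with t ht htS
  refine (hle _ _).trans (le_trans ?_ hrε)
  rw [hmean]
  calc _ ≤ ENNReal.ofReal C * ENNReal.ofReal ((r / C) ^ 2) ^ (2⁻¹ : ℝ) := by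
        gcongr
        exact htS ht
    _ = ENNReal.ofReal r := by
        rw [ENNReal.ofReal_rpow_of_pos (by positivity), ← one_div, ← Real.sqrt_eq_rpow,
          Real.sqrt_sq (by positivity), ← ENNReal.ofReal_mul hC.le, mul_comm C,
          div_mul_cancel₀ _ hC.ne']
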